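/- Let $\mathfrak g$ be a finite-dimensional complex semisimple Lie algebra with Cartan subalgebra $\mathfrak h$ and a set of simple roots, let $P^+\subset\mathfrak h^*$ be the set of dominant integral weights and, for $\mu\in P^+$, let $V(\mu)$ be the finite-dimensional simple $\mathfrak g$-module of highest weight $\mu$. Let $V$ be a finite-dimensional $\mathfrak g$-module with set of weights $\mathrm{wt}(V)$ and let $\Psi\subset\mathrm{wt}(V)$ be a nonempty subset with the following property (which characterizes the sets of all weights of $V$ lying on a proper face of the weight polytope of $V$): whenever $\sum_{\alpha\in\Psi}m_\alpha\alpha=\sum_{\beta\in\mathrm{wt}(V)}r_\beta\beta$ with $m_\alpha,r_\beta\in\mathbb Z_+$, then $\sum_\alpha m_\alpha\le\sum_\beta r_\beta$, with equality if and only if $\beta\in\Psi$ whenever $r_\beta>0$. Put $N_\Psi=\sum_{\xi\in\Psi}\dim V_\xi$. For $\mu,\nu\in\mathfrak h^*$ write $\mu\le_\Psi\nu$ if $\nu-\mu\in\mathbb Z_+\Psi$, and then let $d_\Psi(\mu,\nu)$ be the least $\sum_{\beta\in\Psi}m_\beta$ over all expressions $\nu-\mu=\sum_{\beta\in\Psi}m_\beta\beta$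 with $m_\beta\in\mathbb Z_+$. On $\Lambda=P^+\times\mathbb Z$ let $\preccurlyeq$ be the reflexive and transitive closure of the relation "$(\mu,s)$ covers $(\lambda,r)$", which means $s=r+1$ and $\mu-\lambda\in\mathrm{wt}(V)$; and put $(\lambda,r)\preccurlyeq_\Psi(\mu,s)$ if $\lambda\le_\Psi\mu$ and $d_\Psi(\lambda,\mu)=s-r$. A set $\Gamma\subset\Lambda$ is interval-closed if $x\preccurlyeq y\preccurlyeq z$ with $x,z\in\Gamma$ implies $y\in\Gamma$. Grade $\mathfrak a=\mathfrak g\ltimes V$ ($V$ an abelian ideal) and its enveloping algebra $U(\mathfrak a)$ by placing $\mathfrak g$ in degree $0$ and $V$ in degree $1$. For $(\lambda,r)\in\Lambda$ let $P(\lambda,r)=U(\mathfrak a)\otimes_{U(\mathfrak g)}V(\lambda)$, graded with $V(\lambda)$ in degree $r$. For finite $\Gamma\subset\Lambda$ let $\mathfrak B(\Gamma)$ be the algebra of degree-preserving $\mathfrak a$-module endomorphisms of $\bigoplus_{(\lambda,r)\in\Gamma}P(\lambda,r)$, graded by $$\mathfrak B(\Gamma)[k]=\bigoplus_{(\lambda,r),(\mu,r-k)\in\Gamma}\mathrm{Hom}(P(\lambda,r),P(\mu,r-k)),\qquad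 k\in\mathbb Z_+ .$$ Let $A=\mathrm{Sym}\,V$ and let $\mathbf A=A\otimes\bigl(\bigoplus_{\mu\in P^+}V(\mu)^*\bigr)\otimes\bigl(\bigoplus_{\mu\in P^+}V(\mu)\bigr)$, with product $(a\otimes f\otimes v)(b\otimes g\otimes w)=g(v)\,ab\otimes f\otimes w$, the tensor product action of $\mathfrak g$, and the grading of $A$. Let $1_\mu\in\mathbf A$ be $1_A$ tensored with the canonical invariant element of $V(\mu)^*\otimes V(\mu)$, and for $F\subset P^+$ let $$\mathbf A_\Psi(F)=\bigoplus_{\mu,\nu\in F,\ \mu\le_\Psi\nu}1_\nu\,\mathbf A[d_\Psi(\mu,\nu)]\,1_\mu ,$$ with subspace of invariants $\mathbf A_\Psi(F)^{\mathfrak g}$. Fix $(\mu,r)\in\Lambda$, and let $\Gamma\subset\Lambda$ be finite and interval-closed, with $(\mu,r)\preccurlyeq_\Psi(\nu,s)$ for all $(\nu,s)\in\Gamma$. Let $\pi_1(\Gamma)\subset P^+$ be the image of $\Gamma$ under the first projection. Then the algebra $\mathfrak B(\Gamma)^{\mathrm{op}}$ has global dimension at most $N_\Psi$, the spaces $\mathfrak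 B(\Gamma)[k]$, $k\in\mathbb Z_+$, form an algebra grading of $\mathfrak B(\Gamma)$, and $\mathfrak B(\Gamma)^{\mathrm{op}}$ is isomorphic as a $\mathbb Z_+$-graded algebra to $\mathbf A_\Psi(\pi_1(\Gamma))^{\mathfrak g}$. -/

import Mathlib

open scoped TensorProduct DirectSum

noncomputable section

namespace FaceKoszul

attribute [local instance 100] LieRing.ofAssociativeRing

universe u v w

/-! ### Symmetric algebra of a Lie module -/

section Sym

variable {L : Type u} [LieRing L] [LieAlgebra ℂ L]
variable {V : Type v} [AddCommGroup V] [Module ℂ V] [LieRingModule L V] [LieModule ℂ L V]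

/-- The algebra map `Sym V → Sym V [ε]` with `v ↦ v + ε ⁅x, v⁆`. -/
def symDual (x : L) :
    SymmetricAlgebra ℂ V →ₐ[ℂ] TrivSqZeroExt (SymmetricAlgebra ℂ V) (SymmetricAlgebra ℂ V) :=
  SymmetricAlgebra.lift
    ((TrivSqZeroExt.inlAlgHom ℂ (SymmetricAlgebra ℂ V) (SymmetricAlgebra ℂ V)).toLinearMap ∘ₗ
        SymmetricAlgebra.ι ℂ V +
      (TrivSqZeroExt.inrHom (SymmetricAlgebra ℂ V) (SymmetricAlgebra ℂ V)).restrictScalars ℂ ∘ₗ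
        SymmetricAlgebra.ι ℂ V ∘ₗ (LieModule.toEnd ℂ L V x))

theorem symDual_fst (x : L) (s : SymmetricAlgebra ℂ V) : (symDual x s).fst = s := by
  have h : (TrivSqZeroExt.fstHom ℂ (SymmetricAlgebra ℂ V) (SymmetricAlgebra ℂ V)).comp
      (symDual (V := V) x) = AlgHom.id ℂ _ := by
    apply SymmetricAlgebra.algHom_ext
    ext v
    simp [symDual]
  exact DFunLike.congr_fun h s

/-- The derivation of `Sym V` extending the action of `x` on `V`. -/
def symDer (x : L) : Derivation ℂ (SymmetricAlgebra ℂ V) (SymmetricAlgebra ℂ V) :=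
  Derivation.mk'
    ((TrivSqZeroExt.sndHom (SymmetricAlgebra ℂ V) (SymmetricAlgebra ℂ V)).restrictScalars ℂ ∘ₗ
      (symDual x).toLinearMap)
    (fun a b => by simp [symDual_fst, mul_comm])

@[simp]
theorem symDer_ι (x : L) (v : V) :
    symDer x (SymmetricAlgebra.ι ℂ V v) = SymmetricAlgebra.ι ℂ V ⁅x, v⁆ := by
  simp [symDer, symDual]

theorem derivation_ext_ι {D E : Derivation ℂ (SymmetricAlgebra ℂ V) (SymmetricAlgebra ℂ V)}
    (h : ∀ v, D (SymmetricAlgebra.ι ℂ V v) = E (SymmetricAlgebra.ι ℂ V v)) : D = E := by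
  ext s
  induction s using SymmetricAlgebra.induction with
  | algebraMap r => simp
  | ι x => exact h x
  | mul a b ha hb => simp [ha, hb]
  | add a b ha hb => simp [ha, hb]

/-- `L` acts on `Sym V` by derivations. -/
instance symLieRingModule : LieRingModule L (SymmetricAlgebra ℂ V) where
  bracket x s := symDer x s
  add_lie x y s := by
    have : symDer (V := V) (x + y) = symDer x + symDer y := derivation_ext_ι fun v => by simp
    change symDer (x + y) s = symDer x s + symDer y s
    rw [this]; rfl
  lie_add x s t := map_add _ s t
  leibniz_lie x y s := by
    have : symDer (V := V) ⁅x, y⁆ = ⁅symDer x, symDer y⁆ :=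
      derivation_ext_ι fun v => by
        rw [Derivation.commutator_apply, symDer_ι, symDer_ι, symDer_ι, symDer_ι, symDer_ι, lie_lie,
          map_sub]
    change symDer x (symDer y s) = symDer ⁅x, y⁆ s + symDer y (symDer x s)
    rw [this, Derivation.commutator_apply]; abel

instance symLieModule : LieModule ℂ L (SymmetricAlgebra ℂ V) where
  smul_lie c x s := by
    have : symDer (V := V) (c • x) = c • symDer x := derivation_ext_ι fun v => by simp
    change symDer (c • x) s = c • symDer x s
    rw [this]; rfl
  lie_smul c x s := (symDer x).map_smul c s

variable (V) in
/-- `Sym^k V`. -/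
def symPow (k : ℕ) : Submodule ℂ (SymmetricAlgebra ℂ V) :=
  (LinearMap.range (SymmetricAlgebra.ι ℂ V)) ^ k

end Sym

/-! ### The semidirect product `𝔤 ⋉ V` and its enveloping algebra -/

section Semidirect

variable (L : Type u) [LieRing L] [LieAlgebra ℂ L]
variable (V : Type v) [AddCommGroup V] [Module ℂ V] [LieRingModule L V] [LieModule ℂ L V]

/-- `V` regarded as an abelian Lie algebra. -/
def AbelianLie (V : Type v) : Type v := V

instance : AddCommGroup (AbelianLie V) := inferInstanceAs (AddCommGroup V)
instance : Module ℂ (AbelianLie V) := inferInstanceAs (Module ℂ V)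

instance : LieRing (AbelianLie V) where
  bracket _ _ := 0
  add_lie _ _ _ := (add_zero _).symm
  lie_add _ _ _ := (add_zero _).symm
  lie_self _ := rfl
  leibniz_lie _ _ _ := (add_zero _).symm

instance : LieAlgebra ℂ (AbelianLie V) where
  lie_smul t _ _ := (smul_zero t).symm

/-- The action of `L` on `V`, by derivations of the abelian Lie algebra `V`. -/
def actionDer : L →ₗ⁅ℂ⁆ LieDerivation ℂ (AbelianLie V) (AbelianLie V) where
  toFun x :=
    { toLinearMap := (LieModule.toEnd ℂ L V x : V →ₗ[ℂ] V)
      leibniz' := fun a b => by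
        exact (lie_zero (M := V) x).trans (sub_zero (0 : V)).symm }
  map_add' x y := by ext v; exact add_lie x y (show V from v)
  map_smul' c x := by ext v; exact smul_lie c x (show V from v)
  map_lie' := by intro x y; ext v; exact lie_lie x y (show V from v)

/-- The Lie algebra `𝔞 = 𝔤 ⋉ V`, in which `V` is an abelian ideal. -/
abbrev SemiLie : Type (max u v) :=
  LieAlgebra.SemiDirectSum (AbelianLie V) L (actionDer L V)

/-- The enveloping algebra `U(𝔤 ⋉ V)`. -/
abbrev Ua : Type (max u v) := UniversalEnvelopingAlgebra ℂ (SemiLie L V)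

/-- The generators of `U(𝔤 ⋉ V)` coming from `𝔤` and from `V`. -/
def uaGen : L ⊕ V → Ua L V :=
  Sum.elim
    (fun x => UniversalEnvelopingAlgebra.ι ℂ (LieAlgebra.SemiDirectSum.inr (actionDer L V) x))
    (fun y => UniversalEnvelopingAlgebra.ι ℂ
      (LieAlgebra.SemiDirectSum.inl (actionDer L V) (show AbelianLie V from y)))

/-- `𝔤` lives in degree zero and `V` in degree one. -/
def genDeg : L ⊕ V → ℕ := Sum.elim (fun _ => 0) (fun _ => 1)

/-- The component `U(𝔤 ⋉ V)[n]`, spanned by the monomials of degree `n`. -/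
def uaGrade (n : ℕ) : Submodule ℂ (Ua L V) :=
  Submodule.span ℂ
    {u | ∃ l : List (L ⊕ V), (l.map (genDeg L V)).sum = n ∧ u = (l.map (uaGen L V)).prod}

variable (M : Type w) [AddCommGroup M] [Module ℂ M] [LieRingModule L M] [LieModule ℂ L M]

/-- The relations `u x ⊗ m = u ⊗ x m`, for `x` in `𝔤`. -/
def indRel : Submodule (Ua L V) (Ua L V ⊗[ℂ] M) :=
  Submodule.span (Ua L V)
    {t | ∃ (a : Ua L V) (x : L) (m : M), t = (a * uaGen L V (Sum.inl x)) ⊗ₜ m - a ⊗ₜ ⁅x, m⁆}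

/-- The induced module `U(𝔤 ⋉ V) ⊗_{U(𝔤)} M`. -/
abbrev Ind : Type (max u v w) := (Ua L V ⊗[ℂ] M) ⧸ indRel L V M

/-- The component of degree `k` of the induced module when `M` is placed in degree `r`. -/
def indGrade (r k : ℤ) : Submodule ℂ (Ind L V M) :=
  Submodule.span ℂ
    {p | ∃ (n : ℕ) (a : Ua L V) (m : M),
      (n : ℤ) + r = k ∧ a ∈ uaGrade L V n ∧ p = Submodule.Quotient.mk (a ⊗ₜ m)}

end Semidirect

/-! ### Dominant weights and simple modules -/

section Weights

variable {L : Type u} [LieRing L] [LieAlgebra ℂ L] [FiniteDimensional ℂ L]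
  [LieAlgebra.IsSemisimple ℂ L]
variable {H : LieSubalgebra ℂ L} [H.IsCartanSubalgebra]

/-- The set `P⁺` of dominant integral weights with respect to the base `b`. -/
abbrev Dominant (b : (LieAlgebra.IsKilling.rootSystem H).Base) : Type u :=
  {μ : Module.Dual ℂ H //
    ∀ i ∈ b.support, ∃ n : ℕ, μ ((LieAlgebra.IsKilling.rootSystem H).coroot i) = n}

variable (b : (LieAlgebra.IsKilling.rootSystem H).Base)

/-- `N` is a left ideal of `U(𝔤)` such that `U(𝔤)/N` is a finite-dimensional simple module in
which the class of `1` is a highest weight vector of weight `μ`. -/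
structure IsHighestWeightIdeal (μ : Module.Dual ℂ H)
    (N : Submodule (UniversalEnvelopingAlgebra ℂ L) (UniversalEnvelopingAlgebra ℂ L)) :
    Prop where
  isCoatom : IsCoatom N
  finite : FiniteDimensional ℂ (UniversalEnvelopingAlgebra ℂ L ⧸ N)
  pos_mem : ∀ i : H.root, b.IsPos i → ∀ x ∈ LieAlgebra.rootSpace H i.1,
    UniversalEnvelopingAlgebra.ι ℂ x ∈ N
  cartan_mem : ∀ h : H, UniversalEnvelopingAlgebra.ι ℂ (h : L) -
    algebraMap ℂ (UniversalEnvelopingAlgebra ℂ L) (μ h) ∈ N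

open Classical in
/-- The left ideal of `U(𝔤)` annihilating the highest weight vector of `V(μ)`. By the theorem of
the highest weight it exists and is unique for every dominant integral weight `μ`, so that the
second alternative is void. -/
def highestWeightIdeal (μ : Dominant b) :
    Submodule (UniversalEnvelopingAlgebra ℂ L) (UniversalEnvelopingAlgebra ℂ L) :=
  if h : ∃ N, IsHighestWeightIdeal b μ.1 N then h.choose else ⊤

/-- The finite-dimensional simple `𝔤`-module `V(μ)` of highest weight `μ`. -/
def Simple (μ : Dominant b) : Type u :=
  UniversalEnvelopingAlgebra ℂ L ⧸ highestWeightIdeal b μ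

variable (μ : Dominant b)

instance : AddCommGroup (Simple b μ) :=
  inferInstanceAs (AddCommGroup (UniversalEnvelopingAlgebra ℂ L ⧸ highestWeightIdeal b μ))

instance : Module (UniversalEnvelopingAlgebra ℂ L) (Simple b μ) :=
  inferInstanceAs (Module (UniversalEnvelopingAlgebra ℂ L)
    (UniversalEnvelopingAlgebra ℂ L ⧸ highestWeightIdeal b μ))

instance : Module ℂ (Simple b μ) :=
  inferInstanceAs (Module ℂ (UniversalEnvelopingAlgebra ℂ L ⧸ highestWeightIdeal b μ))

instance : IsScalarTower ℂ (UniversalEnvelopingAlgebra ℂ L) (Simple b μ) :=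
  inferInstanceAs (IsScalarTower ℂ (UniversalEnvelopingAlgebra ℂ L)
    (UniversalEnvelopingAlgebra ℂ L ⧸ highestWeightIdeal b μ))

instance : FiniteDimensional ℂ (Simple b μ) := by
  change FiniteDimensional ℂ (UniversalEnvelopingAlgebra ℂ L ⧸ highestWeightIdeal b μ)
  unfold highestWeightIdeal
  by_cases h : ∃ N, IsHighestWeightIdeal b μ.1 N
  · rw [dif_pos h]
    exact h.choose_spec.finite
  · rw [dif_neg h]
    have : Subsingleton (UniversalEnvelopingAlgebra ℂ L ⧸
        (⊤ : Submodule (UniversalEnvelopingAlgebra ℂ L) (UniversalEnvelopingAlgebra ℂ L))) :=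
      Submodule.Quotient.subsingleton_iff.mpr rfl
    exact Module.Finite.of_surjective (0 : ℂ →ₗ[ℂ] _) fun y => ⟨0, Subsingleton.elim _ _⟩

/-- `𝔤` acts on `V(μ)` through `U(𝔤)`. -/
instance : LieRingModule L (Simple b μ) where
  bracket x m := UniversalEnvelopingAlgebra.ι ℂ x • m
  add_lie x y m := by
    rw [map_add, add_smul]
  lie_add x m n := smul_add _ m n
  leibniz_lie x y m := by
    change UniversalEnvelopingAlgebra.ι ℂ x • UniversalEnvelopingAlgebra.ι ℂ y • m =
      UniversalEnvelopingAlgebra.ι ℂ ⁅x, y⁆ • m +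
        UniversalEnvelopingAlgebra.ι ℂ y • UniversalEnvelopingAlgebra.ι ℂ x • m
    rw [LieHom.map_lie, LieRing.of_associative_ring_bracket, sub_smul, mul_smul, mul_smul,
      sub_add_cancel]

instance : LieModule ℂ L (Simple b μ) where
  smul_lie c x m := by
    change UniversalEnvelopingAlgebra.ι ℂ (c • x) • m = c • UniversalEnvelopingAlgebra.ι ℂ x • m
    rw [map_smul, smul_assoc]
  lie_smul c x m := by
    change UniversalEnvelopingAlgebra.ι ℂ x • c • m = c • UniversalEnvelopingAlgebra.ι ℂ x • m
    exact smul_comm _ _ _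

end Weights

/-! ### The algebra `𝐕^⊛ ⊗ 𝐕` and the algebra `𝐀 = A ⊗ 𝐕^⊛ ⊗ 𝐕` -/

section Algebra

variable {L : Type u} [LieRing L] [LieAlgebra ℂ L] [FiniteDimensional ℂ L]
  [LieAlgebra.IsSemisimple ℂ L]
variable {H : LieSubalgebra ℂ L} [H.IsCartanSubalgebra]
variable (b : (LieAlgebra.IsKilling.rootSystem H).Base)

/-- `𝐕`, the direct sum of the `V(μ)`, for `μ` in `P⁺`. -/
abbrev BigV : Type u := ⨁ μ : Dominant b, Simple b μ

/-- `𝐕^⊛`, the direct sum of the `V(μ)^*`, for `μ` in `P⁺`. -/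
abbrev BigVStar : Type u := ⨁ μ : Dominant b, (Simple b μ →ₗ[ℂ] ℂ)

open Classical in
/-- The pairing `𝐕^⊛ × 𝐕 → ℂ`, `(g, v) ↦ g(v)`. -/
def pairing : BigVStar b →ₗ[ℂ] BigV b →ₗ[ℂ] ℂ :=
  DirectSum.toModule ℂ (Dominant b) (BigV b →ₗ[ℂ] ℂ)
    fun μ => LinearMap.lcomp ℂ ℂ (DirectSum.component ℂ (Dominant b) (fun ν => Simple b ν) μ)

/-- `𝐕^⊛ ⊗ 𝐕`. -/
def Mat : Type u := BigVStar b ⊗[ℂ] BigV b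

instance : AddCommGroup (Mat b) := inferInstanceAs (AddCommGroup (BigVStar b ⊗[ℂ] BigV b))
instance : Module ℂ (Mat b) := inferInstanceAs (Module ℂ (BigVStar b ⊗[ℂ] BigV b))
instance : LieRingModule L (Mat b) :=
  inferInstanceAs (LieRingModule L (BigVStar b ⊗[ℂ] BigV b))
instance : LieModule ℂ L (Mat b) := inferInstanceAs (LieModule ℂ L (BigVStar b ⊗[ℂ] BigV b))

variable {b} in
/-- The element `f ⊗ v` of `𝐕^⊛ ⊗ 𝐕`. -/
def Mat.tmul (f : BigVStar b) (v : BigV b) : Mat b := (f ⊗ₜ[ℂ] v : BigVStar b ⊗[ℂ] BigV b)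

/-- The multiplication `(f ⊗ v)(g ⊗ w) = g(v) f ⊗ w` of `𝐕^⊛ ⊗ 𝐕`. -/
def matMul : Mat b →ₗ[ℂ] Mat b →ₗ[ℂ] Mat b :=
  TensorProduct.lift (R := ℂ) (M := BigVStar b) (N := BigV b) (P₂ := Mat b →ₗ[ℂ] Mat b)
    (LinearMap.mk₂ ℂ
      (fun f v => (TensorProduct.lift (R := ℂ) (M := BigVStar b) (N := BigV b) (P₂ := Mat b)
        (LinearMap.mk₂ ℂ (fun g w => pairing b g v • Mat.tmul f w)
          (fun _ _ _ => by rw [map_add, LinearMap.add_apply, add_smul])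
          (fun _ _ _ => by rw [map_smul, LinearMap.smul_apply, smul_assoc])
          (fun _ _ _ => by
            rw [← smul_add]; exact congrArg _ (TensorProduct.tmul_add _ _ _))
          (fun _ _ _ => by
            rw [smul_comm]; exact congrArg _ (TensorProduct.tmul_smul _ _ _)))))
      (fun f f' v => by
        refine TensorProduct.ext' fun g w => ?_
        change pairing b g v • Mat.tmul (f + f') w =
          pairing b g v • Mat.tmul f w + pairing b g v • Mat.tmul f' w
        rw [← smul_add]; exact congrArg _ (TensorProduct.add_tmul _ _ _))
      (fun c f v => by
        refine TensorProduct.ext' fun g w => ?_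
        change pairing b g v • Mat.tmul (c • f) w = c • pairing b g v • Mat.tmul f w
        rw [smul_comm c]; exact congrArg _ (TensorProduct.smul_tmul' _ _ _).symm)
      (fun f v v' => by
        refine TensorProduct.ext' fun g w => ?_
        change pairing b g (v + v') • Mat.tmul f w =
          pairing b g v • Mat.tmul f w + pairing b g v' • Mat.tmul f w
        rw [map_add, add_smul])
      (fun c f v => by
        refine TensorProduct.ext' fun g w => ?_
        change pairing b g (c • v) • Mat.tmul f w = c • pairing b g v • Mat.tmul f w
        rw [map_smul, smul_assoc]))

theorem matMul_tmul (f g : BigVStar b) (v w : BigV b) :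
    matMul b (Mat.tmul f v) (Mat.tmul g w) = pairing b g v • Mat.tmul f w := rfl

theorem Mat.induction {p : Mat b → Prop} (h0 : p 0) (ht : ∀ f v, p (Mat.tmul f v))
    (ha : ∀ x y, p x → p y → p (x + y)) (x : Mat b) : p x :=
  TensorProduct.induction_on (motive := p) x h0 ht ha

instance : NonUnitalRing (Mat b) where
  mul x y := matMul b x y
  left_distrib x y z := map_add (matMul b x) y z
  right_distrib x y z := by
    change matMul b (x + y) z = _
    rw [map_add]; rfl
  zero_mul x := by
    change matMul b 0 x = 0
    rw [map_zero]; rfl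
  mul_zero x := map_zero (matMul b x)
  mul_assoc x y z := by
    change matMul b (matMul b x y) z = matMul b x (matMul b y z)
    induction x using Mat.induction with
    | h0 => simp
    | ha x x' h h' =>
      rw [map_add, LinearMap.add_apply, LinearMap.add_apply, map_add, LinearMap.add_apply, h, h']
    | ht f v =>
      induction y using Mat.induction with
      | h0 => simp
      | ha x x' h h' =>
        rw [map_add, map_add, LinearMap.add_apply, map_add, LinearMap.add_apply, map_add, h, h']
      | ht g w =>
        induction z using Mat.induction with
        | h0 => simp
        | ha x x' h h' => rw [map_add, map_add, map_add, h, h']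
        | ht k t =>
          rw [matMul_tmul, matMul_tmul, map_smul, map_smul, LinearMap.smul_apply, matMul_tmul,
            matMul_tmul, smul_comm]

theorem mat_mul_def (x y : Mat b) : x * y = matMul b x y := rfl

instance : IsScalarTower ℂ (Mat b) (Mat b) where
  smul_assoc c x y := by simp [mat_mul_def]

instance : SMulCommClass ℂ (Mat b) (Mat b) where
  smul_comm c x y := by simp [mat_mul_def]

open Classical in
/-- The canonical invariant element `1_μ` of `V(μ)^* ⊗ V(μ)`, corresponding to the identity. -/
def oneMat (μ : Dominant b) : Mat b :=
  (TensorProduct.map (DirectSum.lof ℂ (Dominant b) (fun ν => (Simple b ν →ₗ[ℂ] ℂ)) μ)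
    (DirectSum.lof ℂ (Dominant b) (fun ν => Simple b ν) μ)
    ((dualTensorHomEquiv ℂ (Simple b μ) (Simple b μ)).symm LinearMap.id) :
      BigVStar b ⊗[ℂ] BigV b)

variable (V : Type v) [AddCommGroup V] [Module ℂ V] [LieRingModule L V] [LieModule ℂ L V]

/-- The algebra `𝐀 = A ⊗ 𝐕^⊛ ⊗ 𝐕`, with `A = Sym V`. It is associative, in general without a
unit, with product `(a ⊗ f ⊗ v)(a' ⊗ g ⊗ w) = g(v) a a' ⊗ f ⊗ w`, and `𝔤` acts on it as on a
tensor product. -/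
abbrev BigA : Type (max u v) := SymmetricAlgebra ℂ V ⊗[ℂ] Mat b

/-- The component `𝐀[k]`. -/
def bigAGrade (k : ℕ) : Submodule ℂ (BigA b V) :=
  LinearMap.range (TensorProduct.map (symPow V k).subtype (LinearMap.id : Mat b →ₗ[ℂ] Mat b))

/-- The idempotent `1_μ` of `𝐀`. -/
def idem (μ : Dominant b) : BigA b V := 1 ⊗ₜ oneMat b μ

end Algebra

/-! ### The relation `≤_Ψ`, the distance `d_Ψ` and the orders on `Λ` -/

section Order

variable {E : Type w} [AddCommGroup E]

/-- `μ ≤_Ψ ν` means that `ν - μ` lies in the submonoid generated by `Ψ`. -/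
def LePsi (Ψ : Finset E) (μ ν : E) : Prop :=
  ν - μ ∈ AddSubmonoid.closure (Ψ : Set E)

/-- `d_Ψ(μ, ν)`, the least number of terms in an expression of `ν - μ` as a sum of elements of
`Ψ`. -/
def dPsi (Ψ : Finset E) (μ ν : E) : ℕ :=
  sInf {n | ∃ m : E →₀ ℕ, m.support ⊆ Ψ ∧ (m.sum fun β k => k • β) = ν - μ ∧
    (m.sum fun _ k => k) = n}

/-- If `∑_{α ∈ Ψ} m_α α = ∑_{β ∈ W} r_β β` with non-negative integers `m_α`, `r_β`, then
`∑ m_α ≤ ∑ r_β`, with equality if and only if `β ∈ Ψ` whenever `r_β > 0`. -/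
def Rigid (W : Set E) (Ψ : Finset E) : Prop :=
  ∀ m r : E →₀ ℕ, m.support ⊆ Ψ → (r.support : Set E) ⊆ W →
    (m.sum fun α k => k • α) = (r.sum fun β k => k • β) →
    (m.sum fun _ k => k) ≤ (r.sum fun _ k => k) ∧
      ((m.sum fun _ k => k) = (r.sum fun _ k => k) ↔ ∀ β, 0 < r β → β ∈ Ψ)

end Order

section Main

variable {L : Type u} [LieRing L] [LieAlgebra ℂ L] [FiniteDimensional ℂ L]
  [LieAlgebra.IsSemisimple ℂ L]
variable {H : LieSubalgebra ℂ L} [H.IsCartanSubalgebra]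
variable (V : Type v) [AddCommGroup V] [Module ℂ V] [LieRingModule L V] [LieModule ℂ L V]

variable (H) in
/-- The set of weights `wt(V)`. -/
def wt : Set (Module.Dual ℂ H) :=
  {μ | LieModule.weightSpace V (μ : H → ℂ) ≠ ⊥}

/-- `N_Ψ`, the sum of the dimensions of the weight spaces `V_ξ` for `ξ ∈ Ψ`. -/
def nPsi (Ψ : Finset (Module.Dual ℂ H)) : ℕ :=
  ∑ ξ ∈ Ψ, Module.finrank ℂ (LieModule.weightSpace V (ξ : H → ℂ))

variable (b : (LieAlgebra.IsKilling.rootSystem H).Base)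

/-- `Λ = P⁺ × ℤ`. -/
abbrev Lam : Type u := Dominant b × ℤ

variable {b}

/-- `y` covers `x` in `Λ`. As the Lie algebra `𝔤 ⋉ V` has no component of degree at least two,
this requires the degrees to differ by one. -/
def Covers (y x : Lam b) : Prop :=
  y.2 = x.2 + 1 ∧ y.1.1 - x.1.1 ∈ wt H V

/-- The order `≼` on `Λ`. -/
def Preceq : Lam b → Lam b → Prop :=
  Relation.ReflTransGen fun x y => Covers V y x

/-- The order `≼_Ψ` on `Λ`. -/
def PreceqPsi (Ψ : Finset (Module.Dual ℂ H)) (x y : Lam b) : Prop :=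
  LePsi Ψ x.1.1 y.1.1 ∧ (dPsi Ψ x.1.1 y.1.1 : ℤ) = y.2 - x.2

/-- `Γ` is interval-closed in `Λ` with respect to `≼`. -/
def IntervalClosed (Γ : Finset (Lam b)) : Prop :=
  ∀ x ∈ Γ, ∀ z ∈ Γ, ∀ y, Preceq V x y → Preceq V y z → y ∈ Γ

/-- `π₁(Γ)`. -/
def proj (Γ : Finset (Lam b)) : Set (Dominant b) := {ν | ∃ s : ℤ, (ν, s) ∈ Γ}

/-! ### The algebra `𝔅(Γ)` -/

/-- `P(Γ)`, the direct sum over `(λ, r) ∈ Γ` of the modules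
`P(λ, r) = U(𝔤 ⋉ V) ⊗_{U(𝔤)} V(λ, r)`. As `Γ` is finite, the direct sum is written as a
product. -/
def PGamma (Γ : Finset (Lam b)) : Type (max u v) := ∀ x : Γ, Ind L V (Simple b x.1.1)

instance (Γ : Finset (Lam b)) : AddCommGroup (PGamma V Γ) :=
  inferInstanceAs (AddCommGroup (∀ x : Γ, Ind L V (Simple b x.1.1)))

instance (Γ : Finset (Lam b)) : Module (Ua L V) (PGamma V Γ) :=
  inferInstanceAs (Module (Ua L V) (∀ x : Γ, Ind L V (Simple b x.1.1)))

instance (Γ : Finset (Lam b)) : Module ℂ (PGamma V Γ) :=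
  inferInstanceAs (Module ℂ (∀ x : Γ, Ind L V (Simple b x.1.1)))

instance (Γ : Finset (Lam b)) : IsScalarTower ℂ (Ua L V) (PGamma V Γ) :=
  inferInstanceAs (IsScalarTower ℂ (Ua L V) (∀ x : Γ, Ind L V (Simple b x.1.1)))

open Classical in
/-- The inclusion of the summand of `P(Γ)` indexed by `x`. -/
def PGamma.single (Γ : Finset (Lam b)) (x : Γ) :
    Ind L V (Simple b x.1.1) →ₗ[Ua L V] PGamma V Γ :=
  LinearMap.single (Ua L V) (fun x : Γ => Ind L V (Simple b x.1.1)) x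

/-- The component `P(Γ)[k]`, for the grading in which the generators `V(λ)` of the summand
indexed by `(λ, r)` have degree `r`. -/
def pGammaGrade (Γ : Finset (Lam b)) (k : ℤ) : Set (PGamma V Γ) :=
  {p | ∀ x : Γ, p x ∈ indGrade L V (Simple b x.1.1) x.1.2 k}

/-- `𝔅(Γ)`, the algebra of degree preserving endomorphisms of the `𝔤 ⋉ V`-module `P(Γ)`. -/
def frakB (Γ : Finset (Lam b)) : Subalgebra ℂ (Module.End (Ua L V) (PGamma V Γ)) where
  carrier := {f | ∀ k : ℤ, ∀ p ∈ pGammaGrade V Γ k, f p ∈ pGammaGrade V Γ k}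
  mul_mem' hf hg k p hp := hf k _ (hg k p hp)
  add_mem' hf hg k p hp x := by
    exact add_mem (hf k p hp x) (hg k p hp x)
  algebraMap_mem' c k p hp x := by
    rw [Module.algebraMap_end_apply]
    exact Submodule.smul_mem _ c (hp x)

/-- The component `𝔅(Γ)[k]`, the sum of the `Hom(P(λ, r), P(μ, r - k))` over all `(λ, r)` and
`(μ, r - k)` in `Γ`. -/
def frakBGrade (Γ : Finset (Lam b)) (k : ℕ) : Submodule ℂ (frakB V Γ) where
  carrier := {f | ∀ (x y : Γ) (p : Ind L V (Simple b x.1.1)), y.1.2 ≠ x.1.2 - k →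
    f.1 (PGamma.single V Γ x p) y = 0}
  zero_mem' x y p h := rfl
  add_mem' {f g} hf hg x y p h := by
    change f.1 _ y + g.1 _ y = 0
    rw [hf x y p h, hg x y p h, add_zero]
  smul_mem' c f hf x y p h := by
    change c • f.1 _ y = 0
    rw [hf x y p h, smul_zero]

/-! ### The algebras `𝐀_Ψ(F)^𝔤` -/

variable (b)

/-- `𝐀_Ψ(ν, μ) = 1_ν 𝐀[d_Ψ(μ, ν)] 1_μ`. -/
def aPsiPiece (Ψ : Finset (Module.Dual ℂ H)) (ν μ : Dominant b) : Submodule ℂ (BigA b V) :=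
  (bigAGrade b V (dPsi Ψ μ.1 ν.1)).map
    (LinearMap.mulRight ℂ (idem b V μ) ∘ₗ LinearMap.mulLeft ℂ (idem b V ν))

/-- `𝐀_Ψ(F)`, the sum of the `𝐀_Ψ(ν, μ)` over all `μ ≤_Ψ ν` in `F`. -/
def aPsi (Ψ : Finset (Module.Dual ℂ H)) (F : Set (Dominant b)) : Submodule ℂ (BigA b V) :=
  ⨆ (μ ∈ F) (ν ∈ F) (_ : LePsi Ψ μ.1 ν.1), aPsiPiece V b Ψ ν μ

/-- The space of invariants `𝐀_Ψ(F)^𝔤`. -/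
def aPsiInv (Ψ : Finset (Module.Dual ℂ H)) (F : Set (Dominant b)) : Submodule ℂ (BigA b V) :=
  aPsi V b Ψ F ⊓ (LieModule.maxTrivSubmodule ℂ L (BigA b V)).toSubmodule

end Main

/-- The ring `R` has (left) global dimension at most `n`. -/
def GlobalDimLE (R : Type w) [Ring R] (n : ℕ) : Prop :=
  ∀ M : ModuleCat.{w} R, CategoryTheory.HasProjectiveDimensionLE M n

end FaceKoszul

end

/-! As a module over `U(𝔤 ⋉ V)`, the induced module `P(λ, r)` is `Sym V ⊗ V(λ)`, because both have
the same universal property. A graded homomorphism `P(λ, r) → P(μ, s)` is therefore a `𝔤`-map `V(λ)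
→ Sym^(r-s) V ⊗ V(μ)`. If it is nonzero, the image of a highest weight vector can be lifted through
the multiplication maps `V ⊗ Sym^k V → Sym^(k+1) V` by Weyl's theorem, and one weight of `V` after
another can be peeled off (`IsHighest.peel`, `IsHighest.chain`). All intermediate weights are
dominant, so `(μ, s) ≼ (λ, r)`.

Every element of `Γ` lies above the base point with `d_Ψ` equal to the difference of degrees. By the
equality case of rigidity, a weight expression joining two elements of `Γ`, with as many terms as
the degrees differ, uses only weights in `Ψ` (`support_subset_of_preceqPsi`). Hence on `Γ` the
relation `≼` implies `≤_Ψ`, the degree of a homomorphism is `d_Ψ`, and a weight determines its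
degree, so that `π₁` is injective on `Γ`.

The isomorphism: an element `a ⊗ f ⊗ v` of `𝐀` is read as the map `w ↦ f(w) a ⊗ v` from `𝐕` to `A ⊗
𝐕`. Products then become compositions in the reverse order, which explains the opposite algebra, and
invariants become equivariant maps. Restricting an endomorphism of `P(Γ)` to the generators of the
summands gives `toBigA`. Its image lies in `𝐀_Ψ(π₁ Γ)^𝔤` by the preceding paragraph, and each
invariant extends back to an endomorphism by the universal property.

The global dimension: for `x = (λ, r)` in `Γ`, take the Koszul complex `Sym V ⊗ Λ^j V ⊗ V(λ)`, with
generators in degree `r + j`. The operators `∑ e_i ⊗ e_i^*` and `∑ ∂_i ⊗ e_i` have as anticommutator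
the total degree, so the complex is exact except in total degree zero (`koszul_homotopy`). Weyl's
theorem keeps it exact under graded homomorphisms from `P(Γ)`, and this gives a resolution of the
module at the vertex `x`. Its terms are projective (`projective_freeHom`): a simple constituent
`V(ν)` of `Λ^j V ⊗ V(λ)` either contributes no homomorphism, or has `(ν, r + j)` between two
elements of `Γ` and hence in `Γ`. Its terms vanish for `j > N_Ψ` (`le_nPsi_of_isHighest`): a nonzero
homomorphism produces a wedge of `j` distinct weight basis vectors, and rigidity puts all their
weights in `Ψ`.

Finally, `𝔅(Γ)` is triangular for the degree, with scalars on the diagonal by Schur's lemma. An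
arbitrary module is thus a finite iterated extension of direct sums of copies of vertex modules, and
each layer has projective dimension at most `N_Ψ` (`exists_submodule_hasProjectiveDimensionLT`). -/

noncomputable section

namespace FaceKoszul

attribute [local instance 100] LieRing.ofAssociativeRing

universe u v w

set_option linter.unusedSectionVars false

/-! ### Complete reducibility -/

section Weyl

open LieAlgebra LieModule

variable {L : Type u} [LieRing L] [LieAlgebra ℂ L] [FiniteDimensional ℂ L]
  [LieAlgebra.IsSemisimple ℂ L]

/-- An ideal acting faithfully on `X` and lying in the kernel of the trace form is zero. -/
theorem eq_bot_of_traceForm_eq_zero {X : Type*} [AddCommGroup X] [Module ℂ X] [LieRingModule L X]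
    [LieModule ℂ L X] [FiniteDimensional ℂ X] (K : LieIdeal ℂ L)
    (hf : ∀ x ∈ K, (∀ m : X, ⁅x, m⁆ = 0) → x = 0)
    (h0 : ∀ x ∈ K, ∀ y ∈ K, traceForm ℂ L X x y = 0) : K = ⊥ := by
  set D : LieIdeal ℂ L := ⁅K, K⁆
  have hDK : D ≤ K := LieSubmodule.lie_le_left K K
  have htf : traceForm ℂ K X = 0 := by
    ext ⟨x, hx⟩ ⟨y, hy⟩
    exact h0 x hx y hy
  -- Cartan's criterion: the derived ideal acts nilpotently on `X`. Faithfulness carries nilpotency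
  -- over to the adjoint action of `D`, and Engel's theorem then makes `D` nilpotent.
  have hnil := LieModule.isNilpotent_derivedSeries_of_traceForm_eq_zero htf
  have hring : LieRing.IsNilpotent D := by
    rw [LieAlgebra.isNilpotent_iff_forall (R := ℂ)]
    rintro ⟨x, hx⟩
    have hx' : (⟨x, hDK hx⟩ : K) ∈ derivedSeries ℂ K 1 := by
      rw [LieIdeal.derivedSeries_eq_derivedSeriesOfIdeal_comap, LieIdeal.mem_comap]
      exact hx
    have h1 : _root_.IsNilpotent (toEnd ℂ L X x) :=
      (LieModule.isNilpotent_iff_forall' (R := ℂ)).mp hnil ⟨⟨x, hDK hx⟩, hx'⟩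
    obtain ⟨n, hn⟩ := LieAlgebra.ad_nilpotent_of_nilpotent (R := ℂ) h1
    refine ⟨n, ?_⟩
    ext ⟨y, hy⟩
    have key : ∀ (k : ℕ), toEnd ℂ L X (((ad ℂ D ⟨x, hx⟩) ^ k) ⟨y, hy⟩ : D) =
        ((ad ℂ (Module.End ℂ X) (toEnd ℂ L X x)) ^ k) (toEnd ℂ L X y) := by
      intro k
      induction k with
      | zero => simp
      | succ k ih =>
        rw [pow_succ', pow_succ', Module.End.mul_apply, Module.End.mul_apply, ← ih]
        simp [LieHom.map_lie]
    have h2 := key n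
    rw [hn] at h2
    have h3 := hf _ (hDK (((ad ℂ D ⟨x, hx⟩) ^ n) ⟨y, hy⟩ : D).2)
      (fun m => by simpa using LinearMap.congr_fun h2 m)
    simpa using h3
  have hD : D = ⊥ := HasTrivialRadical.eq_bot_of_isSolvable D
  have : IsLieAbelian K := by
    rw [LieSubmodule.lie_abelian_iff_lie_self_eq_bot]
    exact hD
  exact HasTrivialRadical.eq_bot_of_isSolvable K

/-- If `L` acts non-trivially on `X`, then the Casimir endomorphism of the trace form is an
equivariant endomorphism that is not nilpotent. -/
theorem exists_casimir {X : Type*} [AddCommGroup X] [Module ℂ X] [LieRingModule L X]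
    [LieModule ℂ L X] [FiniteDimensional ℂ X] (hX : ∃ (x : L) (m : X), ⁅x, m⁆ ≠ 0) :
    ∃ c : X →ₗ⁅ℂ, L⁆ X, (∀ m, c m ∈ ⁅(⊤ : LieIdeal ℂ L), (⊤ : LieSubmodule ℂ L X)⁆) ∧
      ¬ _root_.IsNilpotent (c : X →ₗ[ℂ] X) := by
  classical
  set N : LieIdeal ℂ L := LieModule.ker ℂ L X
  set I : LieIdeal ℂ L := Nᶜ
  have hIN : IsCompl N I := isCompl_compl
  have hmemN : ∀ x, x ∈ N ↔ ∀ m : X, ⁅x, m⁆ = 0 := fun x => LieModule.mem_ker ..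
  have hdec : ∀ x : L, ∃ n ∈ N, ∃ i ∈ I, x = n + i := fun x => by
    have : x ∈ N ⊔ I := by rw [hIN.sup_eq_top]; trivial
    obtain ⟨n, hn, i, hi, h⟩ := (LieSubmodule.mem_sup N I x).mp this
    exact ⟨n, hn, i, hi, h.symm⟩
  have hinf : ∀ x, x ∈ N → x ∈ I → x = 0 := fun x h1 h2 => by
    have : x ∈ N ⊓ I := ⟨h1, h2⟩
    rwa [hIN.inf_eq_bot, LieSubmodule.mem_bot] at this
  let β : LinearMap.BilinForm ℂ L := traceForm ℂ L X
  have hβN : ∀ x ∈ N, ∀ y, β x y = 0 := fun x hx y => by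
    have : toEnd ℂ L X x = 0 := by ext m; exact (hmemN x).1 hx m
    simp [β, traceForm_apply_apply, this]
  have hNIbr : ∀ x ∈ N, ∀ y ∈ I, ⁅x, y⁆ = 0 := fun x hx y hy =>
    hinf _ (lie_mem_left ℂ L N x y hx) (lie_mem_right ℂ L I x y hy)
  let βI : LinearMap.BilinForm ℂ I := β.restrict I.toSubmodule
  have hsymm : βI.IsSymm := ⟨fun x y => LieModule.traceForm_comm ℂ L X x y⟩
  -- The radical of the form on `I` is an ideal that acts faithfully and on which the trace form
  -- vanishes, so it is zero.
  have hnd : βI.Nondegenerate := by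
    have hrad : ∀ x ∈ I, (∀ y ∈ I, β x y = 0) → x = 0 := by
      let K : LieIdeal ℂ L := I ⊓ InvariantForm.orthogonal β
        (LieModule.traceForm_lieInvariant ℂ L X) I
      have hK : K = ⊥ := by
        refine eq_bot_of_traceForm_eq_zero (X := X) K ?_ ?_
        · intro x hx h
          exact hinf x ((hmemN x).2 h) hx.1
        · intro x hx y hy
          exact (InvariantForm.mem_orthogonal β _ I y).1 hy.2 x hx.1
      intro x hx h
      have : x ∈ K := ⟨hx, (InvariantForm.mem_orthogonal β _ I x).2 fun y hy => by
        rw [← h y hy]; exact LieModule.traceForm_comm ℂ L X y x⟩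
      rwa [hK, LieSubmodule.mem_bot] at this
    refine hsymm.isRefl.nondegenerate_iff_separatingLeft.2 ?_
    intro x hx
    exact Subtype.ext (hrad x x.2 fun y hy => hx ⟨y, hy⟩)
  let bs := Module.finBasis ℂ I
  let ds := βI.dualBasis hnd bs
  have hbd : ∀ i j, βI (bs i) (ds j) = if i = j then 1 else 0 :=
    LinearMap.BilinForm.apply_dualBasis_right hnd hsymm bs
  have exb : ∀ z : I, z = ∑ j, βI z (ds j) • bs j := fun z => by
    apply bs.repr.injective
    ext k
    conv_lhs => rw [← bs.sum_repr z]
    have : ∀ j, βI z (ds j) = bs.repr z j := fun j => by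
      conv_lhs => rw [← bs.sum_repr z]
      simp only [map_sum, map_smul, LinearMap.sum_apply, LinearMap.smul_apply, hbd, smul_eq_mul,
        mul_ite, mul_one, mul_zero, Finset.sum_ite_eq', Finset.mem_univ, if_true]
    simp [this]
  have exd : ∀ z : I, z = ∑ j, βI (bs j) z • ds j := fun z => by
    conv_lhs => rw [← ds.sum_repr z]
    refine Finset.sum_congr rfl fun j _ => ?_
    rw [LinearMap.BilinForm.dualBasis_repr_apply, hsymm.eq]
  let φ := toEnd ℂ L X
  let c : Module.End ℂ X := ∑ i, φ (bs i) * φ (ds i)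
  have hcomm : ∀ z : L, φ z * c = c * φ z := by
    intro z
    obtain ⟨n, hn, y, hy, rfl⟩ := hdec z
    have hφn : φ n = 0 := by ext m; exact (hmemN n).1 hn m
    rw [map_add, hφn, zero_add]
    let Y : I := ⟨y, hy⟩
    have e1 : φ y * c - c * φ y = ∑ i, (φ (⁅Y, bs i⁆ : I) * φ (ds i) +
        φ (bs i) * φ (⁅Y, ds i⁆ : I)) := by
      simp only [c, Finset.mul_sum, Finset.sum_mul, ← Finset.sum_sub_distrib]
      refine Finset.sum_congr rfl fun i _ => ?_
      have a1 : φ (⁅Y, bs i⁆ : I) = φ y * φ (bs i) - φ (bs i) * φ y := LieHom.map_lie φ _ _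
      have a2 : φ (⁅Y, ds i⁆ : I) = φ y * φ (ds i) - φ (ds i) * φ y := LieHom.map_lie φ _ _
      rw [a1, a2]
      noncomm_ring
    have b1 : ∀ i, φ (⁅Y, bs i⁆ : I) = ∑ j, βI ⁅Y, bs i⁆ (ds j) • φ (bs j) := fun i => by
      conv_lhs => rw [exb ⁅Y, bs i⁆]
      simp
    have b2 : ∀ i, φ (⁅Y, ds i⁆ : I) = ∑ j, βI (bs j) ⁅Y, ds i⁆ • φ (ds j) := fun i => by
      conv_lhs => rw [exd ⁅Y, ds i⁆]
      simp
    -- By invariance, the matrices of `ad Y` in the two dual bases are negative transposes of each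
    -- other, so the double sum for the commutator cancels.
    have hinv : ∀ i j, βI ⁅Y, bs i⁆ (ds j) = - βI (bs i) ⁅Y, ds j⁆ := fun i j =>
      LieModule.traceForm_lieInvariant ℂ L X y (bs i) (ds j)
    have e2 : ∑ i, (φ (⁅Y, bs i⁆ : I) * φ (ds i) + φ (bs i) * φ (⁅Y, ds i⁆ : I)) = 0 := by
      rw [Finset.sum_add_distrib]
      simp only [b1, b2, Finset.sum_mul, Finset.mul_sum]
      rw [Finset.sum_comm, ← Finset.sum_add_distrib]
      refine Finset.sum_eq_zero fun i _ => ?_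
      rw [← Finset.sum_add_distrib]
      refine Finset.sum_eq_zero fun j _ => ?_
      rw [smul_mul_assoc, mul_smul_comm, hinv]
      simp
    exact sub_eq_zero.1 (e1.trans e2)
  refine ⟨{ c with map_lie' := fun {z m} => (LinearMap.congr_fun (hcomm z) m).symm }, ?_, ?_⟩
  · intro m
    change c m ∈ _
    simp only [c, LinearMap.sum_apply]
    exact sum_mem fun i _ => LieSubmodule.lie_mem_lie (LieSubmodule.mem_top _)
      (LieSubmodule.mem_top _)
  · intro hnil
    have htr : LinearMap.trace ℂ X c = 0 :=
      (LinearMap.isNilpotent_trace_of_isNilpotent hnil).eq_zero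
    -- Each summand has trace `β(b_i, d_i) = 1`. The trace is thus `dim I`, which is nonzero because
    -- `L` acts non-trivially.
    have htr2 : LinearMap.trace ℂ X c = (Module.finrank ℂ I : ℂ) := by
      simp only [c, map_sum]
      have : ∀ i, LinearMap.trace ℂ X (φ (bs i) * φ (ds i)) = 1 := fun i =>
        (hbd i i).trans (if_pos rfl)
      simp [this]
    rw [htr2] at htr
    have h0 : Module.finrank ℂ I = 0 := by exact_mod_cast htr
    obtain ⟨x, m, hxm⟩ := hX
    obtain ⟨n, hn, y, hy, rfl⟩ := hdec x
    have hy0 : (⟨y, hy⟩ : I) = 0 := by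
      have := Module.finrank_zero_iff.1 h0
      exact Subsingleton.elim _ _
    have : y = 0 := congrArg Subtype.val hy0
    rw [this, add_zero] at hxm
    exact hxm ((hmemN n).1 hn m)

/-- `X` is spanned by its invariants and by `L X`. -/
theorem maxTriv_sup_lie_top (n : ℕ) : ∀ (X : Type w) [AddCommGroup X] [Module ℂ X]
    [LieRingModule L X] [LieModule ℂ L X] [FiniteDimensional ℂ X], Module.finrank ℂ X ≤ n →
    LieModule.maxTrivSubmodule ℂ L X ⊔ ⁅(⊤ : LieIdeal ℂ L), (⊤ : LieSubmodule ℂ L X)⁆ = ⊤ := by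
  induction n with
  | zero =>
    intro X _ _ _ _ _ h
    have := Module.finrank_zero_iff.1 (Nat.le_zero.1 h)
    exact Subsingleton.elim _ _
  | succ n ih =>
    intro X _ _ _ _ _ hn
    by_cases hX : ∃ (x : L) (m : X), ⁅x, m⁆ ≠ 0
    swap
    · push Not at hX
      have : LieModule.maxTrivSubmodule ℂ L X = ⊤ := by
        rw [eq_top_iff]
        intro m _
        exact (LieModule.mem_maxTrivSubmodule ..).2 fun x => hX x m
      rw [this, top_sup_eq]
    obtain ⟨c, hc, hnil⟩ := exists_casimir hX
    let f : Module.End ℂ X := c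
    have hfl : ∀ (k : ℕ) (x : L) (m : X), (f ^ k) ⁅x, m⁆ = ⁅x, (f ^ k) m⁆ := by
      intro k x m
      induction k with
      | zero => rfl
      | succ k ihk =>
        rw [pow_succ', Module.End.mul_apply, Module.End.mul_apply, ihk]
        exact c.map_lie x _
    -- Fitting decomposition for the Casimir operator. The kernel part is proper because the
    -- operator is not nilpotent, so induction applies to it. The exponent `k + 1` leaves an outer
    -- factor `c` in the range part, whose values lie in `L X`.
    obtain ⟨k, hk⟩ := Filter.eventually_atTop.1 (LinearMap.eventually_isCompl_ker_pow_range_pow f)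
    have hcompl := hk (k + 1) (Nat.le_succ k)
    let Z : LieSubmodule ℂ L X :=
      { LinearMap.ker (f ^ (k + 1)) with
        lie_mem := fun {x m} hm => by
          change (f ^ (k + 1)) ⁅x, m⁆ = 0
          rw [hfl, show (f ^ (k + 1)) m = 0 from hm, lie_zero] }
    have hZ : Module.finrank ℂ Z ≤ n := by
      have hlt : LinearMap.ker (f ^ (k + 1)) ≠ ⊤ := fun h =>
        hnil ⟨k + 1, LinearMap.ker_eq_top.1 h⟩
      have := Submodule.finrank_lt hlt
      have h2 : Module.finrank ℂ Z = Module.finrank ℂ (LinearMap.ker (f ^ (k + 1))) := rfl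
      omega
    have hih := ih Z hZ
    rw [eq_top_iff]
    intro m _
    have hm : m ∈ LinearMap.ker (f ^ (k + 1)) ⊔ LinearMap.range (f ^ (k + 1)) := by
      rw [hcompl.sup_eq_top]; trivial
    obtain ⟨z, hz, y, ⟨y', rfl⟩, rfl⟩ := Submodule.mem_sup.1 hm
    refine add_mem ?_ ?_
    · have hz' : (⟨z, hz⟩ : Z) ∈ LieModule.maxTrivSubmodule ℂ L Z ⊔
          ⁅(⊤ : LieIdeal ℂ L), (⊤ : LieSubmodule ℂ L Z)⁆ := by rw [hih]; trivial
      have hmap := LieSubmodule.mem_map_of_mem (f := Z.incl) hz'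
      rw [LieSubmodule.map_sup, LieSubmodule.map_bracket_eq] at hmap
      refine sup_le_sup ?_ (LieSubmodule.mono_lie_right _ le_top) hmap
      rintro _ ⟨a, ha, rfl⟩
      refine (LieModule.mem_maxTrivSubmodule ..).2 fun x => ?_
      exact congrArg Subtype.val ((LieModule.mem_maxTrivSubmodule ..).1 ha x)
    · refine le_sup_right (a := LieModule.maxTrivSubmodule ℂ L X) ?_
      rw [pow_succ', Module.End.mul_apply]
      exact hc _

/-- **Weyl's theorem**, in the form of a lifting property. -/
theorem exists_lieModuleHom_lift {M : Type v} {Y : Type w} {Z : Type*} [AddCommGroup M] [Module ℂ M]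
    [LieRingModule L M] [LieModule ℂ L M] [FiniteDimensional ℂ M] [AddCommGroup Y] [Module ℂ Y]
    [LieRingModule L Y] [LieModule ℂ L Y] [FiniteDimensional ℂ Y] [AddCommGroup Z] [Module ℂ Z]
    [LieRingModule L Z] [LieModule ℂ L Z] (p : Y →ₗ⁅ℂ, L⁆ Z) (f : M →ₗ⁅ℂ, L⁆ Z)
    (hp : ∀ m, ∃ y, p y = f m) : ∃ g : M →ₗ⁅ℂ, L⁆ Y, ∀ m, p (g m) = f m := by
  let P : (M →ₗ[ℂ] Y) →ₗ[ℂ] (M →ₗ[ℂ] Z) := LinearMap.compRight ℂ (p : Y →ₗ[ℂ] Z)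
  have hP : ∀ g m, P g m = p (g m) := fun _ _ => rfl
  have hPl : ∀ (x : L) (g : M →ₗ[ℂ] Y), P ⁅x, g⁆ = ⁅x, P g⁆ := fun x g => by
    ext m; simp [hP, LieHom.lie_apply]
  have hfl : ∀ x : L, ⁅x, (f : M →ₗ[ℂ] Z)⁆ = 0 := fun x => by
    ext m; simp [LieHom.lie_apply]
  -- The linear maps `g` such that `p ∘ g` is a multiple of `f`. As `f` is invariant, `p ∘ -` kills
  -- `L X`; so if a linear lift of `f` is split into an invariant part and a part in `L X`, the
  -- invariant part is still a lift.
  let X : LieSubmodule ℂ L (M →ₗ[ℂ] Y) :=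
    { (Submodule.span ℂ {(f : M →ₗ[ℂ] Z)}).comap P with
      lie_mem := fun {x g} hg => by
        change P ⁅x, g⁆ ∈ Submodule.span ℂ {(f : M →ₗ[ℂ] Z)}
        obtain ⟨a, ha⟩ := Submodule.mem_span_singleton.1
          (show P g ∈ Submodule.span ℂ {(f : M →ₗ[ℂ] Z)} from hg)
        rw [hPl, ← ha, lie_smul, hfl, smul_zero]
        exact zero_mem _ }
  have hX0 : ∀ (x : L) (g : X), P ⁅x, (g : M →ₗ[ℂ] Y)⁆ = 0 := fun x g => by
    obtain ⟨a, ha⟩ := Submodule.mem_span_singleton.1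
      (show P g ∈ Submodule.span ℂ {(f : M →ₗ[ℂ] Z)} from g.2)
    rw [hPl, ← ha, lie_smul, hfl, smul_zero]
  obtain ⟨f', hf'⟩ : ∃ f' : M →ₗ[ℂ] Y, P f' = f := by
    let bs := Module.finBasis ℂ M
    choose y hy using fun i => hp (bs i)
    refine ⟨bs.constr ℂ y, bs.ext fun i => ?_⟩
    rw [hP, bs.constr_basis, hy]; rfl
  have hmem : f' ∈ X := by
    change P f' ∈ Submodule.span ℂ {(f : M →ₗ[ℂ] Z)}
    rw [hf']; exact Submodule.mem_span_singleton_self _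
  have htop := maxTriv_sup_lie_top (L := L) _ X le_rfl
  have hm : (⟨f', hmem⟩ : X) ∈ LieModule.maxTrivSubmodule ℂ L X ⊔
      ⁅(⊤ : LieIdeal ℂ L), (⊤ : LieSubmodule ℂ L X)⁆ := by rw [htop]; trivial
  obtain ⟨a, ha, c, hc, hac⟩ := (LieSubmodule.mem_sup _ _ _).1 hm
  have hPc : P (c : M →ₗ[ℂ] Y) = 0 := by
    rw [← LieSubmodule.mem_toSubmodule, LieSubmodule.lieIdeal_oper_eq_linear_span'] at hc
    clear hac
    induction hc using Submodule.span_induction with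
    | mem c hc =>
      obtain ⟨x, -, g, -, rfl⟩ := hc
      exact hX0 x g
    | zero => simp
    | add a b _ _ ha hb => simp [ha, hb]
    | smul t a _ ha => simp [ha]
  have haP : P (a : M →ₗ[ℂ] Y) = f := by
    have h1 : (a : M →ₗ[ℂ] Y) + c = f' := congrArg Subtype.val hac
    rw [← hf', ← h1, map_add, hPc, add_zero]
  refine ⟨{ (a : M →ₗ[ℂ] Y) with map_lie' := fun {x m} => ?_ }, fun m => ?_⟩
  · have h1 := (LieModule.mem_maxTrivSubmodule ..).1 ha x
    have h2 : ⁅x, (a : M →ₗ[ℂ] Y)⁆ m = 0 := by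
      rw [← LieSubmodule.coe_bracket, h1]; rfl
    rw [LieHom.lie_apply, sub_eq_zero] at h2
    exact h2.symm
  · exact LinearMap.congr_fun haP m

/-- **Weyl's theorem**: every submodule of a finite-dimensional module has a complement. -/
theorem exists_isCompl_lieSubmodule {X : Type w} [AddCommGroup X] [Module ℂ X]
    [LieRingModule L X] [LieModule ℂ L X] [FiniteDimensional ℂ X] (W : LieSubmodule ℂ L X) :
    ∃ W' : LieSubmodule ℂ L X, IsCompl W W' := by
  obtain ⟨g, hg⟩ := exists_lieModuleHom_lift (LieSubmodule.Quotient.mk' W)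
    (LieModuleHom.id : (X ⧸ W) →ₗ⁅ℂ, L⁆ (X ⧸ W)) (fun m => LieSubmodule.Quotient.surjective_mk' W m)
  have hW : ∀ x, LieSubmodule.Quotient.mk' W x = 0 ↔ x ∈ W := fun x =>
    LieSubmodule.Quotient.mk_eq_zero'
  refine ⟨g.range, ?_⟩
  constructor
  · rw [disjoint_iff, eq_bot_iff]
    rintro _ ⟨hx, ⟨q, rfl⟩⟩
    have h1 : q = 0 := by
      rw [← show LieSubmodule.Quotient.mk' W (g q) = q from hg q]
      exact (hW _).2 hx
    rw [h1]; simp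
  · rw [codisjoint_iff, eq_top_iff]
    intro x _
    refine (LieSubmodule.mem_sup _ _ _).2 ⟨x - g (LieSubmodule.Quotient.mk' W x), ?_,
      g (LieSubmodule.Quotient.mk' W x), ⟨_, rfl⟩, sub_add_cancel _ _⟩
    rw [← hW, map_sub, hg]
    simp

end Weyl

/-! ### Highest weight vectors -/

section HighestWeight

open LieAlgebra LieModule Module

variable {L : Type u} [LieRing L] [LieAlgebra ℂ L] [FiniteDimensional ℂ L]
  [LieAlgebra.IsSemisimple ℂ L]
variable {H : LieSubalgebra ℂ L} [H.IsCartanSubalgebra]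
variable (b : (LieAlgebra.IsKilling.rootSystem H).Base)

/-- The span of the positive root spaces. -/
def nPos : Submodule ℂ L :=
  ⨆ (i : H.root) (_ : b.IsPos i), (rootSpace H i.1).toSubmodule

/-- The span of the negative root spaces. -/
def nNeg : Submodule ℂ L :=
  ⨆ (i : H.root) (_ : ¬ b.IsPos i), (rootSpace H i.1).toSubmodule

theorem nPos_sup_nNeg_sup_cartan : nPos b ⊔ (nNeg b ⊔ H.toSubmodule) = ⊤ := by
  have h := congrArg LieSubmodule.toSubmodule
    (LieAlgebra.cartan_sup_iSup_rootSpace_eq_top (K := ℂ) (L := L) H)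
  rw [LieSubmodule.top_toSubmodule] at h
  rw [eq_top_iff, ← h]
  simp only [LieSubmodule.sup_toSubmodule, LieSubmodule.iSup_toSubmodule]
  refine sup_le ?_ (iSup₂_le fun α hα => ?_)
  · exact le_sup_of_le_right le_sup_right
  · have hα' : α ∈ H.root := by simpa using hα
    by_cases hp : b.IsPos ⟨α, hα'⟩
    · exact le_sup_of_le_left (le_iSup₂_of_le (f := fun (i : H.root) (_ : b.IsPos i) =>
        (rootSpace H i.1).toSubmodule) ⟨α, hα'⟩ hp le_rfl)
    · exact le_sup_of_le_right (le_sup_of_le_left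
        (le_iSup₂_of_le (f := fun (i : H.root) (_ : ¬ b.IsPos i) =>
        (rootSpace H i.1).toSubmodule) ⟨α, hα'⟩ hp le_rfl))

/-- The simple roots are linearly independent, so some functional on the dual of `H` takes the value
`1` on each of them. In finite dimension it is evaluation at an element of `H`. -/
theorem exists_heightElement : ∃ h₀ : H, ∀ i : H.root, i.1 h₀ = (b.height i : ℂ) := by
  classical
  let P := LieAlgebra.IsKilling.rootSystem H
  have hli : LinearIndependent ℂ (fun i : b.support => P.root i) := b.linearIndepOn_root
  let e := Module.Basis.extend (LinearIndependent.linearIndepOn_id hli)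
  obtain ⟨g, hg⟩ : ∃ g : Module.Dual ℂ (Module.Dual ℂ H), ∀ i : b.support, g (P.root i) = 1 := by
    refine ⟨e.constr ℂ fun _ => 1, fun i => ?_⟩
    have hmem : P.root i ∈ (LinearIndependent.linearIndepOn_id hli).extend
        (Set.subset_univ _) := (LinearIndependent.linearIndepOn_id hli).subset_extend _ ⟨i, rfl⟩
    have : P.root i = e ⟨P.root i, hmem⟩ := by simp [e]
    rw [this, e.constr_basis]
  refine ⟨(Module.evalEquiv ℂ H).symm g, fun i => ?_⟩
  have hev : ∀ χ : Module.Dual ℂ H, χ ((Module.evalEquiv ℂ H).symm g) = g χ := fun χ => by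
    simp
  obtain ⟨f, -, -, hf⟩ := b.exists_root_eq_sum_int i
  have h1 : i.1 ((Module.evalEquiv ℂ H).symm g) = g (P.root i) := hev (P.root i)
  rw [h1, hf, RootPairing.Base.height_eq_sum hf, map_sum]
  push_cast
  refine Finset.sum_congr rfl fun j hj => ?_
  rw [map_zsmul, hg ⟨j, hj⟩]; simp

/-- An element of the Cartan subalgebra on which every root takes its height as value. -/
def heightElement : H := (exists_heightElement b).choose

theorem root_heightElement (i : H.root) : i.1 (heightElement b) = (b.height i : ℂ) :=
  (exists_heightElement b).choose_spec i

section Module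

variable {X : Type*} [AddCommGroup X] [Module ℂ X] [LieRingModule L X] [LieModule ℂ L X]

theorem lie_mem_of_mem_nPos {v : X} {T : Submodule ℂ X}
    (h : ∀ i : H.root, b.IsPos i → ∀ x ∈ rootSpace H i.1, ⁅x, v⁆ ∈ T) :
    ∀ x ∈ nPos b, ⁅x, v⁆ ∈ T := by
  have : nPos b ≤ T.comap ((toEnd ℂ L X : L →ₗ[ℂ] Module.End ℂ X).flip v) :=
    iSup₂_le fun i hi x hx => h i hi x hx
  exact this

theorem lie_mem_of_mem_nNeg {v : X} {T : Submodule ℂ X}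
    (h : ∀ i : H.root, ¬ b.IsPos i → ∀ x ∈ rootSpace H i.1, ⁅x, v⁆ ∈ T) :
    ∀ x ∈ nNeg b, ⁅x, v⁆ ∈ T := by
  have : nNeg b ≤ T.comap ((toEnd ℂ L X : L →ₗ[ℂ] Module.End ℂ X).flip v) :=
    iSup₂_le fun i hi x hx => h i hi x hx
  exact this

/-- If `L = A + B` and `B` preserves the line through `v`, then the submodule generated by `v` is
the smallest `A`-stable subspace containing `v`. -/
theorem lieSpan_le_of_stable {A B : Submodule ℂ L} (hAB : A ⊔ B = ⊤) {v : X}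
    (hB : ∀ x ∈ B, ⁅x, v⁆ ∈ ℂ ∙ v) {T : Submodule ℂ X} (hv : v ∈ T)
    (hT : ∀ x ∈ A, ∀ m ∈ T, ⁅x, m⁆ ∈ T) :
    (LieSubmodule.lieSpan ℂ L {v}).toSubmodule ≤ T := by
  let S : Submodule ℂ X :=
    sInf {T : Submodule ℂ X | v ∈ T ∧ ∀ x ∈ A, ∀ m ∈ T, ⁅x, m⁆ ∈ T}
  have hvS : v ∈ S := (Submodule.mem_sInf).2 fun T hT => hT.1
  have hAS : ∀ x ∈ A, ∀ m ∈ S, ⁅x, m⁆ ∈ S := fun x hx m hm =>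
    (Submodule.mem_sInf).2 fun T hT => hT.2 x hx m ((Submodule.mem_sInf).1 hm T hT)
  have hSle : ∀ {T : Submodule ℂ X}, v ∈ T → (∀ x ∈ A, ∀ m ∈ T, ⁅x, m⁆ ∈ T) → S ≤ T :=
    fun h1 h2 => sInf_le ⟨h1, h2⟩
  -- The vectors of `S` which all of `L` maps into `S`. By the Leibniz rule this space is
  -- `A`-stable, so it is all of `S` by minimality, and `S` is a submodule. No ordering of monomials
  -- in the enveloping algebra is needed.
  let T' : Submodule ℂ X :=
    { carrier := {m | m ∈ S ∧ ∀ z : L, ⁅z, m⁆ ∈ S}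
      add_mem' := fun {a c} ha hc => ⟨add_mem ha.1 hc.1, fun z => by
        rw [lie_add]; exact add_mem (ha.2 z) (hc.2 z)⟩
      zero_mem' := ⟨zero_mem _, fun z => by rw [lie_zero]; exact zero_mem _⟩
      smul_mem' := fun t a ha => ⟨Submodule.smul_mem _ _ ha.1, fun z => by
        rw [lie_smul]; exact Submodule.smul_mem _ _ (ha.2 z)⟩ }
  have hST : S ≤ T' := by
    refine hSle ⟨hvS, fun z => ?_⟩ ?_
    · have hz : z ∈ A ⊔ B := by rw [hAB]; trivial
      obtain ⟨x, hx, y, hy, rfl⟩ := Submodule.mem_sup.1 hz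
      rw [add_lie]
      refine add_mem (hAS x hx v hvS) ?_
      exact (Submodule.span_singleton_le_iff_mem _ _).2 hvS (hB y hy)
    · rintro x hx m ⟨hm, hm'⟩
      refine ⟨hm' x, fun z => ?_⟩
      rw [leibniz_lie]
      exact add_mem (hm' _) (hAS x hx _ (hm' z))
  let S' : LieSubmodule ℂ L X := { S with lie_mem := fun {z m} hm => (hST hm).2 z }
  have h1 : LieSubmodule.lieSpan ℂ L {v} ≤ S' :=
    LieSubmodule.lieSpan_le.2 (Set.singleton_subset_iff.2 hvS)
  exact le_trans (b := S) h1 (hSle hv hT)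

/-- `v` is annihilated by the positive root spaces and has weight `χ`. -/
def IsHighest (v : X) (χ : Module.Dual ℂ H) : Prop :=
  (∀ i : H.root, b.IsPos i → ∀ x ∈ rootSpace H i.1, ⁅x, v⁆ = 0) ∧
    ∀ h : H, ⁅(h : L), v⁆ = χ h • v

/-- The sum of the eigenspaces of the height element for the eigenvalues `c - 1`, `c - 2`, ... -/
def lowerPart (X : Type*) [AddCommGroup X] [Module ℂ X] [LieRingModule L X] [LieModule ℂ L X]
    (c : ℂ) : Submodule ℂ X :=
  ⨆ n : ℕ, (toEnd ℂ L X (heightElement b : L)).eigenspace (c - (n + 1))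

theorem lie_mem_eigenspace (i : H.root) {x : L} (hx : x ∈ rootSpace H i.1) {c : ℂ} {m : X}
    (hm : m ∈ (toEnd ℂ L X (heightElement b : L)).eigenspace c) :
    ⁅x, m⁆ ∈ (toEnd ℂ L X (heightElement b : L)).eigenspace (c + b.height i) := by
  rw [Module.End.mem_eigenspace_iff, toEnd_apply_apply] at hm ⊢
  have h1 : ⁅(heightElement b : L), x⁆ = (b.height i : ℂ) • x := by
    rw [← root_heightElement]
    exact LieAlgebra.IsKilling.lie_eq_smul_of_mem_rootSpace hx _
  rw [leibniz_lie, h1, hm, smul_lie, lie_smul, add_smul, add_comm]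

theorem lie_cartan_mem_eigenspace (h : H) {c : ℂ} {m : X}
    (hm : m ∈ (toEnd ℂ L X (heightElement b : L)).eigenspace c) :
    ⁅(h : L), m⁆ ∈ (toEnd ℂ L X (heightElement b : L)).eigenspace c := by
  rw [Module.End.mem_eigenspace_iff, toEnd_apply_apply] at hm ⊢
  have h1 : ⁅(heightElement b : L), (h : L)⁆ = 0 := by
    have : ⁅heightElement b, h⁆ = 0 := trivial_lie_zero H H _ _
    exact congrArg Subtype.val this
  rw [leibniz_lie, h1, hm, zero_lie, lie_smul, zero_add]

theorem eigenspace_le_lowerPart {c c' : ℂ} {n : ℕ} (h : c' = c - (n + 1)) :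
    (toEnd ℂ L X (heightElement b : L)).eigenspace c' ≤ lowerPart b X c := by
  subst h
  exact le_iSup (fun n : ℕ => (toEnd ℂ L X (heightElement b : L)).eigenspace (c - (n + 1))) n

theorem height_of_not_isPos {i : H.root} (hi : ¬ b.IsPos i) :
    ∃ k : ℕ, (b.height i : ℂ) = - (k + 1) := by
  have h1 := b.height_ne_zero i
  rw [RootPairing.Base.isPos_iff] at hi
  refine ⟨(-(b.height i) - 1).toNat, ?_⟩
  have : (((-(b.height i) - 1).toNat : ℤ) : ℂ) = ((-(b.height i) - 1 : ℤ) : ℂ) := by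
    rw [Int.toNat_of_nonneg (by omega)]
  rw [Int.cast_natCast] at this
  rw [this]; push_cast; ring

theorem lie_mem_lowerPart_of_eigenspace {c : ℂ} {m : X}
    (hm : m ∈ (toEnd ℂ L X (heightElement b : L)).eigenspace c) :
    ∀ x ∈ nNeg b, ⁅x, m⁆ ∈ lowerPart b X c := by
  refine lie_mem_of_mem_nNeg b fun i hi x hx => ?_
  obtain ⟨k, hk⟩ := height_of_not_isPos b hi
  refine eigenspace_le_lowerPart b (n := k) ?_ (lie_mem_eigenspace b i hx hm)
  rw [hk]; ring

theorem lowerPart_le {c : ℂ} (n : ℕ) : lowerPart b X (c - n) ≤ lowerPart b X c :=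
  iSup_le fun k => eigenspace_le_lowerPart b (n := n + k) (by push_cast; ring)

theorem lie_mem_lowerPart {c : ℂ} {m : X} (hm : m ∈ lowerPart b X c) :
    ∀ x ∈ nNeg b, ⁅x, m⁆ ∈ lowerPart b X c := by
  intro x hx
  refine Submodule.iSup_induction _ (motive := fun m => ⁅x, m⁆ ∈ lowerPart b X c) hm
    (fun n m hm => ?_) (by rw [lie_zero]; exact zero_mem _)
    (fun a c ha hc => by rw [lie_add]; exact add_mem ha hc)
  have := lie_mem_lowerPart_of_eigenspace b hm x hx
  have h2 := lowerPart_le (X := X) b (c := c) (n + 1)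
  push_cast at h2
  exact h2 this

theorem lie_cartan_mem_lowerPart {c : ℂ} {m : X} (hm : m ∈ lowerPart b X c) (h : H) :
    ⁅(h : L), m⁆ ∈ lowerPart b X c := by
  refine Submodule.iSup_induction _ (motive := fun m => ⁅(h : L), m⁆ ∈ lowerPart b X c) hm
    (fun n m hm => eigenspace_le_lowerPart b rfl (lie_cartan_mem_eigenspace b h hm))
    (by rw [lie_zero]; exact zero_mem _)
    (fun a c ha hc => by rw [lie_add]; exact add_mem ha hc)

theorem disjoint_eigenspace_lowerPart (c : ℂ) :
    Disjoint ((toEnd ℂ L X (heightElement b : L)).eigenspace c) (lowerPart b X c) := by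
  have h := (toEnd ℂ L X (heightElement b : L)).eigenspaces_iSupIndep c
  refine h.mono_right (iSup_le fun n => ?_)
  refine le_iSup₂_of_le (f := fun j (_ : j ≠ c) =>
    (toEnd ℂ L X (heightElement b : L)).eigenspace j) (c - (n + 1)) ?_ le_rfl
  intro h
  have h2 : (n : ℂ) + 1 = 0 := by linear_combination -h
  exact Nat.cast_add_one_ne_zero n h2

variable {b}

theorem IsHighest.mem_eigenspace {v : X} {χ : Module.Dual ℂ H} (hv : IsHighest b v χ) :
    v ∈ (toEnd ℂ L X (heightElement b : L)).eigenspace (χ (heightElement b)) := by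
  rw [Module.End.mem_eigenspace_iff]
  exact hv.2 _

/-- Positive root vectors and the Cartan subalgebra preserve the line through `v`, while negative
root vectors lower the eigenvalue of the height element by positive integers. Hence the top
eigenvalue occurs in the generated module only on this line. -/
theorem IsHighest.lieSpan_le {v : X} {χ : Module.Dual ℂ H} (hv : IsHighest b v χ) :
    (LieSubmodule.lieSpan ℂ L {v}).toSubmodule ≤ (ℂ ∙ v) ⊔ lowerPart b X (χ (heightElement b)) := by
  refine lieSpan_le_of_stable (A := nNeg b) (B := nPos b ⊔ H.toSubmodule) ?_ ?_
    (Submodule.mem_sup_left (Submodule.mem_span_singleton_self v)) ?_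
  · rw [← nPos_sup_nNeg_sup_cartan b, sup_left_comm]
  · intro x hx
    obtain ⟨y, hy, h, hh, rfl⟩ := Submodule.mem_sup.1 hx
    have h1 : ⁅y, v⁆ ∈ (⊥ : Submodule ℂ X) :=
      lie_mem_of_mem_nPos b (fun i hi x hx => (Submodule.mem_bot ℂ).2 (hv.1 i hi x hx)) y hy
    rw [add_lie, (Submodule.mem_bot ℂ).1 h1, zero_add]
    exact Submodule.mem_span_singleton.2 ⟨χ ⟨h, hh⟩, (hv.2 ⟨h, hh⟩).symm⟩
  · intro x hx m hm
    obtain ⟨y, hy, l, hl, rfl⟩ := Submodule.mem_sup.1 hm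
    obtain ⟨t, rfl⟩ := Submodule.mem_span_singleton.1 hy
    rw [lie_add]
    refine Submodule.mem_sup_right (add_mem ?_ (lie_mem_lowerPart b hl x hx))
    rw [lie_smul]
    exact Submodule.smul_mem _ _ (lie_mem_lowerPart_of_eigenspace b hv.mem_eigenspace x hx)

theorem lieSpan_singleton_eq_top [LieModule.IsIrreducible ℂ L X] {v : X} (hv : v ≠ 0) :
    LieSubmodule.lieSpan ℂ L {v} = ⊤ := by
  have := (LieSubmodule.nontrivial_iff_ne_bot ℂ L X (N := LieSubmodule.lieSpan ℂ L {v})).2 fun h => hv ?_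
  · exact LieSubmodule.eq_top_of_isIrreducible ℂ L X _
  have : v ∈ LieSubmodule.lieSpan ℂ L {v} := LieSubmodule.subset_lieSpan rfl
  rwa [h, LieSubmodule.mem_bot] at this

/-- The functional that is dual to the highest weight vector is a lowest weight vector. -/
theorem IsHighest.exists_functional [LieModule.IsIrreducible ℂ L X] [FiniteDimensional ℂ X] {v : X}
    {χ : Module.Dual ℂ H} (hv : IsHighest b v χ) (hv0 : v ≠ 0) :
    ∃ ξ : Module.Dual ℂ X, (∀ h : H, ⁅(h : L), ξ⁆ = -χ h • ξ) ∧
      ∀ T : Submodule ℂ (Module.Dual ℂ X), ξ ∈ T → (∀ x ∈ nPos b, ∀ η ∈ T, ⁅x, η⁆ ∈ T) → T = ⊤ := by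
  set c := χ (heightElement b)
  have htop : (ℂ ∙ v) ⊔ lowerPart b X c = ⊤ := by
    rw [eq_top_iff, ← LieSubmodule.top_toSubmodule (R := ℂ) (L := L) (M := X),
      ← lieSpan_singleton_eq_top (L := L) hv0]
    exact hv.lieSpan_le
  have hnot : v ∉ lowerPart b X c := fun h =>
    hv0 (Submodule.disjoint_def.1 (disjoint_eigenspace_lowerPart b c) v hv.mem_eigenspace h)
  -- A functional that vanishes on the lower part but not at `v`. The Cartan subalgebra preserves
  -- the lower part and the negative root vectors map everything into it, so `ξ` has weight `-χ` and
  -- is killed by the latter.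
  obtain ⟨ξ, hξv, hξ⟩ := Submodule.exists_le_ker_of_notMem hnot
  have hξl : ∀ m ∈ lowerPart b X c, ξ m = 0 := fun m hm => hξ hm
  have hdec : ∀ m : X, ∃ (t : ℂ) (l : X), l ∈ lowerPart b X c ∧ m = t • v + l := fun m => by
    have hm : m ∈ (ℂ ∙ v) ⊔ lowerPart b X c := by rw [htop]; trivial
    obtain ⟨y, hy, l, hl, rfl⟩ := Submodule.mem_sup.1 hm
    obtain ⟨t, rfl⟩ := Submodule.mem_span_singleton.1 hy
    exact ⟨t, l, hl, rfl⟩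
  have hH : ∀ h : H, ⁅(h : L), ξ⁆ = -χ h • ξ := fun h => by
    ext m
    obtain ⟨t, l, hl, rfl⟩ := hdec m
    rw [Module.Dual.lie_apply, lie_add, lie_smul, hv.2, map_add,
      hξl _ (lie_cartan_mem_lowerPart b hl h), LinearMap.smul_apply, map_add, hξl _ hl]
    simp; ring
  have hN : ∀ x ∈ nNeg b, ⁅x, ξ⁆ = 0 := fun x hx => by
    ext m
    obtain ⟨t, l, hl, rfl⟩ := hdec m
    rw [Module.Dual.lie_apply, lie_add, lie_smul, map_add, hξl _ (lie_mem_lowerPart b hl x hx),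
      map_smul, hξl _ (lie_mem_lowerPart_of_eigenspace b hv.mem_eigenspace x hx)]
    simp
  refine ⟨ξ, hH, fun T hT hTA => ?_⟩
  have hle : (LieSubmodule.lieSpan ℂ L {ξ}).toSubmodule ≤ T := by
    refine lieSpan_le_of_stable (nPos_sup_nNeg_sup_cartan b) ?_ hT hTA
    intro x hx
    obtain ⟨y, hy, h, hh, rfl⟩ := Submodule.mem_sup.1 hx
    rw [add_lie, hN y hy, zero_add]
    exact Submodule.mem_span_singleton.2 ⟨-χ ⟨h, hh⟩, (hH ⟨h, hh⟩).symm⟩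
  rw [eq_top_iff]
  refine le_trans ?_ hle
  set W := LieSubmodule.lieSpan ℂ L {ξ} with hW
  -- The common zeros of the submodule generated by `ξ`. They form a submodule of `X` missing `v`,
  -- hence are zero, so that `ξ` generates the whole dual.
  let A : LieSubmodule ℂ L X :=
    { W.toSubmodule.dualCoannihilator with
      lie_mem := fun {x m} hm => by
        refine (Submodule.mem_dualCoannihilator _).2 fun η hη => ?_
        have h1 := (Submodule.mem_dualCoannihilator m).1 hm _ (W.lie_mem (x := x) hη)
        rw [Module.Dual.lie_apply, neg_eq_zero] at h1
        exact h1 }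
  have hA : A = ⊥ := by
    by_contra hA
    have := (LieSubmodule.nontrivial_iff_ne_bot ℂ L X).2 hA
    have h1 := LieSubmodule.eq_top_of_isIrreducible ℂ L X A
    have h2 : v ∈ A := by rw [h1]; trivial
    exact hξv ((Submodule.mem_dualCoannihilator v).1 h2 ξ (LieSubmodule.subset_lieSpan rfl))
  have h3 : W.toSubmodule.dualCoannihilator = ⊥ := congrArg LieSubmodule.toSubmodule hA
  rw [← Subspace.dualCoannihilator_dualAnnihilator_eq (W := W.toSubmodule), h3,
    Submodule.dualAnnihilator_bot]

end Module

end HighestWeight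

/-- The universal property gives a homomorphism from the enveloping algebra to `A`. Followed by the
inclusion it fixes the generators, so the composite is the identity. -/
theorem uea_induction {L : Type*} [LieRing L] [LieAlgebra ℂ L]
    {A : Subalgebra ℂ (UniversalEnvelopingAlgebra ℂ L)}
    (h : ∀ x, UniversalEnvelopingAlgebra.ι ℂ x ∈ A) (a : UniversalEnvelopingAlgebra ℂ L) :
    a ∈ A := by
  let f : L →ₗ⁅ℂ⁆ A :=
    { toFun := fun x => ⟨UniversalEnvelopingAlgebra.ι ℂ x, h x⟩
      map_add' := fun x y => Subtype.ext (map_add _ x y)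
      map_smul' := fun t x => Subtype.ext (map_smul _ t x)
      map_lie' := fun {x y} => Subtype.ext (LieHom.map_lie _ x y) }
  have h1 : A.val.comp (UniversalEnvelopingAlgebra.lift ℂ f) = AlgHom.id ℂ _ := by
    apply UniversalEnvelopingAlgebra.hom_ext
    ext x
    simp [f]
  have h2 := DFunLike.congr_fun h1 a
  rw [← show A.val (UniversalEnvelopingAlgebra.lift ℂ f a) = a from h2]
  exact Subtype.property _

/-! ### Existence and uniqueness for highest weight vectors, and the classification of simple
modules -/

section HighestWeight

open LieAlgebra LieModule Module

variable {L : Type u} [LieRing L] [LieAlgebra ℂ L] [FiniteDimensional ℂ L]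
  [LieAlgebra.IsSemisimple ℂ L]
variable {H : LieSubalgebra ℂ L} [H.IsCartanSubalgebra]
variable {b : (LieAlgebra.IsKilling.rootSystem H).Base}
variable {X : Type*} [AddCommGroup X] [Module ℂ X] [LieRingModule L X] [LieModule ℂ L X]
variable {Y : Type*} [AddCommGroup Y] [Module ℂ Y] [LieRingModule L Y] [LieModule ℂ L Y]
variable {M : Type*} [AddCommGroup M] [Module ℂ M] [LieRingModule L M] [LieModule ℂ L M]

/-- A highest weight vector `y` of weight `ν` in a module `Y` on which the dual of a simple module
of highest weight `χ` acts with values in `M` yields a vector of weight `ν - χ` in `M`. -/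
theorem IsHighest.exists_weightVector [LieModule.IsIrreducible ℂ L X] [FiniteDimensional ℂ X]
    (E : Module.Dual ℂ X →ₗ[ℂ] Y →ₗ[ℂ] M)
    (hE : ∀ (z : L) η y, ⁅z, E η y⁆ = E ⁅z, η⁆ y + E η ⁅z, y⁆) {v : X} {χ ν : Module.Dual ℂ H}
    (hv : IsHighest b v χ) (hv0 : v ≠ 0) {y : Y} (hy : IsHighest b y ν)
    (hne : ∃ η, E η y ≠ 0) :
    ∃ ξ, E ξ y ≠ 0 ∧ ∀ h : H, ⁅(h : L), E ξ y⁆ = (ν - χ) h • E ξ y := by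
  obtain ⟨ξ, hξ, htop⟩ := hv.exists_functional hv0
  refine ⟨ξ, fun h0 => ?_, fun h => ?_⟩
  · let T : Submodule ℂ (Module.Dual ℂ X) := LinearMap.ker (E.flip y)
    have hT : T = ⊤ := by
      refine htop T h0 ?_
      intro x hx η hη
      have h1 : ⁅x, y⁆ ∈ (⊥ : Submodule ℂ Y) :=
        lie_mem_of_mem_nPos b (fun i hi x hx => (Submodule.mem_bot ℂ).2 (hy.1 i hi x hx)) x hx
      have h2 := hE x η y
      rw [(Submodule.mem_bot ℂ).1 h1, show E η y = 0 from hη, lie_zero, map_zero, add_zero] at h2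
      exact h2.symm
    obtain ⟨η, hη⟩ := hne
    have : η ∈ T := by rw [hT]; trivial
    exact hη this
  · rw [hE, hξ, hy.2, map_smul, map_smul, LinearMap.smul_apply, ← add_smul, LinearMap.sub_apply]
    congr 1; ring

theorem IsHighest.map {v : X} {χ : Module.Dual ℂ H} (hv : IsHighest b v χ) (f : X →ₗ⁅ℂ, L⁆ Y) :
    IsHighest b (f v) χ :=
  ⟨fun i hi x hx => by rw [← LieModuleHom.map_lie, hv.1 i hi x hx, map_zero],
    fun h => by rw [← LieModuleHom.map_lie, hv.2, map_smul]⟩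

theorem weightSpace_shift (i : H.root) {x : L} (hx : x ∈ rootSpace H i.1) {χ : Module.Dual ℂ H}
    {m : X} (hm : ∀ h : H, ⁅(h : L), m⁆ = χ h • m) :
    ∀ h : H, ⁅(h : L), ⁅x, m⁆⁆ =
      (χ + (LieAlgebra.IsKilling.rootSystem H).root i) h • ⁅x, m⁆ := by
  intro h
  have h1 : ⁅(h : L), x⁆ = i.1 h • x := LieAlgebra.IsKilling.lie_eq_smul_of_mem_rootSpace hx h
  rw [leibniz_lie, h1, hm, smul_lie, lie_smul, ← add_smul, add_comm]
  rfl

theorem exists_weightVector [Nontrivial X] [FiniteDimensional ℂ X] :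
    ∃ (χ : Module.Dual ℂ H) (m : X), m ≠ 0 ∧ ∀ h : H, ⁅(h : L), m⁆ = χ h • m := by
  obtain ⟨χ, hχ⟩ := LieModule.exists_nontrivial_weightSpace_of_isNilpotent ℂ H X
  obtain ⟨⟨m, hm⟩, hm0⟩ := exists_ne (0 : weightSpace X (χ : H → ℂ))
  exact ⟨χ, m, fun h => hm0 (Subtype.ext h), (LieModule.mem_weightSpace _ m).1 hm⟩

variable (b) in
-- Finitely many values of weights at the height element occur. A weight vector for which this value
-- has maximal real part is killed by positive root vectors, since these add a positive integer to
-- the value.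
theorem exists_isHighest [Nontrivial X] [FiniteDimensional ℂ X] :
    ∃ (χ : Module.Dual ℂ H) (v : X), v ≠ 0 ∧ IsHighest b v χ := by
  let S : Set ℂ := {c | ∃ (χ : Module.Dual ℂ H) (m : X), m ≠ 0 ∧
    (∀ h : H, ⁅(h : L), m⁆ = χ h • m) ∧ c = χ (heightElement b)}
  have hfin : S.Finite := by
    refine (Module.End.finite_hasEigenvalue (toEnd ℂ L X (heightElement b : L))).subset ?_
    rintro c ⟨χ, m, hm0, hm, rfl⟩
    exact Module.End.hasEigenvalue_of_hasEigenvector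
      ⟨Module.End.mem_eigenspace_iff.2 (hm _), hm0⟩
  obtain ⟨χ₀, m₀, hm₀, hχ₀⟩ := exists_weightVector (L := L) (H := H) (X := X)
  obtain ⟨c, ⟨χ, v, hv0, hv, rfl⟩, hmax⟩ :=
    Set.exists_max_image S Complex.re hfin ⟨_, χ₀, m₀, hm₀, hχ₀, rfl⟩
  refine ⟨χ, v, hv0, fun i hi x hx => ?_, hv⟩
  by_contra hne
  have h1 := hmax _ ⟨_, _, hne, weightSpace_shift i hx hv, rfl⟩
  have h2 : ((χ + (LieAlgebra.IsKilling.rootSystem H).root i) (heightElement b)) =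
      χ (heightElement b) + (b.height i : ℂ) := by
    rw [← root_heightElement]; rfl
  rw [h2, Complex.add_re, Complex.intCast_re] at h1
  have h3 : (0 : ℝ) < b.height i := by exact_mod_cast hi
  linarith

/-- For each simple root the vector is primitive for the corresponding `sl₂`-triple, and in finite
dimension the weight of a primitive vector is a natural number. -/
theorem IsHighest.isDominant [FiniteDimensional ℂ X] {v : X} {χ : Module.Dual ℂ H}
    (hv : IsHighest b v χ) (hv0 : v ≠ 0) :
    ∀ i ∈ b.support, ∃ n : ℕ, χ ((LieAlgebra.IsKilling.rootSystem H).coroot i) = n := by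
  intro i hi
  have hα : (i.1 : Weight ℂ H L).IsNonZero := LieSubalgebra.isNonZero_coe_root i
  obtain ⟨h, e, f, ht, he, hf⟩ := LieAlgebra.IsKilling.exists_isSl2Triple_of_weight_isNonZero hα
  have hh := ht.h_eq_coroot hα he hf
  have hP : ht.HasPrimitiveVectorWith v (χ ((LieAlgebra.IsKilling.rootSystem H).coroot i)) :=
    { ne_zero := hv0
      lie_h := by rw [hh]; exact hv.2 _
      lie_e := hv.1 i (RootPairing.Base.isPos_of_mem_support hi) e he }
  exact hP.exists_nat

/-- The module generated by a highest weight vector that generates two simple quotients. -/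
theorem IsHighest.lieSpan_disjoint_ker [LieModule.IsIrreducible ℂ L Y] (p : M →ₗ⁅ℂ, L⁆ X)
    (q : M →ₗ⁅ℂ, L⁆ Y) (hpq : ∀ m, p m = 0 → q m = 0 → m = 0) {z : M} {χ : Module.Dual ℂ H}
    (hz : IsHighest b z χ) (hp : p z ≠ 0) (hq : q z ≠ 0) :
    ∀ m ∈ LieSubmodule.lieSpan ℂ L {z}, p m = 0 → m = 0 := by
  set D := LieSubmodule.lieSpan ℂ L {z}
  by_contra! hcon
  obtain ⟨m, hmD, hpm, hm0⟩ := hcon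
  have hne : (D ⊓ p.ker).map q ≠ ⊥ := fun h => by
    have : q m ∈ (D ⊓ p.ker).map q := LieSubmodule.mem_map_of_mem ⟨hmD, by simpa using hpm⟩
    rw [h, LieSubmodule.mem_bot] at this
    exact hm0 (hpq m hpm this)
  have := (LieSubmodule.nontrivial_iff_ne_bot ℂ L Y).2 hne
  have htop := LieSubmodule.eq_top_of_isIrreducible ℂ L Y ((D ⊓ p.ker).map q)
  have hw : q z ∈ (D ⊓ p.ker).map q := by rw [htop]; trivial
  obtain ⟨k, ⟨hkD, hkp⟩, hkq⟩ := (LieSubmodule.mem_map _).1 hw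
  have hkp : p k = 0 := by simpa using hkp
  -- The vector `k` has the image of `z` under `q` and image zero under `p`. These two maps are
  -- jointly injective, so `k` has the same eigenvalue as `z`. It is then a multiple of `z`, which
  -- contradicts `p z ≠ 0` or `q z ≠ 0`.
  have hke : k ∈ (toEnd ℂ L M (heightElement b : L)).eigenspace (χ (heightElement b)) := by
    rw [Module.End.mem_eigenspace_iff, toEnd_apply_apply, ← sub_eq_zero]
    refine hpq _ ?_ ?_
    · rw [map_sub, LieModuleHom.map_lie, map_smul, hkp]; simp
    · rw [map_sub, LieModuleHom.map_lie, map_smul, hkq, (hz.map q).2, sub_self]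
  obtain ⟨y, hy, l, hl, hyl⟩ := Submodule.mem_sup.1 (hz.lieSpan_le hkD)
  obtain ⟨t, rfl⟩ := Submodule.mem_span_singleton.1 hy
  have hle : l ∈ (toEnd ℂ L M (heightElement b : L)).eigenspace (χ (heightElement b)) := by
    rw [← add_sub_cancel_left (t • z) l, hyl]
    exact sub_mem hke (Submodule.smul_mem _ _ hz.mem_eigenspace)
  have hl0 := Submodule.disjoint_def.1 (disjoint_eigenspace_lowerPart b _) l hle hl
  rw [hl0, add_zero] at hyl
  rw [← hyl, map_smul] at hkp
  rcases smul_eq_zero.1 hkp with ht | ht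
  · rw [← hkq, ← hyl, ht] at hq; simp at hq
  · exact hp ht

/-- The diagonal action on a product. -/
instance prodLieRingModule : LieRingModule L (X × Y) where
  bracket x m := (⁅x, m.1⁆, ⁅x, m.2⁆)
  add_lie x y m := Prod.ext (add_lie x y m.1) (add_lie x y m.2)
  lie_add x m n := Prod.ext (lie_add x m.1 n.1) (lie_add x m.2 n.2)
  leibniz_lie x y m := Prod.ext (leibniz_lie x y m.1) (leibniz_lie x y m.2)

instance prodLieModule : LieModule ℂ L (X × Y) where
  smul_lie t x m := Prod.ext (smul_lie t x m.1) (smul_lie t x m.2)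
  lie_smul t x m := Prod.ext (lie_smul t x m.1) (lie_smul t x m.2)

/-- A bijective homomorphism of Lie modules is an equivalence. -/
def lieModuleEquivOfBijective (f : X →ₗ⁅ℂ, L⁆ Y) (hf : Function.Bijective f) : X ≃ₗ⁅ℂ, L⁆ Y :=
  { LinearEquiv.ofBijective (f : X →ₗ[ℂ] Y) hf with map_lie' := fun {x m} => f.map_lie x m }

theorem bijective_comp_incl [LieModule.IsIrreducible ℂ L X] (p : M →ₗ⁅ℂ, L⁆ X)
    {D : LieSubmodule ℂ L M} {z : M} (hz : z ∈ D) (hp : p z ≠ 0)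
    (hinj : ∀ m ∈ D, p m = 0 → m = 0) : Function.Bijective (p.comp D.incl) := by
  constructor
  · rw [injective_iff_map_eq_zero]
    rintro ⟨m, hm⟩ h
    exact Subtype.ext (hinj m hm h)
  · have hne : (p.comp D.incl).range ≠ ⊥ := fun h => by
      have : p z ∈ (p.comp D.incl).range := ⟨⟨z, hz⟩, rfl⟩
      rw [h, LieSubmodule.mem_bot] at this
      exact hp this
    have := (LieSubmodule.nontrivial_iff_ne_bot ℂ L X).2 hne
    have htop := LieSubmodule.eq_top_of_isIrreducible ℂ L X (p.comp D.incl).range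
    rwa [LieModuleHom.range_eq_top] at htop

/-- Simple modules with the same highest weight are isomorphic. -/
theorem IsHighest.nonempty_equiv [LieModule.IsIrreducible ℂ L X] [LieModule.IsIrreducible ℂ L Y]
    {v : X} {w : Y} {χ : Module.Dual ℂ H} (hv : IsHighest b v χ) (hv0 : v ≠ 0)
    (hw : IsHighest b w χ) (hw0 : w ≠ 0) : Nonempty (X ≃ₗ⁅ℂ, L⁆ Y) := by
  let p : (X × Y) →ₗ⁅ℂ, L⁆ X := { LinearMap.fst ℂ X Y with map_lie' := rfl }
  let q : (X × Y) →ₗ⁅ℂ, L⁆ Y := { LinearMap.snd ℂ X Y with map_lie' := rfl }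
  have hz : IsHighest b ((v, w) : X × Y) χ :=
    ⟨fun i hi x hx => Prod.ext (hv.1 i hi x hx) (hw.1 i hi x hx),
      fun h => Prod.ext (hv.2 h) (hw.2 h)⟩
  -- The submodule generated by the pair of highest weight vectors is the graph of the desired
  -- isomorphism: both projections are bijective on it.
  set D := LieSubmodule.lieSpan ℂ L {((v, w) : X × Y)} with hD
  have hzD : ((v, w) : X × Y) ∈ D := LieSubmodule.subset_lieSpan rfl
  have h1 := bijective_comp_incl p hzD hv0
    (hz.lieSpan_disjoint_ker p q (fun m h1 h2 => Prod.ext h1 h2) hv0 hw0)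
  have h2 := bijective_comp_incl q hzD hw0
    (hz.lieSpan_disjoint_ker q p (fun m h1 h2 => Prod.ext h2 h1) hw0 hv0)
  exact ⟨(lieModuleEquivOfBijective _ h1).symm.trans (lieModuleEquivOfBijective _ h2)⟩

theorem lie_mem_of_forall_root (b : (LieAlgebra.IsKilling.rootSystem H).Base) {m : X} {T : Submodule ℂ X}
    (hr : ∀ i : H.root, ∀ x ∈ rootSpace H i.1, ⁅x, m⁆ ∈ T) (hH : ∀ h : H, ⁅(h : L), m⁆ ∈ T)
    (x : L) : ⁅x, m⁆ ∈ T := by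
  have hx : x ∈ nPos b ⊔ (nNeg b ⊔ H.toSubmodule) := by
    rw [nPos_sup_nNeg_sup_cartan]; trivial
  obtain ⟨y, hy, k, hk, rfl⟩ := Submodule.mem_sup.1 hx
  obtain ⟨z, hz, h, hh, rfl⟩ := Submodule.mem_sup.1 hk
  rw [add_lie, add_lie]
  exact add_mem (lie_mem_of_mem_nPos b (fun i _ => hr i) y hy)
    (add_mem (lie_mem_of_mem_nNeg b (fun i _ => hr i) z hz) (hH ⟨h, hh⟩))

/-- A finite-dimensional module is spanned by its weight vectors. -/
theorem span_weightVectors (b : (LieAlgebra.IsKilling.rootSystem H).Base) [FiniteDimensional ℂ X] :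
    Submodule.span ℂ {m : X | ∃ χ : Module.Dual ℂ H, ∀ h : H, ⁅(h : L), m⁆ = χ h • m} = ⊤ := by
  set S := {m : X | ∃ χ : Module.Dual ℂ H, ∀ h : H, ⁅(h : L), m⁆ = χ h • m} with hS
  let D : LieSubmodule ℂ L X :=
    { Submodule.span ℂ S with
      lie_mem := fun {x m} hm => by
        change ⁅x, m⁆ ∈ Submodule.span ℂ S
        have hm' : m ∈ Submodule.span ℂ S := hm
        clear hm
        induction hm' using Submodule.span_induction with
        | mem m hm =>
          obtain ⟨χ, hχ⟩ := hm
          refine lie_mem_of_forall_root b (T := Submodule.span ℂ S)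
            (fun i x hx => Submodule.subset_span ⟨_, weightSpace_shift i hx hχ⟩) (fun h => ?_) x
          rw [hχ]
          exact Submodule.smul_mem _ _ (Submodule.subset_span ⟨χ, hχ⟩)
        | zero => rw [lie_zero]; exact zero_mem _
        | add a c _ _ ha hc => rw [lie_add]; exact add_mem ha hc
        | smul t a _ ha => rw [lie_smul]; exact Submodule.smul_mem _ _ ha }
  -- A nonzero complement would itself contain a weight vector, which already lies in `D`.
  obtain ⟨D', hD'⟩ := exists_isCompl_lieSubmodule D
  have hbot : D' = ⊥ := by
    by_contra hne
    have := (LieSubmodule.nontrivial_iff_ne_bot ℂ L X).2 hne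
    obtain ⟨χ, ⟨m, hm⟩, hm0, hχ⟩ := exists_weightVector (L := L) (H := H) (X := D')
    refine hm0 (Subtype.ext ?_)
    have h1 : m ∈ D ⊓ D' := ⟨Submodule.subset_span ⟨χ, fun h => congrArg Subtype.val (hχ h)⟩, hm⟩
    rwa [hD'.inf_eq_bot, LieSubmodule.mem_bot] at h1
  have htop : D = ⊤ := by rw [← hD'.sup_eq_top, hbot, sup_bot_eq]
  exact congrArg LieSubmodule.toSubmodule htop

theorem isIrreducible_of_isAtom {S : LieSubmodule ℂ L X} (hS : IsAtom S) :
    LieModule.IsIrreducible ℂ L S := by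
  have : Nontrivial S := (LieSubmodule.nontrivial_iff_ne_bot ℂ L X).2 hS.1
  refine LieModule.IsIrreducible.mk fun N hN => ?_
  have hle : N.map S.incl ≤ S := by
    rintro _ ⟨m, -, rfl⟩; exact m.2
  have hne : N.map S.incl ≠ ⊥ := fun h => hN ((LieSubmodule.eq_bot_iff _).2 fun m hm => by
    have h1 : (m : X) ∈ N.map S.incl := ⟨m, hm, rfl⟩
    rw [h, LieSubmodule.mem_bot] at h1
    exact Subtype.ext h1)
  have heq := (hS.le_iff.1 hle).resolve_left hne
  rw [eq_top_iff]
  intro m _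
  have h1 : (m : X) ∈ N.map S.incl := by rw [heq]; exact m.2
  obtain ⟨m', hm', h2⟩ := h1
  rwa [← show m' = m from Subtype.ext h2]

/-! ### The simple modules `V(μ)` -/

/-- Unless the ideal defining it is improper, `V(μ)` is a simple module with a highest weight
vector of weight `μ`. -/
theorem Simple.isIrreducible_of_ideal {μ : Dominant b}
    (hN : ∃ N, IsHighestWeightIdeal b μ.1 N) :
    LieModule.IsIrreducible ℂ L (Simple b μ) ∧ ∃ v : Simple b μ, v ≠ 0 ∧ IsHighest b v μ.1 := by
  have hI : IsHighestWeightIdeal b μ.1 (highestWeightIdeal b μ) := by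
    rw [highestWeightIdeal, dif_pos hN]; exact hN.choose_spec
  let U := UniversalEnvelopingAlgebra ℂ L
  have hsimple : IsSimpleModule U (Simple b μ) := isSimpleModule_iff_isCoatom.2 hI.isCoatom
  let π : U →ₗ[U] Simple b μ := (highestWeightIdeal b μ).mkQ
  have hπ : ∀ a, π a = 0 ↔ a ∈ highestWeightIdeal b μ := fun a => Submodule.Quotient.mk_eq_zero _
  have hlie : ∀ (x : L) (a : U), ⁅x, π a⁆ = π (UniversalEnvelopingAlgebra.ι ℂ x * a) :=
    fun _ _ => rfl
  have hπ1 : π 1 ≠ 0 := fun h => hI.isCoatom.1 ((Ideal.eq_top_iff_one _).2 ((hπ 1).1 h))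
  have : Nontrivial (Simple b μ) := ⟨π 1, 0, hπ1⟩
  refine ⟨LieModule.IsIrreducible.mk fun N hN => ?_, π 1, hπ1, fun i hi x hx => ?_, fun h => ?_⟩
  · let A : Subalgebra ℂ U :=
      { carrier := {a | ∀ m ∈ N, a • m ∈ N}
        mul_mem' := fun {a c} ha hc m hm => by rw [mul_smul]; exact ha _ (hc _ hm)
        add_mem' := fun {a c} ha hc m hm => by rw [add_smul]; exact add_mem (ha _ hm) (hc _ hm)
        algebraMap_mem' := fun t m hm => by
          rw [algebraMap_smul]; exact N.smul_mem t hm }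
    let N' : Submodule U (Simple b μ) :=
      { N.toSubmodule with
        smul_mem' := fun a m hm => uea_induction (A := A) (fun x m hm => N.lie_mem hm) a m hm }
    have h1 : N' = ⊤ := (eq_bot_or_eq_top N').resolve_left fun h => hN
      ((LieSubmodule.eq_bot_iff _).2 fun m hm => by
        have : m ∈ N' := hm
        rwa [h, Submodule.mem_bot] at this)
    rw [eq_top_iff]
    intro m _
    have : m ∈ N' := by rw [h1]; trivial
    exact this
  · rw [hlie, mul_one]
    exact (hπ _).2 (hI.pos_mem i hi x hx)
  · rw [hlie, mul_one, ← sub_eq_zero]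
    have h1 := (hπ _).2 (hI.cartan_mem h)
    rw [map_sub] at h1
    rw [← h1, Algebra.algebraMap_eq_smul_one]
    rfl

/-- This dichotomy stands in for the existence part of the theorem of the highest weight. The later
arguments allow `V(μ)` to be zero, and `exists_equiv_simple` shows that every finite-dimensional
simple module is nevertheless some `V(μ)`. -/
theorem Simple.subsingleton_or (μ : Dominant b) : Subsingleton (Simple b μ) ∨
    (LieModule.IsIrreducible ℂ L (Simple b μ) ∧
      ∃ v : Simple b μ, v ≠ 0 ∧ IsHighest b v μ.1) := by
  by_cases hN : ∃ N, IsHighestWeightIdeal b μ.1 N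
  · exact Or.inr (Simple.isIrreducible_of_ideal hN)
  · left
    have : highestWeightIdeal b μ = ⊤ := by rw [highestWeightIdeal, dif_neg hN]
    change Subsingleton (UniversalEnvelopingAlgebra ℂ L ⧸ highestWeightIdeal b μ)
    rw [Submodule.Quotient.subsingleton_iff, this]

variable (b) in
/-- Every finite-dimensional simple module is isomorphic to some `V(μ)`. -/
theorem exists_equiv_simple [FiniteDimensional ℂ X] [LieModule.IsIrreducible ℂ L X] :
    ∃ μ : Dominant b, Nonempty (Simple b μ ≃ₗ⁅ℂ, L⁆ X) := by
  have := LieModule.nontrivial_of_isIrreducible ℂ L X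
  obtain ⟨χ, v, hv0, hv⟩ := exists_isHighest b (X := X)
  let μ : Dominant b := ⟨χ, hv.isDominant hv0⟩
  let U := UniversalEnvelopingAlgebra ℂ L
  let ρ : U →ₐ[ℂ] Module.End ℂ X := UniversalEnvelopingAlgebra.lift ℂ (toEnd ℂ L X)
  have hρ : ∀ x m, ρ (UniversalEnvelopingAlgebra.ι ℂ x) m = ⁅x, m⁆ := fun x m => by
    rw [UniversalEnvelopingAlgebra.lift_ι_apply, toEnd_apply_apply]
  let e : U →ₗ[ℂ] X := (LinearMap.applyₗ v) ∘ₗ ρ.toLinearMap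
  have he : ∀ a, e a = ρ a v := fun _ => rfl
  let N : Submodule U U :=
    { LinearMap.ker e with
      smul_mem' := fun a c hc => by
        change ρ (a * c) v = 0
        rw [map_mul, Module.End.mul_apply, show ρ c v = 0 from hc, map_zero] }
  have hNmem : ∀ a, a ∈ N ↔ ρ a v = 0 := fun _ => Iff.rfl
  have hsurj : ∀ w, w ≠ 0 → ∀ m, ∃ a : U, ρ a w = m := by
    intro w hw m
    let R : LieSubmodule ℂ L X :=
      { LinearMap.range ((LinearMap.applyₗ w) ∘ₗ ρ.toLinearMap : U →ₗ[ℂ] X) with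
        lie_mem := by
          rintro x _ ⟨a, rfl⟩
          refine ⟨UniversalEnvelopingAlgebra.ι ℂ x * a, ?_⟩
          change ρ (_ * a) w = ⁅x, ρ a w⁆
          rw [map_mul, Module.End.mul_apply, hρ] }
    have hne : R ≠ ⊥ := fun h => by
      have h1 : w ∈ R := ⟨1, by change ρ 1 w = w; rw [map_one]; rfl⟩
      rw [h, LieSubmodule.mem_bot] at h1
      exact hw h1
    have := (LieSubmodule.nontrivial_iff_ne_bot ℂ L X).2 hne
    have htop := LieSubmodule.eq_top_of_isIrreducible ℂ L X R
    have h1 : m ∈ R := by rw [htop]; trivial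
    exact h1
  -- The annihilator of the highest weight vector is a maximal left ideal because every nonzero
  -- vector generates `X`. So the default value in the definition of `V(μ)` does not occur here.
  have hN : IsHighestWeightIdeal b χ N :=
    { isCoatom := by
        refine ⟨fun h => hv0 ?_, fun N' hN' => ?_⟩
        · have h1 : (1 : U) ∈ N := by rw [h]; trivial
          rwa [hNmem, map_one] at h1
        · obtain ⟨hle, hne⟩ := SetLike.lt_iff_le_and_exists.1 hN'
          obtain ⟨c, hc, hcN⟩ := hne
          obtain ⟨a, ha⟩ := hsurj (ρ c v) hcN v
          have h1 : a * c - 1 ∈ N := by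
            rw [hNmem, map_sub, map_mul, LinearMap.sub_apply, Module.End.mul_apply, ha, map_one,
              Module.End.one_apply, sub_self]
          rw [Ideal.eq_top_iff_one, ← sub_sub_cancel (a * c) 1]
          exact sub_mem (N'.smul_mem a hc) (hle h1)
      finite := by
        have : LinearMap.ker e = N.restrictScalars ℂ := rfl
        have h2 := (LinearMap.quotKerEquivRange e).symm
        exact Module.Finite.equiv (h2.trans (Submodule.quotEquivOfEq _ _ this))
      pos_mem := fun i hi x hx => by rw [hNmem, hρ]; exact hv.1 i hi x hx
      cartan_mem := fun h => by
        rw [hNmem, map_sub, LinearMap.sub_apply, hρ, hv.2, AlgHom.commutes,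
          Module.algebraMap_end_apply, sub_self] }
  -- The ideal chosen in the definition of `V(μ)` is not known to be `N`; the isomorphism comes from
  -- the equality of highest weights.
  obtain ⟨hirr, w, hw0, hw⟩ := Simple.isIrreducible_of_ideal (μ := μ) ⟨N, hN⟩
  exact ⟨μ, hw.nonempty_equiv hw0 hv hv0⟩

end HighestWeight

/-! ### Weights of generated algebras -/

section Gen

open LieAlgebra LieModule Module

variable {L : Type u} [LieRing L] [LieAlgebra ℂ L]

theorem lie_map_of_tmul {M N P : Type*} [AddCommGroup M] [Module ℂ M] [LieRingModule L M]
    [LieModule ℂ L M] [AddCommGroup N] [Module ℂ N] [LieRingModule L N] [LieModule ℂ L N]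
    [AddCommGroup P] [Module ℂ P] [LieRingModule L P] [LieModule ℂ L P] {f : M ⊗[ℂ] N →ₗ[ℂ] P}
    (h : ∀ (x : L) m n, f (⁅x, m⁆ ⊗ₜ n + m ⊗ₜ ⁅x, n⁆) = ⁅x, f (m ⊗ₜ n)⁆) (x : L)
    (t : M ⊗[ℂ] N) : f ⁅x, t⁆ = ⁅x, f t⁆ := by
  induction t using TensorProduct.induction_on with
  | zero => simp
  | tmul m n => rw [TensorProduct.LieModule.lie_tmul_right, h]
  | add a b ha hb => rw [lie_add, map_add, map_add, lie_add, ha, hb]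

section TensorAct

variable {V M N : Type*} [AddCommGroup V] [Module ℂ V] [LieRingModule L V] [LieModule ℂ L V]
  [AddCommGroup M] [Module ℂ M] [LieRingModule L M] [LieModule ℂ L M]
  [AddCommGroup N] [Module ℂ N] [LieRingModule L N] [LieModule ℂ L N]

/-- The map `V ⊗ M ⊗ Z → N ⊗ Z` given by a bilinear map `V × M → N`. -/
def tensorActLin (β : V →ₗ[ℂ] M →ₗ[ℂ] N) (Z : Type*) [AddCommGroup Z] [Module ℂ Z] :
    V ⊗[ℂ] (M ⊗[ℂ] Z) →ₗ[ℂ] N ⊗[ℂ] Z :=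
  TensorProduct.lift (LinearMap.rTensorHom Z ∘ₗ β)

theorem tensorActLin_tmul (β : V →ₗ[ℂ] M →ₗ[ℂ] N) (Z : Type*) [AddCommGroup Z] [Module ℂ Z]
    (v : V) (m : M) (z : Z) : tensorActLin β Z (v ⊗ₜ (m ⊗ₜ z)) = β v m ⊗ₜ z := rfl

theorem tensorActLin_lie (β : V →ₗ[ℂ] M →ₗ[ℂ] N)
    (hβ : ∀ (x : L) v m, β ⁅x, v⁆ m + β v ⁅x, m⁆ = ⁅x, β v m⁆)
    (Z : Type*) [AddCommGroup Z] [Module ℂ Z] [LieRingModule L Z] [LieModule ℂ L Z] (x : L)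
    (t : V ⊗[ℂ] (M ⊗[ℂ] Z)) : tensorActLin β Z ⁅x, t⁆ = ⁅x, tensorActLin β Z t⁆ := by
  induction t using TensorProduct.induction_on with
  | zero => rw [lie_zero, map_zero, lie_zero]
  | add a b ha hb => rw [lie_add, map_add, map_add, lie_add, ha, hb]
  | tmul v s =>
    rw [TensorProduct.LieModule.lie_tmul_right]
    induction s using TensorProduct.induction_on with
    | zero =>
      rw [lie_zero, TensorProduct.tmul_zero, TensorProduct.tmul_zero, add_zero, map_zero, lie_zero]
    | add s s' h h' =>
      rw [lie_add, TensorProduct.tmul_add, TensorProduct.tmul_add, TensorProduct.tmul_add,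
        map_add (tensorActLin β Z) (v ⊗ₜ[ℂ] s), lie_add, ← h, ← h', ← map_add]
      congr 1
      abel
    | tmul a z =>
      rw [TensorProduct.LieModule.lie_tmul_right, TensorProduct.tmul_add, map_add, map_add,
        tensorActLin_tmul, tensorActLin_tmul, tensorActLin_tmul, tensorActLin_tmul,
        TensorProduct.LieModule.lie_tmul_right, ← hβ, TensorProduct.add_tmul, add_assoc]

/-- The equivariant map `V ⊗ M ⊗ Z → N ⊗ Z` given by an equivariant bilinear map `V × M → N`. -/
def tensorAct (β : V →ₗ[ℂ] M →ₗ[ℂ] N)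
    (hβ : ∀ (x : L) v m, β ⁅x, v⁆ m + β v ⁅x, m⁆ = ⁅x, β v m⁆)
    (Z : Type*) [AddCommGroup Z] [Module ℂ Z] [LieRingModule L Z] [LieModule ℂ L Z] :
    V ⊗[ℂ] (M ⊗[ℂ] Z) →ₗ⁅ℂ, L⁆ N ⊗[ℂ] Z :=
  { tensorActLin β Z with map_lie' := fun {x t} => tensorActLin_lie β hβ Z x t }

end TensorAct

variable {V : Type v} [AddCommGroup V] [Module ℂ V] [LieRingModule L V] [LieModule ℂ L V]
variable {A : Type*} [Ring A] [Algebra ℂ A] [LieRingModule L A] [LieModule ℂ L A]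

variable (L) in
/-- `L` acts on the algebra `A` by derivations extending its action on `V`. -/
structure IsDerAction (ι : V →ₗ[ℂ] A) : Prop where
  lie_ι : ∀ (x : L) v, ⁅x, ι v⁆ = ι ⁅x, v⁆
  lie_mul : ∀ (x : L) (a c : A), ⁅x, a * c⁆ = ⁅x, a⁆ * c + a * ⁅x, c⁆

namespace IsDerAction

variable {ι : V →ₗ[ℂ] A}

theorem lie_one (hι : IsDerAction L ι) (x : L) : ⁅x, (1 : A)⁆ = 0 := by
  have h := hι.lie_mul x 1 1
  rw [mul_one, mul_one, one_mul] at h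
  exact left_eq_add.1 h

theorem lie_mem_pow (hι : IsDerAction L ι) (k : ℕ) (x : L) {a : A} (ha : a ∈ (LinearMap.range ι) ^ k) :
    ⁅x, a⁆ ∈ (LinearMap.range ι) ^ k := by
  induction k generalizing a with
  | zero =>
    rw [pow_zero] at ha ⊢
    obtain ⟨t, rfl⟩ := Submodule.mem_one.1 ha
    rw [Algebra.algebraMap_eq_smul_one, lie_smul, hι.lie_one, smul_zero]
    exact zero_mem _
  | succ k ih =>
    rw [pow_succ'] at ha ⊢
    induction ha using Submodule.mul_induction_on' with
    | mem_mul_mem m hm n hn =>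
      obtain ⟨v, rfl⟩ := hm
      rw [hι.lie_mul, hι.lie_ι]
      exact add_mem (Submodule.mul_mem_mul ⟨_, rfl⟩ hn) (Submodule.mul_mem_mul ⟨_, rfl⟩ (ih hn))
    | add a _ c _ ha hc => rw [lie_add]; exact add_mem ha hc

variable (hι : IsDerAction L ι)

/-- The component of degree `k`. -/
def comp (k : ℕ) : LieSubmodule ℂ L A :=
  { (LinearMap.range ι) ^ k with lie_mem := fun {x _} ha => hι.lie_mem_pow k x ha }

theorem mem_comp {k : ℕ} {a : A} : a ∈ hι.comp k ↔ a ∈ (LinearMap.range ι) ^ k := Iff.rfl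

theorem finiteDimensional_comp [FiniteDimensional ℂ V] (k : ℕ) :
    FiniteDimensional ℂ (hι.comp k) := by
  have h1 : (LinearMap.range ι).FG := by
    rw [LinearMap.range_eq_map]; exact Module.Finite.fg_top.map ι
  exact Module.Finite.iff_fg.2 (h1.pow k)

/-- Multiplication by an element of `V`. -/
def mulComp (k : ℕ) : V →ₗ[ℂ] hι.comp k →ₗ[ℂ] hι.comp (k + 1) :=
  LinearMap.mk₂ ℂ (fun v a => ⟨ι v * a, by
      rw [mem_comp, pow_succ']; exact Submodule.mul_mem_mul ⟨v, rfl⟩ a.2⟩)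
    (fun v w a => Subtype.ext (by simp [add_mul]))
    (fun t v a => Subtype.ext (by simp))
    (fun v a c => Subtype.ext (by simp [mul_add]))
    (fun t v a => Subtype.ext (by simp))

variable (Z : Type*) [AddCommGroup Z] [Module ℂ Z] [LieRingModule L Z] [LieModule ℂ L Z]

/-- The map `V ⊗ A_k ⊗ Z → A_{k+1} ⊗ Z` given by multiplication. -/
def mulTensor (k : ℕ) : V ⊗[ℂ] (hι.comp k ⊗[ℂ] Z) →ₗ⁅ℂ, L⁆ hι.comp (k + 1) ⊗[ℂ] Z :=
  tensorAct (hι.mulComp k) (fun x v a => Subtype.ext (by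
    change ι ⁅x, v⁆ * (a : A) + ι v * ⁅x, (a : A)⁆ = ⁅x, ι v * (a : A)⁆
    rw [hι.lie_mul, hι.lie_ι])) Z

/-- The space `A_{k+1}` is spanned by products of an element of `V` and one of `A_k`. Surjectivity
is what lets Weyl's theorem pull highest weight vectors back to `V ⊗ A_k ⊗ Z`. -/
theorem mulTensor_surjective (k : ℕ) : Function.Surjective (hι.mulTensor Z k) := by
  intro t
  induction t using TensorProduct.induction_on with
  | zero => exact ⟨0, map_zero _⟩
  | add s t hs ht =>
    obtain ⟨s, rfl⟩ := hs
    obtain ⟨t, rfl⟩ := ht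
    exact ⟨s + t, map_add _ _ _⟩
  | tmul a z =>
    obtain ⟨a, ha⟩ := a
    have key : ∀ a, a ∈ LinearMap.range ι * (LinearMap.range ι) ^ k →
        ∃ h : a ∈ hι.comp (k + 1), ∃ y, hι.mulTensor Z k y = (⟨a, h⟩ : hι.comp (k + 1)) ⊗ₜ z := by
      intro a ha
      induction ha using Submodule.mul_induction_on' with
      | mem_mul_mem m hm n hn =>
        obtain ⟨v, rfl⟩ := hm
        exact ⟨(hι.mulComp k v ⟨n, hn⟩).2, v ⊗ₜ ((⟨n, hn⟩ : hι.comp k) ⊗ₜ z), rfl⟩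
      | add a _ c _ ha hc =>
        obtain ⟨h1, y1, e1⟩ := ha
        obtain ⟨h2, y2, e2⟩ := hc
        refine ⟨add_mem h1 h2, y1 + y2, ?_⟩
        rw [map_add, e1, e2, ← TensorProduct.add_tmul]; rfl
    obtain ⟨_, y, hy⟩ := key a (by rw [← pow_succ']; exact ha)
    exact ⟨y, hy⟩

end IsDerAction

end Gen

/-! ### Peeling weights of `V` off a highest weight vector -/

section Chain

open LieAlgebra LieModule Module

variable {L : Type u} [LieRing L] [LieAlgebra ℂ L] [FiniteDimensional ℂ L]
  [LieAlgebra.IsSemisimple ℂ L]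
variable {H : LieSubalgebra ℂ L} [H.IsCartanSubalgebra]
variable {b : (LieAlgebra.IsKilling.rootSystem H).Base}
variable {V : Type v} [AddCommGroup V] [Module ℂ V] [LieRingModule L V] [LieModule ℂ L V]
variable {Z : Type*} [AddCommGroup Z] [Module ℂ Z] [LieRingModule L Z] [LieModule ℂ L Z]

variable (V) in
/-- A finite-dimensional module has a basis of weight vectors. -/
theorem exists_weightBasis (b : (LieAlgebra.IsKilling.rootSystem H).Base) [FiniteDimensional ℂ V] :
    ∃ (I : Type v) (_ : Fintype I) (e : Basis I ℂ V) (ξ : I → Module.Dual ℂ H),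
      ∀ i (h : H), ⁅(h : L), e i⁆ = ξ i h • e i := by
  let e := Basis.ofSpan (span_weightVectors (X := V) b).ge
  have he : ∀ i, e i ∈ {m : V | ∃ χ : Module.Dual ℂ H, ∀ h : H, ⁅(h : L), m⁆ = χ h • m} :=
    fun i => Basis.ofSpan_subset (span_weightVectors (X := V) b).ge ⟨i, rfl⟩
  choose ξ hξ using he
  exact ⟨_, FiniteDimensional.fintypeBasisIndex e, e, ξ, hξ⟩

theorem mem_wt {χ : Module.Dual ℂ H} {m : V} (hm0 : m ≠ 0)
    (hm : ∀ h : H, ⁅(h : L), m⁆ = χ h • m) : χ ∈ wt H V := by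
  intro h
  have : m ∈ weightSpace V (χ : H → ℂ) := (LieModule.mem_weightSpace _ m).2 hm
  rw [h, LieSubmodule.mem_bot] at this
  exact hm0 this

/-- A highest weight vector of `V ⊗ Z` yields one of `Z`. -/
theorem IsHighest.peel [FiniteDimensional ℂ V] {y : V ⊗[ℂ] Z} {ν : Module.Dual ℂ H} (hy0 : y ≠ 0)
    (hy : IsHighest b y ν) :
    ∃ ξ ∈ wt H V, ∃ z : Z, z ≠ 0 ∧ IsHighest b z (ν - ξ) := by
  classical
  obtain ⟨I, _, e, ξ, hξ⟩ := exists_weightBasis V b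
  let C : Module.Dual ℂ V → V ⊗[ℂ] Z →ₗ[ℂ] Z := fun c =>
    TensorProduct.lid ℂ Z ∘ₗ LinearMap.rTensor Z c
  have hC : ∀ c v z, C c (v ⊗ₜ z) = c v • z := fun c v z => by simp [C]
  have hlie : ∀ (x : L) c t, C c ⁅x, t⁆ = C (c ∘ₗ toEnd ℂ L V x) t + ⁅x, C c t⁆ := by
    intro x c t
    induction t using TensorProduct.induction_on with
    | zero => simp
    | tmul v z => simp [hC, TensorProduct.LieModule.lie_tmul_right]
    | add s t hs ht => rw [lie_add, map_add, map_add, map_add, lie_add, hs, ht]; abel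
  have hsum : ∀ c t, C c t = ∑ j, c (e j) • C (e.coord j) t := by
    intro c t
    have : c = ∑ j, c (e j) • e.coord j := by
      refine e.ext fun i => ?_
      simp
    induction t using TensorProduct.induction_on with
    | zero => simp
    | tmul v z =>
      simp only [hC, smul_smul, ← Finset.sum_smul]
      congr 1
      have h1 := LinearMap.congr_fun this v
      rw [h1, LinearMap.sum_apply]
      rfl
    | add s t hs ht => simp only [map_add, hs, ht, smul_add, Finset.sum_add_distrib]
  have hrec : ∀ t, t = ∑ j, e j ⊗ₜ[ℂ] C (e.coord j) t := by
    intro t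
    induction t using TensorProduct.induction_on with
    | zero => simp
    | tmul v z =>
      simp only [hC, ← TensorProduct.smul_tmul, ← TensorProduct.sum_tmul]
      conv_lhs => rw [← e.sum_repr v]
      simp
    | add s t hs ht =>
      conv_lhs => rw [hs, ht]
      simp only [map_add, TensorProduct.tmul_add, Finset.sum_add_distrib]
  have hne : ∃ i, C (e.coord i) y ≠ 0 := by
    by_contra! hcon
    refine hy0 ?_
    rw [hrec y]
    exact Finset.sum_eq_zero fun j _ => by rw [hcon, TensorProduct.tmul_zero]
  -- Among the nonzero coordinates of `y` along the weight basis, take one of lowest weight. A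
  -- positive root vector applied to it brings in only coordinates whose weight is lower by a
  -- positive root, and these vanish by minimality.
  obtain ⟨i, hi, hmin⟩ := Finset.exists_min_image
    (Finset.univ.filter fun i => C (e.coord i) y ≠ 0) (fun i => (ξ i (heightElement b)).re)
    (by obtain ⟨i, hi⟩ := hne; exact ⟨i, by simpa using hi⟩)
  have hi0 : C (e.coord i) y ≠ 0 := (Finset.mem_filter.1 hi).2
  have hcoord : ∀ (h : H) u, e.coord i ⁅(h : L), u⁆ = ξ i h * e.coord i u := by
    intro h u
    have : (e.coord i) ∘ₗ toEnd ℂ L V (h : L) = ξ i h • e.coord i := by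
      refine e.ext fun j => ?_
      by_cases hij : j = i <;> simp [hξ, hij]
    exact LinearMap.congr_fun this u
  refine ⟨ξ i, mem_wt (e.ne_zero i) (hξ i), C (e.coord i) y, hi0, fun j hj x hx => ?_,
    fun h => ?_⟩
  · have h1 := hlie x (e.coord i) y
    rw [hy.1 j hj x hx, map_zero, hsum] at h1
    rw [Finset.sum_eq_zero, zero_add] at h1
    · exact h1.symm
    · intro k _
      by_cases hk : C (e.coord k) y = 0
      · rw [hk, smul_zero]
      have h2 := hmin k (by simpa using hk)
      have h3 := hcoord (heightElement b) ⁅x, e k⁆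
      rw [weightSpace_shift j hx (hξ k), map_smul, smul_eq_mul] at h3
      have h4 : e.coord i ⁅x, e k⁆ = 0 := by
        by_contra hne
        have h5 := mul_right_cancel₀ hne h3
        have h6 : (ξ k + (LieAlgebra.IsKilling.rootSystem H).root j) (heightElement b) =
          ξ k (heightElement b) + (b.height j : ℂ) := by rw [← root_heightElement]; rfl
        rw [← h5, h6, Complex.add_re, Complex.intCast_re] at h2
        have h7 : (0 : ℝ) < b.height j := by exact_mod_cast hj
        linarith
      change (e.coord i ⁅x, e k⁆) • _ = _
      rw [h4, zero_smul]
  · have h1 := hlie h (e.coord i) y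
    have h2 : (e.coord i) ∘ₗ toEnd ℂ L V (h : L) = ξ i h • e.coord i := by
      ext u; exact hcoord h u
    have h3 : C (ξ i h • e.coord i) y = ξ i h • C (e.coord i) y := by
      simp [C, LinearMap.rTensor_smul]
    rw [hy.2, map_smul, h2, h3] at h1
    rw [LinearMap.sub_apply, sub_smul, h1, add_sub_cancel_left]

variable {A : Type*} [Ring A] [Algebra ℂ A] [LieRingModule L A] [LieModule ℂ L A]
  {ι : V →ₗ[ℂ] A}

/-- A highest weight vector of `A_k ⊗ Z` lies above one of `Z`, at distance `k`. -/
theorem IsHighest.chain [FiniteDimensional ℂ V] [FiniteDimensional ℂ Z] (hι : IsDerAction L ι)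
    (k : ℕ) : ∀ (ν : Module.Dual ℂ H) (y : hι.comp k ⊗[ℂ] Z), y ≠ 0 → IsHighest b y ν →
    ∃ (κ ν' : Dominant b) (z : Z), z ≠ 0 ∧ IsHighest b z κ.1 ∧ ν'.1 = ν ∧
      ∀ r : ℤ, Preceq V (κ, r) (ν', r + k) := by
  have hfd := hι.finiteDimensional_comp
  induction k with
  | zero =>
    intro ν y hy0 hy
    have hsurj : ∀ a : hι.comp 0, ∃ t : ℂ, (a : A) = t • 1 := by
      rintro ⟨a, ha⟩
      rw [IsDerAction.mem_comp, pow_zero] at ha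
      obtain ⟨t, rfl⟩ := Submodule.mem_one.1 ha
      exact ⟨t, Algebra.algebraMap_eq_smul_one t⟩
    have hone : (1 : A) ∈ hι.comp 0 := by
      rw [IsDerAction.mem_comp, pow_zero]
      exact Submodule.mem_one.2 ⟨1, map_one _⟩
    let one : hι.comp 0 := ⟨1, hone⟩
    -- Only surjectivity of `z ↦ 1 ⊗ z` is needed: Weyl's theorem lifts the submodule generated by
    -- `y` back to `Z`.
    let f : Z →ₗ⁅ℂ, L⁆ hι.comp 0 ⊗[ℂ] Z :=
      { TensorProduct.mk ℂ _ _ one with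
        map_lie' := fun {x z} => by
          have : ⁅x, one⁆ = 0 := Subtype.ext (hι.lie_one x)
          change one ⊗ₜ ⁅x, z⁆ = ⁅x, one ⊗ₜ[ℂ] z⁆
          rw [TensorProduct.LieModule.lie_tmul_right, this, TensorProduct.zero_tmul, zero_add] }
    have hf : ∀ y, ∃ z, f z = y := by
      intro y
      induction y using TensorProduct.induction_on with
      | zero => exact ⟨0, map_zero _⟩
      | add s t hs ht =>
        obtain ⟨s, rfl⟩ := hs
        obtain ⟨t, rfl⟩ := ht
        exact ⟨s + t, map_add _ _ _⟩
      | tmul a z =>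
        obtain ⟨t, ht⟩ := hsurj a
        refine ⟨t • z, ?_⟩
        change one ⊗ₜ (t • z) = _
        rw [← TensorProduct.smul_tmul]
        congr 1
        exact Subtype.ext ht.symm
    let D : LieSubmodule ℂ L (hι.comp 0 ⊗[ℂ] Z) := LieSubmodule.lieSpan ℂ L {y}
    obtain ⟨g, hg⟩ := exists_lieModuleHom_lift f D.incl (fun m => hf m)
    let y' : D := ⟨y, LieSubmodule.subset_lieSpan rfl⟩
    have hy' : IsHighest b y' ν :=
      ⟨fun i hi x hx => Subtype.ext (hy.1 i hi x hx), fun h => Subtype.ext (hy.2 h)⟩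
    have hz := hy'.map g
    have hz0 : g y' ≠ 0 := fun h => hy0 (by
      rw [← show f (g y') = y from hg y', h, map_zero])
    let κ : Dominant b := ⟨ν, hz.isDominant hz0⟩
    refine ⟨κ, κ, g y', hz0, hz, rfl, fun r => ?_⟩
    rw [Nat.cast_zero, add_zero]
    exact Relation.ReflTransGen.refl
  | succ k ih =>
    intro ν y hy0 hy
    have := hfd k
    let D : LieSubmodule ℂ L (hι.comp (k + 1) ⊗[ℂ] Z) := LieSubmodule.lieSpan ℂ L {y}
    have := hfd (k + 1)
    -- Pull `y` back along multiplication, peel off a weight `ξ` of `V`, and recurse. The remaining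
    -- weight `ν - ξ` again belongs to a highest weight vector in finite dimension, so it is
    -- dominant and the chain stays in `Λ`.
    obtain ⟨g, hg⟩ := exists_lieModuleHom_lift (hι.mulTensor Z k) D.incl
      (fun m => hι.mulTensor_surjective Z k m)
    let y' : D := ⟨y, LieSubmodule.subset_lieSpan rfl⟩
    have hy' : IsHighest b y' ν :=
      ⟨fun i hi x hx => Subtype.ext (hy.1 i hi x hx), fun h => Subtype.ext (hy.2 h)⟩
    have hz0 : g y' ≠ 0 := fun h => hy0 (by
      rw [← show hι.mulTensor Z k (g y') = y from hg y', h, map_zero])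
    obtain ⟨ξ, hξ, z, hz0, hz⟩ := (hy'.map g).peel hz0
    obtain ⟨κ, ν', z', hz'0, hz', hν', hch⟩ := ih _ z hz0 hz
    refine ⟨κ, ⟨ν, hy.isDominant hy0⟩, z', hz'0, hz', rfl, fun r => ?_⟩
    refine Relation.ReflTransGen.tail (hch r) ⟨?_, ?_⟩
    · push_cast; ring
    · change ν - ν'.1 ∈ _
      rw [hν', sub_sub_cancel]; exact hξ

end Chain

/-! ### The exterior algebra of a Lie module -/

section Ext

open Module CliffordAlgebra

variable {L : Type u} [LieRing L] [LieAlgebra ℂ L]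
variable {V : Type v} [AddCommGroup V] [Module ℂ V] [LieRingModule L V] [LieModule ℂ L V]
  [FiniteDimensional ℂ V]

/-- The endomorphism `∑ (x e_i) ∧ (e_i^* ⌋ ω)` of the exterior algebra. -/
def extDer (x : L) : ExteriorAlgebra ℂ V →ₗ[ℂ] ExteriorAlgebra ℂ V :=
  ∑ i, LinearMap.mulLeft ℂ (ExteriorAlgebra.ι ℂ ⁅x, finBasis ℂ V i⁆) ∘ₗ
    contractLeft ((finBasis ℂ V).coord i)

theorem extDer_apply (x : L) (ω : ExteriorAlgebra ℂ V) : extDer x ω =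
    ∑ i, ExteriorAlgebra.ι ℂ ⁅x, finBasis ℂ V i⁆ * contractLeft ((finBasis ℂ V).coord i) ω := by
  simp [extDer]

theorem extDer_algebraMap (x : L) (r : ℂ) :
    extDer x (algebraMap ℂ (ExteriorAlgebra ℂ V) r) = 0 := by
  rw [extDer_apply]
  refine Finset.sum_eq_zero fun i _ => ?_
  rw [contractLeft_algebraMap, mul_zero]

theorem ext_ι_mul_ι (v w : V) : ExteriorAlgebra.ι ℂ v * ExteriorAlgebra.ι ℂ w =
    -(ExteriorAlgebra.ι ℂ w * ExteriorAlgebra.ι ℂ v) :=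
  eq_neg_of_add_eq_zero_left (ExteriorAlgebra.ι_add_mul_swap v w)

theorem ext_contractLeft_ι_mul (ξ : Dual ℂ V) (v : V) (ω : ExteriorAlgebra ℂ V) :
    contractLeft ξ (ExteriorAlgebra.ι ℂ v * ω) =
      ξ v • ω - ExteriorAlgebra.ι ℂ v * contractLeft ξ ω :=
  contractLeft_ι_mul (d := ξ) v ω

theorem sum_coord_smul_lie (x : L) (v : V) :
    ∑ i, (finBasis ℂ V).coord i v • ⁅x, finBasis ℂ V i⁆ = ⁅x, v⁆ := by
  conv_rhs => rw [← (finBasis ℂ V).sum_repr v]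
  rw [lie_sum]
  exact Finset.sum_congr rfl fun i _ => (lie_smul _ _ _).symm

/-- Contraction is an antiderivation. In the sum over the basis, the coordinates of `v` rebuild `⁅x,
v⁆`, and in the other term the sign of the contraction cancels the one from moving `v` past `x e_i`.
-/
theorem extDer_ι_mul (x : L) (v : V) (ω : ExteriorAlgebra ℂ V) :
    extDer x (ExteriorAlgebra.ι ℂ v * ω) =
      ExteriorAlgebra.ι ℂ ⁅x, v⁆ * ω + ExteriorAlgebra.ι ℂ v * extDer x ω := by
  rw [extDer_apply, extDer_apply, Finset.mul_sum, ← sum_coord_smul_lie x v, map_sum,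
    Finset.sum_mul, ← Finset.sum_add_distrib]
  refine Finset.sum_congr rfl fun i _ => ?_
  rw [ext_contractLeft_ι_mul, mul_sub, ← mul_assoc, ext_ι_mul_ι ⁅x, _⁆ v, map_smul,
    smul_mul_assoc, mul_smul_comm, neg_mul, sub_neg_eq_add, mul_assoc]

theorem ext_linearMap_ext {f g : ExteriorAlgebra ℂ V →ₗ[ℂ] ExteriorAlgebra ℂ V}
    (h1 : ∀ r, f (algebraMap ℂ _ r) = g (algebraMap ℂ _ r))
    (h : ∀ v ω, f ω = g ω → f (ExteriorAlgebra.ι ℂ v * ω) = g (ExteriorAlgebra.ι ℂ v * ω)) :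
    f = g := by
  refine LinearMap.ext fun ω => ?_
  induction ω using CliffordAlgebra.left_induction with
  | algebraMap r => exact h1 r
  | add a b ha hb => rw [map_add, map_add, ha, hb]
  | ι_mul ω v hω => exact h v ω hω

instance extLieRingModule : LieRingModule L (ExteriorAlgebra ℂ V) where
  bracket x ω := extDer x ω
  add_lie x y ω := by
    change extDer (x + y) ω = extDer x ω + extDer y ω
    simp only [extDer_apply, add_lie, map_add, add_mul, Finset.sum_add_distrib]
  lie_add x ω η := map_add _ _ _
  leibniz_lie x y ω := by
    have : extDer x ∘ₗ extDer y = extDer (V := V) ⁅x, y⁆ + extDer y ∘ₗ extDer x := by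
      refine ext_linearMap_ext (fun r => ?_) fun v ω h => ?_
      · simp [extDer_algebraMap]
      · simp only [LinearMap.comp_apply, LinearMap.add_apply] at h ⊢
        simp only [extDer_ι_mul, map_add, h, lie_lie, mul_add, map_sub, sub_mul]
        abel
    exact LinearMap.congr_fun this ω

theorem lie_ext (x : L) (ω : ExteriorAlgebra ℂ V) : ⁅x, ω⁆ = extDer x ω := rfl

instance extLieModule : LieModule ℂ L (ExteriorAlgebra ℂ V) where
  smul_lie c x ω := by
    simp only [lie_ext, extDer_apply, smul_lie, map_smul, smul_mul_assoc, Finset.smul_sum]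
  lie_smul c x ω := map_smul _ _ _

variable (L V) in
theorem isDerAction_ext : IsDerAction L (ExteriorAlgebra.ι ℂ : V →ₗ[ℂ] ExteriorAlgebra ℂ V) where
  lie_ι x v := by
    have := extDer_ι_mul x v 1
    rwa [mul_one, mul_one, ← map_one (algebraMap ℂ (ExteriorAlgebra ℂ V)), extDer_algebraMap,
      mul_zero, add_zero] at this
  lie_mul x a c := by
    induction a using CliffordAlgebra.left_induction with
    | algebraMap r =>
      simp only [lie_ext, ← Algebra.smul_def, map_smul, extDer_algebraMap, zero_mul, zero_add]
    | add a b ha hb => simp only [add_mul, lie_add, ha, hb]; abel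
    | ι_mul ω v hω =>
      rw [mul_assoc]
      change extDer x (ExteriorAlgebra.ι ℂ v * (ω * c)) =
        extDer x (ExteriorAlgebra.ι ℂ v * ω) * c + ExteriorAlgebra.ι ℂ v * ω * extDer x c
      change extDer x (ω * c) = extDer x ω * c + ω * extDer x c at hω
      rw [extDer_ι_mul, extDer_ι_mul, hω]
      simp only [mul_add, add_mul, mul_assoc, add_assoc]

theorem ext_contractLeft_comm (ξ η : Dual ℂ V) (ω : ExteriorAlgebra ℂ V) :
    contractLeft ξ (contractLeft η ω) = -contractLeft η (contractLeft ξ ω) :=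
  contractLeft_comm ξ (d' := η) ω

/-- Contraction is equivariant once the action on the functional is taken into account. The
equivariance of the Koszul differential rests on this. -/
theorem contractLeft_extDer (x : L) (ξ : Dual ℂ V) (ω : ExteriorAlgebra ℂ V) :
    contractLeft ξ (extDer x ω) =
      contractLeft (ξ ∘ₗ LieModule.toEnd ℂ L V x) ω + extDer x (contractLeft ξ ω) := by
  have h1 : ξ ∘ₗ LieModule.toEnd ℂ L V x =
      ∑ i, ξ ⁅x, finBasis ℂ V i⁆ • (finBasis ℂ V).coord i := by
    refine (finBasis ℂ V).ext fun j => ?_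
    simp [Finsupp.single_apply]
  rw [h1, map_sum, LinearMap.sum_apply, extDer_apply, extDer_apply, map_sum,
    ← Finset.sum_add_distrib]
  refine Finset.sum_congr rfl fun i _ => ?_
  rw [ext_contractLeft_ι_mul, map_smul, LinearMap.smul_apply, ext_contractLeft_comm ξ, mul_neg,
    sub_neg_eq_add]

variable (L V) in
theorem isDerAction_sym : IsDerAction L (SymmetricAlgebra.ι ℂ V) where
  lie_ι x v := symDer_ι x v
  lie_mul x a c := by
    change symDer x (a * c) = symDer x a * c + a * symDer x c
    rw [Derivation.leibniz, smul_eq_mul, smul_eq_mul, mul_comm c, add_comm]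

end Ext

/-! ### Weights of simple modules and of exterior powers -/

section Weights

open LieAlgebra LieModule Module

variable {L : Type u} [LieRing L] [LieAlgebra ℂ L] [FiniteDimensional ℂ L]
  [LieAlgebra.IsSemisimple ℂ L]
variable {H : LieSubalgebra ℂ L} [H.IsCartanSubalgebra]
variable {b : (LieAlgebra.IsKilling.rootSystem H).Base}
variable {V : Type v} [AddCommGroup V] [Module ℂ V] [LieRingModule L V] [LieModule ℂ L V]
  [FiniteDimensional ℂ V]
variable {M : Type*} [AddCommGroup M] [Module ℂ M] [LieRingModule L M] [LieModule ℂ L M]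

/-- Weight spaces for distinct weights are independent, so a nonzero vector of weight `χ` is not in
the span of vectors of other weights. -/
theorem exists_weightVector_of_mem_span {I : Type*} {s : I → M} {ξ : I → Module.Dual ℂ H}
    (hs : ∀ i (h : H), ⁅(h : L), s i⁆ = ξ i h • s i) {m : M} {χ : Module.Dual ℂ H} (hm0 : m ≠ 0)
    (hm : ∀ h : H, ⁅(h : L), m⁆ = χ h • m) (hspan : m ∈ Submodule.span ℂ (Set.range s)) :
    ∃ i, s i ≠ 0 ∧ ξ i = χ := by
  by_contra! hcon
  have hmem : ∀ {m : M} {χ : Module.Dual ℂ H}, (∀ h : H, ⁅(h : L), m⁆ = χ h • m) →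
      m ∈ genWeightSpace M (χ : H → ℂ) := fun h =>
    weightSpace_le_genWeightSpace _ _ ((LieModule.mem_weightSpace _ _).2 h)
  have hind := LieModule.iSupIndep_genWeightSpace ℂ H M (χ : H → ℂ)
  refine hm0 ((LieSubmodule.mem_bot (R := ℂ) (L := H) m).1 (hind.le_bot ⟨hmem hm, ?_⟩))
  refine (Submodule.span_le (p := (⨆ j, ⨆ (_ : j ≠ (χ : H → ℂ)), genWeightSpace M j :
    LieSubmodule ℂ H M).toSubmodule)).2 ?_ hspan
  rintro _ ⟨i, rfl⟩
  by_cases h0 : s i = 0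
  · rw [h0]; exact zero_mem _
  · have h1 : (ξ i : H → ℂ) ≠ χ := fun h => hcon i h0 (DFunLike.coe_injective h)
    exact (le_iSup₂ (f := fun j (_ : j ≠ (χ : H → ℂ)) => genWeightSpace M j) _ h1) (hmem (hs i))

/-- If `A_j ⊗ X` has a highest weight vector of weight `ν`, where `X` is simple of highest weight
`χ`, then `ν - χ` is a weight of `A_j`. -/
theorem IsHighest.exists_weight_sub {X : Type*} [AddCommGroup X] [Module ℂ X] [LieRingModule L X]
    [LieModule ℂ L X] [LieModule.IsIrreducible ℂ L X] [FiniteDimensional ℂ X] {v : X}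
    {χ ν : Module.Dual ℂ H} (hv : IsHighest b v χ) (hv0 : v ≠ 0) {y : M ⊗[ℂ] X} (hy0 : y ≠ 0)
    (hy : IsHighest b y ν) : ∃ m : M, m ≠ 0 ∧ ∀ h : H, ⁅(h : L), m⁆ = (ν - χ) h • m := by
  let E : Module.Dual ℂ X →ₗ[ℂ] M ⊗[ℂ] X →ₗ[ℂ] M :=
    LinearMap.compRight ℂ (TensorProduct.rid ℂ M).toLinearMap ∘ₗ LinearMap.lTensorHom M
  have hE : ∀ η m x, E η (m ⊗ₜ x) = η x • m := fun η m x => by simp [E]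
  obtain ⟨ξ, h1, h2⟩ := IsHighest.exists_weightVector E (fun z η t => by
    induction t using TensorProduct.induction_on with
    | zero => simp
    | tmul m x => simp [hE, TensorProduct.LieModule.lie_tmul_right]
    | add s t hs ht => simp only [lie_add, map_add, hs, ht]; abel) hv hv0 hy (by
    by_contra! hcon
    refine hy0 ?_
    let e := finBasis ℂ X
    have hrec : ∀ t : M ⊗[ℂ] X, t = ∑ j, E (e.coord j) t ⊗ₜ[ℂ] e j := by
      intro t
      induction t using TensorProduct.induction_on with
      | zero => simp
      | tmul v z =>
        simp only [hE, TensorProduct.smul_tmul, ← TensorProduct.tmul_sum]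
        conv_lhs => rw [← e.sum_repr z]
        simp
      | add s t hs ht =>
        conv_lhs => rw [hs, ht]
        simp only [map_add, TensorProduct.add_tmul, Finset.sum_add_distrib]
    rw [hrec y]
    exact Finset.sum_eq_zero fun j _ => by rw [hcon, TensorProduct.zero_tmul])
  exact ⟨_, h1, h2⟩

/-- Apply `IsHighest.exists_weightVector` to the evaluation of functionals on `V(μ)`, with values in
the trivial module: `κ - μ` is then a weight of the trivial module, that is, zero. -/
theorem Simple.weight_eq {μ : Dominant b} {z : Simple b μ} {κ : Module.Dual ℂ H} (hz0 : z ≠ 0)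
    (hz : IsHighest b z κ) : κ = μ.1 := by
  rcases Simple.subsingleton_or μ with h | ⟨_, v, hv0, hv⟩
  · exact absurd (Subsingleton.elim z 0) hz0
  let E : Module.Dual ℂ (Simple b μ) →ₗ[ℂ] Simple b μ →ₗ[ℂ] TrivialLieModule ℂ L ℂ :=
    LinearMap.compRight ℂ (TrivialLieModule.equiv ℂ L ℂ).symm.toLinearMap
  obtain ⟨η, hη⟩ : ∃ η : Module.Dual ℂ (Simple b μ), η z ≠ 0 := by
    by_contra! h
    exact hz0 ((Module.forall_dual_apply_eq_zero_iff ℂ z).1 h)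
  obtain ⟨ξ, h1, h2⟩ := IsHighest.exists_weightVector E (fun z η y => by
    rw [trivial_lie_zero]
    change (0 : ℂ) = ⁅z, η⁆ y + η ⁅z, y⁆
    rw [Module.Dual.lie_apply, neg_add_cancel]) hv hv0 hz ⟨η, fun h => hη (by simpa [E] using h)⟩
  ext h
  have h3 := h2 h
  rw [trivial_lie_zero] at h3
  have := (smul_eq_zero.1 h3.symm).resolve_right h1
  exact sub_eq_zero.1 this

theorem sum_lie_ofFn_prod {A : Type*} [Ring A] [Algebra ℂ A] [LieRingModule L A] [LieModule ℂ L A]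
    {ι : V →ₗ[ℂ] A} (hι : IsDerAction L ι) {I : Type*} {e : I → V} {ξ : I → Module.Dual ℂ H}
    (hξ : ∀ i (h : H), ⁅(h : L), e i⁆ = ξ i h • e i) (h : H) (l : List I) :
    ⁅(h : L), (l.map fun i => ι (e i)).prod⁆ =
      (l.map ξ).sum h • (l.map fun i => ι (e i)).prod := by
  induction l with
  | nil => simp [hι.lie_one]
  | cons i l ih =>
    rw [List.map_cons, List.prod_cons, hι.lie_mul, hι.lie_ι, hξ, ih, List.map_cons, List.sum_cons,
      LinearMap.add_apply, add_smul, map_smul, smul_mul_assoc, mul_smul_comm]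

theorem IsDerAction.comp_le_span {A : Type*} [Ring A] [Algebra ℂ A] [LieRingModule L A]
    [LieModule ℂ L A] {ι : V →ₗ[ℂ] A} (hι : IsDerAction L ι) {I : Type*} (e : Basis I ℂ V)
    (k : ℕ) : (hι.comp k).toSubmodule ≤
      Submodule.span ℂ (Set.range fun l : {l : List I // l.length = k} =>
        (l.1.map fun i => ι (e i)).prod) := by
  change (LinearMap.range ι) ^ k ≤ _
  have h1 : LinearMap.range ι = Submodule.span ℂ (Set.range (ι ∘ e)) := by
    rw [LinearMap.range_eq_map, ← e.span_eq, Submodule.map_span, Set.range_comp]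
  rw [h1, Submodule.span_pow]
  refine Submodule.span_mono ?_
  intro a ha
  obtain ⟨f, rfl⟩ := Set.mem_pow.1 ha
  choose g hg using fun i => (f i).2
  refine ⟨⟨List.ofFn g, List.length_ofFn⟩, ?_⟩
  simp only [List.map_ofFn]
  congr 1
  congr 1
  funext i
  exact hg i

theorem ext_nodup_of_prod_ne_zero {I : Type*} (e : I → V) (l : List I)
    (h : (l.map fun i => ExteriorAlgebra.ι ℂ (e i)).prod ≠ 0) : l.Nodup := by
  by_contra hl
  refine h ?_
  have := ExteriorAlgebra.ιMulti_apply (R := ℂ) (n := l.length) (fun i => e (l.get i))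
  rw [AlternatingMap.map_eq_zero_of_not_injective] at this
  · rw [this]
    congr 1
    refine List.ext_get (by simp) fun n h1 h2 => by simp
  · intro hinj
    exact hl (List.nodup_iff_injective_get.2 fun i j hij => hinj (congrArg e hij))

end Weights

/-! ### Consequences of rigidity -/

section Expr

variable {E : Type w} [AddCommGroup E]

/-- `δ = ∑ r_β β` and `n = ∑ r_β`. -/
def IsExpr (r : E →₀ ℕ) (δ : E) (n : ℕ) : Prop :=
  (r.sum fun β k => k • β) = δ ∧ (r.sum fun _ k => k) = n

theorem IsExpr.zero : IsExpr (0 : E →₀ ℕ) 0 0 := ⟨Finsupp.sum_zero_index, Finsupp.sum_zero_index⟩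

theorem IsExpr.single (β : E) : IsExpr (Finsupp.single β 1) β 1 := by
  constructor
  · exact (Finsupp.sum_single_index (h := fun (β : E) (k : ℕ) => k • β) (zero_smul ℕ β)).trans
      (one_smul ℕ β)
  · rw [Finsupp.sum_single_index rfl]

theorem IsExpr.add {r s : E →₀ ℕ} {δ ε : E} {n k : ℕ} (hr : IsExpr r δ n) (hs : IsExpr s ε k) :
    IsExpr (r + s) (δ + ε) (n + k) := by
  classical
  constructor
  · rw [Finsupp.sum_add_index' (h := fun (β : E) (k : ℕ) => k • β) (fun β => zero_smul ℕ β)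
      (fun β k l => add_smul k l β), hr.1, hs.1]
  · rw [Finsupp.sum_add_index' (fun _ => rfl) (fun _ _ _ => rfl), hr.2, hs.2]

theorem support_add_subset {W : Set E} {r s : E →₀ ℕ} (hr : (r.support : Set E) ⊆ W)
    (hs : (s.support : Set E) ⊆ W) : ((r + s).support : Set E) ⊆ W := by
  classical
  intro x hx
  rcases Finset.mem_union.1 (Finsupp.support_add hx) with h | h
  exacts [hr h, hs h]

theorem support_single_subset {W : Set E} {β : E} (hβ : β ∈ W) :
    ((Finsupp.single β 1 : E →₀ ℕ).support : Set E) ⊆ W := by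
  intro x hx
  have := Finsupp.support_single_subset hx
  rw [Finset.mem_singleton] at this
  rwa [this]

variable {W : Set E} {Ψ : Finset E}

/-- Each expression can play the part of the arbitrary one in rigidity for the other. So the minimum
defining `d_Ψ` is in fact the common length of all expressions. -/
theorem Rigid.card_eq (hR : Rigid W Ψ) (hΨ : (Ψ : Set E) ⊆ W) {m m' : E →₀ ℕ} {δ : E} {n n' : ℕ}
    (hm : (m.support : Set E) ⊆ Ψ) (hm' : (m'.support : Set E) ⊆ Ψ) (h : IsExpr m δ n)
    (h' : IsExpr m' δ n') : n = n' := by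
  have h1 := (hR m m' (by exact_mod_cast hm) (hm'.trans hΨ) (h.1.trans h'.1.symm)).1
  have h2 := (hR m' m (by exact_mod_cast hm') (hm.trans hΨ) (h'.1.trans h.1.symm)).1
  rw [h.2, h'.2] at h1
  rw [h.2, h'.2] at h2
  exact le_antisymm h1 h2

/-- The sum `m + r` expresses the same element as `m'`, with as many terms. The equality case of
rigidity forces all its weights into `Ψ`. -/
theorem Rigid.subset (hR : Rigid W Ψ) (hΨ : (Ψ : Set E) ⊆ W) {m m' r : E →₀ ℕ} {δ ε : E}
    {n k : ℕ} (hm : (m.support : Set E) ⊆ Ψ) (hm' : (m'.support : Set E) ⊆ Ψ)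
    (hr : (r.support : Set E) ⊆ W) (h : IsExpr m δ n) (h' : IsExpr m' (δ + ε) (n + k))
    (hk : IsExpr r ε k) : (r.support : Set E) ⊆ Ψ := by
  have h1 := h.add hk
  have h2 := (hR m' (m + r) (by exact_mod_cast hm') (support_add_subset (hm.trans hΨ) hr)
    (h'.1.trans h1.1.symm)).2.1 (h'.2.trans h1.2.symm)
  intro β hβ
  refine h2 β ?_
  rw [Finsupp.add_apply]
  exact Nat.add_pos_right _ (Nat.pos_of_ne_zero (Finsupp.mem_support_iff.1 hβ))

theorem lePsi_iff {μ ν : E} :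
    LePsi Ψ μ ν ↔ ∃ (m : E →₀ ℕ) (n : ℕ), (m.support : Set E) ⊆ Ψ ∧ IsExpr m (ν - μ) n := by
  constructor
  · intro h
    refine AddSubmonoid.closure_induction (motive := fun δ _ => ∃ (m : E →₀ ℕ) (n : ℕ),
      (m.support : Set E) ⊆ Ψ ∧ IsExpr m δ n) ?_ ?_ ?_ h
    · exact fun β hβ => ⟨_, _, support_single_subset hβ, IsExpr.single β⟩
    · exact ⟨0, 0, by simp, IsExpr.zero⟩
    · rintro δ ε - - ⟨m, n, h1, h2⟩ ⟨m', n', h1', h2'⟩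
      exact ⟨_, _, support_add_subset h1 h1', h2.add h2'⟩
  · rintro ⟨m, n, h1, h2, -⟩
    rw [LePsi, ← h2]
    exact sum_mem fun β hβ => nsmul_mem (AddSubmonoid.subset_closure (h1 hβ)) _

theorem dPsi_spec {μ ν : E} (h : LePsi Ψ μ ν) :
    ∃ m : E →₀ ℕ, (m.support : Set E) ⊆ Ψ ∧ IsExpr m (ν - μ) (dPsi Ψ μ ν) := by
  obtain ⟨m, n, h1, h2⟩ := lePsi_iff.1 h
  obtain ⟨m, h1, h2, h3⟩ := Nat.sInf_mem (s := {n | ∃ m : E →₀ ℕ, m.support ⊆ Ψ ∧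
    (m.sum fun β k => k • β) = ν - μ ∧ (m.sum fun _ k => k) = n})
    ⟨n, m, by exact_mod_cast h1, h2.1, h2.2⟩
  exact ⟨m, by exact_mod_cast h1, h2, h3⟩

theorem Rigid.dPsi_eq (hR : Rigid W Ψ) (hΨ : (Ψ : Set E) ⊆ W) {μ ν : E} {m : E →₀ ℕ} {n : ℕ}
    (hm : (m.support : Set E) ⊆ Ψ) (h : IsExpr m (ν - μ) n) :
    LePsi Ψ μ ν ∧ dPsi Ψ μ ν = n := by
  have h1 : LePsi Ψ μ ν := lePsi_iff.2 ⟨m, n, hm, h⟩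
  obtain ⟨m', h2, h3⟩ := dPsi_spec h1
  exact ⟨h1, hR.card_eq hΨ h2 hm h3 h⟩

end Expr

/-! ### What rigidity says about the orders on `Λ` and about highest weight vectors -/

section Poset

open LieAlgebra LieModule Module

variable {L : Type u} [LieRing L] [LieAlgebra ℂ L] [FiniteDimensional ℂ L]
  [LieAlgebra.IsSemisimple ℂ L]
variable {H : LieSubalgebra ℂ L} [H.IsCartanSubalgebra]
variable {b : (LieAlgebra.IsKilling.rootSystem H).Base}
variable {V : Type v} [AddCommGroup V] [Module ℂ V] [LieRingModule L V] [LieModule ℂ L V]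

theorem Preceq.exists_expr {x y : Lam b} (h : Preceq V x y) :
    ∃ (r : Module.Dual ℂ H →₀ ℕ) (n : ℕ), (r.support : Set _) ⊆ wt H V ∧
      IsExpr r (y.1.1 - x.1.1) n ∧ y.2 = x.2 + n := by
  induction h with
  | refl => exact ⟨0, 0, by simp, by rw [sub_self]; exact IsExpr.zero, by simp⟩
  | @tail y z _ hc ih =>
    obtain ⟨r, n, h1, h2, h3⟩ := ih
    obtain ⟨h4, h5⟩ := hc
    refine ⟨r + Finsupp.single _ 1, n + 1, support_add_subset h1 (support_single_subset h5), ?_, ?_⟩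
    · have := h2.add (IsExpr.single (z.1.1 - y.1.1))
      rwa [sub_add_sub_cancel'] at this
    · rw [h4, h3]; push_cast; ring

variable {Ψ : Finset (Module.Dual ℂ H)}

/-- Both points are reached from `x₀` by expressions in `Ψ` whose lengths are the degree
differences. An expression of `y - x` of length `y.2 - x.2` therefore completes one of extremal
length, and the equality case applies. -/
theorem support_subset_of_preceqPsi (hwt : (Ψ : Set (Module.Dual ℂ H)) ⊆ wt H V)
    (hR : Rigid (wt H V) Ψ) {x₀ x y : Lam b} (hx : PreceqPsi Ψ x₀ x) (hy : PreceqPsi Ψ x₀ y)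
    {r : Module.Dual ℂ H →₀ ℕ} {n : ℕ} (hr : (r.support : Set _) ⊆ wt H V)
    (he : IsExpr r (y.1.1 - x.1.1) n) (hn : y.2 = x.2 + n) : (r.support : Set (Module.Dual ℂ H)) ⊆ Ψ := by
  obtain ⟨m, h1, h2⟩ := dPsi_spec hx.1
  obtain ⟨m', h1', h2'⟩ := dPsi_spec hy.1
  have h3 : dPsi Ψ x₀.1.1 y.1.1 = dPsi Ψ x₀.1.1 x.1.1 + n := by
    have e1 := hx.2
    have e2 := hy.2
    omega
  refine hR.subset hwt h1 h1' hr h2 ?_ he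
  rw [← h3, sub_add_sub_cancel']
  exact h2'

/-- Together with `dPsi_eq_of_lePsi`, this matches the pairs of summands of `P(Γ)` joined by a
nonzero homomorphism with pieces of `𝐀_Ψ`, in the correct degree. -/
theorem lePsi_of_preceq (hwt : (Ψ : Set (Module.Dual ℂ H)) ⊆ wt H V)
    (hR : Rigid (wt H V) Ψ) {x₀ x y : Lam b} (hx : PreceqPsi Ψ x₀ x) (hy : PreceqPsi Ψ x₀ y)
    (h : Preceq V x y) : LePsi Ψ x.1.1 y.1.1 ∧ (dPsi Ψ x.1.1 y.1.1 : ℤ) = y.2 - x.2 := by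
  obtain ⟨r, n, h1, h2, h3⟩ := h.exists_expr
  have := hR.dPsi_eq hwt (support_subset_of_preceqPsi hwt hR hx hy h1 h2 h3) h2
  exact ⟨this.1, by rw [this.2, h3]; ring⟩

theorem dPsi_eq_of_lePsi (hwt : (Ψ : Set (Module.Dual ℂ H)) ⊆ wt H V)
    (hR : Rigid (wt H V) Ψ) {x₀ x y : Lam b} (hx : PreceqPsi Ψ x₀ x) (hy : PreceqPsi Ψ x₀ y)
    (h : LePsi Ψ x.1.1 y.1.1) : (dPsi Ψ x.1.1 y.1.1 : ℤ) = y.2 - x.2 := by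
  obtain ⟨m, h1, h2⟩ := dPsi_spec hx.1
  obtain ⟨m', h1', h2'⟩ := dPsi_spec h
  have h3 := h2.add h2'
  rw [sub_add_sub_cancel'] at h3
  have h4 := (hR.dPsi_eq hwt (support_add_subset h1 h1') h3).2
  have e1 := hx.2
  have e2 := hy.2
  omega

/-- The distance `d_Ψ` from `x₀` recovers the degree from the weight. Consequently `π₁` is injective
on `Γ`. -/
theorem eq_of_fst_eq {x₀ x y : Lam b} (hx : PreceqPsi Ψ x₀ x) (hy : PreceqPsi Ψ x₀ y)
    (h : x.1 = y.1) : x = y := by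
  have h1 := hx.2
  have h2 := hy.2
  rw [← h] at h2
  exact Prod.ext h (by omega)

variable [FiniteDimensional ℂ V]

/-- A highest weight vector in `A_k ⊗ V(μ)`. -/
theorem preceq_of_isHighest {A : Type*} [Ring A] [Algebra ℂ A] [LieRingModule L A]
    [LieModule ℂ L A] {ι : V →ₗ[ℂ] A} (hι : IsDerAction L ι) {k : ℕ} {μ ν : Dominant b}
    {y : hι.comp k ⊗[ℂ] Simple b μ} (hy0 : y ≠ 0) (hy : IsHighest b y ν.1) (r : ℤ) :
    Preceq V (μ, r) (ν, r + k) := by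
  obtain ⟨κ, ν', z, hz0, hz, hν, h⟩ := IsHighest.chain hι k ν.1 y hy0 hy
  have h1 : κ = μ := Subtype.ext (Simple.weight_eq hz0 hz)
  have h2 : ν' = ν := Subtype.ext hν
  rw [← h1, ← h2]
  exact h r

/-- A highest weight vector in `Sym^n V ⊗ Λ^j V ⊗ V(μ)` exists only for `j ≤ N_Ψ`. -/
theorem le_nPsi_of_isHighest (hwt : (Ψ : Set (Module.Dual ℂ H)) ⊆ wt H V)
    (hR : Rigid (wt H V) Ψ) {x₀ x y : Lam b} (hx : PreceqPsi Ψ x₀ x) (hy : PreceqPsi Ψ x₀ y)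
    {n j : ℕ} (hn : y.2 = x.2 + j + n)
    {t : (isDerAction_sym L V).comp n ⊗[ℂ] ((isDerAction_ext L V).comp j ⊗[ℂ] Simple b x.1)}
    (ht0 : t ≠ 0) (ht : IsHighest b t y.1.1) : j ≤ nPsi V Ψ := by
  classical
  have := (isDerAction_ext L V).finiteDimensional_comp j
  obtain ⟨κ, ν', z, hz0, hz, hν, h⟩ := IsHighest.chain (isDerAction_sym L V) n _ t ht0 ht
  have hν' : ν' = y.1 := Subtype.ext hν
  subst hν'
  obtain ⟨r, n', h1, h2, h3⟩ := (h (x.2 + j)).exists_expr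
  have hn' : n' = n := by simp at h3; omega
  subst hn'
  rcases Simple.subsingleton_or x.1 with hs | ⟨_, v, hv0, hv⟩
  · exact absurd (Subsingleton.elim z 0) hz0
  -- The difference `κ - x.1` is a weight of `Λ^j V`, hence the weight of some nonzero wedge
  -- monomial in a weight basis; its factors are distinct.
  obtain ⟨ω, hω0, hω⟩ := hv.exists_weight_sub hv0 hz0 hz
  obtain ⟨I, _, e, ξ, hξ⟩ := exists_weightBasis V b
  obtain ⟨⟨l, hl⟩, hl0, hlξ⟩ := exists_weightVector_of_mem_span
    (s := fun l : {l : List I // l.length = j} =>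
      (l.1.map fun i => ExteriorAlgebra.ι ℂ (e i)).prod) (ξ := fun l => (l.1.map ξ).sum)
    (fun l h => sum_lie_ofFn_prod (isDerAction_ext L V) hξ h l.1) (m := (ω : ExteriorAlgebra ℂ V))
    (χ := κ.1 - x.1.1) (fun h => hω0 (Subtype.ext h))
    (fun h => congrArg Subtype.val (hω h)) ((isDerAction_ext L V).comp_le_span e j ω.2)
  simp only at hl0 hlξ
  have hnd := ext_nodup_of_prod_ne_zero e l hl0
  have hexpr : ∀ l : List I, ∃ r : Module.Dual ℂ H →₀ ℕ, (r.support : Set _) ⊆ wt H V ∧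
      IsExpr r (l.map ξ).sum l.length ∧ ∀ i ∈ l, r (ξ i) ≠ 0 := by
    intro l
    induction l with
    | nil => exact ⟨0, by simp, IsExpr.zero, by simp⟩
    | cons i l ih =>
      obtain ⟨r, h1, h2, h3⟩ := ih
      refine ⟨r + Finsupp.single (ξ i) 1, support_add_subset h1
        (support_single_subset (mem_wt (e.ne_zero i) (hξ i))), ?_, ?_⟩
      · rw [List.map_cons, List.sum_cons, add_comm (ξ i)]
        exact h2.add (IsExpr.single _)
      · intro k hk
        rw [Finsupp.add_apply]
        rcases List.mem_cons.1 hk with rfl | hk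
        · simp
        · have := h3 k hk
          omega
  obtain ⟨r', h1', h2', h3'⟩ := hexpr l
  rw [hlξ, hl] at h2'
  -- The `j` weights of the wedge monomial and the `n` steps of the chain together express `y.1 -
  -- x.1` with `y.2 - x.2` terms, so all of them lie in `Ψ`.
  have hsub := support_subset_of_preceqPsi hwt hR hx hy (support_add_subset h1' h1)
    (n := j + n') (by
      have := h2'.add h2
      rwa [sub_add_sub_cancel'] at this) (by rw [hn]; push_cast; ring)
  have hmem : ∀ i ∈ l, ξ i ∈ Ψ := fun i hi => hsub (by
    rw [Finset.mem_coe, Finsupp.mem_support_iff, Finsupp.add_apply]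
    have := h3' i hi
    omega)
  -- It remains to count: at most `dim V_η` basis vectors have weight `η`, so at most `N_Ψ` have a
  -- weight in `Ψ`.
  have hcard : ∀ η : Module.Dual ℂ H, (Finset.univ.filter fun i => ξ i = η).card ≤
      Module.finrank ℂ (weightSpace V (η : H → ℂ)) := by
    intro η
    have hli : LinearIndependent ℂ (fun i : {i // ξ i = η} =>
        (⟨e i.1, (LieModule.mem_weightSpace _ _).2 fun h => (hξ i.1 h).trans (by rw [i.2])⟩ :
          weightSpace V (η : H → ℂ))) := by
      refine LinearIndependent.of_comp (weightSpace V (η : H → ℂ)).toSubmodule.subtype ?_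
      exact e.linearIndependent.comp _ Subtype.val_injective
    have := hli.fintype_card_le_finrank
    rwa [Fintype.card_subtype] at this
  rw [← hl, ← List.toFinset_card_of_nodup hnd, nPsi]
  calc l.toFinset.card ≤ (Finset.univ.filter fun i => ξ i ∈ Ψ).card :=
        Finset.card_le_card fun i hi => by simpa using hmem i (List.mem_toFinset.1 hi)
    _ = ∑ η ∈ Ψ, ((Finset.univ.filter fun i => ξ i ∈ Ψ).filter fun i => ξ i = η).card :=
        Finset.card_eq_sum_card_fiberwise fun i hi => by simpa using hi
    _ ≤ _ := Finset.sum_le_sum fun η _ => (Finset.card_le_card fun i hi => by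
        simp only [Finset.mem_filter] at hi ⊢; exact ⟨Finset.mem_univ _, hi.2⟩).trans (hcard η)

end Poset

/-! ### The `U(𝔤 ⋉ V)`-module `Sym V ⊗ X` -/

section Free

open Module

variable {L : Type u} [LieRing L] [LieAlgebra ℂ L]
variable {V : Type v} [AddCommGroup V] [Module ℂ V] [LieRingModule L V] [LieModule ℂ L V]
variable {X : Type*} [AddCommGroup X] [Module ℂ X] [LieRingModule L X] [LieModule ℂ L X]
variable {X' : Type*} [AddCommGroup X'] [Module ℂ X'] [LieRingModule L X'] [LieModule ℂ L X']

instance : Ring (Ua L V) := inferInstance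
instance : Semiring (Ua L V) := inferInstance
instance : Algebra ℂ (Ua L V) := inferInstance
instance : Module ℂ (Ua L V) := inferInstance

theorem lie_sym_ι_mul (x : L) (v : V) (s : SymmetricAlgebra ℂ V) :
    ⁅x, SymmetricAlgebra.ι ℂ V v * s⁆ =
      SymmetricAlgebra.ι ℂ V ⁅x, v⁆ * s + SymmetricAlgebra.ι ℂ V v * ⁅x, s⁆ := by
  change symDer x _ = _ * _ + _ * symDer x s
  rw [Derivation.leibniz, smul_eq_mul, smul_eq_mul, symDer_ι, mul_comm s, add_comm]

theorem lie_sym_one (x : L) : ⁅x, (1 : SymmetricAlgebra ℂ V)⁆ = 0 :=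
  (symDer x).map_one_eq_zero

theorem sym_left_induction {p : SymmetricAlgebra ℂ V → Prop} (one : p 1)
    (smul : ∀ (c : ℂ) s, p s → p (c • s)) (add : ∀ s t, p s → p t → p (s + t))
    (mul : ∀ v s, p s → p (SymmetricAlgebra.ι ℂ V v * s)) (s : SymmetricAlgebra ℂ V) : p s := by
  suffices h : ∀ s t, p t → p (s * t) by simpa using h s 1 one
  intro s
  induction s using SymmetricAlgebra.induction with
  | algebraMap r => intro t ht; rw [← Algebra.smul_def]; exact smul r t ht
  | ι x => exact fun t ht => mul x t ht
  | mul a b ha hb => intro t ht; rw [mul_assoc]; exact ha _ (hb _ ht)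
  | add a b ha hb => intro t ht; rw [add_mul]; exact add _ _ (ha _ ht) (hb _ ht)

variable (V X) in
/-- Multiplication by an element of `V` on `Sym V ⊗ X`. -/
def mulSym (v : V) : End ℂ (SymmetricAlgebra ℂ V ⊗[ℂ] X) :=
  LinearMap.rTensor X (LinearMap.mulLeft ℂ (SymmetricAlgebra.ι ℂ V v))

theorem mulSym_tmul (v : V) (s : SymmetricAlgebra ℂ V) (m : X) :
    mulSym V X v (s ⊗ₜ m) = (SymmetricAlgebra.ι ℂ V v * s) ⊗ₜ m := rfl

theorem mulSym_comm (v w : V) (t : SymmetricAlgebra ℂ V ⊗[ℂ] X) :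
    mulSym V X v (mulSym V X w t) = mulSym V X w (mulSym V X v t) := by
  induction t using TensorProduct.induction_on with
  | zero => simp
  | tmul s m => rw [mulSym_tmul, mulSym_tmul, mulSym_tmul, mulSym_tmul, mul_left_comm]
  | add s t hs ht => simp only [map_add, hs, ht]

theorem lie_mulSym (x : L) (v : V) (t : SymmetricAlgebra ℂ V ⊗[ℂ] X) :
    ⁅x, mulSym V X v t⁆ = mulSym V X ⁅x, v⁆ t + mulSym V X v ⁅x, t⁆ := by
  induction t using TensorProduct.induction_on with
  | zero => simp
  | tmul s m =>
    rw [mulSym_tmul, TensorProduct.LieModule.lie_tmul_right, TensorProduct.LieModule.lie_tmul_right,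
      map_add, mulSym_tmul, mulSym_tmul, mulSym_tmul, lie_sym_ι_mul, TensorProduct.add_tmul,
      add_assoc]
  | add s t hs ht => simp only [map_add, lie_add, hs, ht]; abel

theorem mulSym_add (v w : V) (t : SymmetricAlgebra ℂ V ⊗[ℂ] X) :
    mulSym V X (v + w) t = mulSym V X v t + mulSym V X w t := by
  induction t using TensorProduct.induction_on with
  | zero => simp
  | tmul s m => simp only [mulSym_tmul, map_add, add_mul, TensorProduct.add_tmul]
  | add s t hs ht => simp only [map_add, hs, ht]; abel

theorem mulSym_smul (c : ℂ) (v : V) (t : SymmetricAlgebra ℂ V ⊗[ℂ] X) :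
    mulSym V X (c • v) t = c • mulSym V X v t := by
  induction t using TensorProduct.induction_on with
  | zero => simp
  | tmul s m => simp only [mulSym_tmul, map_smul, smul_mul_assoc, TensorProduct.smul_tmul']
  | add s t hs ht => simp only [map_add, smul_add, hs, ht]

/-- This is the bracket identity for `semiRep`: multiplications by `V` commute and `L` acts by
derivations. The leading `0` is the bracket of the abelian ideal, as in the bracket of the
semidirect product. -/
theorem mulSym_bracket (v w : V) (x y : L) (t : SymmetricAlgebra ℂ V ⊗[ℂ] X) :
    mulSym V X (0 + ⁅x, w⁆ - ⁅y, v⁆) t + ⁅⁅x, y⁆, t⁆ =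
      (mulSym V X v (mulSym V X w t + ⁅y, t⁆) + ⁅x, mulSym V X w t + ⁅y, t⁆⁆) -
      (mulSym V X w (mulSym V X v t + ⁅x, t⁆) + ⁅y, mulSym V X v t + ⁅x, t⁆⁆) := by
  have h1 : ∀ v w : V, mulSym V X (v - w) t = mulSym V X v t - mulSym V X w t := fun v w => by
    rw [eq_sub_iff_add_eq, ← mulSym_add, sub_add_cancel]
  rw [zero_add, h1, map_add, map_add, lie_add, lie_add, lie_mulSym, lie_mulSym, mulSym_comm w v,
    lie_lie]
  abel

variable (L V X) in
/-- The representation of `𝔤 ⋉ V` on `Sym V ⊗ X`. -/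
def semiRep : SemiLie L V →ₗ⁅ℂ⁆ End ℂ (SymmetricAlgebra ℂ V ⊗[ℂ] X) where
  toFun a := mulSym V X (show V from a.left) + LieModule.toEnd ℂ L _ a.right
  map_add' a c := LinearMap.ext fun t => by
    change mulSym V X ((show V from a.left) + (show V from c.left)) t + ⁅a.right + c.right, t⁆ =
      (mulSym V X a.left t + ⁅a.right, t⁆) + (mulSym V X c.left t + ⁅c.right, t⁆)
    rw [mulSym_add, add_lie]; abel
  map_smul' r a := LinearMap.ext fun t => by
    change mulSym V X (r • (show V from a.left)) t + ⁅r • a.right, t⁆ =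
      r • (mulSym V X a.left t + ⁅a.right, t⁆)
    rw [mulSym_smul, smul_lie, smul_add]
  map_lie' {a c} := LinearMap.ext fun t => by
    exact mulSym_bracket (show V from a.left) (show V from c.left) a.right c.right t

variable (L V X) in
/-- The algebra homomorphism defining the action of `U(𝔤 ⋉ V)` on `Sym V ⊗ X`. -/
def uaRep : Ua L V →ₐ[ℂ] End ℂ (SymmetricAlgebra ℂ V ⊗[ℂ] X) :=
  UniversalEnvelopingAlgebra.lift ℂ (semiRep L V X)

instance freeModule : Module (Ua L V) (SymmetricAlgebra ℂ V ⊗[ℂ] X) :=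
  Module.compHom _ (uaRep L V X).toRingHom

theorem ua_smul_def (a : Ua L V) (t : SymmetricAlgebra ℂ V ⊗[ℂ] X) : a • t = uaRep L V X a t := rfl

instance : IsScalarTower ℂ (Ua L V) (SymmetricAlgebra ℂ V ⊗[ℂ] X) where
  smul_assoc c a t := by rw [ua_smul_def, ua_smul_def, map_smul]; rfl

theorem uaGen_inl_smul (x : L) (t : SymmetricAlgebra ℂ V ⊗[ℂ] X) :
    uaGen L V (Sum.inl x) • t = ⁅x, t⁆ := by
  have : uaRep L V X (uaGen L V (Sum.inl x)) =
      semiRep L V X (LieAlgebra.SemiDirectSum.inr (actionDer L V) x) :=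
    UniversalEnvelopingAlgebra.lift_ι_apply ℂ _ _
  rw [ua_smul_def, this]
  change mulSym V X 0 t + ⁅x, t⁆ = _
  have := mulSym_smul (X := X) 0 (0 : V) t
  rw [zero_smul, zero_smul] at this
  rw [this, zero_add]

theorem uaGen_inr_smul (v : V) (t : SymmetricAlgebra ℂ V ⊗[ℂ] X) :
    uaGen L V (Sum.inr v) • t = mulSym V X v t := by
  have : uaRep L V X (uaGen L V (Sum.inr v)) =
      semiRep L V X (LieAlgebra.SemiDirectSum.inl (actionDer L V) (show AbelianLie V from v)) :=
    UniversalEnvelopingAlgebra.lift_ι_apply ℂ _ _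
  rw [ua_smul_def, this]
  change mulSym V X v t + ⁅(0 : L), t⁆ = _
  rw [zero_lie, add_zero]

theorem semiLie_induction {A : Subalgebra ℂ (Ua L V)} (h : ∀ g, uaGen L V g ∈ A) (a : Ua L V) :
    a ∈ A := by
  refine uea_induction (fun x => ?_) a
  have : x = LieAlgebra.SemiDirectSum.inr (actionDer L V) x.right +
      LieAlgebra.SemiDirectSum.inl (actionDer L V) x.left := by
    ext <;> simp
  rw [this, map_add]
  exact add_mem (h (Sum.inl x.right)) (h (Sum.inr x.left))

section Module

variable {Y : Type*} [AddCommGroup Y] [Module ℂ Y] [Module (Ua L V) Y] [IsScalarTower ℂ (Ua L V) Y]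
variable {Z : Type*} [AddCommGroup Z] [Module ℂ Z] [Module (Ua L V) Z] [IsScalarTower ℂ (Ua L V) Z]

/-- A linear map which commutes with the generators is linear over `U(𝔤 ⋉ V)`. -/
def uaLinear (f : Y →ₗ[ℂ] Z) (hf : ∀ g y, f (uaGen L V g • y) = uaGen L V g • f y) :
    Y →ₗ[Ua L V] Z :=
  { f with
    map_smul' := fun a y => by
      let A : Subalgebra ℂ (Ua L V) :=
        { carrier := {a | ∀ y, f (a • y) = a • f y}
          mul_mem' := fun {a c} ha hc y => by rw [mul_smul, ha, hc, mul_smul]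
          add_mem' := fun {a c} ha hc y => by rw [add_smul, map_add, ha, hc, add_smul]
          algebraMap_mem' := fun r y => by
            rw [algebraMap_smul, map_smul, algebraMap_smul] }
      exact semiLie_induction (A := A) hf a y }

end Module

theorem uaGen_inr_commute (v w : V) :
    uaGen L V (Sum.inr v) * uaGen L V (Sum.inr w) = uaGen L V (Sum.inr w) * uaGen L V (Sum.inr v) := by
  rw [← sub_eq_zero, ← LieRing.of_associative_ring_bracket]
  change ⁅UniversalEnvelopingAlgebra.ι ℂ _, UniversalEnvelopingAlgebra.ι ℂ _⁆ = _
  rw [← LieHom.map_lie, ← LieHom.map_lie]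
  change UniversalEnvelopingAlgebra.ι ℂ (LieAlgebra.SemiDirectSum.inl (actionDer L V) 0) = 0
  rw [map_zero, map_zero]

theorem uaGen_inl_mul_inr (x : L) (w : V) :
    uaGen L V (Sum.inl x) * uaGen L V (Sum.inr w) =
      uaGen L V (Sum.inr ⁅x, w⁆) + uaGen L V (Sum.inr w) * uaGen L V (Sum.inl x) := by
  rw [← sub_eq_iff_eq_add, ← LieRing.of_associative_ring_bracket]
  change ⁅UniversalEnvelopingAlgebra.ι ℂ _, UniversalEnvelopingAlgebra.ι ℂ _⁆ = _
  rw [← LieHom.map_lie]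
  change _ = UniversalEnvelopingAlgebra.ι ℂ _
  congr 1
  ext
  · change (0 : V) + ⁅x, w⁆ - ⁅(0 : L), (0 : V)⁆ = ⁅x, w⁆
    rw [zero_add, lie_zero, sub_zero]
  · change ⁅x, (0 : L)⁆ = 0
    rw [lie_zero]

variable (L V) in
/-- The linear map `V → U(𝔤 ⋉ V)`. -/
def uaInr : V →ₗ[ℂ] Ua L V where
  toFun v := uaGen L V (Sum.inr v)
  map_add' v w := by
    change UniversalEnvelopingAlgebra.ι ℂ (LieAlgebra.SemiDirectSum.inl (actionDer L V)
      ((show AbelianLie V from v) + (show AbelianLie V from w))) = _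
    rw [map_add, map_add]; rfl
  map_smul' c v := by
    change UniversalEnvelopingAlgebra.ι ℂ (LieAlgebra.SemiDirectSum.inl (actionDer L V)
      (c • (show AbelianLie V from v))) = _
    rw [map_smul, map_smul]; rfl

open scoped IsMulCommutative in
-- The image of `f` generates a commutative subalgebra, to which the universal property of `Sym V`
-- applies although `A` need not be commutative.
theorem exists_symmetricAlgebra_lift {A : Type*} [Ring A] [Algebra ℂ A] (f : V →ₗ[ℂ] A)
    (hf : ∀ v w, f v * f w = f w * f v) :
    ∃ g : SymmetricAlgebra ℂ V →ₐ[ℂ] A, ∀ v, g (SymmetricAlgebra.ι ℂ V v) = f v := by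
  have := Algebra.isMulCommutative_adjoin ℂ (s := Set.range f)
    (by rintro _ ⟨v, rfl⟩ _ ⟨w, rfl⟩; exact hf v w)
  let f' : V →ₗ[ℂ] Algebra.adjoin ℂ (Set.range f) :=
    { toFun := fun v => ⟨f v, Algebra.subset_adjoin ⟨v, rfl⟩⟩
      map_add' := fun v w => Subtype.ext (map_add f v w)
      map_smul' := fun c v => Subtype.ext (map_smul f c v) }
  refine ⟨(Algebra.adjoin ℂ (Set.range f)).val.comp (SymmetricAlgebra.lift f'), fun v => ?_⟩
  rw [AlgHom.comp_apply, SymmetricAlgebra.lift_ι_apply]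
  rfl

variable (L V) in
/-- The algebra homomorphism `Sym V → U(𝔤 ⋉ V)`. -/
def symToUa : SymmetricAlgebra ℂ V →ₐ[ℂ] Ua L V :=
  (exists_symmetricAlgebra_lift (uaInr L V) uaGen_inr_commute).choose

theorem symToUa_ι (v : V) : symToUa L V (SymmetricAlgebra.ι ℂ V v) = uaGen L V (Sum.inr v) :=
  (exists_symmetricAlgebra_lift (uaInr L V) uaGen_inr_commute).choose_spec v

theorem uaGen_inl_mul_symToUa (x : L) (s : SymmetricAlgebra ℂ V) :
    uaGen L V (Sum.inl x) * symToUa L V s =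
      symToUa L V ⁅x, s⁆ + symToUa L V s * uaGen L V (Sum.inl x) := by
  induction s using sym_left_induction with
  | one => rw [lie_sym_one, map_zero, map_one, one_mul, mul_one, zero_add]
  | smul c s h => rw [lie_smul, map_smul, map_smul, mul_smul_comm, h, smul_add, smul_mul_assoc]
  | add s t hs ht => rw [lie_add, map_add, map_add, mul_add, hs, ht, add_mul]; abel
  | mul v s h =>
    rw [lie_sym_ι_mul, map_mul, map_add, map_mul, map_mul, symToUa_ι, symToUa_ι, ← mul_assoc,
      uaGen_inl_mul_inr, add_mul, mul_assoc, h, mul_add, mul_assoc, add_assoc]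

theorem symToUa_smul_one_tmul (s : SymmetricAlgebra ℂ V) (m : X) :
    symToUa L V s • ((1 : SymmetricAlgebra ℂ V) ⊗ₜ[ℂ] m) = s ⊗ₜ[ℂ] m := by
  induction s using sym_left_induction with
  | one => rw [map_one, one_smul]
  | smul c s h => rw [map_smul, smul_assoc, h, TensorProduct.smul_tmul']
  | add s t hs ht => rw [map_add, add_smul, hs, ht, TensorProduct.add_tmul]
  | mul v s h => rw [map_mul, mul_smul, h, symToUa_ι, uaGen_inr_smul, mulSym_tmul]

/-! ### Universal properties of `Sym V ⊗ X` and of the induced module -/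

section Lift

variable {Y : Type*} [AddCommGroup Y] [Module ℂ Y] [Module (Ua L V) Y] [IsScalarTower ℂ (Ua L V) Y]

theorem free_ext {f g : SymmetricAlgebra ℂ V ⊗[ℂ] X →ₗ[Ua L V] Y}
    (h : ∀ m : X, f (1 ⊗ₜ m) = g (1 ⊗ₜ m)) : f = g := by
  refine LinearMap.ext fun t => ?_
  induction t using TensorProduct.induction_on with
  | zero => rw [map_zero, map_zero]
  | tmul s m => rw [← symToUa_smul_one_tmul (L := L) s m, map_smul, map_smul, h]
  | add s t hs ht => rw [map_add, map_add, hs, ht]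

/-- The extension of a `𝔤`-equivariant map `X → Y` to `Sym V ⊗ X`. -/
def freeLift (g : X →ₗ[ℂ] Y) (hg : ∀ (x : L) m, g ⁅x, m⁆ = uaGen L V (Sum.inl x) • g m) :
    SymmetricAlgebra ℂ V ⊗[ℂ] X →ₗ[Ua L V] Y :=
  uaLinear (TensorProduct.lift (LinearMap.mk₂ ℂ (fun s m => symToUa L V s • g m)
      (fun s t m => by rw [map_add, add_smul])
      (fun c s m => by rw [map_smul, smul_assoc])
      (fun s m n => by rw [map_add, smul_add])
      (fun c s m => by
        rw [map_smul, ← algebraMap_smul (Ua L V) c (g m), ← mul_smul, ← Algebra.commutes, mul_smul,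
          algebraMap_smul])))
    (fun a t => by
      induction t using TensorProduct.induction_on with
      | zero => rw [smul_zero, map_zero, smul_zero]
      | add s t hs ht => rw [smul_add, map_add, map_add, smul_add, hs, ht]
      | tmul s m =>
        rcases a with x | v
        · rw [uaGen_inl_smul, TensorProduct.LieModule.lie_tmul_right, map_add,
            TensorProduct.lift.tmul, TensorProduct.lift.tmul, TensorProduct.lift.tmul,
            LinearMap.mk₂_apply, LinearMap.mk₂_apply, LinearMap.mk₂_apply, hg, ← mul_smul,
            ← add_smul, ← uaGen_inl_mul_symToUa, mul_smul]
        · rw [uaGen_inr_smul, mulSym_tmul, TensorProduct.lift.tmul, TensorProduct.lift.tmul,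
            LinearMap.mk₂_apply, LinearMap.mk₂_apply, map_mul, symToUa_ι, mul_smul])

theorem freeLift_one_tmul (g : X →ₗ[ℂ] Y)
    (hg : ∀ (x : L) m, g ⁅x, m⁆ = uaGen L V (Sum.inl x) • g m) (m : X) :
    freeLift g hg (1 ⊗ₜ m) = g m := by
  change symToUa L V 1 • g m = g m
  rw [map_one, one_smul]

theorem ind_ext {f g : Ind L V X →ₗ[Ua L V] Y}
    (h : ∀ m : X, f (Submodule.Quotient.mk (1 ⊗ₜ m)) = g (Submodule.Quotient.mk (1 ⊗ₜ m))) :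
    f = g := by
  refine Submodule.linearMap_qext _ (LinearMap.ext fun t => ?_)
  induction t using TensorProduct.induction_on with
  | zero => rw [map_zero, map_zero]
  | add s t hs ht => rw [map_add, map_add, hs, ht]
  | tmul a m =>
    have : a ⊗ₜ[ℂ] m = a • ((1 : Ua L V) ⊗ₜ[ℂ] m) := by
      rw [TensorProduct.smul_tmul', smul_eq_mul, mul_one]
    rw [this, map_smul, map_smul]
    exact congrArg (a • ·) (h m)

/-- The extension of a `𝔤`-equivariant map `X → Y` to the induced module. -/
def indLift (g : X →ₗ[ℂ] Y) (hg : ∀ (x : L) m, g ⁅x, m⁆ = uaGen L V (Sum.inl x) • g m) :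
    Ind L V X →ₗ[Ua L V] Y :=
  (indRel L V X).liftQ
    (TensorProduct.AlgebraTensorModule.lift
      ((LinearMap.toSpanSingleton (Ua L V) (X →ₗ[ℂ] Y) g)))
    (by
      rw [indRel, Submodule.span_le]
      rintro _ ⟨a, x, m, rfl⟩
      rw [SetLike.mem_coe, LinearMap.mem_ker, map_sub, sub_eq_zero]
      change (a * uaGen L V (Sum.inl x)) • g m = a • g ⁅x, m⁆
      rw [hg, mul_smul])

theorem indLift_mk (g : X →ₗ[ℂ] Y) (hg : ∀ (x : L) m, g ⁅x, m⁆ = uaGen L V (Sum.inl x) • g m)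
    (a : Ua L V) (m : X) : indLift g hg (Submodule.Quotient.mk (a ⊗ₜ m)) = a • g m := rfl

end Lift

variable (L V X) in
/-- The map `X → U(𝔤 ⋉ V) ⊗_{U(𝔤)} X`. -/
def indGen : X →ₗ[ℂ] Ind L V X where
  toFun m := Submodule.Quotient.mk (1 ⊗ₜ m)
  map_add' m n := by rw [TensorProduct.tmul_add, Submodule.Quotient.mk_add]
  map_smul' c m := by rw [TensorProduct.tmul_smul, Submodule.Quotient.mk_smul]; rfl

theorem indGen_apply (m : X) : indGen L V X m = Submodule.Quotient.mk (1 ⊗ₜ m) := rfl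

theorem indGen_lie (x : L) (m : X) :
    indGen L V X ⁅x, m⁆ = uaGen L V (Sum.inl x) • indGen L V X m := by
  rw [indGen_apply, indGen_apply, ← Submodule.Quotient.mk_smul, TensorProduct.smul_tmul', smul_eq_mul, mul_one, eq_comm,
    ← sub_eq_zero, ← Submodule.Quotient.mk_sub, Submodule.Quotient.mk_eq_zero]
  refine Submodule.subset_span ⟨1, x, m, ?_⟩
  rw [one_mul]

theorem one_tmul_lie (x : L) (m : X) : TensorProduct.mk ℂ (SymmetricAlgebra ℂ V) X 1 ⁅x, m⁆ =
    uaGen L V (Sum.inl x) • TensorProduct.mk ℂ (SymmetricAlgebra ℂ V) X 1 m := by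
  rw [uaGen_inl_smul, TensorProduct.mk_apply, TensorProduct.mk_apply,
    TensorProduct.LieModule.lie_tmul_right, lie_sym_one, TensorProduct.zero_tmul, zero_add]

variable (L V X) in
/-- The induced module of `X` is isomorphic to `Sym V ⊗ X`. -/
def indEquiv : Ind L V X ≃ₗ[Ua L V] SymmetricAlgebra ℂ V ⊗[ℂ] X :=
  -- Both modules represent equivariant maps out of `X`, so the two canonical maps are inverse to
  -- each other as soon as they are on `1 ⊗ X`. The Poincaré–Birkhoff–Witt theorem is not used.
  LinearEquiv.ofLinearMap
    (indLift (TensorProduct.mk ℂ (SymmetricAlgebra ℂ V) X 1) one_tmul_lie)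
    (freeLift (indGen L V X) indGen_lie)
    (free_ext fun m => by
      rw [LinearMap.comp_apply, freeLift_one_tmul, indGen_apply, indLift_mk, one_smul]; rfl)
    (ind_ext fun m => by
      rw [LinearMap.comp_apply, indLift_mk, one_smul, TensorProduct.mk_apply, freeLift_one_tmul]
      rfl)

theorem indEquiv_mk (a : Ua L V) (m : X) :
    indEquiv L V X (Submodule.Quotient.mk (a ⊗ₜ m)) = a • (1 ⊗ₜ m) := rfl

theorem indEquiv_symm_tmul (s : SymmetricAlgebra ℂ V) (m : X) :
    (indEquiv L V X).symm (s ⊗ₜ m) = Submodule.Quotient.mk (symToUa L V s ⊗ₜ m) := by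
  rw [LinearEquiv.symm_apply_eq, indEquiv_mk, symToUa_smul_one_tmul]

end Free

end FaceKoszul

end

noncomputable section

namespace FaceKoszul

universe u v w

set_option linter.unusedSectionVars false

/-! ### The grading of `Sym V ⊗ X` -/

section Grading

open Module

variable {L : Type u} [LieRing L] [LieAlgebra ℂ L]
variable {V : Type v} [AddCommGroup V] [Module ℂ V] [LieRingModule L V] [LieModule ℂ L V]
variable {X : Type*} [AddCommGroup X] [Module ℂ X] [LieRingModule L X] [LieModule ℂ L X]
variable {Y : Type*} [AddCommGroup Y] [Module ℂ Y] [LieRingModule L Y] [LieModule ℂ L Y]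

instance : SMul (Ua L V) (SymmetricAlgebra ℂ V ⊗[ℂ] X) := freeModule.toSMul

theorem lie_mem_symPow (x : L) {n : ℕ} {s : SymmetricAlgebra ℂ V} (hs : s ∈ symPow V n) :
    ⁅x, s⁆ ∈ symPow V n := by
  have hι : IsDerAction L (SymmetricAlgebra.ι ℂ V) :=
    ⟨fun x v => symDer_ι x v, fun x a c => by
      change symDer x (a * c) = symDer x a * c + a * symDer x c
      rw [Derivation.leibniz, smul_eq_mul, smul_eq_mul, mul_comm c, add_comm]⟩
  exact hι.lie_mem_pow n x hs

theorem one_mem_symPow : (1 : SymmetricAlgebra ℂ V) ∈ symPow V 0 := by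
  rw [symPow, pow_zero]
  exact Submodule.mem_one.2 ⟨1, map_one _⟩

theorem ι_mul_mem_symPow {n : ℕ} (v : V) {s : SymmetricAlgebra ℂ V} (hs : s ∈ symPow V n) :
    SymmetricAlgebra.ι ℂ V v * s ∈ symPow V (n + 1) := by
  rw [symPow, pow_succ']
  exact Submodule.mul_mem_mul ⟨v, rfl⟩ hs

theorem symPow_induction {p : ℕ → SymmetricAlgebra ℂ V → Prop} (one : p 0 1)
    (smul : ∀ n (c : ℂ) s, p n s → p n (c • s)) (add : ∀ n s t, p n s → p n t → p n (s + t))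
    (mul : ∀ n v s, p n s → p (n + 1) (SymmetricAlgebra.ι ℂ V v * s)) {n : ℕ}
    {s : SymmetricAlgebra ℂ V} (hs : s ∈ symPow V n) : p n s := by
  induction n generalizing s with
  | zero =>
    rw [symPow, pow_zero] at hs
    obtain ⟨c, rfl⟩ := Submodule.mem_one.1 hs
    rw [Algebra.algebraMap_eq_smul_one]
    exact smul _ _ _ one
  | succ n ih =>
    rw [symPow, pow_succ'] at hs
    induction hs using Submodule.mul_induction_on' with
    | mem_mul_mem a ha s hs =>
      obtain ⟨v, rfl⟩ := ha
      exact mul _ _ _ (ih hs)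
    | add a _ c _ ha hc => exact add _ _ _ ha hc

variable (V X) in
/-- The component of degree `k` of `Sym V ⊗ X`. -/
def freeGrade (k : ℤ) : Submodule ℂ (SymmetricAlgebra ℂ V ⊗[ℂ] X) :=
  Submodule.span ℂ {t | ∃ n : ℕ, (n : ℤ) = k ∧ ∃ s ∈ symPow V n, ∃ m : X, t = s ⊗ₜ m}

theorem tmul_mem_freeGrade {n : ℕ} {s : SymmetricAlgebra ℂ V} (hs : s ∈ symPow V n) (m : X) :
    s ⊗ₜ m ∈ freeGrade V X n :=
  Submodule.subset_span ⟨n, rfl, s, hs, m, rfl⟩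

theorem one_tmul_mem_freeGrade (m : X) :
    (1 : SymmetricAlgebra ℂ V) ⊗ₜ m ∈ freeGrade V X 0 :=
  tmul_mem_freeGrade one_mem_symPow m

theorem freeGrade_eq_bot {k : ℤ} (hk : k < 0) : freeGrade V X k = ⊥ := by
  rw [freeGrade, Submodule.span_eq_bot]
  rintro _ ⟨n, h, -⟩
  omega

theorem freeGrade_le_comap {Z : Type*} [AddCommGroup Z] [Module ℂ Z]
    (f : SymmetricAlgebra ℂ V ⊗[ℂ] X →ₗ[ℂ] Z) {k : ℤ} {N : Submodule ℂ Z}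
    (h : ∀ n : ℕ, (n : ℤ) = k → ∀ s ∈ symPow V n, ∀ m, f (s ⊗ₜ m) ∈ N)
    {t : SymmetricAlgebra ℂ V ⊗[ℂ] X} (ht : t ∈ freeGrade V X k) : f t ∈ N := by
  have : freeGrade V X k ≤ N.comap f := by
    rw [freeGrade, Submodule.span_le]
    rintro _ ⟨n, hn, s, hs, m, rfl⟩
    exact h n hn s hs m
  exact this ht

theorem lie_mem_freeGrade (x : L) {k : ℤ} {t : SymmetricAlgebra ℂ V ⊗[ℂ] X}
    (ht : t ∈ freeGrade V X k) : ⁅x, t⁆ ∈ freeGrade V X k := by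
  refine freeGrade_le_comap (LieModule.toEnd ℂ L (SymmetricAlgebra ℂ V ⊗[ℂ] X) x)
    (fun n hn s hs m => ?_) ht
  subst hn
  rw [LieModule.toEnd_apply_apply, TensorProduct.LieModule.lie_tmul_right]
  exact add_mem (tmul_mem_freeGrade (lie_mem_symPow x hs) m) (tmul_mem_freeGrade hs _)

theorem mulSym_mem_freeGrade (v : V) {k : ℤ} {t : SymmetricAlgebra ℂ V ⊗[ℂ] X}
    (ht : t ∈ freeGrade V X k) : mulSym V X v t ∈ freeGrade V X (k + 1) := by
  refine freeGrade_le_comap (mulSym V X v) (fun n hn s hs m => ?_) ht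
  subst hn
  exact_mod_cast tmul_mem_freeGrade (ι_mul_mem_symPow v hs) m

variable (L V X) in
/-- The component of degree `k` of `Sym V ⊗ X` as a `𝔤`-module. -/
def freeGradeLie (k : ℤ) : LieSubmodule ℂ L (SymmetricAlgebra ℂ V ⊗[ℂ] X) :=
  { freeGrade V X k with lie_mem := fun ht => lie_mem_freeGrade _ ht }

theorem ua_smul_mem_freeGrade {n : ℕ} {a : Ua L V} (ha : a ∈ uaGrade L V n) {k : ℤ}
    {t : SymmetricAlgebra ℂ V ⊗[ℂ] X} (ht : t ∈ freeGrade V X k) :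
    a • t ∈ freeGrade V X (n + k) := by
  induction ha using Submodule.span_induction with
  | zero => rw [zero_smul]; exact zero_mem _
  | add a c _ _ ha hc => rw [add_smul]; exact add_mem ha hc
  | smul r a _ ha => rw [smul_assoc]; exact Submodule.smul_mem _ _ ha
  | mem a ha =>
    obtain ⟨l, rfl, rfl⟩ := ha
    induction l with
    | nil => simpa using ht
    | cons g l ih =>
      have h1 : (List.map (uaGen L V) (g :: l)).prod =
        uaGen L V g * (List.map (uaGen L V) l).prod := List.prod_cons
      rw [h1, mul_smul, List.map_cons, List.sum_cons]
      rcases g with x | v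
      · rw [uaGen_inl_smul]
        have := lie_mem_freeGrade x ih
        simpa [genDeg] using this
      · rw [uaGen_inr_smul]
        have := mulSym_mem_freeGrade v ih
        have e : ((genDeg L V (Sum.inr v) + (l.map (genDeg L V)).sum : ℕ) : ℤ) + k =
            ((l.map (genDeg L V)).sum : ℤ) + k + 1 := by
          simp [genDeg]; ring
        rw [e]
        exact this

theorem uaGrade_mul {n k : ℕ} {a c : Ua L V} (ha : a ∈ uaGrade L V n) (hc : c ∈ uaGrade L V k) :
    a * c ∈ uaGrade L V (n + k) := by
  have : uaGrade L V n * uaGrade L V k ≤ uaGrade L V (n + k) := by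
    rw [uaGrade, uaGrade, Submodule.span_mul_span, Submodule.span_le]
    rintro _ ⟨_, ⟨l, hl, rfl⟩, _, ⟨l', hl', rfl⟩, rfl⟩
    refine Submodule.subset_span ⟨l ++ l', ?_, ?_⟩
    · rw [List.map_append, List.sum_append, hl, hl']
    · rw [List.map_append, List.prod_append]
  exact this (Submodule.mul_mem_mul ha hc)

theorem symToUa_mem_uaGrade {n : ℕ} {s : SymmetricAlgebra ℂ V} (hs : s ∈ symPow V n) :
    symToUa L V s ∈ uaGrade L V n := by
  refine symPow_induction (p := fun n s => symToUa L V s ∈ uaGrade L V n) ?_ ?_ ?_ ?_ hs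
  · exact Submodule.subset_span ⟨[], rfl, by simp⟩
  · intro n c s h
    rw [map_smul]; exact Submodule.smul_mem _ _ h
  · intro n s t h h'
    rw [map_add]; exact add_mem h h'
  · intro n v s h
    rw [map_mul, symToUa_ι, add_comm n]
    exact uaGrade_mul (Submodule.subset_span ⟨[Sum.inr v], rfl, by simp⟩) h

/-- In one direction, elements of `U(𝔤 ⋉ V)[n]` raise the symmetric degree by `n`; in the other,
`Sym^n V` maps into `U(𝔤 ⋉ V)[n]`. -/
theorem mem_indGrade_iff {r k : ℤ} {p : Ind L V X} :
    p ∈ indGrade L V X r k ↔ indEquiv L V X p ∈ freeGrade V X (k - r) := by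
  constructor
  · intro h
    induction h using Submodule.span_induction with
    | zero => rw [map_zero]; exact zero_mem _
    | add a c _ _ ha hc => rw [map_add]; exact add_mem ha hc
    | smul c a _ ha =>
      rw [← algebraMap_smul (Ua L V) c a, map_smul, algebraMap_smul]
      exact Submodule.smul_mem _ _ ha
    | mem p hp =>
      obtain ⟨n, a, m, h1, h2, rfl⟩ := hp
      rw [indEquiv_mk]
      have := ua_smul_mem_freeGrade h2 (one_tmul_mem_freeGrade (V := V) m)
      rwa [add_zero, eq_sub_of_add_eq h1] at this
  · intro h
    rw [← (indEquiv L V X).symm_apply_apply p]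
    refine freeGrade_le_comap (N := indGrade L V X r k)
      ((indEquiv L V X).symm.toLinearMap.restrictScalars ℂ) (fun n hn s hs m => ?_) h
    change (indEquiv L V X).symm (s ⊗ₜ m) ∈ _
    rw [indEquiv_symm_tmul]
    exact Submodule.subset_span ⟨n, _, m, by omega, symToUa_mem_uaGrade hs, rfl⟩

variable (V) in
/-- The algebra endomorphism of `Sym V` multiplying `V` by `2`. -/
def doubling : SymmetricAlgebra ℂ V →ₐ[ℂ] SymmetricAlgebra ℂ V :=
  SymmetricAlgebra.lift ((2 : ℂ) • SymmetricAlgebra.ι ℂ V)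

theorem doubling_of_mem {n : ℕ} {s : SymmetricAlgebra ℂ V} (hs : s ∈ symPow V n) :
    doubling V s = (2 : ℂ) ^ n • s := by
  refine symPow_induction (p := fun n s => doubling V s = (2 : ℂ) ^ n • s) ?_ ?_ ?_ ?_ hs
  · rw [map_one, pow_zero, one_smul]
  · intro n c s h
    rw [map_smul, h, smul_comm]
  · intro n s t h h'
    rw [map_add, h, h', smul_add]
  · intro n v s h
    rw [map_mul, h, doubling, SymmetricAlgebra.lift_ι_apply, LinearMap.smul_apply, pow_succ',
      smul_mul_smul_comm]

theorem doubling_freeGrade {k : ℤ} {t : SymmetricAlgebra ℂ V ⊗[ℂ] X} (ht : t ∈ freeGrade V X k) :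
    LinearMap.rTensor X (doubling V).toLinearMap t = (2 : ℂ) ^ k • t := by
  induction ht using Submodule.span_induction with
  | zero => rw [map_zero, smul_zero]
  | add a c _ _ ha hc => rw [map_add, ha, hc, smul_add]
  | smul c a _ ha => rw [map_smul, ha, smul_comm]
  | mem t ht =>
    obtain ⟨n, rfl, s, hs, m, rfl⟩ := ht
    rw [LinearMap.rTensor_tmul, AlgHom.toLinearMap_apply, doubling_of_mem hs, zpow_natCast,
      TensorProduct.smul_tmul']

theorem eq_zero_of_smul_eq_smul {M : Type*} [AddCommGroup M] [Module ℂ M] {c d : ℂ} (h : c ≠ d)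
    {m : M} (hm : c • m = d • m) : m = 0 := by
  rw [← sub_eq_zero, ← sub_smul] at hm
  exact (smul_eq_zero.1 hm).resolve_left (sub_ne_zero.2 h)

/-- Doubling `V` acts on the piece of degree `k` by the scalar `2^k`, and these scalars are
distinct. -/
theorem eq_zero_of_mem_freeGrade {k l : ℤ} (hkl : k ≠ l) {t : SymmetricAlgebra ℂ V ⊗[ℂ] X}
    (hk : t ∈ freeGrade V X k) (hl : t ∈ freeGrade V X l) : t = 0 := by
  have h1 := (doubling_freeGrade hk).symm.trans (doubling_freeGrade hl)
  refine eq_zero_of_smul_eq_smul (fun h => hkl ?_) h1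
  have h2 : (((2 : ℝ) ^ k : ℝ) : ℂ) = ((2 : ℝ) ^ l : ℝ) := by push_cast; exact h
  exact zpow_right_injective₀ (by norm_num) (by norm_num) (Complex.ofReal_injective h2)

/-- The linear map `Sym V ⊗ X → Sym V ⊗ Y` induced by an equivariant map `X → Y`. -/
def freeMap (f : X →ₗ⁅ℂ, L⁆ Y) :
    SymmetricAlgebra ℂ V ⊗[ℂ] X →ₗ[Ua L V] SymmetricAlgebra ℂ V ⊗[ℂ] Y :=
  uaLinear (LinearMap.lTensor _ (f : X →ₗ[ℂ] Y)) (fun g t => by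
    induction t using TensorProduct.induction_on with
    | zero => rw [smul_zero, map_zero, smul_zero]
    | add s t hs ht => rw [smul_add, map_add, map_add, smul_add, hs, ht]
    | tmul s m =>
      rcases g with x | v
      · rw [uaGen_inl_smul, uaGen_inl_smul, LinearMap.lTensor_tmul,
          TensorProduct.LieModule.lie_tmul_right, TensorProduct.LieModule.lie_tmul_right, map_add,
          LinearMap.lTensor_tmul, LinearMap.lTensor_tmul]
        congr 2
        exact f.map_lie x m
      · rw [uaGen_inr_smul, uaGen_inr_smul]; rfl)

theorem freeMap_tmul (f : X →ₗ⁅ℂ, L⁆ Y) (s : SymmetricAlgebra ℂ V) (m : X) :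
    freeMap f (s ⊗ₜ[ℂ] m) = s ⊗ₜ[ℂ] f m := rfl

theorem freeMap_mem_freeGrade (f : X →ₗ⁅ℂ, L⁆ Y) {k : ℤ} {t : SymmetricAlgebra ℂ V ⊗[ℂ] X}
    (ht : t ∈ freeGrade V X k) : freeMap f t ∈ freeGrade V Y k := by
  refine freeGrade_le_comap ((freeMap f).restrictScalars ℂ) (fun n hn s hs m => ?_) ht
  subst hn
  exact tmul_mem_freeGrade hs _

theorem freeMap_injective (f : X →ₗ⁅ℂ, L⁆ Y) (hf : Function.Injective f) :
    Function.Injective (freeMap (V := V) f) :=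
  Module.Flat.lTensor_preserves_injective_linearMap (f : X →ₗ[ℂ] Y) hf

theorem linearMap_lie_of_ua {Z : Type*} [AddCommGroup Z] [Module ℂ Z] [LieRingModule L Z]
    [LieModule ℂ L Z]
    (h : SymmetricAlgebra ℂ V ⊗[ℂ] X →ₗ[Ua L V] SymmetricAlgebra ℂ V ⊗[ℂ] Z) (x : L)
    (t : SymmetricAlgebra ℂ V ⊗[ℂ] X) : h ⁅x, t⁆ = ⁅x, h t⁆ := by
  rw [← uaGen_inl_smul, map_smul, uaGen_inl_smul]

/-- A homogeneous homomorphism between free modules respects the gradings. -/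
theorem map_mem_freeGrade (h : SymmetricAlgebra ℂ V ⊗[ℂ] X →ₗ[Ua L V] SymmetricAlgebra ℂ V ⊗[ℂ] Y)
    {d : ℤ} (hd : ∀ m, h (1 ⊗ₜ m) ∈ freeGrade V Y d) {k : ℤ} {t : SymmetricAlgebra ℂ V ⊗[ℂ] X}
    (ht : t ∈ freeGrade V X k) : h t ∈ freeGrade V Y (k + d) := by
  refine freeGrade_le_comap (h.restrictScalars ℂ) (fun n hn s hs m => ?_) ht
  subst hn
  change h (s ⊗ₜ m) ∈ _
  rw [← symToUa_smul_one_tmul (L := L), map_smul]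
  exact ua_smul_mem_freeGrade (symToUa_mem_uaGrade hs) (hd m)

variable (L V) in
/-- The inclusion of `Sym^n V ⊗ X` into `Sym V ⊗ X`. -/
def compIncl [FiniteDimensional ℂ V] (n : ℕ) (X : Type*) [AddCommGroup X] [Module ℂ X]
    [LieRingModule L X] [LieModule ℂ L X] :
    (isDerAction_sym L V).comp n ⊗[ℂ] X →ₗ⁅ℂ, L⁆ SymmetricAlgebra ℂ V ⊗[ℂ] X :=
  { LinearMap.rTensor X ((isDerAction_sym L V).comp n).toSubmodule.subtype with
    map_lie' := fun {x t} => by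
      change LinearMap.rTensor X _ ⁅x, t⁆ = ⁅x, LinearMap.rTensor X _ t⁆
      refine lie_map_of_tmul (fun x s m => ?_) x t
      rw [map_add, LinearMap.rTensor_tmul, LinearMap.rTensor_tmul, LinearMap.rTensor_tmul,
        TensorProduct.LieModule.lie_tmul_right]
      rfl }

theorem compIncl_injective [FiniteDimensional ℂ V] (n : ℕ) :
    Function.Injective (compIncl L V n X) :=
  Module.Flat.rTensor_preserves_injective_linearMap
    ((isDerAction_sym L V).comp n).toSubmodule.subtype Subtype.val_injective

theorem exists_compIncl_eq [FiniteDimensional ℂ V] {n : ℕ} {t : SymmetricAlgebra ℂ V ⊗[ℂ] X}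
    (ht : t ∈ freeGrade V X n) : ∃ t', compIncl L V n X t' = t := by
  refine freeGrade_le_comap (N := LinearMap.range (compIncl L V n X).toLinearMap) LinearMap.id
    (fun k hk s hs m => ?_) ht
  obtain rfl : k = n := by exact_mod_cast hk
  exact ⟨(⟨s, hs⟩ : (isDerAction_sym L V).comp k) ⊗ₜ m, rfl⟩

/-- Finite-dimensionality of the graded pieces is what makes Weyl's theorem applicable inside `Sym V
⊗ X`. -/
instance [FiniteDimensional ℂ V] [FiniteDimensional ℂ X] (k : ℤ) :
    FiniteDimensional ℂ (freeGradeLie L V X k) := by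
  rcases lt_or_ge k 0 with hk | hk
  · have h1 : (freeGradeLie L V X k).toSubmodule = ⊥ := freeGrade_eq_bot hk
    have h2 : FiniteDimensional ℂ (freeGradeLie L V X k).toSubmodule := by
      rw [h1]; infer_instance
    exact h2
  · obtain ⟨n, rfl⟩ := Int.eq_ofNat_of_zero_le hk
    have := (isDerAction_sym L V).finiteDimensional_comp n
    have h1 : (freeGradeLie L V X n).toSubmodule ≤
        LinearMap.range (compIncl L V n X).toLinearMap := fun t ht => exists_compIncl_eq ht
    exact Submodule.finiteDimensional_of_le h1

end Grading

/-! ### Highest weight vectors from graded homomorphisms -/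

section Highest

variable {L : Type u} [LieRing L] [LieAlgebra ℂ L] [FiniteDimensional ℂ L]
  [LieAlgebra.IsSemisimple ℂ L]
variable {H : LieSubalgebra ℂ L} [H.IsCartanSubalgebra]
variable {b : (LieAlgebra.IsKilling.rootSystem H).Base}
variable {V : Type v} [AddCommGroup V] [Module ℂ V] [LieRingModule L V] [LieModule ℂ L V]
  [FiniteDimensional ℂ V]
variable {X : Type*} [AddCommGroup X] [Module ℂ X] [LieRingModule L X] [LieModule ℂ L X]

/-- A nonzero homomorphism from `V(ν)` to `Sym^n V ⊗ X` gives a highest weight vector. -/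
theorem exists_isHighest_of_hom {ν : Dominant b} {n : ℕ}
    (f : Simple b ν →ₗ⁅ℂ, L⁆ SymmetricAlgebra ℂ V ⊗[ℂ] X) (hf : ∀ m, f m ∈ freeGrade V X n)
    {m : Simple b ν} (hm : f m ≠ 0) :
    ∃ t : (isDerAction_sym L V).comp n ⊗[ℂ] X, t ≠ 0 ∧ IsHighest b t ν.1 := by
  rcases Simple.subsingleton_or ν with h | ⟨hirr, w, hw0, hw⟩
  · exact absurd (by rw [Subsingleton.elim m 0, map_zero]) hm
  have hker : f.ker = ⊥ := by
    refine (eq_bot_or_eq_top f.ker).resolve_right fun h => hm ?_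
    exact LieModuleHom.mem_ker.1 (h ▸ LieSubmodule.mem_top (R := ℂ) (L := L) m)
  obtain ⟨t, ht⟩ := exists_compIncl_eq (L := L) (hf w)
  have hfw : f w ≠ 0 := fun h => hw0 (by
    have : w ∈ f.ker := LieModuleHom.mem_ker.2 h
    rwa [hker, LieSubmodule.mem_bot] at this)
  have hh := hw.map f
  refine ⟨t, fun h => hfw (by rw [← ht, h, map_zero]), fun i hi x hx => ?_, fun h => ?_⟩
  · apply compIncl_injective (L := L) (V := V) n
    rw [LieModuleHom.map_lie, ht, map_zero, hh.1 i hi x hx]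
  · apply compIncl_injective (L := L) (V := V) n
    rw [LieModuleHom.map_lie, ht, map_smul, ht, hh.2 h]

end Highest

/-! ### The Koszul differential -/

section KoszulOperators

open Module

variable {V : Type v} [AddCommGroup V] [Module ℂ V] [FiniteDimensional ℂ V]

variable (V) in
/-- The partial derivatives on `Sym V` with respect to a basis of `V`. -/
def symPartial (i : Fin (finrank ℂ V)) : SymmetricAlgebra ℂ V →ₗ[ℂ] SymmetricAlgebra ℂ V :=
  (SymmetricAlgebra.equivMvPolynomial (finBasis ℂ V)).symm.toLinearMap ∘ₗ
    (MvPolynomial.pderiv (R := ℂ) i).toLinearMap ∘ₗ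
      (SymmetricAlgebra.equivMvPolynomial (finBasis ℂ V)).toLinearMap

theorem symPartial_apply (i : Fin (finrank ℂ V)) (s : SymmetricAlgebra ℂ V) : symPartial V i s =
    (SymmetricAlgebra.equivMvPolynomial (finBasis ℂ V)).symm
      (MvPolynomial.pderiv i (SymmetricAlgebra.equivMvPolynomial (finBasis ℂ V) s)) := rfl

theorem symPartial_one (i : Fin (finrank ℂ V)) : symPartial V i 1 = 0 := by
  rw [symPartial_apply, map_one, Derivation.map_one_eq_zero, map_zero]

theorem pderiv_equivMvPolynomial_ι (i : Fin (finrank ℂ V)) (v : V) :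
    MvPolynomial.pderiv i (SymmetricAlgebra.equivMvPolynomial (finBasis ℂ V)
      (SymmetricAlgebra.ι ℂ V v)) = MvPolynomial.C ((finBasis ℂ V).coord i v) := by
  have h : (MvPolynomial.pderiv (R := ℂ) i).toLinearMap ∘ₗ
      (SymmetricAlgebra.equivMvPolynomial (finBasis ℂ V)).toLinearMap ∘ₗ SymmetricAlgebra.ι ℂ V =
      (Algebra.linearMap ℂ _) ∘ₗ (finBasis ℂ V).coord i := by
    refine (finBasis ℂ V).ext fun k => ?_
    simp [SymmetricAlgebra.equivMvPolynomial_ι_apply, MvPolynomial.pderiv_X, Pi.single_apply,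
      Finsupp.single_apply, eq_comm]
  exact LinearMap.congr_fun h v

theorem symPartial_ι_mul (i : Fin (finrank ℂ V)) (v : V) (s : SymmetricAlgebra ℂ V) :
    symPartial V i (SymmetricAlgebra.ι ℂ V v * s) =
      (finBasis ℂ V).coord i v • s + SymmetricAlgebra.ι ℂ V v * symPartial V i s := by
  rw [symPartial_apply, map_mul, Derivation.leibniz, pderiv_equivMvPolynomial_ι, map_add,
    smul_eq_mul, smul_eq_mul, map_mul, map_mul, AlgEquiv.symm_apply_apply,
    AlgEquiv.symm_apply_apply, add_comm, mul_comm s, ← symPartial_apply, Algebra.smul_def]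
  congr 2
  exact AlgEquiv.commutes _ _

theorem sum_coord_smul_ι (v : V) : ∑ i, (finBasis ℂ V).coord i v •
    SymmetricAlgebra.ι ℂ V (finBasis ℂ V i) = SymmetricAlgebra.ι ℂ V v := by
  conv_rhs => rw [← (finBasis ℂ V).sum_repr v]
  rw [map_sum]
  exact Finset.sum_congr rfl fun i _ => (map_smul _ _ _).symm

/-- Euler's identity for homogeneous polynomials. -/
theorem sum_ι_mul_symPartial {n : ℕ} {s : SymmetricAlgebra ℂ V} (hs : s ∈ symPow V n) :
    ∑ i, SymmetricAlgebra.ι ℂ V (finBasis ℂ V i) * symPartial V i s = (n : ℂ) • s := by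
  refine symPow_induction (p := fun n s => ∑ i, SymmetricAlgebra.ι ℂ V (finBasis ℂ V i) *
    symPartial V i s = (n : ℂ) • s) ?_ ?_ ?_ ?_ hs
  · simp [symPartial_one]
  · intro n c s h
    simp only [map_smul, mul_smul_comm, ← Finset.smul_sum, h]
    rw [smul_comm]
  · intro n s t h h'
    simp only [map_add, mul_add, Finset.sum_add_distrib, h, h', smul_add]
  · intro n v s h
    simp only [symPartial_ι_mul, mul_add, Finset.sum_add_distrib, mul_smul_comm,
      mul_left_comm _ (SymmetricAlgebra.ι ℂ V v), ← Finset.mul_sum, h]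
    simp only [← smul_mul_assoc, ← Finset.sum_mul, sum_coord_smul_ι]
    rw [Nat.cast_add, Nat.cast_one, add_smul, one_smul, add_comm, add_mul, smul_mul_assoc]

theorem symPartial_mem (i : Fin (finrank ℂ V)) {n : ℕ} {s : SymmetricAlgebra ℂ V}
    (hs : s ∈ symPow V n) :
    symPartial V i s = 0 ∨ ∃ k : ℕ, n = k + 1 ∧ symPartial V i s ∈ symPow V k := by
  have : s ∈ symPow V n ∧ ((n = 0 ∧ symPartial V i s = 0) ∨
      ∃ k : ℕ, n = k + 1 ∧ symPartial V i s ∈ symPow V k) := by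
    refine symPow_induction (p := fun n s => s ∈ symPow V n ∧ ((n = 0 ∧ symPartial V i s = 0) ∨
      ∃ k : ℕ, n = k + 1 ∧ symPartial V i s ∈ symPow V k)) ?_ ?_ ?_ ?_ hs
    · exact ⟨one_mem_symPow, Or.inl ⟨rfl, symPartial_one i⟩⟩
    · rintro n c s ⟨hs, ⟨h, h'⟩ | ⟨k, h, h'⟩⟩
      · exact ⟨Submodule.smul_mem _ _ hs, Or.inl ⟨h, by rw [map_smul, h', smul_zero]⟩⟩
      · exact ⟨Submodule.smul_mem _ _ hs,
          Or.inr ⟨k, h, by rw [map_smul]; exact Submodule.smul_mem _ _ h'⟩⟩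
    · rintro n s t ⟨hs, ⟨h, h'⟩ | ⟨k, h, h'⟩⟩ ⟨ht, ⟨l, l'⟩ | ⟨m, l, l'⟩⟩
      · exact ⟨add_mem hs ht, Or.inl ⟨h, by rw [map_add, h', l', add_zero]⟩⟩
      · omega
      · omega
      · obtain rfl : k = m := by omega
        exact ⟨add_mem hs ht, Or.inr ⟨k, h, by rw [map_add]; exact add_mem h' l'⟩⟩
    · rintro n v s ⟨hs, h⟩
      refine ⟨ι_mul_mem_symPow v hs, Or.inr ⟨n, rfl, ?_⟩⟩
      rw [symPartial_ι_mul]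
      refine add_mem (Submodule.smul_mem _ _ hs) ?_
      rcases h with ⟨-, h'⟩ | ⟨k, rfl, h'⟩
      · rw [h', mul_zero]; exact zero_mem _
      · exact ι_mul_mem_symPow v h'
  rcases this.2 with h | h
  exacts [Or.inl h.2, Or.inr h]

variable {N : Type*} [AddCommGroup N] [Module ℂ N]

/-- The operator `∑ e_i ⊗ C_i` on `Sym V ⊗ N`. -/
def koszulD (C : Fin (finrank ℂ V) → N →ₗ[ℂ] N) :
    SymmetricAlgebra ℂ V ⊗[ℂ] N →ₗ[ℂ] SymmetricAlgebra ℂ V ⊗[ℂ] N :=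
  ∑ i, TensorProduct.map (LinearMap.mulLeft ℂ (SymmetricAlgebra.ι ℂ V (finBasis ℂ V i))) (C i)

/-- The operator `∑ ∂_i ⊗ U_i` on `Sym V ⊗ N`. -/
def koszulH (U : Fin (finrank ℂ V) → N →ₗ[ℂ] N) :
    SymmetricAlgebra ℂ V ⊗[ℂ] N →ₗ[ℂ] SymmetricAlgebra ℂ V ⊗[ℂ] N :=
  ∑ i, TensorProduct.map (symPartial V i) (U i)

variable {C U : Fin (finrank ℂ V) → N →ₗ[ℂ] N}

theorem koszulD_tmul (s : SymmetricAlgebra ℂ V) (n : N) : koszulD C (s ⊗ₜ n) =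
    ∑ i, (SymmetricAlgebra.ι ℂ V (finBasis ℂ V i) * s) ⊗ₜ C i n := by
  simp [koszulD]

theorem koszulH_tmul (s : SymmetricAlgebra ℂ V) (n : N) : koszulH U (s ⊗ₜ n) =
    ∑ i, symPartial V i s ⊗ₜ U i n := by
  simp [koszulH]

/-- The multiplications commute and the `C i` anticommute, so the double sum equals its own
negative. -/
theorem koszulD_koszulD (hC : ∀ i j n, C i (C j n) = -C j (C i n))
    (t : SymmetricAlgebra ℂ V ⊗[ℂ] N) : koszulD C (koszulD C t) = 0 := by
  induction t using TensorProduct.induction_on with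
  | zero => rw [map_zero, map_zero]
  | add s t hs ht => rw [map_add, map_add, hs, ht, add_zero]
  | tmul s n =>
    have h : koszulD C (koszulD C (s ⊗ₜ n)) = -koszulD C (koszulD C (s ⊗ₜ n)) := by
      conv_lhs => rw [koszulD_tmul, map_sum]
      conv_rhs => rw [koszulD_tmul, map_sum]
      simp only [koszulD_tmul]
      conv_rhs => rw [Finset.sum_comm, ← Finset.sum_neg_distrib]
      refine Finset.sum_congr rfl fun i _ => ?_
      rw [← Finset.sum_neg_distrib]
      refine Finset.sum_congr rfl fun j _ => ?_
      rw [hC j i, TensorProduct.tmul_neg, mul_left_comm]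
    refine eq_zero_of_smul_eq_smul (c := 1) (d := -1) (by norm_num) ?_
    rw [one_smul, neg_one_smul]
    exact h

/-- Differentiating the new factor `e_i` leaves `∑ s ⊗ U_i C_i n`, which contributes `j`. In the
remaining terms the anticommutators of the `C_i` and `U_l` leave only `∑ e_i ∂_i s ⊗ n`, which
contributes `k` by Euler's identity. -/
theorem koszul_homotopy (hCU : ∀ i j n, C i (U j n) + U j (C i n) = if i = j then n else 0)
    {k j : ℕ} {s : SymmetricAlgebra ℂ V} (hs : s ∈ symPow V k) {n : N}
    (hn : ∑ i, U i (C i n) = (j : ℂ) • n) :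
    koszulD C (koszulH U (s ⊗ₜ n)) + koszulH U (koszulD C (s ⊗ₜ n)) =
      ((k + j : ℕ) : ℂ) • (s ⊗ₜ[ℂ] n) := by
  rw [koszulH_tmul, koszulD_tmul, map_sum, map_sum]
  simp only [koszulD_tmul, koszulH_tmul, symPartial_ι_mul, TensorProduct.add_tmul,
    Finset.sum_add_distrib]
  have h1 : ∑ i, ∑ l, ((finBasis ℂ V).coord l (finBasis ℂ V i) • s) ⊗ₜ[ℂ] U l (C i n) =
      (j : ℂ) • s ⊗ₜ[ℂ] n := by
    rw [← TensorProduct.tmul_smul, ← hn, TensorProduct.tmul_sum]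
    refine Finset.sum_congr rfl fun i _ => ?_
    rw [Finset.sum_eq_single i]
    · simp
    · intro l _ hl
      simp [hl.symm]
    · simp
  have h2 : (∑ l, ∑ i, (SymmetricAlgebra.ι ℂ V (finBasis ℂ V i) * symPartial V l s) ⊗ₜ[ℂ]
      C i (U l n)) + ∑ i, ∑ l, (SymmetricAlgebra.ι ℂ V (finBasis ℂ V i) * symPartial V l s) ⊗ₜ[ℂ]
      U l (C i n) = (k : ℂ) • s ⊗ₜ[ℂ] n := by
    rw [TensorProduct.smul_tmul', ← sum_ι_mul_symPartial hs, TensorProduct.sum_tmul,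
      Finset.sum_comm, ← Finset.sum_add_distrib]
    refine Finset.sum_congr rfl fun i _ => ?_
    rw [← Finset.sum_add_distrib]
    simp only [← TensorProduct.tmul_add, hCU]
    rw [Finset.sum_eq_single i]
    · simp
    · intro l _ hl
      simp [hl.symm]
    · simp
  rw [h1, add_left_comm, h2, ← add_smul, Nat.cast_add, add_comm (k : ℂ)]

end KoszulOperators

/-! ### Contraction and multiplication on the exterior algebra -/

section Koszul

open Module

variable {L : Type u} [LieRing L] [LieAlgebra ℂ L]
variable {V : Type v} [AddCommGroup V] [Module ℂ V] [LieRingModule L V] [LieModule ℂ L V]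
  [FiniteDimensional ℂ V]
variable {X : Type w} [AddCommGroup X] [Module ℂ X] [LieRingModule L X] [LieModule ℂ L X]

variable (V) in
/-- Contraction with a basis vector. -/
def extC (i : Fin (finrank ℂ V)) : ExteriorAlgebra ℂ V →ₗ[ℂ] ExteriorAlgebra ℂ V :=
  CliffordAlgebra.contractLeft ((finBasis ℂ V).coord i)

variable (V) in
/-- Multiplication by a basis vector. -/
def extU (i : Fin (finrank ℂ V)) : ExteriorAlgebra ℂ V →ₗ[ℂ] ExteriorAlgebra ℂ V :=
  LinearMap.mulLeft ℂ (ExteriorAlgebra.ι ℂ (finBasis ℂ V i))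

theorem extC_ι_mul (i : Fin (finrank ℂ V)) (v : V) (ω : ExteriorAlgebra ℂ V) :
    extC V i (ExteriorAlgebra.ι ℂ v * ω) =
      (finBasis ℂ V).coord i v • ω - ExteriorAlgebra.ι ℂ v * extC V i ω :=
  ext_contractLeft_ι_mul _ v ω

theorem extC_extC (i j : Fin (finrank ℂ V)) (ω : ExteriorAlgebra ℂ V) :
    extC V i (extC V j ω) = -extC V j (extC V i ω) := ext_contractLeft_comm _ _ ω

theorem extC_extU (i j : Fin (finrank ℂ V)) (ω : ExteriorAlgebra ℂ V) :
    extC V i (extU V j ω) + extU V j (extC V i ω) = if i = j then ω else 0 := by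
  change extC V i (ExteriorAlgebra.ι ℂ (finBasis ℂ V j) * ω) +
    ExteriorAlgebra.ι ℂ (finBasis ℂ V j) * extC V i ω = _
  rw [extC_ι_mul, sub_add_cancel, Basis.coord_apply, Basis.repr_self, Finsupp.single_apply]
  by_cases h : i = j
  · rw [if_pos h, if_pos h.symm, one_smul]
  · rw [if_neg h, if_neg (Ne.symm h), zero_smul]

theorem extC_algebraMap (i : Fin (finrank ℂ V)) (r : ℂ) :
    extC V i (algebraMap ℂ (ExteriorAlgebra ℂ V) r) = 0 :=
  CliffordAlgebra.contractLeft_algebraMap _ _ r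

theorem extC_of_mem_comp_zero (i : Fin (finrank ℂ V)) {ω : ExteriorAlgebra ℂ V}
    (hω : ω ∈ (isDerAction_ext L V).comp 0) : extC V i ω = 0 := by
  rw [IsDerAction.mem_comp, pow_zero] at hω
  obtain ⟨r, rfl⟩ := Submodule.mem_one.1 hω
  exact extC_algebraMap i r

theorem extC_mem_comp (i : Fin (finrank ℂ V)) {j : ℕ} {ω : ExteriorAlgebra ℂ V}
    (hω : ω ∈ (isDerAction_ext L V).comp (j + 1)) :
    extC V i ω ∈ (isDerAction_ext L V).comp j := by
  induction j generalizing ω with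
  | zero =>
    rw [IsDerAction.mem_comp, pow_succ'] at hω
    induction hω using Submodule.mul_induction_on' with
    | mem_mul_mem a ha ω hω =>
      obtain ⟨v, rfl⟩ := ha
      rw [extC_ι_mul, extC_of_mem_comp_zero (L := L) i hω, mul_zero, sub_zero]
      exact Submodule.smul_mem _ _ hω
    | add a _ c _ ha hc => rw [map_add]; exact add_mem ha hc
  | succ j ih =>
    rw [IsDerAction.mem_comp, pow_succ'] at hω
    induction hω using Submodule.mul_induction_on' with
    | mem_mul_mem a ha ω hω =>
      obtain ⟨v, rfl⟩ := ha
      rw [extC_ι_mul]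
      refine sub_mem (Submodule.smul_mem _ _ hω) ?_
      have := ih hω
      rw [IsDerAction.mem_comp] at this ⊢
      rw [pow_succ']
      exact Submodule.mul_mem_mul ⟨v, rfl⟩ this
    | add a _ c _ ha hc => rw [map_add]; exact add_mem ha hc

theorem extU_mem_comp (i : Fin (finrank ℂ V)) {j : ℕ} {ω : ExteriorAlgebra ℂ V}
    (hω : ω ∈ (isDerAction_ext L V).comp j) :
    extU V i ω ∈ (isDerAction_ext L V).comp (j + 1) := by
  rw [IsDerAction.mem_comp] at hω ⊢
  rw [pow_succ']
  exact Submodule.mul_mem_mul ⟨_, rfl⟩ hω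

/-- The exterior analogue of Euler's identity, by the antiderivation rule for contraction. -/
theorem sum_extU_extC {j : ℕ} {ω : ExteriorAlgebra ℂ V}
    (hω : ω ∈ (isDerAction_ext L V).comp j) : ∑ i, extU V i (extC V i ω) = (j : ℂ) • ω := by
  induction j generalizing ω with
  | zero =>
    rw [Nat.cast_zero, zero_smul]
    refine Finset.sum_eq_zero fun i _ => ?_
    rw [extC_of_mem_comp_zero (L := L) i hω, map_zero]
  | succ j ih =>
    rw [IsDerAction.mem_comp, pow_succ'] at hω
    induction hω using Submodule.mul_induction_on' with
    | mem_mul_mem a ha ω hω =>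
      obtain ⟨v, rfl⟩ := ha
      have h1 : ∀ i, extU V i (extC V i (ExteriorAlgebra.ι ℂ v * ω)) =
          (finBasis ℂ V).coord i v • ExteriorAlgebra.ι ℂ (finBasis ℂ V i) * ω +
            ExteriorAlgebra.ι ℂ v * extU V i (extC V i ω) := fun i => by
        change ExteriorAlgebra.ι ℂ (finBasis ℂ V i) * extC V i (ExteriorAlgebra.ι ℂ v * ω) =
          _ + _ * (ExteriorAlgebra.ι ℂ (finBasis ℂ V i) * extC V i ω)
        rw [extC_ι_mul, mul_sub, ← mul_assoc, ext_ι_mul_ι _ v, neg_mul, sub_neg_eq_add, mul_assoc,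
          mul_smul_comm, smul_mul_assoc]
      have h2 : ∑ i, (finBasis ℂ V).coord i v • ExteriorAlgebra.ι ℂ (finBasis ℂ V i) =
          ExteriorAlgebra.ι ℂ v := by
        conv_rhs => rw [← (finBasis ℂ V).sum_repr v]
        rw [map_sum]
        exact Finset.sum_congr rfl fun i _ => (map_smul _ _ _).symm
      rw [Finset.sum_congr rfl fun i _ => h1 i, Finset.sum_add_distrib, ← Finset.sum_mul, h2,
        ← Finset.mul_sum, ih hω, mul_smul_comm, Nat.cast_add, Nat.cast_one, add_smul, one_smul,
        add_comm]
    | add a _ c _ ha hc => simp only [map_add, Finset.sum_add_distrib, ha, hc, smul_add]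

theorem lie_extC (x : L) (i : Fin (finrank ℂ V)) (ω : ExteriorAlgebra ℂ V) :
    extC V i ⁅x, ω⁆ = ⁅x, extC V i ω⁆ +
      ∑ k, (finBasis ℂ V).coord i ⁅x, finBasis ℂ V k⁆ • extC V k ω := by
  have h1 : (finBasis ℂ V).coord i ∘ₗ LieModule.toEnd ℂ L V x =
      ∑ k, (finBasis ℂ V).coord i ⁅x, finBasis ℂ V k⁆ • (finBasis ℂ V).coord k := by
    refine (finBasis ℂ V).ext fun j => ?_
    simp [Finsupp.single_apply]
  have h2 := contractLeft_extDer x ((finBasis ℂ V).coord i) ω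
  rw [h1, map_sum, LinearMap.sum_apply, add_comm] at h2
  refine h2.trans ?_
  congr 1
  exact Finset.sum_congr rfl fun k _ => by rw [map_smul]; rfl

end Koszul

/-! ### The Koszul complex with coefficients in a `𝔤`-module -/

section KoszulComplex

open Module

variable {L : Type u} [LieRing L] [LieAlgebra ℂ L]
variable {V : Type v} [AddCommGroup V] [Module ℂ V] [LieRingModule L V] [LieModule ℂ L V]
  [FiniteDimensional ℂ V]
variable {X : Type w} [AddCommGroup X] [Module ℂ X] [LieRingModule L X] [LieModule ℂ L X]

variable (V X) in
/-- Contraction with a basis vector on `Λ V ⊗ X`. -/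
def extCX (i : Fin (finrank ℂ V)) : ExteriorAlgebra ℂ V ⊗[ℂ] X →ₗ[ℂ] ExteriorAlgebra ℂ V ⊗[ℂ] X :=
  LinearMap.rTensor X (extC V i)

variable (V X) in
/-- Multiplication by a basis vector on `Λ V ⊗ X`. -/
def extUX (i : Fin (finrank ℂ V)) : ExteriorAlgebra ℂ V ⊗[ℂ] X →ₗ[ℂ] ExteriorAlgebra ℂ V ⊗[ℂ] X :=
  LinearMap.rTensor X (extU V i)

theorem extCX_tmul (i : Fin (finrank ℂ V)) (ω : ExteriorAlgebra ℂ V) (m : X) :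
    extCX V X i (ω ⊗ₜ m) = extC V i ω ⊗ₜ m := rfl

theorem extUX_tmul (i : Fin (finrank ℂ V)) (ω : ExteriorAlgebra ℂ V) (m : X) :
    extUX V X i (ω ⊗ₜ m) = extU V i ω ⊗ₜ m := rfl

theorem extCX_extCX (i j : Fin (finrank ℂ V)) (n : ExteriorAlgebra ℂ V ⊗[ℂ] X) :
    extCX V X i (extCX V X j n) = -extCX V X j (extCX V X i n) := by
  induction n using TensorProduct.induction_on with
  | zero => simp only [map_zero, neg_zero]
  | add a c ha hc => simp only [map_add, ha, hc, neg_add]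
  | tmul ω m => rw [extCX_tmul, extCX_tmul, extCX_tmul, extCX_tmul, extC_extC,
      TensorProduct.neg_tmul]

theorem extCX_extUX (i j : Fin (finrank ℂ V)) (n : ExteriorAlgebra ℂ V ⊗[ℂ] X) :
    extCX V X i (extUX V X j n) + extUX V X j (extCX V X i n) = if i = j then n else 0 := by
  induction n using TensorProduct.induction_on with
  | zero => simp only [map_zero, add_zero, ite_self]
  | add a c ha hc =>
    have : (if i = j then a + c else 0) = (if i = j then a else 0) + if i = j then c else 0 := by
      split_ifs <;> simp
    rw [this, ← ha, ← hc]
    simp only [map_add]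
    abel
  | tmul ω m =>
    rw [extCX_tmul, extUX_tmul, extCX_tmul, extUX_tmul, ← TensorProduct.add_tmul, extC_extU]
    split_ifs
    · rfl
    · rw [TensorProduct.zero_tmul]

theorem lie_extCX (x : L) (i : Fin (finrank ℂ V)) (n : ExteriorAlgebra ℂ V ⊗[ℂ] X) :
    extCX V X i ⁅x, n⁆ = ⁅x, extCX V X i n⁆ +
      ∑ k, (finBasis ℂ V).coord i ⁅x, finBasis ℂ V k⁆ • extCX V X k n := by
  induction n using TensorProduct.induction_on with
  | zero => simp only [lie_zero, map_zero, smul_zero, Finset.sum_const_zero, add_zero]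
  | add a c ha hc =>
    simp only [lie_add, map_add, ha, hc, smul_add, Finset.sum_add_distrib]
    abel
  | tmul ω m =>
    rw [TensorProduct.LieModule.lie_tmul_right, map_add, extCX_tmul, extCX_tmul, extCX_tmul,
      lie_extC, TensorProduct.add_tmul, TensorProduct.LieModule.lie_tmul_right,
      TensorProduct.sum_tmul]
    simp only [extCX_tmul, TensorProduct.smul_tmul']
    abel

/-- The operator is built from the invariant element `∑ e_i ⊗ e_i^*`: the variation of the `e_i^*`
under `x`, summed over the basis, becomes the variation of the `e_i`. -/
theorem koszulD_lie (x : L) (t : SymmetricAlgebra ℂ V ⊗[ℂ] (ExteriorAlgebra ℂ V ⊗[ℂ] X)) :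
    koszulD (extCX V X) ⁅x, t⁆ = ⁅x, koszulD (extCX V X) t⁆ := by
  refine lie_map_of_tmul (fun x s n => ?_) x t
  rw [map_add, koszulD_tmul, koszulD_tmul, koszulD_tmul, lie_sum, ← Finset.sum_add_distrib]
  have h1 : ∀ i, (SymmetricAlgebra.ι ℂ V (finBasis ℂ V i) * s) ⊗ₜ[ℂ] extCX V X i ⁅x, n⁆ =
      (SymmetricAlgebra.ι ℂ V (finBasis ℂ V i) * s) ⊗ₜ[ℂ] ⁅x, extCX V X i n⁆ +
      ∑ k, ((finBasis ℂ V).coord i ⁅x, finBasis ℂ V k⁆ •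
        (SymmetricAlgebra.ι ℂ V (finBasis ℂ V i) * s)) ⊗ₜ[ℂ] extCX V X k n := fun i => by
    rw [lie_extCX, TensorProduct.tmul_add, TensorProduct.tmul_sum]
    simp only [TensorProduct.smul_tmul]
  simp only [h1, TensorProduct.LieModule.lie_tmul_right, lie_sym_ι_mul, TensorProduct.add_tmul,
    Finset.sum_add_distrib]
  have h2 : ∑ i, ∑ k, ((finBasis ℂ V).coord i ⁅x, finBasis ℂ V k⁆ •
        (SymmetricAlgebra.ι ℂ V (finBasis ℂ V i) * s)) ⊗ₜ[ℂ] extCX V X k n =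
      ∑ k, (SymmetricAlgebra.ι ℂ V ⁅x, finBasis ℂ V k⁆ * s) ⊗ₜ[ℂ] extCX V X k n := by
    rw [Finset.sum_comm]
    refine Finset.sum_congr rfl fun k _ => ?_
    rw [← TensorProduct.sum_tmul, ← sum_coord_smul_ι ⁅x, _⁆, Finset.sum_mul]
    simp only [smul_mul_assoc]
  rw [h2]
  abel

variable (L V X) in
/-- The Koszul differential on `Sym V ⊗ Λ V ⊗ X`. -/
def koszulFull : SymmetricAlgebra ℂ V ⊗[ℂ] (ExteriorAlgebra ℂ V ⊗[ℂ] X) →ₗ[Ua L V]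
    SymmetricAlgebra ℂ V ⊗[ℂ] (ExteriorAlgebra ℂ V ⊗[ℂ] X) :=
  uaLinear (koszulD (extCX V X)) (fun g t => by
    rcases g with x | v
    · rw [uaGen_inl_smul, uaGen_inl_smul, koszulD_lie]
    · rw [uaGen_inr_smul, uaGen_inr_smul]
      induction t using TensorProduct.induction_on with
      | zero => simp only [map_zero]
      | add a c ha hc => simp only [map_add, ha, hc]
      | tmul s n => simp only [mulSym_tmul, koszulD_tmul, map_sum, mul_left_comm])

variable (L V X) in
/-- `Λ^j V ⊗ X`. -/
def ExtTensor (j : ℕ) : Type (max v w) := (isDerAction_ext L V).comp j ⊗[ℂ] X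

instance (j : ℕ) : AddCommGroup (ExtTensor L V X j) :=
  inferInstanceAs (AddCommGroup ((isDerAction_ext L V).comp j ⊗[ℂ] X))
instance (j : ℕ) : Module ℂ (ExtTensor L V X j) :=
  inferInstanceAs (Module ℂ ((isDerAction_ext L V).comp j ⊗[ℂ] X))
instance (j : ℕ) : LieRingModule L (ExtTensor L V X j) :=
  inferInstanceAs (LieRingModule L ((isDerAction_ext L V).comp j ⊗[ℂ] X))
instance (j : ℕ) : LieModule ℂ L (ExtTensor L V X j) :=
  inferInstanceAs (LieModule ℂ L ((isDerAction_ext L V).comp j ⊗[ℂ] X))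
instance (j : ℕ) [FiniteDimensional ℂ X] : FiniteDimensional ℂ (ExtTensor L V X j) :=
  have := (isDerAction_ext L V).finiteDimensional_comp j
  inferInstanceAs (FiniteDimensional ℂ ((isDerAction_ext L V).comp j ⊗[ℂ] X))

/-- The element `ω ⊗ m` of `Λ^j V ⊗ X`. -/
def ExtTensor.tmul {j : ℕ} (ω : (isDerAction_ext L V).comp j) (m : X) : ExtTensor L V X j :=
  ω ⊗ₜ[ℂ] m

theorem ExtTensor.induction {j : ℕ} {p : ExtTensor L V X j → Prop} (zero : p 0)
    (tmul : ∀ ω m, p (ExtTensor.tmul ω m)) (add : ∀ a c, p a → p c → p (a + c))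
    (n : ExtTensor L V X j) : p n :=
  TensorProduct.induction_on (motive := p) n zero tmul add

variable (L V X) in
/-- The inclusion of `Λ^j V ⊗ X` into `Λ V ⊗ X`. -/
def extIncl (j : ℕ) : ExtTensor L V X j →ₗ⁅ℂ, L⁆ ExteriorAlgebra ℂ V ⊗[ℂ] X :=
  { LinearMap.rTensor X ((isDerAction_ext L V).comp j).toSubmodule.subtype with
    map_lie' := fun {x t} => by
      change LinearMap.rTensor X _ ⁅x, t⁆ = ⁅x, LinearMap.rTensor X _ t⁆
      refine lie_map_of_tmul (fun x s m => ?_) x t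
      rw [map_add, LinearMap.rTensor_tmul, LinearMap.rTensor_tmul, LinearMap.rTensor_tmul,
        TensorProduct.LieModule.lie_tmul_right]
      rfl }

theorem extIncl_tmul (j : ℕ) (ω : (isDerAction_ext L V).comp j) (m : X) :
    extIncl L V X j (ExtTensor.tmul ω m) = (ω : ExteriorAlgebra ℂ V) ⊗ₜ m := rfl

theorem extIncl_injective (j : ℕ) : Function.Injective (extIncl L V X j) :=
  Module.Flat.rTensor_preserves_injective_linearMap
    ((isDerAction_ext L V).comp j).toSubmodule.subtype Subtype.val_injective

variable (L V X) in
/-- Contraction with a basis vector, from `Λ^{j+1} V ⊗ X` to `Λ^j V ⊗ X`. -/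
def extCComp (i : Fin (finrank ℂ V)) (j : ℕ) :
    ExtTensor L V X (j + 1) →ₗ[ℂ] ExtTensor L V X j :=
  LinearMap.rTensor X
    ({ toFun := fun ω => ⟨extC V i ω, extC_mem_comp i ω.2⟩
       map_add' := fun _ _ => Subtype.ext (map_add _ _ _)
       map_smul' := fun _ _ => Subtype.ext (map_smul _ _ _) } :
      (isDerAction_ext L V).comp (j + 1) →ₗ[ℂ] (isDerAction_ext L V).comp j)

variable (L V X) in
/-- Multiplication by a basis vector, from `Λ^j V ⊗ X` to `Λ^{j+1} V ⊗ X`. -/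
def extUComp (i : Fin (finrank ℂ V)) (j : ℕ) :
    ExtTensor L V X j →ₗ[ℂ] ExtTensor L V X (j + 1) :=
  LinearMap.rTensor X
    ({ toFun := fun ω => ⟨extU V i ω, extU_mem_comp i ω.2⟩
       map_add' := fun _ _ => Subtype.ext (map_add _ _ _)
       map_smul' := fun _ _ => Subtype.ext (map_smul _ _ _) } :
      (isDerAction_ext L V).comp j →ₗ[ℂ] (isDerAction_ext L V).comp (j + 1))

theorem extIncl_extCComp (i : Fin (finrank ℂ V)) (j : ℕ) (n : ExtTensor L V X (j + 1)) :
    extIncl L V X j (extCComp L V X i j n) = extCX V X i (extIncl L V X (j + 1) n) := by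
  induction n using ExtTensor.induction with
  | zero => simp only [map_zero]
  | add a c ha hc => simp only [map_add, ha, hc]
  | tmul ω m => rfl

theorem extIncl_extUComp (i : Fin (finrank ℂ V)) (j : ℕ) (n : ExtTensor L V X j) :
    extIncl L V X (j + 1) (extUComp L V X i j n) = extUX V X i (extIncl L V X j n) := by
  induction n using ExtTensor.induction with
  | zero => simp only [map_zero]
  | add a c ha hc => simp only [map_add, ha, hc]
  | tmul ω m => rfl

theorem sum_extUX_extCX {j : ℕ} (n : ExtTensor L V X j) :
    ∑ i, extUX V X i (extCX V X i (extIncl L V X j n)) = (j : ℂ) • extIncl L V X j n := by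
  induction n using ExtTensor.induction with
  | zero => simp only [map_zero, smul_zero, Finset.sum_const_zero]
  | add a c ha hc => simp only [map_add, Finset.sum_add_distrib, ha, hc, smul_add]
  | tmul ω m =>
    simp only [extIncl_tmul, extCX_tmul, extUX_tmul]
    rw [← TensorProduct.sum_tmul, sum_extU_extC ω.2, TensorProduct.smul_tmul']

variable (L V X) in
/-- The Koszul differential on generators. -/
def koszulGen (j : ℕ) :
    ExtTensor L V X (j + 1) →ₗ[ℂ] SymmetricAlgebra ℂ V ⊗[ℂ] ExtTensor L V X j :=
  ∑ i, TensorProduct.mk ℂ _ _ (SymmetricAlgebra.ι ℂ V (finBasis ℂ V i)) ∘ₗ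
    extCComp L V X i j

/-- Through this, properties of the differential between fixed exterior degrees are verified after
the injection into the whole exterior algebra, where the differential has a closed formula. -/
theorem freeMap_koszulGen (j : ℕ) (n : ExtTensor L V X (j + 1)) :
    freeMap (extIncl L V X j) (koszulGen L V X j n) =
      koszulFull L V X (1 ⊗ₜ extIncl L V X (j + 1) n) := by
  have h1 : koszulFull L V X (1 ⊗ₜ extIncl L V X (j + 1) n) =
    koszulD (extCX V X) (1 ⊗ₜ extIncl L V X (j + 1) n) := rfl
  have h2 : koszulGen L V X j n = ∑ i, SymmetricAlgebra.ι ℂ V (finBasis ℂ V i) ⊗ₜ[ℂ]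
      extCComp L V X i j n := by
    rw [koszulGen, LinearMap.sum_apply]; rfl
  rw [h1, koszulD_tmul, h2, map_sum]
  refine Finset.sum_congr rfl fun i _ => ?_
  rw [freeMap_tmul, extIncl_extCComp, mul_one]

theorem koszulGen_lie (j : ℕ) (x : L) (n : ExtTensor L V X (j + 1)) :
    koszulGen L V X j ⁅x, n⁆ = uaGen L V (Sum.inl x) • koszulGen L V X j n := by
  refine freeMap_injective (extIncl L V X j) (extIncl_injective j) ?_
  have h1 : (1 : SymmetricAlgebra ℂ V) ⊗ₜ[ℂ] ⁅x, extIncl L V X (j + 1) n⁆ =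
    ⁅x, (1 : SymmetricAlgebra ℂ V) ⊗ₜ[ℂ] extIncl L V X (j + 1) n⁆ := by
    rw [TensorProduct.LieModule.lie_tmul_right, lie_sym_one, TensorProduct.zero_tmul, zero_add]
  rw [map_smul, freeMap_koszulGen, freeMap_koszulGen, LieModuleHom.map_lie, h1, ← uaGen_inl_smul,
    map_smul]

variable (L V X) in
/-- The Koszul differential `Sym V ⊗ Λ^{j+1} V ⊗ X → Sym V ⊗ Λ^j V ⊗ X`. -/
def koszulMap (j : ℕ) : SymmetricAlgebra ℂ V ⊗[ℂ] ExtTensor L V X (j + 1) →ₗ[Ua L V]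
    SymmetricAlgebra ℂ V ⊗[ℂ] ExtTensor L V X j :=
  freeLift (koszulGen L V X j) (koszulGen_lie j)

theorem freeMap_koszulMap (j : ℕ) (t : SymmetricAlgebra ℂ V ⊗[ℂ] ExtTensor L V X (j + 1)) :
    freeMap (extIncl L V X j) (koszulMap L V X j t) =
      koszulFull L V X (freeMap (extIncl L V X (j + 1)) t) := by
  have : (freeMap (V := V) (extIncl L V X j)).comp (koszulMap L V X j) =
      (koszulFull L V X).comp (freeMap (extIncl L V X (j + 1))) :=
    free_ext fun m => by
      rw [LinearMap.comp_apply, LinearMap.comp_apply, koszulMap, freeLift_one_tmul,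
        freeMap_koszulGen, freeMap_tmul]
  exact LinearMap.congr_fun this t

theorem koszulFull_koszulFull (t : SymmetricAlgebra ℂ V ⊗[ℂ] (ExteriorAlgebra ℂ V ⊗[ℂ] X)) :
    koszulFull L V X (koszulFull L V X t) = 0 := koszulD_koszulD extCX_extCX t

theorem koszulMap_koszulMap (j : ℕ) (t : SymmetricAlgebra ℂ V ⊗[ℂ] ExtTensor L V X (j + 2)) :
    koszulMap L V X j (koszulMap L V X (j + 1) t) = 0 := by
  refine freeMap_injective (extIncl L V X j) (extIncl_injective j) ?_
  rw [freeMap_koszulMap, freeMap_koszulMap, koszulFull_koszulFull, map_zero]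

theorem koszulGen_mem (j : ℕ) (n : ExtTensor L V X (j + 1)) :
    koszulGen L V X j n ∈ freeGrade V (ExtTensor L V X j) 1 := by
  rw [koszulGen, LinearMap.sum_apply]
  refine sum_mem fun i _ => ?_
  have h : SymmetricAlgebra.ι ℂ V (finBasis ℂ V i) ∈ symPow V 1 := by
    rw [symPow, pow_one]; exact ⟨_, rfl⟩
  exact tmul_mem_freeGrade h (extCComp L V X i j n)

theorem koszulMap_mem (j : ℕ) {k : ℤ} {t : SymmetricAlgebra ℂ V ⊗[ℂ] ExtTensor L V X (j + 1)}
    (ht : t ∈ freeGrade V _ k) : koszulMap L V X j t ∈ freeGrade V (ExtTensor L V X j) (k + 1) :=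
  map_mem_freeGrade _ (fun m => by
    rw [koszulMap, freeLift_one_tmul]; exact koszulGen_mem j m) ht

/-- The Koszul complex is exact in positive total degree. -/
theorem koszulMap_exact {j : ℕ} {n : ℤ} (hnj : n + j ≠ 0)
    {t : SymmetricAlgebra ℂ V ⊗[ℂ] ExtTensor L V X j} (ht : t ∈ freeGrade V _ n)
    (hd : koszulFull L V X (freeMap (extIncl L V X j) t) = 0) :
    ∃ t' ∈ freeGrade V (ExtTensor L V X (j + 1)) (n - 1), koszulMap L V X j t' = t := by
  have h1 : koszulD (extCX V X) (koszulH (extUX V X) (freeMap (extIncl L V X j) t)) +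
      koszulH (extUX V X) (koszulD (extCX V X) (freeMap (extIncl L V X j) t)) =
      ((n + j : ℤ) : ℂ) • freeMap (extIncl L V X j) t := by
    clear hd
    induction ht using Submodule.span_induction with
    | zero => simp only [map_zero, smul_zero, add_zero]
    | add a c _ _ ha hc =>
      simp only [map_add, smul_add, ← ha, ← hc]
      abel
    | smul r a _ ha =>
      have e : freeMap (V := V) (extIncl L V X j) (r • a) = r • freeMap (extIncl L V X j) a :=
        map_smul ((freeMap (V := V) (extIncl L V X j)).restrictScalars ℂ) r a
      rw [e, map_smul, map_smul, map_smul, map_smul, ← smul_add, ha, smul_comm]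
    | mem t ht =>
      obtain ⟨k, rfl, s, hs, m, rfl⟩ := ht
      rw [freeMap_tmul]
      exact_mod_cast koszul_homotopy extCX_extUX hs (sum_extUX_extCX m)
  -- The homotopy lowers the symmetric degree by one and raises the exterior degree by one, so its
  -- value comes from `Λ^{j+1} V ⊗ X`.
  have h2 : ∃ t' ∈ freeGrade V (ExtTensor L V X (j + 1)) (n - 1),
      freeMap (extIncl L V X (j + 1)) t' =
        koszulH (extUX V X) (freeMap (extIncl L V X j) t) := by
    clear hd h1
    induction ht using Submodule.span_induction with
    | zero => exact ⟨0, zero_mem _, by simp only [map_zero]⟩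
    | add a c _ _ ha hc =>
      obtain ⟨a', ha', ha⟩ := ha
      obtain ⟨c', hc', hc⟩ := hc
      exact ⟨a' + c', add_mem ha' hc', by simp only [map_add, ha, hc]⟩
    | smul r a _ ha =>
      obtain ⟨a', ha', ha⟩ := ha
      refine ⟨r • a', Submodule.smul_mem _ _ ha', ?_⟩
      have e : ∀ (j : ℕ) a, freeMap (V := V) (extIncl L V X j) (r • a) =
          r • freeMap (extIncl L V X j) a := fun j a =>
        map_smul ((freeMap (V := V) (extIncl L V X j)).restrictScalars ℂ) r a
      rw [e, e, ha, map_smul]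
    | mem t ht =>
      obtain ⟨k, rfl, s, hs, m, rfl⟩ := ht
      refine ⟨∑ i, symPartial V i s ⊗ₜ extUComp L V X i j m,
        sum_mem fun i _ => ?_, ?_⟩
      · rcases symPartial_mem i hs with h | ⟨l, rfl, h⟩
        · rw [h, TensorProduct.zero_tmul]; exact zero_mem _
        · have e : ((l + 1 : ℕ) : ℤ) - 1 = l := by push_cast; ring
          rw [e]
          exact tmul_mem_freeGrade h _
      · rw [freeMap_tmul, koszulH_tmul, map_sum]
        refine Finset.sum_congr rfl fun i _ => ?_
        rw [freeMap_tmul, extIncl_extUComp]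
  obtain ⟨t', ht', h2⟩ := h2
  have hc : ((n + j : ℤ) : ℂ) ≠ 0 := by exact_mod_cast hnj
  -- On a cycle the homotopy identity reads `d h t = (n + j) t`; division by the total degree gives
  -- the preimage.
  refine ⟨((n + j : ℤ) : ℂ)⁻¹ • t', Submodule.smul_mem _ _ ht', ?_⟩
  refine freeMap_injective (extIncl L V X j) (extIncl_injective j) ?_
  have hd' : koszulD (extCX V X) (freeMap (extIncl L V X j) t) = 0 := hd
  rw [hd', map_zero, add_zero] at h1
  have e1 : koszulMap L V X j (((n + j : ℤ) : ℂ)⁻¹ • t') =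
      ((n + j : ℤ) : ℂ)⁻¹ • koszulMap L V X j t' :=
    map_smul ((koszulMap L V X j).restrictScalars ℂ) _ _
  have e2 : ∀ (r : ℂ) a, freeMap (V := V) (extIncl L V X j) (r • a) =
      r • freeMap (extIncl L V X j) a := fun r a =>
    map_smul ((freeMap (V := V) (extIncl L V X j)).restrictScalars ℂ) r a
  have e3 : koszulFull L V X (freeMap (extIncl L V X (j + 1)) t') =
    koszulD (extCX V X) (freeMap (extIncl L V X (j + 1)) t') := rfl
  rw [e1, e2, freeMap_koszulMap, e3, h2, h1, inv_smul_smul₀ hc]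

/-- In exterior degree zero everything is a cycle. With cycles defined by the full differential,
`koszulMap_exact` covers `j = 0` and `j > 0` together. -/
theorem koszulFull_freeMap_zero (t : SymmetricAlgebra ℂ V ⊗[ℂ] ExtTensor L V X 0) :
    koszulFull L V X (freeMap (extIncl L V X 0) t) = 0 := by
  change koszulD (extCX V X) _ = 0
  induction t using TensorProduct.induction_on with
  | zero => simp only [map_zero]
  | add a c ha hc => simp only [map_add, ha, hc, add_zero]
  | tmul s n =>
    rw [freeMap_tmul, koszulD_tmul]
    refine Finset.sum_eq_zero fun i _ => ?_
    have : extCX V X i (extIncl L V X 0 n) = 0 := by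
      induction n using ExtTensor.induction with
      | zero => simp only [map_zero]
      | add a c ha hc => simp only [map_add, ha, hc, add_zero]
      | tmul ω m => rw [extIncl_tmul, extCX_tmul, extC_of_mem_comp_zero i ω.2,
          TensorProduct.zero_tmul]
    rw [this, TensorProduct.tmul_zero]

end KoszulComplex

/-! ### Coordinates on `P(Γ)` and `𝔅(Γ)` -/

section PGamma

variable {L : Type u} [LieRing L] [LieAlgebra ℂ L] [FiniteDimensional ℂ L]
  [LieAlgebra.IsSemisimple ℂ L]
variable {H : LieSubalgebra ℂ L} [H.IsCartanSubalgebra]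
variable {b : (LieAlgebra.IsKilling.rootSystem H).Base}
variable {V : Type v} [AddCommGroup V] [Module ℂ V] [LieRingModule L V] [LieModule ℂ L V]
variable {Γ : Finset (Lam b)}

variable (V) in
/-- The free module `Sym V ⊗ V(μ)`. -/
abbrev FreeSimple (μ : Dominant b) : Type (max u v) := SymmetricAlgebra ℂ V ⊗[ℂ] Simple b μ

variable (V) in
/-- The coordinate of an element of `P(Γ)` in `Sym V ⊗ V(λ)`. -/
def pCoord (x : Γ) : PGamma V Γ →ₗ[Ua L V] FreeSimple V x.1.1 :=
  (indEquiv L V (Simple b x.1.1)).toLinearMap ∘ₗ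
    (LinearMap.proj x : (∀ x : Γ, Ind L V (Simple b x.1.1)) →ₗ[Ua L V] _)

variable (V) in
/-- The inclusion of `Sym V ⊗ V(λ)` into `P(Γ)`. -/
def pIncl (x : Γ) : FreeSimple V x.1.1 →ₗ[Ua L V] PGamma V Γ :=
  PGamma.single V Γ x ∘ₗ (indEquiv L V (Simple b x.1.1)).symm.toLinearMap

theorem pCoord_single (x y : Γ) (p : Ind L V (Simple b x.1.1)) (h : y ≠ x) :
    pCoord V y (PGamma.single V Γ x p) = 0 := by
  classical
  have : PGamma.single V Γ x p y = 0 := by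
    unfold PGamma.single
    exact Pi.single_eq_of_ne h _
  change indEquiv L V _ (PGamma.single V Γ x p y) = 0
  rw [this, map_zero]

theorem pCoord_pIncl_of_ne {x y : Γ} (h : y ≠ x) (t : FreeSimple V x.1.1) :
    pCoord V y (pIncl V x t) = 0 := pCoord_single x y _ h

theorem pCoord_pIncl_self (x : Γ) (t : FreeSimple V x.1.1) :
    pCoord V x (pIncl V x t) = t := by
  classical
  have : PGamma.single V Γ x ((indEquiv L V (Simple b x.1.1)).symm t) x =
      (indEquiv L V (Simple b x.1.1)).symm t := by
    unfold PGamma.single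
    exact Pi.single_eq_same _ _
  exact (congrArg (indEquiv L V _) this).trans (LinearEquiv.apply_symm_apply _ _)

theorem pGamma_ext {p q : PGamma V Γ} (h : ∀ x, pCoord V x p = pCoord V x q) : p = q :=
  funext fun x => (indEquiv L V (Simple b x.1.1)).injective (h x)

theorem sum_pIncl_pCoord (p : PGamma V Γ) : ∑ x, pIncl V x (pCoord V x p) = p := by
  refine pGamma_ext fun y => ?_
  rw [map_sum, Finset.sum_eq_single y]
  · rw [pCoord_pIncl_self]
  · intro x _ hxy
    exact pCoord_pIncl_of_ne hxy.symm _
  · intro h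
    exact absurd (Finset.mem_univ y) h

theorem mem_pGammaGrade_iff {k : ℤ} {p : PGamma V Γ} :
    p ∈ pGammaGrade V Γ k ↔ ∀ x, pCoord V x p ∈ freeGrade V (Simple b x.1.1) (k - x.1.2) :=
  forall_congr' fun _ => mem_indGrade_iff

theorem pIncl_mem_pGammaGrade {x : Γ} {k : ℤ} {t : FreeSimple V x.1.1}
    (ht : t ∈ freeGrade V (Simple b x.1.1) (k - x.1.2)) : pIncl V x t ∈ pGammaGrade V Γ k := by
  rw [mem_pGammaGrade_iff]
  intro y
  by_cases h : y = x
  · subst h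
    rwa [pCoord_pIncl_self]
  · rw [pCoord_pIncl_of_ne h]
    exact zero_mem _

theorem pGamma_hom_ext {Y : Type*} [AddCommGroup Y] [Module ℂ Y] [Module (Ua L V) Y]
    [IsScalarTower ℂ (Ua L V) Y] {f g : PGamma V Γ →ₗ[Ua L V] Y}
    (h : ∀ x m, f (pIncl V x (1 ⊗ₜ m)) = g (pIncl V x (1 ⊗ₜ m))) : f = g := by
  refine LinearMap.ext fun p => ?_
  rw [← sum_pIncl_pCoord p, map_sum, map_sum]
  refine Finset.sum_congr rfl fun x _ => ?_
  have : f ∘ₗ pIncl V x = g ∘ₗ pIncl V x := free_ext (h x)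
  exact LinearMap.congr_fun this _

/-- The homomorphism from `P(Γ)` with given values on the generators. -/
def pLift {Y : Type*} [AddCommGroup Y] [Module ℂ Y] [Module (Ua L V) Y]
    [IsScalarTower ℂ (Ua L V) Y] (g : ∀ x : Γ, FreeSimple V x.1.1 →ₗ[Ua L V] Y) :
    PGamma V Γ →ₗ[Ua L V] Y :=
  ∑ x, g x ∘ₗ pCoord V x

theorem pLift_pIncl {Y : Type*} [AddCommGroup Y] [Module ℂ Y] [Module (Ua L V) Y]
    [IsScalarTower ℂ (Ua L V) Y] (g : ∀ x : Γ, FreeSimple V x.1.1 →ₗ[Ua L V] Y) (x : Γ)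
    (t : FreeSimple V x.1.1) : pLift g (pIncl V x t) = g x t := by
  rw [pLift, LinearMap.sum_apply, Finset.sum_eq_single x]
  · rw [LinearMap.comp_apply, pCoord_pIncl_self]
  · intro y _ hy
    rw [LinearMap.comp_apply, pCoord_pIncl_of_ne hy, map_zero]
  · intro h
    exact absurd (Finset.mem_univ x) h

theorem hom_apply_eq_sum {Y : Type*} [AddCommGroup Y] [Module ℂ Y] [Module (Ua L V) Y]
    [IsScalarTower ℂ (Ua L V) Y] (f : PGamma V Γ →ₗ[Ua L V] Y) (p : PGamma V Γ) :
    f p = ∑ x, f (pIncl V x (pCoord V x p)) := by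
  conv_lhs => rw [← sum_pIncl_pCoord p, map_sum]

/-- Preservation of degrees can be tested on the generators `1 ⊗ V(λ)` of each summand, which have
degree `r`; the action of `Sym V` shifts degrees on both sides alike. -/
theorem mem_frakB_iff {f : Module.End (Ua L V) (PGamma V Γ)} : f ∈ frakB V Γ ↔
    ∀ x y m, pCoord V y (f (pIncl V x (1 ⊗ₜ m))) ∈
      freeGrade V (Simple b y.1.1) (x.1.2 - y.1.2) := by
  constructor
  · intro hf x y m
    refine mem_pGammaGrade_iff.1 (hf x.1.2 _ (pIncl_mem_pGammaGrade ?_)) y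
    rw [sub_self]
    exact one_tmul_mem_freeGrade m
  · intro h k p hp
    rw [mem_pGammaGrade_iff] at hp ⊢
    intro y
    rw [hom_apply_eq_sum f p, map_sum]
    refine sum_mem fun x _ => ?_
    have := map_mem_freeGrade (pCoord V y ∘ₗ f ∘ₗ pIncl V x) (h x y) (hp x)
    rwa [sub_add_sub_cancel] at this

theorem frakB_mem (f : frakB V Γ) (x y : Γ) (m : Simple b x.1.1) :
    pCoord V y (f.1 (pIncl V x (1 ⊗ₜ m))) ∈ freeGrade V (Simple b y.1.1) (x.1.2 - y.1.2) :=
  mem_frakB_iff.1 f.2 x y m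

theorem mem_frakBGrade_iff {k : ℕ} {f : frakB V Γ} : f ∈ frakBGrade V Γ k ↔
    ∀ x y : Γ, y.1.2 ≠ x.1.2 - k → ∀ t, pCoord V y (f.1 (pIncl V x t)) = 0 := by
  constructor
  · intro hf x y h t
    change indEquiv L V _ (f.1 (PGamma.single V Γ x _) y) = 0
    rw [hf x y _ h, map_zero]
  · intro hf x y p h
    have := hf x y h (indEquiv L V _ p)
    change indEquiv L V _ (f.1 (PGamma.single V Γ x ((indEquiv L V (Simple b x.1.1)).symm
      (indEquiv L V (Simple b x.1.1) p))) y) = 0 at this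
    rw [LinearEquiv.symm_apply_apply] at this
    exact (LinearEquiv.map_eq_zero_iff _).1 this

theorem frakB_ext {f g : frakB V Γ} (h : ∀ (x y : Γ) (t : FreeSimple V x.1.1),
    pCoord V y (f.1 (pIncl V x t)) = pCoord V y (g.1 (pIncl V x t))) : f = g :=
  Subtype.ext (pGamma_hom_ext fun x _ => pGamma_ext fun y => h x y _)

open Classical in
/-- The homogeneous component of degree `k` of an endomorphism of `P(Γ)`. -/
def endPart (k : ℕ) (f : Module.End (Ua L V) (PGamma V Γ)) : Module.End (Ua L V) (PGamma V Γ) :=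
  ∑ x : Γ, ∑ y : Γ, if y.1.2 = x.1.2 - (k : ℤ) then
    pIncl V y ∘ₗ pCoord V y ∘ₗ f ∘ₗ pIncl V x ∘ₗ pCoord V x else 0

open Classical in
theorem pCoord_endPart (k : ℕ) (f : Module.End (Ua L V) (PGamma V Γ)) (x y : Γ)
    (t : FreeSimple V x.1.1) : pCoord V y (endPart k f (pIncl V x t)) =
      if y.1.2 = x.1.2 - (k : ℤ) then pCoord V y (f (pIncl V x t)) else 0 := by
  rw [endPart, LinearMap.sum_apply, map_sum, Finset.sum_eq_single x]
  · rw [LinearMap.sum_apply, map_sum, Finset.sum_eq_single y]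
    · split_ifs
      · simp only [LinearMap.comp_apply, pCoord_pIncl_self]
      · rw [LinearMap.zero_apply, map_zero]
    · intro y' _ hy'
      split_ifs
      · simp only [LinearMap.comp_apply, pCoord_pIncl_of_ne hy'.symm]
      · rw [LinearMap.zero_apply, map_zero]
    · intro h
      exact absurd (Finset.mem_univ y) h
  · intro x' _ hx'
    rw [LinearMap.sum_apply, map_sum]
    refine Finset.sum_eq_zero fun y' _ => ?_
    split_ifs
    · simp only [LinearMap.comp_apply, pCoord_pIncl_of_ne hx', map_zero]
    · rw [LinearMap.zero_apply, map_zero]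
  · intro h
    exact absurd (Finset.mem_univ x) h

theorem pCoord_smul (x : Γ) (c : ℂ) (p : PGamma V Γ) : pCoord V x (c • p) = c • pCoord V x p :=
  map_smul ((pCoord V x).restrictScalars ℂ) c p

open Classical in
/-- The homogeneous component of degree `k` of an element of `𝔅(Γ)`. -/
def frakBPart (k : ℕ) : frakB V Γ →ₗ[ℂ] frakB V Γ where
  toFun f := ⟨endPart k f.1, by
    rw [mem_frakB_iff]
    intro x y m
    rw [pCoord_endPart]
    split_ifs
    · exact frakB_mem f x y m
    · exact zero_mem _⟩
  map_add' f g := frakB_ext fun x y t => by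
    change pCoord V y (endPart k _ _) = pCoord V y (endPart k _ _ + endPart k _ _)
    rw [map_add, pCoord_endPart, pCoord_endPart, pCoord_endPart]
    split_ifs
    · exact map_add (pCoord V y) _ _
    · rw [add_zero]
  map_smul' c f := frakB_ext fun x y t => by
    change pCoord V y (endPart k _ _) = pCoord V y (c • endPart k _ _)
    rw [pCoord_smul, pCoord_endPart, pCoord_endPart]
    split_ifs
    · exact pCoord_smul y c _
    · rw [smul_zero]

open Classical in
theorem pCoord_frakBPart (k : ℕ) (f : frakB V Γ) (x y : Γ) (t : FreeSimple V x.1.1) :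
    pCoord V y ((frakBPart k f).1 (pIncl V x t)) =
      if y.1.2 = x.1.2 - (k : ℤ) then pCoord V y (f.1 (pIncl V x t)) else 0 :=
  pCoord_endPart k f.1 x y t

theorem frakBPart_mem (k : ℕ) (f : frakB V Γ) : frakBPart k f ∈ frakBGrade V Γ k := by
  rw [mem_frakBGrade_iff]
  intro x y h t
  rw [pCoord_frakBPart, if_neg h]

theorem frakBPart_self {k : ℕ} {f : frakB V Γ} (hf : f ∈ frakBGrade V Γ k) :
    frakBPart k f = f := by
  refine frakB_ext fun x y t => ?_
  rw [pCoord_frakBPart]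
  split_ifs with h
  · rfl
  · exact (mem_frakBGrade_iff.1 hf x y h t).symm

theorem frakBPart_of_ne {k l : ℕ} (hkl : k ≠ l) {f : frakB V Γ} (hf : f ∈ frakBGrade V Γ l) :
    frakBPart k f = 0 := by
  refine frakB_ext fun x y t => ?_
  rw [pCoord_frakBPart]
  split_ifs with h
  · exact (mem_frakBGrade_iff.1 hf x y (by omega) t).trans (map_zero (pCoord V y)).symm
  · exact (map_zero (pCoord V y)).symm

/-- Such a component would send generators to elements of negative symmetric degree. -/
theorem pCoord_frakB_eq_zero (f : frakB V Γ) {x y : Γ} (h : x.1.2 < y.1.2)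
    (t : FreeSimple V x.1.1) : pCoord V y (f.1 (pIncl V x t)) = 0 := by
  have : pCoord V y ∘ₗ f.1 ∘ₗ pIncl V x = 0 := free_ext fun m => by
    have := frakB_mem f x y m
    rwa [freeGrade_eq_bot (by omega), Submodule.mem_bot] at this
  exact LinearMap.congr_fun this t

theorem exists_degree_bound (Γ : Finset (Lam b)) :
    ∃ N : ℕ, ∀ x y : Γ, x.1.2 - y.1.2 < (N : ℤ) := by
  refine ⟨∑ x : Γ, ∑ y : Γ, ((x.1.2 - y.1.2).toNat + 1), fun x y => ?_⟩
  have h1 : (x.1.2 - y.1.2).toNat + 1 ≤ ∑ y : Γ, ((x.1.2 - y.1.2).toNat + 1) :=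
    Finset.single_le_sum (f := fun y : Γ => (x.1.2 - y.1.2).toNat + 1)
      (fun _ _ => Nat.zero_le _) (Finset.mem_univ y)
  have h2 := Finset.single_le_sum (f := fun x : Γ => ∑ y : Γ, ((x.1.2 - y.1.2).toNat + 1))
    (fun _ _ => Nat.zero_le _) (Finset.mem_univ x)
  have h3 := h1.trans h2
  omega

theorem sum_frakBPart {N : ℕ} (hN : ∀ x y : Γ, x.1.2 - y.1.2 < (N : ℤ)) (f : frakB V Γ) :
    ∑ k ∈ Finset.range N, frakBPart k f = f := by
  refine frakB_ext fun x y t => ?_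
  have h : (∑ k ∈ Finset.range N, frakBPart k f).1 (pIncl V x t) =
      ∑ k ∈ Finset.range N, (frakBPart k f).1 (pIncl V x t) := by
    have h0 : (∑ k ∈ Finset.range N, frakBPart k f).1 =
        ∑ k ∈ Finset.range N, (frakBPart k f).1 := map_sum (frakB V Γ).val _ _
    rw [h0, LinearMap.sum_apply]
  rw [h, map_sum]
  by_cases hxy : x.1.2 < y.1.2
  · rw [pCoord_frakB_eq_zero f hxy]
    exact Finset.sum_eq_zero fun k _ => pCoord_frakB_eq_zero _ hxy _
  · rw [Finset.sum_eq_single (x.1.2 - y.1.2).toNat]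
    · rw [pCoord_frakBPart, if_pos (by omega)]
    · intro k _ hk
      rw [pCoord_frakBPart, if_neg (by omega)]
    · intro hk
      have := hN x y
      rw [Finset.mem_range] at hk
      omega

variable (V Γ) in
theorem frakBGrade_gradedMonoid : SetLike.GradedMonoid (frakBGrade V Γ) where
  one_mem := by
    rw [mem_frakBGrade_iff]
    intro x y h t
    refine pCoord_pIncl_of_ne (fun hxy => h ?_) t
    rw [hxy]
    simp
  mul_mem i j f g hf hg := by
    rw [mem_frakBGrade_iff] at hf hg ⊢
    intro x y h t
    change pCoord V y (f.1 (g.1 (pIncl V x t))) = 0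
    rw [hom_apply_eq_sum f.1, map_sum]
    refine Finset.sum_eq_zero fun z _ => ?_
    by_cases hz : z.1.2 = x.1.2 - j
    · exact hf z y (by push_cast at h; omega) _
    · rw [hg x z hz t, map_zero, map_zero, map_zero]

variable (V Γ) in
open Classical in
-- As `Γ` is finite, only finitely many degree differences occur, so the projections onto
-- homogeneous components form a finite sum and give the decomposition.
theorem nonempty_gradedAlgebra_frakBGrade : Nonempty (GradedAlgebra (frakBGrade V Γ)) := by
  obtain ⟨N, hN⟩ := exists_degree_bound Γ
  have := frakBGrade_gradedMonoid V Γ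
  suffices h : ∃ d : DirectSum.Decomposition (frakBGrade V Γ), True from
    ⟨{ toDecomposition := h.choose }⟩
  refine ⟨DirectSum.Decomposition.ofLinearMap _
    (∑ k ∈ Finset.range N, DirectSum.lof ℂ ℕ (fun k => frakBGrade V Γ k) k ∘ₗ
      (frakBPart k).codRestrict (frakBGrade V Γ k) (frakBPart_mem k)) ?_ ?_, trivial⟩
  · refine LinearMap.ext fun f => ?_
    rw [LinearMap.comp_apply, LinearMap.sum_apply, map_sum, LinearMap.id_apply]
    conv_rhs => rw [← sum_frakBPart hN f]
    refine Finset.sum_congr rfl fun k _ => ?_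
    exact DirectSum.coeLinearMap_lof (frakBGrade V Γ) k _
  · refine DirectSum.linearMap_ext ℂ fun i => LinearMap.ext fun f => ?_
    rw [LinearMap.comp_apply, LinearMap.comp_apply, DirectSum.coeLinearMap_lof,
      LinearMap.sum_apply, LinearMap.comp_apply, LinearMap.id_apply]
    have hk : ∀ k, k ≠ i → (DirectSum.lof ℂ ℕ (fun k => frakBGrade V Γ k) k ∘ₗ
        (frakBPart k).codRestrict (frakBGrade V Γ k) (frakBPart_mem k)) f.1 = 0 := by
      intro k hk
      have : (frakBPart k).codRestrict (frakBGrade V Γ k) (frakBPart_mem k) f.1 = 0 :=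
        Subtype.ext (frakBPart_of_ne hk f.2)
      rw [LinearMap.comp_apply, this, map_zero]
    by_cases hi : i < N
    · rw [Finset.sum_eq_single i]
      · have : (frakBPart i).codRestrict (frakBGrade V Γ i) (frakBPart_mem i) f.1 = f :=
          Subtype.ext (frakBPart_self f.2)
        rw [LinearMap.comp_apply, this]
      · intro k _ h
        exact hk k h
      · intro h
        exact absurd (Finset.mem_range.2 hi) h
    · rw [Finset.sum_eq_zero fun k hkN => hk k fun h => hi (h ▸ Finset.mem_range.1 hkN)]
      have h0 : f = 0 := by
        refine Subtype.ext ?_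
        rw [← sum_frakBPart hN f.1]
        exact Finset.sum_eq_zero fun k hkN =>
          frakBPart_of_ne (by have := Finset.mem_range.1 hkN; omega) f.2
      rw [h0, map_zero]

end PGamma

/-! ### Linear maps over `Sym V` -/

section SymExt

variable {L : Type u} [LieRing L] [LieAlgebra ℂ L]
variable {V : Type v} [AddCommGroup V] [Module ℂ V] [LieRingModule L V] [LieModule ℂ L V]
variable {X : Type*} [AddCommGroup X] [Module ℂ X] [LieRingModule L X] [LieModule ℂ L X]
variable {Y : Type*} [AddCommGroup Y] [Module ℂ Y] [LieRingModule L Y] [LieModule ℂ L Y]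

theorem symToUa_smul_tmul (s t : SymmetricAlgebra ℂ V) (m : X) :
    symToUa L V s • (t ⊗ₜ[ℂ] m) = (s * t) ⊗ₜ[ℂ] m := by
  rw [← symToUa_smul_one_tmul (L := L) t m, ← mul_smul, ← map_mul, symToUa_smul_one_tmul]

theorem ua_smul_smul (a : Ua L V) (c : ℂ) (t : SymmetricAlgebra ℂ V ⊗[ℂ] X) :
    a • c • t = c • a • t := by
  rw [ua_smul_def, ua_smul_def, map_smul]

theorem lie_smul_tmul (z : L) (c : ℂ) (t : SymmetricAlgebra ℂ V ⊗[ℂ] X) : ⁅z, c • t⁆ = c • ⁅z, t⁆ :=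
  lie_smul c z t

theorem add_neg_smul_add {M : Type*} [AddCommGroup M] [Module ℂ M] (t r y : M) (d : ℂ) :
    t + (-d • r + y) = t + y - d • r := by
  rw [neg_smul]; abel

theorem lie_linearMap_zero (z : L) : ⁅z, (0 : X →ₗ[ℂ] Y)⁆ = 0 := lie_zero z

theorem lie_linearMap_add (z : L) (f g : X →ₗ[ℂ] Y) : ⁅z, f + g⁆ = ⁅z, f⁆ + ⁅z, g⁆ := lie_add z f g

variable (L) in
/-- The extension of a linear map `X → Sym V ⊗ Y` to a map `Sym V ⊗ X → Sym V ⊗ Y` which is linear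
over `Sym V`. -/
def symExt (h : X →ₗ[ℂ] SymmetricAlgebra ℂ V ⊗[ℂ] Y) :
    SymmetricAlgebra ℂ V ⊗[ℂ] X →ₗ[ℂ] SymmetricAlgebra ℂ V ⊗[ℂ] Y :=
  TensorProduct.lift (LinearMap.mk₂ ℂ (fun s m => symToUa L V s • h m)
    (fun s t m => by rw [map_add, add_smul])
    (fun c s m => by rw [map_smul, smul_assoc])
    (fun s m n => by rw [map_add, smul_add])
    (fun c s m => by rw [map_smul, smul_algebra_smul_comm]))

theorem symExt_tmul (h : X →ₗ[ℂ] SymmetricAlgebra ℂ V ⊗[ℂ] Y) (s : SymmetricAlgebra ℂ V) (m : X) :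
    symExt L h (s ⊗ₜ m) = symToUa L V s • h m := rfl

theorem symExt_eq_of_one_tmul (h : X →ₗ[ℂ] SymmetricAlgebra ℂ V ⊗[ℂ] Y)
    (f : SymmetricAlgebra ℂ V ⊗[ℂ] X →ₗ[Ua L V] SymmetricAlgebra ℂ V ⊗[ℂ] Y)
    (hf : ∀ m, f (1 ⊗ₜ m) = h m) (t : SymmetricAlgebra ℂ V ⊗[ℂ] X) : symExt L h t = f t := by
  induction t using TensorProduct.induction_on with
  | zero => rw [map_zero, map_zero]
  | tmul s m => rw [symExt_tmul, ← hf, ← map_smul, symToUa_smul_one_tmul]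
  | add s t hs ht => rw [map_add, map_add, hs, ht]

theorem symExt_freeMap {Z : Type*} [AddCommGroup Z] [Module ℂ Z] [LieRingModule L Z]
    [LieModule ℂ L Z] (h : X →ₗ[ℂ] SymmetricAlgebra ℂ V ⊗[ℂ] Y) (g : Z →ₗ⁅ℂ, L⁆ X)
    (f : SymmetricAlgebra ℂ V ⊗[ℂ] Z →ₗ[Ua L V] SymmetricAlgebra ℂ V ⊗[ℂ] Y)
    (hf : ∀ m, f (1 ⊗ₜ m) = h (g m)) (t : SymmetricAlgebra ℂ V ⊗[ℂ] Z) :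
    symExt L h (freeMap g t) = f t := by
  induction t using TensorProduct.induction_on with
  | zero => rw [map_zero, map_zero, map_zero]
  | tmul s m => rw [freeMap_tmul, symExt_tmul, ← hf, ← map_smul, symToUa_smul_one_tmul]
  | add s t hs ht => rw [map_add, map_add, map_add, hs, ht]

end SymExt

/-! ### The algebra `𝐀` as an algebra of matrices -/

section BigAlgebra

variable {L : Type u} [LieRing L] [LieAlgebra ℂ L] [FiniteDimensional ℂ L]
  [LieAlgebra.IsSemisimple ℂ L]
variable {H : LieSubalgebra ℂ L} [H.IsCartanSubalgebra]
variable {b : (LieAlgebra.IsKilling.rootSystem H).Base}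
variable {V : Type v} [AddCommGroup V] [Module ℂ V] [LieRingModule L V] [LieModule ℂ L V]

open Classical in
/-- The inclusion of `V(μ)` into `𝐕`. -/
def bigOf (μ : Dominant b) : Simple b μ →ₗ⁅ℂ, L⁆ BigV b :=
  DirectSum.lieModuleOf ℂ (Dominant b) L (fun ν => Simple b ν) μ

/-- The projection of `𝐕` onto `V(μ)`. -/
def bigComp (μ : Dominant b) : BigV b →ₗ⁅ℂ, L⁆ Simple b μ :=
  DirectSum.lieModuleComponent ℂ (Dominant b) L (fun ν => Simple b ν) μ

theorem bigComp_bigOf_self (μ : Dominant b) (m : Simple b μ) : bigComp μ (bigOf μ m) = m := by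
  classical
  exact DirectSum.component.lof_self ℂ μ m

theorem bigComp_bigOf_of_ne {μ ν : Dominant b} (h : ν ≠ μ) (m : Simple b μ) :
    bigComp ν (bigOf μ m) = 0 := by
  classical
  exact DFinsupp.single_eq_of_ne h

open Classical in
/-- The inclusion of `V(μ)^*` into `𝐕^⊛`. -/
def bigStarOf (μ : Dominant b) : (Simple b μ →ₗ[ℂ] ℂ) →ₗ⁅ℂ, L⁆ BigVStar b :=
  DirectSum.lieModuleOf ℂ (Dominant b) L (fun ν => (Simple b ν →ₗ[ℂ] ℂ)) μ

/-- The projection of `𝐕^⊛` onto `V(μ)^*`. -/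
def bigStarComp (μ : Dominant b) : BigVStar b →ₗ⁅ℂ, L⁆ (Simple b μ →ₗ[ℂ] ℂ) :=
  DirectSum.lieModuleComponent ℂ (Dominant b) L (fun ν => (Simple b ν →ₗ[ℂ] ℂ)) μ

theorem bigStar_induction {p : BigVStar b → Prop} (h0 : p 0) (hof : ∀ μ g, p (bigStarOf μ g))
    (hadd : ∀ f g, p f → p g → p (f + g)) (f : BigVStar b) : p f := by
  classical
  exact DirectSum.induction_on f h0 hof hadd

open Classical in
theorem pairing_bigStarOf (μ : Dominant b) (g : Simple b μ →ₗ[ℂ] ℂ) (w : BigV b) :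
    pairing b (bigStarOf μ g) w = g (bigComp μ w) := by
  exact LinearMap.congr_fun (DirectSum.toModule_lof ℂ (φ := fun μ : Dominant b =>
    LinearMap.lcomp ℂ ℂ (DirectSum.component ℂ (Dominant b) (fun ν => Simple b ν) μ)) μ g) w

theorem pairing_bigOf (f : BigVStar b) (μ : Dominant b) (m : Simple b μ) :
    pairing b f (bigOf μ m) = bigStarComp μ f m := by
  classical
  induction f using bigStar_induction with
  | h0 => rw [map_zero, map_zero]; rfl
  | hof ν g =>
    rw [pairing_bigStarOf]
    by_cases h : ν = μ
    · subst h
      rw [bigComp_bigOf_self]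
      have : bigStarComp ν (bigStarOf ν g) = g := DFinsupp.single_eq_same
      rw [this]
    · rw [bigComp_bigOf_of_ne h, map_zero]
      have : bigStarComp μ (bigStarOf ν g) = 0 := DFinsupp.single_eq_of_ne (Ne.symm h)
      rw [this]
      rfl
  | hadd f g hf hg => rw [map_add, map_add, LinearMap.add_apply, LinearMap.add_apply, hf, hg]

theorem pairing_lie (z : L) (f : BigVStar b) (w : BigV b) :
    pairing b ⁅z, f⁆ w = -pairing b f ⁅z, w⁆ := by
  induction f using bigStar_induction with
  | h0 => rw [lie_zero, map_zero, LinearMap.zero_apply, LinearMap.zero_apply, neg_zero]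
  | hof μ g =>
    rw [← LieModuleHom.map_lie, pairing_bigStarOf, pairing_bigStarOf, LieModuleHom.map_lie]
    exact Module.Dual.lie_apply z _ g
  | hadd f g hf hg =>
    rw [lie_add, map_add, map_add, LinearMap.add_apply, LinearMap.add_apply, hf, hg, neg_add]

variable (b) in
/-- The endomorphism `w ↦ f(w) v` given by `f ⊗ v`. -/
def matRow : Mat b →ₗ[ℂ] BigV b →ₗ[ℂ] BigV b :=
  TensorProduct.lift (R := ℂ) (M := BigVStar b) (N := BigV b) (P₂ := BigV b →ₗ[ℂ] BigV b)
    (LinearMap.smulRightₗ ∘ₗ pairing b)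

theorem matRow_tmul (f : BigVStar b) (v w : BigV b) :
    matRow b (Mat.tmul f v) w = pairing b f w • v := rfl

variable (b V) in
/-- The linear map `𝐕 → A ⊗ 𝐕`, `w ↦ f(w) a ⊗ v` given by `a ⊗ f ⊗ v`. -/
def row : BigA b V →ₗ[ℂ] BigV b →ₗ[ℂ] SymmetricAlgebra ℂ V ⊗[ℂ] BigV b :=
  TensorProduct.lift (LinearMap.mk₂ ℂ
    (fun s x => TensorProduct.mk ℂ (SymmetricAlgebra ℂ V) (BigV b) s ∘ₗ matRow b x)
    (fun s t x => by rw [map_add, LinearMap.add_comp])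
    (fun c s x => by rw [map_smul, LinearMap.smul_comp])
    (fun s x y => by rw [map_add, LinearMap.comp_add])
    (fun c s x => by rw [map_smul, LinearMap.comp_smul]))

theorem row_tmul (s : SymmetricAlgebra ℂ V) (x : Mat b) (w : BigV b) :
    row b V (s ⊗ₜ x) w = s ⊗ₜ matRow b x w := rfl

theorem row_tmul_tmul (s : SymmetricAlgebra ℂ V) (f : BigVStar b) (v w : BigV b) :
    row b V (s ⊗ₜ Mat.tmul f v) w = pairing b f w • (s ⊗ₜ[ℂ] v) := by
  rw [row_tmul, matRow_tmul, TensorProduct.tmul_smul]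

theorem BigA.induction {p : BigA b V → Prop} (zero : p 0)
    (tmul : ∀ s f v, p (s ⊗ₜ Mat.tmul f v)) (add : ∀ x y, p x → p y → p (x + y))
    (x : BigA b V) : p x := by
  induction x using TensorProduct.induction_on with
  | zero => exact zero
  | add x y hx hy => exact add x y hx hy
  | tmul s m =>
    induction m using Mat.induction with
    | h0 => rw [TensorProduct.tmul_zero]; exact zero
    | ht f v => exact tmul s f v
    | ha x y hx hy => rw [TensorProduct.tmul_add]; exact add _ _ hx hy

theorem tmul_mul_bigA (s t : SymmetricAlgebra ℂ V) (x y : Mat b) :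
    (s ⊗ₜ[ℂ] x : BigA b V) * (t ⊗ₜ[ℂ] y) = (s * t) ⊗ₜ[ℂ] (matMul b x y) :=
  Algebra.TensorProduct.tmul_mul_tmul s t x y

/-- The product `(a ⊗ f ⊗ v)(b ⊗ g ⊗ u)` pairs `v` with `g`. Read as maps on `𝐕`, the left factor
therefore acts first, so products are compositions in the reverse order. -/
theorem row_mul (x y : BigA b V) (w : BigV b) :
    row b V (x * y) w = symExt L (row b V y) (row b V x w) := by
  induction x using BigA.induction with
  | zero => rw [zero_mul, map_zero, LinearMap.zero_apply, map_zero]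
  | add x x' hx hx' =>
    rw [add_mul, map_add, map_add, LinearMap.add_apply, LinearMap.add_apply, map_add, hx, hx']
  | tmul s f v =>
    rw [row_tmul_tmul, map_smul, symExt_tmul]
    induction y using BigA.induction with
    | zero => rw [mul_zero, map_zero, LinearMap.zero_apply, LinearMap.zero_apply, smul_zero, smul_zero]
    | add y y' hy hy' =>
      rw [mul_add, map_add, map_add, LinearMap.add_apply, LinearMap.add_apply, smul_add, smul_add,
        hy, hy']
    | tmul t g u =>
      rw [tmul_mul_bigA, matMul_tmul, TensorProduct.tmul_smul, map_smul, LinearMap.smul_apply,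
        row_tmul_tmul, row_tmul_tmul, ua_smul_smul, symToUa_smul_tmul,
        smul_comm (pairing b f w)]

/-- The right side is the usual action on a space of linear maps, so the row map takes invariants of
`𝐀` to equivariant maps. -/
theorem row_lie (z : L) (x : BigA b V) (w : BigV b) :
    row b V ⁅z, x⁆ w = ⁅z, row b V x w⁆ - row b V x ⁅z, w⁆ := by
  induction x using BigA.induction with
  | zero => simp
  | add x x' hx hx' =>
    rw [lie_add, map_add, map_add, LinearMap.add_apply, LinearMap.add_apply, LinearMap.add_apply,
      lie_add, hx, hx']
    abel
  | tmul s f v =>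
    have h : ⁅z, Mat.tmul f v⁆ = Mat.tmul ⁅z, f⁆ v + Mat.tmul f ⁅z, v⁆ :=
      TensorProduct.LieModule.lie_tmul_right z f v
    have h' : ⁅z, pairing b f w • (s ⊗ₜ[ℂ] v)⁆ = pairing b f w • ⁅z, s ⊗ₜ[ℂ] v⁆ := lie_smul_tmul _ _ _
    rw [TensorProduct.LieModule.lie_tmul_right, h, TensorProduct.tmul_add, map_add, map_add,
      LinearMap.add_apply, LinearMap.add_apply, row_tmul_tmul, row_tmul_tmul, row_tmul_tmul,
      row_tmul_tmul, row_tmul_tmul, h', TensorProduct.LieModule.lie_tmul_right, pairing_lie,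
      smul_add]
    exact add_neg_smul_add (M := SymmetricAlgebra ℂ V ⊗[ℂ] BigV b) _ _ _ _

theorem row_mem_freeGrade {n : ℕ} {x : BigA b V} (hx : x ∈ bigAGrade b V n) (w : BigV b) :
    row b V x w ∈ freeGrade V (BigV b) n := by
  obtain ⟨τ, rfl⟩ := hx
  induction τ using TensorProduct.induction_on with
  | zero => rw [map_zero, map_zero]; exact zero_mem _
  | add s t hs ht => rw [map_add, map_add]; exact add_mem hs ht
  | tmul s x => exact tmul_mem_freeGrade s.2 _

open Classical in
theorem matRow_oneMat (μ : Dominant b) (w : BigV b) :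
    matRow b (oneMat b μ) w = bigOf μ (bigComp μ w) := by
  have key : ∀ τ : (Simple b μ →ₗ[ℂ] ℂ) ⊗[ℂ] Simple b μ,
      matRow b (TensorProduct.map (DirectSum.lof ℂ (Dominant b) (fun ν => (Simple b ν →ₗ[ℂ] ℂ)) μ)
        (DirectSum.lof ℂ (Dominant b) (fun ν => Simple b ν) μ) τ :
          BigVStar b ⊗[ℂ] BigV b) w = bigOf μ (dualTensorHom ℂ _ _ τ (bigComp μ w)) := by
    intro τ
    induction τ using TensorProduct.induction_on with
    | zero => simp only [map_zero, LinearMap.zero_apply]; exact LinearMap.zero_apply _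
    | add s t hs ht =>
      rw [map_add, map_add, LinearMap.add_apply, map_add, ← hs, ← ht, ← LinearMap.add_apply]
      congr 1
      exact map_add (matRow b) _ _
    | tmul f v =>
      rw [TensorProduct.map_tmul]
      refine (matRow_tmul _ _ _).trans ?_
      rw [dualTensorHom_apply, map_smul]
      congr 1
      exact pairing_bigStarOf μ f w
  refine (key _).trans ?_
  have : dualTensorHom ℂ (Simple b μ) (Simple b μ)
      ((dualTensorHomEquiv ℂ (Simple b μ) (Simple b μ)).symm LinearMap.id) = LinearMap.id :=
    LinearEquiv.apply_symm_apply (dualTensorHomEquiv ℂ (Simple b μ) (Simple b μ)) _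
  rw [this]
  rfl

theorem row_idem (μ : Dominant b) (w : BigV b) :
    row b V (idem b V μ) w = 1 ⊗ₜ bigOf μ (bigComp μ w) := by
  rw [idem, row_tmul, matRow_oneMat]

open Classical in
theorem oneMat_mul_tmul (μ : Dominant b) (f : BigVStar b) (v : BigV b) :
    matMul b (oneMat b μ) (Mat.tmul f v) = Mat.tmul (bigStarOf μ (bigStarComp μ f)) v := by
  have key : ∀ τ : (Simple b μ →ₗ[ℂ] ℂ) ⊗[ℂ] Simple b μ,
      matMul b (TensorProduct.map (DirectSum.lof ℂ (Dominant b) (fun ν => (Simple b ν →ₗ[ℂ] ℂ)) μ)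
        (DirectSum.lof ℂ (Dominant b) (fun ν => Simple b ν) μ) τ :
          BigVStar b ⊗[ℂ] BigV b) (Mat.tmul f v) =
        Mat.tmul (bigStarOf μ (bigStarComp μ f ∘ₗ dualTensorHom ℂ _ _ τ)) v := by
    intro τ
    induction τ using TensorProduct.induction_on with
    | zero =>
      rw [map_zero, map_zero, LinearMap.comp_zero, map_zero]
      refine Eq.trans (LinearMap.congr_fun (map_zero (matMul b)) _) ?_
      exact (TensorProduct.zero_tmul _ _).symm
    | add s t hs ht =>
      rw [map_add, map_add, LinearMap.comp_add, map_add]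
      refine Eq.trans (LinearMap.congr_fun (map_add (matMul b) _ _) _) ?_
      rw [LinearMap.add_apply, hs, ht]
      exact (TensorProduct.add_tmul _ _ _).symm
    | tmul g u =>
      rw [TensorProduct.map_tmul]
      refine (matMul_tmul b _ _ _ _).trans ?_
      have h1 : bigStarComp μ f ∘ₗ dualTensorHom ℂ _ _ (g ⊗ₜ[ℂ] u) = bigStarComp μ f u • g := by
        ext m
        simp [dualTensorHom_apply, mul_comm]
      rw [h1, map_smul]
      have h2 : pairing b f (DirectSum.lof ℂ (Dominant b) (fun ν => Simple b ν) μ u) =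
        bigStarComp μ f u := pairing_bigOf f μ u
      rw [h2]
      exact TensorProduct.smul_tmul' _ _ _
  refine (key _).trans ?_
  have : dualTensorHom ℂ (Simple b μ) (Simple b μ)
      ((dualTensorHomEquiv ℂ (Simple b μ) (Simple b μ)).symm LinearMap.id) = LinearMap.id :=
    LinearEquiv.apply_symm_apply (dualTensorHomEquiv ℂ (Simple b μ) (Simple b μ)) _
  rw [this, LinearMap.comp_id]

variable (b V) in
/-- The map `A ⊗ 𝐕 → 𝐀`, `s ⊗ v ↦ s ⊗ h ⊗ v`. -/
def place : BigVStar b →ₗ[ℂ] SymmetricAlgebra ℂ V ⊗[ℂ] BigV b →ₗ[ℂ] BigA b V :=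
  LinearMap.lTensorHom (R := ℂ) (SymmetricAlgebra ℂ V) (N := BigV b) (P := Mat b) ∘ₗ
    (TensorProduct.mk ℂ (BigVStar b) (BigV b) : BigVStar b →ₗ[ℂ] BigV b →ₗ[ℂ] Mat b)

theorem place_tmul (h : BigVStar b) (s : SymmetricAlgebra ℂ V) (v : BigV b) :
    place b V h (s ⊗ₜ v) = s ⊗ₜ Mat.tmul h v := rfl

theorem row_place (h : BigVStar b) (t : SymmetricAlgebra ℂ V ⊗[ℂ] BigV b) (w : BigV b) :
    row b V (place b V h t) w = pairing b h w • t := by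
  induction t using TensorProduct.induction_on with
  | zero => rw [map_zero, map_zero, LinearMap.zero_apply, smul_zero]
  | add s t hs ht => rw [map_add, map_add, LinearMap.add_apply, hs, ht, smul_add]
  | tmul s v => rw [place_tmul, row_tmul_tmul]

theorem lie_place (z : L) (h : BigVStar b) (t : SymmetricAlgebra ℂ V ⊗[ℂ] BigV b) :
    ⁅z, place b V h t⁆ = place b V ⁅z, h⁆ t + place b V h ⁅z, t⁆ := by
  induction t using TensorProduct.induction_on with
  | zero => simp
  | add s t hs ht => rw [map_add, lie_add, hs, ht, lie_add, map_add, map_add]; abel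
  | tmul s v =>
    have h' : ⁅z, Mat.tmul h v⁆ = Mat.tmul ⁅z, h⁆ v + Mat.tmul h ⁅z, v⁆ :=
      TensorProduct.LieModule.lie_tmul_right z h v
    rw [place_tmul, place_tmul, TensorProduct.LieModule.lie_tmul_right,
      TensorProduct.LieModule.lie_tmul_right, h', map_add, place_tmul, place_tmul,
      TensorProduct.tmul_add]
    abel

theorem place_mem_bigAGrade {n : ℕ} (h : BigVStar b) {t : SymmetricAlgebra ℂ V ⊗[ℂ] BigV b}
    (ht : t ∈ freeGrade V (BigV b) n) : place b V h t ∈ bigAGrade b V n := by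
  refine freeGrade_le_comap (place b V h) (fun k hk s hs v => ?_) ht
  obtain rfl : k = n := by exact_mod_cast hk
  exact ⟨(⟨s, hs⟩ : symPow V k) ⊗ₜ Mat.tmul h v, rfl⟩

variable (V) in
/-- The element of `𝐀` with given row indexed by `μ`, and with the other rows zero. -/
def emb (μ : Dominant b) :
    (Simple b μ →ₗ[ℂ] SymmetricAlgebra ℂ V ⊗[ℂ] BigV b) →ₗ[ℂ] BigA b V :=
  TensorProduct.lift (place b V ∘ₗ (bigStarOf μ : (Simple b μ →ₗ[ℂ] ℂ) →ₗ[ℂ] BigVStar b)) ∘ₗ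
    (dualTensorHomEquiv ℂ (Simple b μ) (SymmetricAlgebra ℂ V ⊗[ℂ] BigV b)).symm.toLinearMap

theorem emb_smulRight (μ : Dominant b) (f : Simple b μ →ₗ[ℂ] ℂ)
    (t : SymmetricAlgebra ℂ V ⊗[ℂ] BigV b) :
    emb V μ (f.smulRight t) = place b V (bigStarOf μ f) t := by
  have : (dualTensorHomEquiv ℂ (Simple b μ) (SymmetricAlgebra ℂ V ⊗[ℂ] BigV b)).symm
      (f.smulRight t) = f ⊗ₜ t := by
    rw [LinearEquiv.symm_apply_eq]
    ext m
    exact (dualTensorHom_apply f m t).symm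
  rw [emb, LinearMap.comp_apply, LinearEquiv.coe_coe, this]
  rfl

theorem hom_induction {X Y : Type*} [AddCommGroup X] [Module ℂ X] [FiniteDimensional ℂ X]
    [AddCommGroup Y] [Module ℂ Y] {p : (X →ₗ[ℂ] Y) → Prop} (zero : p 0)
    (smulRight : ∀ (f : X →ₗ[ℂ] ℂ) (y : Y), p (f.smulRight y))
    (add : ∀ f g, p f → p g → p (f + g)) (f : X →ₗ[ℂ] Y) : p f := by
  obtain ⟨τ, rfl⟩ := (dualTensorHomEquiv ℂ X Y).surjective f
  induction τ using TensorProduct.induction_on with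
  | zero => rw [map_zero]; exact zero
  | add s t hs ht => rw [map_add]; exact add _ _ hs ht
  | tmul f y =>
    have : dualTensorHomEquiv ℂ X Y (f ⊗ₜ y) = f.smulRight y :=
      LinearMap.ext fun m => dualTensorHom_apply f m y
    rw [this]
    exact smulRight f y

theorem row_emb (μ : Dominant b) (g : Simple b μ →ₗ[ℂ] SymmetricAlgebra ℂ V ⊗[ℂ] BigV b)
    (w : BigV b) : row b V (emb V μ g) w = g (bigComp μ w) := by
  induction g using hom_induction with
  | zero => rw [map_zero, map_zero]; rfl
  | add f g hf hg => rw [map_add, map_add, LinearMap.add_apply, hf, hg]; rfl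
  | smulRight f t => rw [emb_smulRight, row_place, pairing_bigStarOf, LinearMap.smulRight_apply]

/-- Left multiplication by `1_μ` keeps just the row indexed by `μ`, and an element of `1_μ 𝐀` is
rebuilt from that row because `V(μ)` is finite-dimensional. -/
theorem emb_row (μ : Dominant b) (x : BigA b V) :
    emb V μ (row b V x ∘ₗ (bigOf μ : Simple b μ →ₗ[ℂ] BigV b)) = idem b V μ * x := by
  induction x using BigA.induction with
  | zero => rw [map_zero, LinearMap.zero_comp, map_zero, mul_zero]
  | add x y hx hy => rw [map_add, LinearMap.add_comp, map_add, hx, hy, mul_add]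
  | tmul s f v =>
    have : row b V (s ⊗ₜ Mat.tmul f v) ∘ₗ (bigOf μ : Simple b μ →ₗ[ℂ] BigV b) =
        (bigStarComp μ f).smulRight (s ⊗ₜ[ℂ] v) := by
      ext m
      rw [LinearMap.comp_apply, row_tmul_tmul, LinearMap.smulRight_apply]
      congr 1
      exact pairing_bigOf f μ m
    rw [this, emb_smulRight, place_tmul, idem, tmul_mul_bigA, one_mul, oneMat_mul_tmul]

theorem lie_emb (z : L) (μ : Dominant b)
    (g : Simple b μ →ₗ[ℂ] SymmetricAlgebra ℂ V ⊗[ℂ] BigV b) :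
    ⁅z, emb V μ g⁆ = emb V μ ⁅z, g⁆ := by
  induction g using hom_induction with
  | zero =>
    have : ⁅z, (0 : Simple b μ →ₗ[ℂ] SymmetricAlgebra ℂ V ⊗[ℂ] BigV b)⁆ = 0 := lie_linearMap_zero z
    rw [this, map_zero, lie_zero]
  | add f g hf hg =>
    have : ⁅z, f + g⁆ = ⁅z, f⁆ + ⁅z, g⁆ := lie_linearMap_add z f g
    rw [this, map_add, lie_add, hf, hg, map_add]
  | smulRight f t =>
    have : ⁅z, f.smulRight t⁆ = (⁅z, f⁆ : Simple b μ →ₗ[ℂ] ℂ).smulRight t + f.smulRight ⁅z, t⁆ := by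
      ext m
      have h1 : (⁅z, f⁆ : Simple b μ →ₗ[ℂ] ℂ) m = - f ⁅z, m⁆ := Module.Dual.lie_apply z m f
      rw [LieHom.lie_apply, LinearMap.add_apply, LinearMap.smulRight_apply,
        LinearMap.smulRight_apply, LinearMap.smulRight_apply, LinearMap.smulRight_apply, h1,
        lie_smul, neg_smul]
      abel
    rw [this, map_add, emb_smulRight, emb_smulRight, emb_smulRight, lie_place,
      LieModuleHom.map_lie]

theorem emb_mem_bigAGrade {n : ℕ} (μ : Dominant b)
    {g : Simple b μ →ₗ[ℂ] SymmetricAlgebra ℂ V ⊗[ℂ] BigV b}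
    (hg : ∀ m, g m ∈ freeGrade V (BigV b) n) : emb V μ g ∈ bigAGrade b V n := by
  let e := Module.finBasis ℂ (Simple b μ)
  have : g = ∑ i, (e.coord i).smulRight (g (e i)) := by
    refine e.ext fun j => ?_
    rw [LinearMap.sum_apply, Finset.sum_eq_single j]
    · simp
    · intro i _ hij
      simp [hij.symm]
    · intro h
      exact absurd (Finset.mem_univ j) h
  rw [this, map_sum]
  refine sum_mem fun i _ => ?_
  rw [emb_smulRight]
  exact place_mem_bigAGrade _ (hg _)

end BigAlgebra

/-! ### The isomorphism between `𝔅(Γ)^op` and `𝐀_Ψ(π₁(Γ))^𝔤` -/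

section Comparison

variable {L : Type u} [LieRing L] [LieAlgebra ℂ L] [FiniteDimensional ℂ L]
  [LieAlgebra.IsSemisimple ℂ L]
variable {H : LieSubalgebra ℂ L} [H.IsCartanSubalgebra]
variable {b : (LieAlgebra.IsKilling.rootSystem H).Base}
variable {V : Type v} [AddCommGroup V] [Module ℂ V] [LieRingModule L V] [LieModule ℂ L V]
variable {Γ : Finset (Lam b)}

theorem freeMap_bigComp_bigOf_self (μ : Dominant b) (t : FreeSimple V μ) :
    freeMap (V := V) (bigComp μ) (freeMap (bigOf μ) t) = t := by
  have : freeMap (V := V) (bigComp μ) ∘ₗ freeMap (bigOf μ) = LinearMap.id := free_ext fun m => by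
    rw [LinearMap.comp_apply, freeMap_tmul, freeMap_tmul, bigComp_bigOf_self, LinearMap.id_apply]
  exact LinearMap.congr_fun this t

theorem freeMap_bigComp_bigOf_of_ne {μ ν : Dominant b} (h : ν ≠ μ) (t : FreeSimple V μ) :
    freeMap (V := V) (bigComp ν) (freeMap (bigOf μ) t) = 0 := by
  have : freeMap (V := V) (bigComp ν) ∘ₗ freeMap (bigOf μ) = 0 := free_ext fun m => by
    rw [LinearMap.comp_apply, freeMap_tmul, freeMap_tmul, bigComp_bigOf_of_ne h,
      TensorProduct.tmul_zero, LinearMap.zero_apply]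
  exact LinearMap.congr_fun this t

variable (V Γ) in
/-- The homomorphism from `P(Γ)` to `A ⊗ 𝐕`. -/
def bigIncl : PGamma V Γ →ₗ[Ua L V] SymmetricAlgebra ℂ V ⊗[ℂ] BigV b :=
  pLift fun x => freeMap (bigOf x.1.1)

variable (V Γ) in
/-- The homomorphism from `A ⊗ 𝐕` to `P(Γ)`. -/
def bigProj : SymmetricAlgebra ℂ V ⊗[ℂ] BigV b →ₗ[Ua L V] PGamma V Γ :=
  ∑ x : Γ, pIncl V x ∘ₗ freeMap (bigComp x.1.1)

theorem bigIncl_pIncl (x : Γ) (t : FreeSimple V x.1.1) :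
    bigIncl V Γ (pIncl V x t) = freeMap (bigOf x.1.1) t := pLift_pIncl _ x t

theorem bigIncl_eq_sum (p : PGamma V Γ) :
    bigIncl V Γ p = ∑ x : Γ, freeMap (bigOf x.1.1) (pCoord V x p) := by
  rw [bigIncl, pLift, LinearMap.sum_apply]
  rfl

theorem pCoord_bigProj (y : Γ) (t : SymmetricAlgebra ℂ V ⊗[ℂ] BigV b) :
    pCoord V y (bigProj V Γ t) = freeMap (bigComp y.1.1) t := by
  rw [bigProj, LinearMap.sum_apply, map_sum, Finset.sum_eq_single y]
  · rw [LinearMap.comp_apply, pCoord_pIncl_self]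
  · intro x _ hx
    rw [LinearMap.comp_apply, pCoord_pIncl_of_ne hx.symm]
  · intro h
    exact absurd (Finset.mem_univ y) h

/-- Distinct elements of `Γ` have distinct weights, so distinct summands of `P(Γ)` go to distinct
summands of `A ⊗ 𝐕`. -/
theorem bigProj_bigIncl (hinj : ∀ x y : Γ, x.1.1 = y.1.1 → x = y) (p : PGamma V Γ) :
    bigProj V Γ (bigIncl V Γ p) = p := by
  have : bigProj V Γ ∘ₗ bigIncl V Γ = LinearMap.id := pGamma_hom_ext fun x m =>
    pGamma_ext fun y => by
      rw [LinearMap.comp_apply, pCoord_bigProj, bigIncl_pIncl, LinearMap.id_apply]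
      by_cases h : y = x
      · subst h
        rw [freeMap_bigComp_bigOf_self, pCoord_pIncl_self]
      · rw [freeMap_bigComp_bigOf_of_ne (fun h' => h (hinj _ _ h')), pCoord_pIncl_of_ne h]
  exact LinearMap.congr_fun this p

theorem bigIncl_injective (hinj : ∀ x y : Γ, x.1.1 = y.1.1 → x = y) :
    Function.Injective (bigIncl V Γ) :=
  Function.LeftInverse.injective (bigProj_bigIncl hinj)

/-- The restriction of a homomorphism to the generators of a summand. -/
def genRestrict {Y : Type*} [AddCommGroup Y] [Module ℂ Y] [Module (Ua L V) Y]
    [IsScalarTower ℂ (Ua L V) Y] (x : Γ) (f : PGamma V Γ →ₗ[Ua L V] Y) : Simple b x.1.1 →ₗ[ℂ] Y :=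
  (f ∘ₗ pIncl V x).restrictScalars ℂ ∘ₗ TensorProduct.mk ℂ (SymmetricAlgebra ℂ V) _ 1

/-- The restriction of a homomorphism to the generators of a summand, as an equivariant map. -/
def genRestrictLie {X : Type*} [AddCommGroup X] [Module ℂ X] [LieRingModule L X] [LieModule ℂ L X]
    (x : Γ) (f : PGamma V Γ →ₗ[Ua L V] SymmetricAlgebra ℂ V ⊗[ℂ] X) :
    Simple b x.1.1 →ₗ⁅ℂ, L⁆ SymmetricAlgebra ℂ V ⊗[ℂ] X :=
  { genRestrict x f with
    map_lie' := fun {z m} => by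
      have h : (1 : SymmetricAlgebra ℂ V) ⊗ₜ[ℂ] ⁅z, m⁆ =
          uaGen L V (Sum.inl z) • ((1 : SymmetricAlgebra ℂ V) ⊗ₜ[ℂ] m) := one_tmul_lie z m
      change f (pIncl V x (1 ⊗ₜ ⁅z, m⁆)) = ⁅z, f (pIncl V x (1 ⊗ₜ m))⁆
      rw [h, map_smul, map_smul, uaGen_inl_smul] }

variable (V Γ) in
/-- The linear map `𝔅(Γ) → 𝐀`. -/
def toBigA : frakB V Γ →ₗ[ℂ] BigA b V where
  toFun f := ∑ x : Γ, emb V x.1.1 (genRestrict x (bigIncl V Γ ∘ₗ f.1))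
  map_add' f g := by
    rw [← Finset.sum_add_distrib]
    refine Finset.sum_congr rfl fun x _ => ?_
    rw [← map_add]
    congr 1
    refine LinearMap.ext fun m => ?_
    exact map_add (bigIncl V Γ) _ _
  map_smul' c f := by
    rw [Finset.smul_sum]
    refine Finset.sum_congr rfl fun x _ => ?_
    rw [RingHom.id_apply, ← map_smul]
    congr 1
    refine LinearMap.ext fun m => ?_
    exact map_smul ((bigIncl V Γ).restrictScalars ℂ) c _

theorem toBigA_apply (f : frakB V Γ) :
    toBigA V Γ f = ∑ x : Γ, emb V x.1.1 (genRestrict x (bigIncl V Γ ∘ₗ f.1)) := rfl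

theorem row_toBigA (hinj : ∀ x y : Γ, x.1.1 = y.1.1 → x = y) (f : frakB V Γ) (x : Γ)
    (m : Simple b x.1.1) :
    row b V (toBigA V Γ f) (bigOf x.1.1 m) = bigIncl V Γ (f.1 (pIncl V x (1 ⊗ₜ m))) := by
  rw [toBigA_apply, map_sum, LinearMap.sum_apply, Finset.sum_eq_single x]
  · rw [row_emb, bigComp_bigOf_self]
    rfl
  · intro y _ hy
    rw [row_emb, bigComp_bigOf_of_ne (fun h => hy (hinj _ _ h)), map_zero]
  · intro h
    exact absurd (Finset.mem_univ x) h

variable (V Γ) in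
/-- The sum of the idempotents `1_μ`, for `μ` in `π₁(Γ)`. -/
def sumIdem : BigA b V := ∑ x : Γ, idem b V x.1.1

theorem sumIdem_mul (α : BigA b V) : sumIdem V Γ * α =
    ∑ x : Γ, emb V x.1.1 (row b V α ∘ₗ (bigOf x.1.1 : Simple b x.1.1 →ₗ[ℂ] BigV b)) := by
  rw [sumIdem, Finset.sum_mul]
  exact Finset.sum_congr rfl fun x _ => (emb_row x.1.1 α).symm

theorem eq_of_row {α β : BigA b V} (hα : sumIdem V Γ * α = α) (hβ : sumIdem V Γ * β = β)
    (h : ∀ (x : Γ) m, row b V α (bigOf x.1.1 m) = row b V β (bigOf x.1.1 m)) : α = β := by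
  rw [← hα, ← hβ, sumIdem_mul, sumIdem_mul]
  refine Finset.sum_congr rfl fun x _ => ?_
  congr 1
  exact LinearMap.ext fun m => h x m

theorem sumIdem_mul_toBigA (hinj : ∀ x y : Γ, x.1.1 = y.1.1 → x = y) (f : frakB V Γ) :
    sumIdem V Γ * toBigA V Γ f = toBigA V Γ f := by
  rw [sumIdem_mul, toBigA_apply]
  refine Finset.sum_congr rfl fun x _ => ?_
  congr 1
  exact LinearMap.ext fun m => row_toBigA hinj f x m

theorem symExt_row_toBigA (hinj : ∀ x y : Γ, x.1.1 = y.1.1 → x = y) (f : frakB V Γ)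
    (p : PGamma V Γ) :
    symExt L (row b V (toBigA V Γ f)) (bigIncl V Γ p) = bigIncl V Γ (f.1 p) := by
  rw [bigIncl_eq_sum, map_sum]
  conv_rhs => rw [← sum_pIncl_pCoord p, map_sum, map_sum]
  refine Finset.sum_congr rfl fun x _ => ?_
  exact symExt_freeMap _ (bigOf x.1.1) (bigIncl V Γ ∘ₗ f.1 ∘ₗ pIncl V x)
    (fun m => (row_toBigA hinj f x m).symm) _

/-- Compare rows: on them the product of `𝐀` is composition in the reverse order, and the rows of
the image of `f` are the restrictions of `f` to generators. -/
theorem toBigA_mul (hinj : ∀ x y : Γ, x.1.1 = y.1.1 → x = y) (f g : frakB V Γ) :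
    toBigA V Γ (g * f) = toBigA V Γ f * toBigA V Γ g := by
  refine eq_of_row (sumIdem_mul_toBigA hinj _) ?_ fun x m => ?_
  · rw [← mul_assoc, sumIdem_mul_toBigA hinj]
  · rw [row_toBigA hinj, row_mul, row_toBigA hinj, symExt_row_toBigA hinj]
    rfl

theorem lie_toBigA (z : L) (f : frakB V Γ) : ⁅z, toBigA V Γ f⁆ = 0 := by
  rw [toBigA_apply, lie_sum]
  refine Finset.sum_eq_zero fun x _ => ?_
  rw [lie_emb]
  have : ⁅z, genRestrict x (bigIncl V Γ ∘ₗ f.1)⁆ = 0 := LinearMap.ext fun m => by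
    rw [LieHom.lie_apply, LinearMap.zero_apply]
    refine sub_eq_zero.2 ?_
    exact ((genRestrictLie x (bigIncl V Γ ∘ₗ f.1)).map_lie z m).symm
  rw [this, map_zero]

theorem symExt_row_idem (μ : Dominant b) (t : SymmetricAlgebra ℂ V ⊗[ℂ] BigV b) :
    symExt L (row b V (idem b V μ)) t = freeMap (bigOf μ) (freeMap (bigComp μ) t) :=
  symExt_eq_of_one_tmul _ (freeMap (bigOf μ) ∘ₗ freeMap (bigComp μ))
    (fun m => (row_idem μ m).symm) t

theorem idem_eq_emb (μ : Dominant b) : idem b V μ = emb V μ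
    (TensorProduct.mk ℂ (SymmetricAlgebra ℂ V) (BigV b) 1 ∘ₗ
      (bigOf μ : Simple b μ →ₗ[ℂ] BigV b)) := by
  classical
  have key : ∀ τ : (Simple b μ →ₗ[ℂ] ℂ) ⊗[ℂ] Simple b μ,
      (1 : SymmetricAlgebra ℂ V) ⊗ₜ[ℂ] (TensorProduct.map
        (DirectSum.lof ℂ (Dominant b) (fun ν => (Simple b ν →ₗ[ℂ] ℂ)) μ)
        (DirectSum.lof ℂ (Dominant b) (fun ν => Simple b ν) μ) τ : Mat b) =
      emb V μ (TensorProduct.mk ℂ (SymmetricAlgebra ℂ V) (BigV b) 1 ∘ₗ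
        (bigOf μ : Simple b μ →ₗ[ℂ] BigV b) ∘ₗ dualTensorHom ℂ _ _ τ) := by
    intro τ
    induction τ using TensorProduct.induction_on with
    | zero =>
      rw [map_zero, map_zero, LinearMap.comp_zero, LinearMap.comp_zero, map_zero]
      exact TensorProduct.tmul_zero _ _
    | add s t hs ht =>
      rw [map_add, map_add, LinearMap.comp_add, LinearMap.comp_add, map_add, ← hs, ← ht]
      exact TensorProduct.tmul_add _ _ _
    | tmul f v =>
      have : TensorProduct.mk ℂ (SymmetricAlgebra ℂ V) (BigV b) 1 ∘ₗ
          (bigOf μ : Simple b μ →ₗ[ℂ] BigV b) ∘ₗ dualTensorHom ℂ _ _ (f ⊗ₜ v) =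
          f.smulRight ((1 : SymmetricAlgebra ℂ V) ⊗ₜ[ℂ] bigOf μ v) := by
        refine LinearMap.ext fun m => ?_
        rw [LinearMap.comp_apply, LinearMap.comp_apply, dualTensorHom_apply, map_smul, map_smul]
        rfl
      rw [this, emb_smulRight, place_tmul]
      rfl
  have := key ((dualTensorHomEquiv ℂ (Simple b μ) (Simple b μ)).symm LinearMap.id)
  have h : dualTensorHom ℂ (Simple b μ) (Simple b μ)
      ((dualTensorHomEquiv ℂ (Simple b μ) (Simple b μ)).symm LinearMap.id) = LinearMap.id :=
    LinearEquiv.apply_symm_apply (dualTensorHomEquiv ℂ (Simple b μ) (Simple b μ)) _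
  rw [h, LinearMap.comp_id] at this
  exact this

theorem idem_mul_idem (μ : Dominant b) : idem b V μ * idem b V μ = idem b V μ := by
  rw [← emb_row]
  conv_rhs => rw [idem_eq_emb]
  congr 1
  refine LinearMap.ext fun m => ?_
  refine (row_idem μ _).trans ?_
  exact congrArg (fun m => (1 : SymmetricAlgebra ℂ V) ⊗ₜ[ℂ] bigOf μ m) (bigComp_bigOf_self μ m)

/-- The matrix entry of `f` at `(x, y)`, as an element of `𝐀`. -/
def entry (f : frakB V Γ) (x y : Γ) : BigA b V :=
  emb V x.1.1 (genRestrict x (freeMap (bigOf y.1.1) ∘ₗ pCoord V y ∘ₗ f.1))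

theorem toBigA_eq_sum_entry (f : frakB V Γ) : toBigA V Γ f = ∑ x : Γ, ∑ y : Γ, entry f x y := by
  rw [toBigA_apply]
  refine Finset.sum_congr rfl fun x _ => ?_
  simp only [entry]
  rw [← map_sum]
  congr 1
  refine LinearMap.ext fun m => ?_
  rw [LinearMap.sum_apply]
  exact bigIncl_eq_sum _

theorem row_entry (f : frakB V Γ) (x y : Γ) (w : BigV b) : row b V (entry f x y) w =
    freeMap (bigOf y.1.1) (pCoord V y (f.1 (pIncl V x (1 ⊗ₜ bigComp x.1.1 w)))) := row_emb _ _ _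

theorem idem_mul_entry (f : frakB V Γ) (x y : Γ) : idem b V x.1.1 * entry f x y = entry f x y := by
  rw [← emb_row]
  conv_rhs => rw [entry]
  congr 1
  refine LinearMap.ext fun m => ?_
  rw [LinearMap.comp_apply, row_entry]
  change freeMap _ (pCoord V y (f.1 (pIncl V x (1 ⊗ₜ bigComp x.1.1 (bigOf x.1.1 m))))) = _
  rw [bigComp_bigOf_self]
  rfl

theorem entry_mul_idem (f : frakB V Γ) (x y : Γ) : entry f x y * idem b V y.1.1 = entry f x y := by
  have h : idem b V x.1.1 * (entry f x y * idem b V y.1.1) = entry f x y * idem b V y.1.1 := by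
    rw [← mul_assoc, idem_mul_entry]
  refine h.symm.trans (Eq.trans ?_ (idem_mul_entry f x y))
  rw [← emb_row, ← emb_row]
  congr 1
  refine LinearMap.ext fun m => ?_
  change row b V _ _ = row b V _ _
  rw [row_mul, row_entry, symExt_row_idem, freeMap_bigComp_bigOf_self]

theorem entry_mem_bigAGrade (f : frakB V Γ) {x y : Γ} {n : ℕ} (hn : x.1.2 - y.1.2 = n) :
    entry f x y ∈ bigAGrade b V n := by
  refine emb_mem_bigAGrade _ fun m => ?_
  rw [← hn]
  exact freeMap_mem_freeGrade _ (frakB_mem f x y m)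

theorem entry_eq_zero (f : frakB V Γ) {x y : Γ}
    (h : ∀ m, pCoord V y (f.1 (pIncl V x (1 ⊗ₜ m))) = 0) : entry f x y = 0 := by
  have : genRestrict x (freeMap (bigOf y.1.1) ∘ₗ pCoord V y ∘ₗ f.1) = 0 :=
    LinearMap.ext fun m => by
      change freeMap _ (pCoord V y (f.1 (pIncl V x (1 ⊗ₜ m)))) = 0
      rw [h, map_zero]
  rw [entry, this, map_zero]

/-- A nonzero component is a nonzero `𝔤`-map from the simple module at `x` to `Sym^n V` tensored
with the one at `y`. The image of a highest weight vector starts the chain of covers down to `y`. -/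
theorem preceq_of_pCoord_ne_zero [FiniteDimensional ℂ V] (f : frakB V Γ) {x y : Γ}
    {m : Simple b x.1.1} (h : pCoord V y (f.1 (pIncl V x (1 ⊗ₜ m))) ≠ 0) :
    Preceq V y.1 x.1 ∧ ∃ n : ℕ, x.1.2 - y.1.2 = n := by
  obtain ⟨n, hn⟩ : ∃ n : ℕ, x.1.2 - y.1.2 = n := by
    refine ⟨(x.1.2 - y.1.2).toNat, ?_⟩
    by_contra hn
    have := frakB_mem f x y m
    rw [freeGrade_eq_bot (by omega), Submodule.mem_bot] at this
    exact h this
  obtain ⟨t, ht0, ht⟩ := exists_isHighest_of_hom (n := n) (genRestrictLie x (pCoord V y ∘ₗ f.1))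
    (fun m => by rw [← hn]; exact frakB_mem f x y m) h
  have := preceq_of_isHighest (isDerAction_sym L V) ht0 ht y.1.2
  rw [← hn, add_sub_cancel] at this
  exact ⟨this, n, hn⟩

theorem aPsi_induction {Ψ : Finset (Module.Dual ℂ H)} {p : BigA b V → Prop} (zero : p 0)
    (add : ∀ α β, p α → p β → p (α + β))
    (piece : ∀ x y : Γ, LePsi Ψ y.1.1.1 x.1.1.1 →
      ∀ β ∈ bigAGrade b V (dPsi Ψ y.1.1.1 x.1.1.1), p (idem b V x.1.1 * β * idem b V y.1.1))
    {α : BigA b V} (hα : α ∈ aPsi V b Ψ (proj Γ)) : p α := by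
  refine Submodule.iSup_induction _ (motive := p) hα (fun μ α hα => ?_) zero add
  refine Submodule.iSup_induction _ (motive := p) hα (fun hμ α hα => ?_) zero add
  refine Submodule.iSup_induction _ (motive := p) hα (fun ν α hα => ?_) zero add
  refine Submodule.iSup_induction _ (motive := p) hα (fun hν α hα => ?_) zero add
  refine Submodule.iSup_induction _ (motive := p) hα (fun hle α hα => ?_) zero add
  obtain ⟨r, hr⟩ := hμ
  obtain ⟨s, hs⟩ := hν
  obtain ⟨β, hβ, rfl⟩ := hα
  exact piece ⟨_, hs⟩ ⟨_, hr⟩ hle β hβ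

/-- Split into matrix entries. A nonzero entry at `(x, y)` forces `y ≼ x`, so its weights are
comparable for `≤_Ψ` and its symmetric degree `x.2 - y.2` is the required `d_Ψ`. -/
theorem toBigA_mem_aPsiInv [FiniteDimensional ℂ V] {Ψ : Finset (Module.Dual ℂ H)}
    (hp : ∀ x y : Γ, Preceq V y.1 x.1 → LePsi Ψ y.1.1.1 x.1.1.1 ∧
      (dPsi Ψ y.1.1.1 x.1.1.1 : ℤ) = x.1.2 - y.1.2) (f : frakB V Γ) :
    toBigA V Γ f ∈ aPsiInv V b Ψ (proj Γ) := by
  refine ⟨?_, (LieModule.mem_maxTrivSubmodule ℂ L _ _).2 fun z => lie_toBigA z f⟩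
  change toBigA V Γ f ∈ aPsi V b Ψ (proj Γ)
  rw [toBigA_eq_sum_entry]
  refine sum_mem fun x _ => sum_mem fun y _ => ?_
  by_cases h : ∀ m, pCoord V y (f.1 (pIncl V x (1 ⊗ₜ m))) = 0
  · rw [entry_eq_zero f h]
    exact zero_mem _
  · obtain ⟨m, hm⟩ := not_forall.1 h
    obtain ⟨h1, h2⟩ := hp x y (preceq_of_pCoord_ne_zero f hm).1
    refine Submodule.mem_iSup_of_mem y.1.1 (Submodule.mem_iSup_of_mem ⟨y.1.2, y.2⟩
      (Submodule.mem_iSup_of_mem x.1.1 (Submodule.mem_iSup_of_mem ⟨x.1.2, x.2⟩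
        (Submodule.mem_iSup_of_mem h1 ⟨entry f x y, entry_mem_bigAGrade f h2.symm, ?_⟩))))
    change idem b V x.1.1 * entry f x y * idem b V y.1.1 = entry f x y
    rw [idem_mul_entry, entry_mul_idem]

theorem toBigA_injective (hinj : ∀ x y : Γ, x.1.1 = y.1.1 → x = y) :
    Function.Injective (toBigA V Γ) := by
  refine (injective_iff_map_eq_zero _).2 fun f hf => ?_
  refine Subtype.ext (pGamma_hom_ext fun x m => bigIncl_injective hinj ?_)
  rw [← row_toBigA hinj f x m, hf, map_zero, LinearMap.zero_apply]
  exact (map_zero (bigIncl V Γ)).symm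

theorem row_idem_mul_idem (μ ν : Dominant b) (β : BigA b V) (w : BigV b) :
    row b V (idem b V μ * β * idem b V ν) w =
      freeMap (bigOf ν) (freeMap (bigComp ν) (row b V β (bigOf μ (bigComp μ w)))) := by
  rw [row_mul, symExt_row_idem, row_mul, row_idem, symExt_tmul, map_one, one_smul]

theorem sumIdem_mul_of_mem (hinj : ∀ x y : Γ, x.1.1 = y.1.1 → x = y)
    {Ψ : Finset (Module.Dual ℂ H)} {α : BigA b V} (hα : α ∈ aPsi V b Ψ (proj Γ)) :
    sumIdem V Γ * α = α := by
  refine aPsi_induction (p := fun α => sumIdem V Γ * α = α) (mul_zero _) (fun α β h h' => by rw [mul_add, h, h'])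
    (fun x y _ β _ => ?_) hα
  have h : ∀ z : Γ, z ≠ x → idem b V z.1.1 * idem b V x.1.1 = 0 := fun z hz => by
    rw [← emb_row]
    have : row b V (idem b V x.1.1) ∘ₗ (bigOf z.1.1 : Simple b z.1.1 →ₗ[ℂ] BigV b) = 0 :=
      LinearMap.ext fun m => by
        refine (row_idem x.1.1 (bigOf z.1.1 m)).trans ?_
        rw [bigComp_bigOf_of_ne (fun h => hz (hinj _ _ h.symm)), map_zero, TensorProduct.tmul_zero]
        rfl
    rw [this, map_zero]
  have h' := idem_mul_idem (V := V) x.1.1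
  have hs : sumIdem V Γ * idem b V x.1.1 = idem b V x.1.1 := by
    rw [sumIdem, Finset.sum_mul, Finset.sum_eq_single x (fun z _ hz => h z hz)
      (fun h => absurd (Finset.mem_univ x) h), h']
  rw [← mul_assoc, ← mul_assoc, hs]

theorem freeMap_row_mem (hinj : ∀ x y : Γ, x.1.1 = y.1.1 → x = y)
    {Ψ : Finset (Module.Dual ℂ H)}
    (hd : ∀ x y : Γ, LePsi Ψ y.1.1.1 x.1.1.1 → (dPsi Ψ y.1.1.1 x.1.1.1 : ℤ) = x.1.2 - y.1.2)
    {α : BigA b V} (hα : α ∈ aPsi V b Ψ (proj Γ)) (x y : Γ) (m : Simple b x.1.1) :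
    freeMap (bigComp y.1.1) (row b V α (bigOf x.1.1 m)) ∈
      freeGrade V (Simple b y.1.1) (x.1.2 - y.1.2) := by
  refine aPsi_induction (p := fun α => freeMap (bigComp y.1.1) (row b V α (bigOf x.1.1 m)) ∈
      freeGrade V (Simple b y.1.1) (x.1.2 - y.1.2)) ?_ (fun α β h h' => ?_)
    (fun x' y' hle β hβ => ?_) hα
  · rw [map_zero, LinearMap.zero_apply, map_zero]
    exact zero_mem _
  · rw [map_add, LinearMap.add_apply, map_add]
    exact add_mem h h'
  · rw [row_idem_mul_idem]
    by_cases hy : y = y'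
    · subst hy
      rw [freeMap_bigComp_bigOf_self]
      by_cases hx : x = x'
      · subst hx
        rw [← hd x y hle]
        exact freeMap_mem_freeGrade _ (row_mem_freeGrade hβ _)
      · rw [bigComp_bigOf_of_ne (fun h => hx (hinj _ _ h.symm)), map_zero, map_zero, map_zero]
        exact zero_mem _
    · rw [freeMap_bigComp_bigOf_of_ne (fun h => hy (hinj _ _ h))]
      exact zero_mem _

theorem bigIncl_bigProj_row (hinj : ∀ x y : Γ, x.1.1 = y.1.1 → x = y)
    {Ψ : Finset (Module.Dual ℂ H)} {α : BigA b V} (hα : α ∈ aPsi V b Ψ (proj Γ)) (w : BigV b) :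
    bigIncl V Γ (bigProj V Γ (row b V α w)) = row b V α w := by
  refine aPsi_induction (p := fun α => bigIncl V Γ (bigProj V Γ (row b V α w)) = row b V α w)
    ?_ (fun α β h h' => ?_) (fun x y _ β _ => ?_) hα
  · rw [map_zero, LinearMap.zero_apply, map_zero, map_zero]
  · rw [map_add, LinearMap.add_apply, map_add, map_add, h, h']
  · rw [row_idem_mul_idem]
    generalize freeMap (bigComp y.1.1) (row b V β (bigOf x.1.1 (bigComp x.1.1 w))) = t
    rw [← bigIncl_pIncl y t, bigProj_bigIncl hinj]

/-- The rows of an invariant element are equivariant, so they extend to the free modules by the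
universal property. Projecting back to `P(Γ)` loses nothing for elements of `𝐀_Ψ(π₁ Γ)`, and the
result preserves degrees by `hd`. -/
theorem exists_toBigA_eq (hinj : ∀ x y : Γ, x.1.1 = y.1.1 → x = y)
    {Ψ : Finset (Module.Dual ℂ H)}
    (hd : ∀ x y : Γ, LePsi Ψ y.1.1.1 x.1.1.1 → (dPsi Ψ y.1.1.1 x.1.1.1 : ℤ) = x.1.2 - y.1.2)
    {α : BigA b V} (hα : α ∈ aPsiInv V b Ψ (proj Γ)) : ∃ f : frakB V Γ, toBigA V Γ f = α := by
  have hα1 : α ∈ aPsi V b Ψ (proj Γ) := hα.1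
  have hα2 : ∀ z : L, ⁅z, α⁆ = 0 := (LieModule.mem_maxTrivSubmodule ℂ L _ _).1 hα.2
  have hlie : ∀ (z : L) w, row b V α ⁅z, w⁆ = ⁅z, row b V α w⁆ := fun z w => by
    have := row_lie z α w
    rw [hα2, map_zero] at this
    exact (sub_eq_zero.1 this.symm).symm
  let F : PGamma V Γ →ₗ[Ua L V] PGamma V Γ := pLift fun x =>
    bigProj V Γ ∘ₗ freeLift (row b V α ∘ₗ (bigOf x.1.1 : Simple b x.1.1 →ₗ[ℂ] BigV b))
      (fun z m => by
        rw [uaGen_inl_smul, LinearMap.comp_apply, LinearMap.comp_apply]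
        refine Eq.trans ?_ (hlie z _)
        exact congrArg _ ((bigOf x.1.1).map_lie z m))
  have hF : ∀ (x : Γ) m, F (pIncl V x (1 ⊗ₜ m)) = bigProj V Γ (row b V α (bigOf x.1.1 m)) :=
    fun x m => by
      rw [pLift_pIncl, LinearMap.comp_apply, freeLift_one_tmul]
      rfl
  let f : frakB V Γ := ⟨F, mem_frakB_iff.2 fun x y m => by
    rw [hF, pCoord_bigProj]
    exact freeMap_row_mem hinj hd hα1 x y m⟩
  refine ⟨f, eq_of_row (sumIdem_mul_toBigA hinj f) (sumIdem_mul_of_mem hinj hα1) fun x m => ?_⟩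
  rw [row_toBigA hinj]
  exact (congrArg _ (hF x m)).trans (bigIncl_bigProj_row hinj hα1 _)

theorem mem_frakBGrade_iff_toBigA [FiniteDimensional ℂ V]
    (hinj : ∀ x y : Γ, x.1.1 = y.1.1 → x = y) (k : ℕ)
    (f : frakB V Γ) : f ∈ frakBGrade V Γ k ↔ toBigA V Γ f ∈ bigAGrade b V k := by
  rw [mem_frakBGrade_iff]
  constructor
  · intro h
    rw [toBigA_eq_sum_entry]
    refine sum_mem fun x _ => sum_mem fun y _ => ?_
    by_cases hxy : y.1.2 = x.1.2 - k
    · exact entry_mem_bigAGrade f (by omega)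
    · rw [entry_eq_zero f fun m => h x y hxy _]
      exact zero_mem _
  · intro h x y hxy t
    have : pCoord V y ∘ₗ f.1 ∘ₗ pIncl V x = 0 := free_ext fun m => by
      -- The component lies both in degree `k`, by assumption on the image, and in degree `x.2 -
      -- y.2`, as `f` preserves degrees; these differ.
      refine eq_zero_of_mem_freeGrade (k := k) (l := x.1.2 - y.1.2) (by omega) ?_
        (frakB_mem f x y m)
      have h1 := freeMap_mem_freeGrade (bigComp y.1.1) (row_mem_freeGrade h (bigOf x.1.1 m))
      rwa [row_toBigA hinj, ← pCoord_bigProj, bigProj_bigIncl hinj] at h1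
    exact LinearMap.congr_fun this t

/-- The isomorphism between `𝔅(Γ)^op` and `𝐀_Ψ(π₁(Γ))^𝔤`. -/
theorem exists_equiv_aPsiInv [FiniteDimensional ℂ V] (hinj : ∀ x y : Γ, x.1.1 = y.1.1 → x = y)
    {Ψ : Finset (Module.Dual ℂ H)}
    (hp : ∀ x y : Γ, Preceq V y.1 x.1 → LePsi Ψ y.1.1.1 x.1.1.1 ∧
      (dPsi Ψ y.1.1.1 x.1.1.1 : ℤ) = x.1.2 - y.1.2)
    (hd : ∀ x y : Γ, LePsi Ψ y.1.1.1 x.1.1.1 → (dPsi Ψ y.1.1.1 x.1.1.1 : ℤ) = x.1.2 - y.1.2) :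
    ∃ φ : (frakB V Γ)ᵐᵒᵖ ≃ₗ[ℂ] aPsiInv V b Ψ (proj Γ),
      (∀ f g, (φ (f * g) : BigA b V) = φ f * φ g) ∧
      ∀ (k : ℕ) (f : (frakB V Γ)ᵐᵒᵖ),
        f.unop ∈ frakBGrade V Γ k ↔ (φ f : BigA b V) ∈ bigAGrade b V k := by
  let φ : frakB V Γ ≃ₗ[ℂ] aPsiInv V b Ψ (proj Γ) := LinearEquiv.ofBijective
    ((toBigA V Γ).codRestrict _ (toBigA_mem_aPsiInv hp))
    ⟨fun f g h => toBigA_injective hinj (congrArg Subtype.val h), fun α => by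
      obtain ⟨f, hf⟩ := exists_toBigA_eq hinj hd α.2
      exact ⟨f, Subtype.ext hf⟩⟩
  refine ⟨(MulOpposite.opLinearEquiv ℂ).symm.trans φ, fun f g => ?_, fun k f => ?_⟩
  · exact toBigA_mul hinj f.unop g.unop
  · exact mem_frakBGrade_iff_toBigA hinj k f.unop

end Comparison

/-! ### Projective dimension from resolutions -/

section Homological

open CategoryTheory

variable {R : Type w} [Ring R]

theorem hasProjectiveDimensionLT_of_surjective {M N : Type w} [AddCommGroup M] [Module R M]
    [AddCommGroup N] [Module R N] {f : M →ₗ[R] N} (hf : Function.Surjective f) {n : ℕ}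
    (h1 : HasProjectiveDimensionLT (ModuleCat.of R (LinearMap.ker f)) n)
    (h2 : HasProjectiveDimensionLT (ModuleCat.of R M) (n + 1)) :
    HasProjectiveDimensionLT (ModuleCat.of R N) (n + 1) :=
  (LinearMap.shortExact_shortComplexKer hf).hasProjectiveDimensionLT_X₃ n h1 h2

theorem hasProjectiveDimensionLT_of_quotient {M : Type w} [AddCommGroup M] [Module R M]
    (N : Submodule R M) {n : ℕ} (h1 : HasProjectiveDimensionLT (ModuleCat.of R N) n)
    (h2 : HasProjectiveDimensionLT (ModuleCat.of R (M ⧸ N)) n) :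
    HasProjectiveDimensionLT (ModuleCat.of R M) n := by
  have h := LinearMap.shortExact_shortComplexKer N.mkQ_surjective
  refine h.hasProjectiveDimensionLT_X₂ n ?_ h2
  change HasProjectiveDimensionLT (ModuleCat.of R (LinearMap.ker N.mkQ)) n
  rwa [Submodule.ker_mkQ]

theorem hasProjectiveDimensionLT_of_subsingleton (M : Type w) [AddCommGroup M] [Module R M]
    [Subsingleton M] (n : ℕ) : HasProjectiveDimensionLT (ModuleCat.of R M) n := by
  have : HasProjectiveDimensionLT (ModuleCat.of R M) 0 :=
    (ModuleCat.isZero_of_subsingleton (ModuleCat.of R M)).hasProjectiveDimensionLT_zero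
  exact hasProjectiveDimensionLT_of_ge _ 0 n (Nat.zero_le n)

theorem hasProjectiveDimensionLT_one (M : Type w) [AddCommGroup M] [Module R M]
    [Module.Projective R M] : HasProjectiveDimensionLT (ModuleCat.of R M) 1 :=
  projective_iff_hasProjectiveDimensionLT_one.1 inferInstance

variable {F : ℕ → Type w} [∀ j, AddCommGroup (F j)] [∀ j, Module R (F j)]

/-- Dimension shifting along `0 → range d_{j+1} → F_{j+1} → range d_j → 0`. It starts where `F_{j+1}
= 0`, since the zero module has projective dimension less than `0`. -/
theorem hasProjectiveDimensionLT_range {d : ∀ j, F (j + 1) →ₗ[R] F j}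
    (hd : ∀ j, LinearMap.ker (d j) = LinearMap.range (d (j + 1)))
    (hproj : ∀ j, Module.Projective R (F j)) {N : ℕ} (hN : ∀ j, N < j → Subsingleton (F j))
    (n j : ℕ) (hnj : N ≤ j + n) :
    HasProjectiveDimensionLT (ModuleCat.of R (LinearMap.range (d j))) n := by
  induction n generalizing j with
  | zero =>
    have := hN (j + 1) (by omega)
    have : Subsingleton (LinearMap.range (d j)) := by
      refine ⟨?_⟩
      rintro ⟨_, a, rfl⟩ ⟨_, c, rfl⟩
      rw [Subsingleton.elim a c]
    exact hasProjectiveDimensionLT_of_subsingleton _ 0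
  | succ n ih =>
    refine hasProjectiveDimensionLT_of_surjective (d j).surjective_rangeRestrict ?_ ?_
    · rw [LinearMap.ker_rangeRestrict, hd]
      exact ih (j + 1) (by omega)
    · have := hproj (j + 1)
      have := hasProjectiveDimensionLT_one (R := R) (F (j + 1))
      exact hasProjectiveDimensionLT_of_ge _ 1 (n + 1) (by omega)

/-- The image of a map on a direct sum of copies of `F 0` which kills exactly the sums of
boundaries has projective dimension at most `N`. -/
theorem hasProjectiveDimensionLT_range_finsupp {d : ∀ j, F (j + 1) →ₗ[R] F j}
    (hd : ∀ j, LinearMap.ker (d j) = LinearMap.range (d (j + 1)))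
    (hproj : ∀ j, Module.Projective R (F j)) {N : ℕ} (hN : ∀ j, N < j → Subsingleton (F j))
    {ι M : Type w} [AddCommGroup M] [Module R M] (π : (ι →₀ F 0) →ₗ[R] M)
    (hπ : ∀ h, π h = 0 ↔ ∀ i, h i ∈ LinearMap.range (d 0)) :
    HasProjectiveDimensionLT (ModuleCat.of R (LinearMap.range π)) (N + 1) := by
  classical
  -- The direct sum of copies of the complex is again exact with projective terms, vanishes beyond
  -- `N`, and resolves the image of `π`.
  let D : ∀ j, (ι →₀ F (j + 1)) →ₗ[R] (ι →₀ F j) := fun j => Finsupp.mapRange.linearMap (d j)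
  have hmem : ∀ j (h : ι →₀ F j), h ∈ LinearMap.range (D j) ↔
      ∀ i, h i ∈ LinearMap.range (d j) := by
    intro j h
    constructor
    · rintro ⟨g, rfl⟩ i
      exact ⟨g i, by simp [D]⟩
    · intro hi
      choose g hg using hi
      refine ⟨∑ i ∈ h.support, Finsupp.single i (g i), ?_⟩
      rw [map_sum]
      conv_rhs => rw [← Finsupp.sum_single h]
      refine Finset.sum_congr rfl fun i _ => ?_
      simp [D, hg]
  have hD : ∀ j, LinearMap.ker (D j) = LinearMap.range (D (j + 1)) := by
    intro j
    ext h
    rw [hmem, ← hd, LinearMap.mem_ker, Finsupp.ext_iff]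
    simp [D]
  have hP : ∀ j, Module.Projective R (ι →₀ F j) := fun j =>
    have := hproj j
    Module.Projective.of_equiv' (finsuppLequivDFinsupp (ι := ι) (M := F j) R).symm
  have hS : ∀ j, N < j → Subsingleton (ι →₀ F j) := fun j hj =>
    have := hN j hj
    inferInstance
  refine hasProjectiveDimensionLT_of_surjective π.surjective_rangeRestrict ?_ ?_
  · have : LinearMap.ker π.rangeRestrict = LinearMap.range (D 0) := by
      ext h
      rw [LinearMap.ker_rangeRestrict, LinearMap.mem_ker, hπ, hmem]
    rw [this]
    exact hasProjectiveDimensionLT_range hD hP hS N 0 (by omega)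
  · have := hP 0
    have := hasProjectiveDimensionLT_one (R := R) (ι →₀ F 0)
    exact hasProjectiveDimensionLT_of_ge _ 1 (N + 1) (by omega)

end Homological

/-! ### Graded homomorphisms from `P(Γ)` -/

section HomP

variable {L : Type u} [LieRing L] [LieAlgebra ℂ L] [FiniteDimensional ℂ L]
  [LieAlgebra.IsSemisimple ℂ L]
variable {H : LieSubalgebra ℂ L} [H.IsCartanSubalgebra]
variable {b : (LieAlgebra.IsKilling.rootSystem H).Base}
variable {V : Type v} [AddCommGroup V] [Module ℂ V] [LieRingModule L V] [LieModule ℂ L V]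
variable {Γ : Finset (Lam b)}

section General

variable {T : Type*} [AddCommGroup T] [Module ℂ T] [Module (Ua L V) T] [IsScalarTower ℂ (Ua L V) T]

variable (V Γ T) in
/-- The homomorphisms from `P(Γ)` to `T`. -/
def HomP : Type _ := PGamma V Γ →ₗ[Ua L V] T

instance : AddCommGroup (HomP V Γ T) := inferInstanceAs (AddCommGroup (PGamma V Γ →ₗ[Ua L V] T))

/-- `𝔅(Γ)^op` acts on the homomorphisms by composition. -/
instance : Module (frakB V Γ)ᵐᵒᵖ (HomP V Γ T) where
  smul r h := LinearMap.comp (h : PGamma V Γ →ₗ[Ua L V] T) r.unop.1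
  one_smul _ := LinearMap.comp_id _
  mul_smul _ _ _ := (LinearMap.comp_assoc _ _ _).symm
  smul_zero _ := LinearMap.zero_comp _
  smul_add _ _ _ := LinearMap.add_comp _ _ _
  add_smul _ _ _ := LinearMap.comp_add _ _ _
  zero_smul _ := LinearMap.comp_zero _

/-- A homomorphism, as a map. -/
def HomP.toHom (h : HomP V Γ T) : PGamma V Γ →ₗ[Ua L V] T := h

variable (V Γ) in
/-- The homomorphisms which respect the gradings. -/
def grHom (G : ℤ → Submodule ℂ T) : Submodule (frakB V Γ)ᵐᵒᵖ (HomP V Γ T) where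
  carrier := {h | ∀ k, ∀ p ∈ pGammaGrade V Γ k, h.toHom p ∈ G k}
  add_mem' hf hg k p hp := add_mem (hf k p hp) (hg k p hp)
  zero_mem' k _ _ := zero_mem (G k)
  smul_mem' r _ hh k p hp := hh k _ (r.unop.2 k p hp)

end General

variable {W : Type w} [AddCommGroup W] [Module ℂ W] [LieRingModule L W] [LieModule ℂ L W]
variable {W' : Type*} [AddCommGroup W'] [Module ℂ W'] [LieRingModule L W'] [LieModule ℂ L W']

variable (V Γ W) in
/-- The graded homomorphisms from `P(Γ)` to `Sym V ⊗ W`, with `W` in degree `t`. -/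
def FreeHom (t : ℤ) : Type (max u v w) :=
  grHom V Γ (T := SymmetricAlgebra ℂ V ⊗[ℂ] W) fun k => freeGrade V W (k - t)

instance (t : ℤ) : AddCommGroup (FreeHom V Γ W t) :=
  inferInstanceAs (AddCommGroup
    (grHom V Γ (T := SymmetricAlgebra ℂ V ⊗[ℂ] W) fun k => freeGrade V W (k - t)))

instance (t : ℤ) : Module (frakB V Γ)ᵐᵒᵖ (FreeHom V Γ W t) :=
  inferInstanceAs (Module (frakB V Γ)ᵐᵒᵖ
    (grHom V Γ (T := SymmetricAlgebra ℂ V ⊗[ℂ] W) fun k => freeGrade V W (k - t)))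

namespace FreeHom

variable {t : ℤ}

/-- The underlying homomorphism. -/
def toHom (h : FreeHom V Γ W t) : PGamma V Γ →ₗ[Ua L V] SymmetricAlgebra ℂ V ⊗[ℂ] W := h.1.toHom

theorem toHom_mem (h : FreeHom V Γ W t) {k : ℤ} {p : PGamma V Γ} (hp : p ∈ pGammaGrade V Γ k) :
    h.toHom p ∈ freeGrade V W (k - t) := h.2 k p hp

theorem toHom_gen_mem (h : FreeHom V Γ W t) (x : Γ) (m : Simple b x.1.1) :
    h.toHom (pIncl V x (1 ⊗ₜ m)) ∈ freeGrade V W (x.1.2 - t) :=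
  h.toHom_mem (pIncl_mem_pGammaGrade (by rw [sub_self]; exact one_tmul_mem_freeGrade m))

theorem ext {h h' : FreeHom V Γ W t}
    (H : ∀ x m, h.toHom (pIncl V x (1 ⊗ₜ m)) = h'.toHom (pIncl V x (1 ⊗ₜ m))) : h = h' :=
  Subtype.ext (pGamma_hom_ext (f := h.toHom) (g := h'.toHom) H)

theorem zero_toHom (p : PGamma V Γ) : (0 : FreeHom V Γ W t).toHom p = 0 := rfl

/-- A homomorphism with homogeneous values on the generators. -/
def mk (f : PGamma V Γ →ₗ[Ua L V] SymmetricAlgebra ℂ V ⊗[ℂ] W)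
    (hf : ∀ x m, f (pIncl V x (1 ⊗ₜ m)) ∈ freeGrade V W (x.1.2 - t)) : FreeHom V Γ W t :=
  ⟨f, fun k p hp => by
    change f p ∈ _
    rw [hom_apply_eq_sum f p]
    refine sum_mem fun x _ => ?_
    have := map_mem_freeGrade (f ∘ₗ pIncl V x) (hf x) (mem_pGammaGrade_iff.1 hp x)
    rwa [sub_add_sub_cancel] at this⟩

theorem mk_toHom (f : PGamma V Γ →ₗ[Ua L V] SymmetricAlgebra ℂ V ⊗[ℂ] W)
    (hf : ∀ x m, f (pIncl V x (1 ⊗ₜ m)) ∈ freeGrade V W (x.1.2 - t)) (p : PGamma V Γ) :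
    (mk f hf).toHom p = f p := rfl

/-- Composition with a homogeneous homomorphism. -/
def post {t' : ℤ} (g : SymmetricAlgebra ℂ V ⊗[ℂ] W →ₗ[Ua L V] SymmetricAlgebra ℂ V ⊗[ℂ] W')
    (hg : ∀ k s, s ∈ freeGrade V W (k - t) → g s ∈ freeGrade V W' (k - t')) :
    FreeHom V Γ W t →ₗ[(frakB V Γ)ᵐᵒᵖ] FreeHom V Γ W' t' where
  toFun h := mk (g ∘ₗ h.toHom) fun x m => hg _ _ (h.toHom_gen_mem x m)
  map_add' _ _ := FreeHom.ext fun _ _ => map_add g _ _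
  map_smul' _ _ := rfl

variable (V Γ t) in
/-- The map of graded homomorphisms given by an equivariant map. -/
def map (g : W →ₗ⁅ℂ, L⁆ W') : FreeHom V Γ W t →ₗ[(frakB V Γ)ᵐᵒᵖ] FreeHom V Γ W' t :=
  post (freeMap g) fun _ _ hs => freeMap_mem_freeGrade g hs

theorem projective_of_retract (i : W →ₗ⁅ℂ, L⁆ W') (s : W' →ₗ⁅ℂ, L⁆ W) (hsi : ∀ w, s (i w) = w)
    [Module.Projective (frakB V Γ)ᵐᵒᵖ (FreeHom V Γ W' t)] :
    Module.Projective (frakB V Γ)ᵐᵒᵖ (FreeHom V Γ W t) := by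
  refine Module.Projective.of_split (map V Γ t i) (map V Γ t s) (LinearMap.ext fun h => ?_)
  refine FreeHom.ext fun x m => ?_
  have : freeMap (V := V) s ∘ₗ freeMap i = LinearMap.id := free_ext fun w => by
    rw [LinearMap.comp_apply, freeMap_tmul, freeMap_tmul, hsi, LinearMap.id_apply]
  exact LinearMap.congr_fun this _

theorem projective_of_sum {W'' : Type*} [AddCommGroup W''] [Module ℂ W''] [LieRingModule L W'']
    [LieModule ℂ L W''] (i : W →ₗ⁅ℂ, L⁆ W') (s : W' →ₗ⁅ℂ, L⁆ W) (i' : W →ₗ⁅ℂ, L⁆ W'')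
    (s' : W'' →ₗ⁅ℂ, L⁆ W) (hsi : ∀ w, s (i w) + s' (i' w) = w)
    [Module.Projective (frakB V Γ)ᵐᵒᵖ (FreeHom V Γ W' t)]
    [Module.Projective (frakB V Γ)ᵐᵒᵖ (FreeHom V Γ W'' t)] :
    Module.Projective (frakB V Γ)ᵐᵒᵖ (FreeHom V Γ W t) := by
  refine Module.Projective.of_split ((map V Γ t i).prod (map V Γ t i'))
    ((map V Γ t s).coprod (map V Γ t s')) (LinearMap.ext fun h => ?_)
  refine FreeHom.ext fun x m => ?_
  have : freeMap (V := V) s ∘ₗ freeMap i + freeMap (V := V) s' ∘ₗ freeMap i' = LinearMap.id :=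
    free_ext fun w => by
      rw [LinearMap.add_apply, LinearMap.comp_apply, LinearMap.comp_apply, freeMap_tmul,
        freeMap_tmul, freeMap_tmul, freeMap_tmul, ← TensorProduct.tmul_add, hsi,
        LinearMap.id_apply]
  exact LinearMap.congr_fun this _

/-- The inclusion of the graded homomorphisms into a summand of `P(Γ)` into `𝔅(Γ)^op`. -/
def toOp (x : Γ) : FreeHom V Γ (Simple b x.1.1) x.1.2 →ₗ[(frakB V Γ)ᵐᵒᵖ] (frakB V Γ)ᵐᵒᵖ where
  toFun h := MulOpposite.op ⟨pIncl V x ∘ₗ h.toHom, fun _ _ hp =>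
    pIncl_mem_pGammaGrade (h.toHom_mem hp)⟩
  map_add' _ _ := MulOpposite.unop_injective (Subtype.ext (LinearMap.ext fun _ =>
    map_add (pIncl V x) _ _))
  map_smul' _ _ := rfl

variable (V) in
/-- The projection of `𝔅(Γ)^op` onto the graded homomorphisms into a summand of `P(Γ)`. -/
def ofOp (x : Γ) : (frakB V Γ)ᵐᵒᵖ →ₗ[(frakB V Γ)ᵐᵒᵖ] FreeHom V Γ (Simple b x.1.1) x.1.2 where
  toFun r := mk (pCoord V x ∘ₗ r.unop.1) fun y m => frakB_mem r.unop y x m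
  map_add' _ _ := FreeHom.ext fun _ _ => map_add (pCoord V x) _ _
  map_smul' _ _ := rfl

/-- The graded homomorphisms into one summand of `P(Γ)` form a direct summand of the graded
endomorphisms, that is, of the regular module. -/
theorem projective_simple (x : Γ) :
    Module.Projective (frakB V Γ)ᵐᵒᵖ (FreeHom V Γ (Simple b x.1.1) x.1.2) := by
  refine Module.Projective.of_split (toOp x) (ofOp V x) (LinearMap.ext fun h => ?_)
  exact FreeHom.ext fun y m => pCoord_pIncl_self x _

theorem projective_of_subsingleton [Subsingleton (FreeHom V Γ W t)] :
    Module.Projective (frakB V Γ)ᵐᵒᵖ (FreeHom V Γ W t) :=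
  Module.Projective.of_split (M := (frakB V Γ)ᵐᵒᵖ) 0 0
    (LinearMap.ext fun _ => Subsingleton.elim _ _)

end FreeHom

end HomP

/-! ### The projective modules of the Koszul resolution -/

section Resolution

variable {L : Type u} [LieRing L] [LieAlgebra ℂ L] [FiniteDimensional ℂ L]
  [LieAlgebra.IsSemisimple ℂ L]
variable {H : LieSubalgebra ℂ L} [H.IsCartanSubalgebra]
variable {b : (LieAlgebra.IsKilling.rootSystem H).Base}
variable {V : Type v} [AddCommGroup V] [Module ℂ V] [LieRingModule L V] [LieModule ℂ L V]
  [FiniteDimensional ℂ V]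
variable {Γ : Finset (Lam b)}

section Projective

variable {W : Type w} [AddCommGroup W] [Module ℂ W] [LieRingModule L W] [LieModule ℂ L W]

namespace FreeHom

theorem exists_isHighest {t : ℤ} (h : FreeHom V Γ W t) {y : Γ} {m : Simple b y.1.1}
    (hm : h.toHom (pIncl V y (1 ⊗ₜ m)) ≠ 0) :
    ∃ n : ℕ, y.1.2 - t = n ∧ ∃ z : (isDerAction_sym L V).comp n ⊗[ℂ] W,
      z ≠ 0 ∧ IsHighest b z y.1.1.1 := by
  obtain ⟨n, hn⟩ : ∃ n : ℕ, y.1.2 - t = n := by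
    refine ⟨(y.1.2 - t).toNat, ?_⟩
    by_contra hn
    have := h.toHom_gen_mem y m
    rw [freeGrade_eq_bot (by omega), Submodule.mem_bot] at this
    exact hm this
  exact ⟨n, hn, exists_isHighest_of_hom (n := n) (genRestrictLie y h.toHom)
    (fun m => by rw [← hn]; exact h.toHom_gen_mem y m) hm⟩

theorem preceq {t : ℤ} {ν : Dominant b} (h : FreeHom V Γ (Simple b ν) t) {y : Γ}
    {m : Simple b y.1.1} (hm : h.toHom (pIncl V y (1 ⊗ₜ m)) ≠ 0) : Preceq V (ν, t) y.1 := by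
  obtain ⟨n, hn, z, hz0, hz⟩ := h.exists_isHighest hm
  have := preceq_of_isHighest (isDerAction_sym L V) hz0 hz t
  rwa [← hn, add_sub_cancel] at this

theorem subsingleton_of_forall {t : ℤ}
    (H : ∀ (h : FreeHom V Γ W t) (y : Γ) (m : Simple b y.1.1),
      h.toHom (pIncl V y (1 ⊗ₜ m)) = 0) : Subsingleton (FreeHom V Γ W t) :=
  ⟨fun h h' => FreeHom.ext fun y m => (H h y m).trans (H h' y m).symm⟩

end FreeHom

/-- By Weyl's theorem, simple submodules can be split off, which leaves `W = V(ν)`. If `(ν, t)` is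
in `Γ`, this is a summand of the regular module. Otherwise there is no nonzero homomorphism, as one
would put `(ν, t)` below an element of `Γ`, against `hW`. -/
theorem projective_freeHom [FiniteDimensional ℂ W] {t : ℤ}
    (hW : ∀ (ν : Dominant b) (w : W), w ≠ 0 → IsHighest b w ν.1 →
      (∃ y ∈ Γ, Preceq V (ν, t) y) → (ν, t) ∈ Γ) :
    Module.Projective (frakB V Γ)ᵐᵒᵖ (FreeHom V Γ W t) := by
  induction hn : Module.finrank ℂ W using Nat.strong_induction_on generalizing W with
  | _ n ih =>
  rcases subsingleton_or_nontrivial W with hsub | hnt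
  · have : Subsingleton (FreeHom V Γ W t) := FreeHom.subsingleton_of_forall fun h y m => by
      have : ∀ s : SymmetricAlgebra ℂ V ⊗[ℂ] W, s = 0 := fun s => by
        induction s using TensorProduct.induction_on with
        | zero => rfl
        | tmul s w => rw [Subsingleton.elim w 0, TensorProduct.tmul_zero]
        | add s t hs ht => rw [hs, ht, add_zero]
      exact this _
    exact FreeHom.projective_of_subsingleton
  have htop : (⊤ : LieSubmodule ℂ L W) ≠ ⊥ := fun h => by
    obtain ⟨w, hw⟩ := exists_ne (0 : W)
    have : w ∈ (⊤ : LieSubmodule ℂ L W) := trivial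
    rw [h] at this
    exact hw this
  obtain ⟨S, hS, -⟩ := (eq_bot_or_exists_atom_le (⊤ : LieSubmodule ℂ L W)).resolve_left htop
  have hirr := isIrreducible_of_isAtom hS
  have hSnt := LieModule.nontrivial_of_isIrreducible ℂ L S
  obtain ⟨ν, ⟨e⟩⟩ := exists_equiv_simple b (X := S)
  have hsimple : Module.Projective (frakB V Γ)ᵐᵒᵖ (FreeHom V Γ (Simple b ν) t) := by
    by_cases hν : (ν, t) ∈ Γ
    · exact FreeHom.projective_simple (V := V) (⟨(ν, t), hν⟩ : Γ)
    · have : Subsingleton (FreeHom V Γ (Simple b ν) t) := FreeHom.subsingleton_of_forall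
        fun h y m => by
          by_contra hm
          rcases Simple.subsingleton_or ν with hs | ⟨-, v, hv0, hv⟩
          · exact not_subsingleton S e.toEquiv.symm.subsingleton
          · refine hν (hW ν (e v) (fun h0 => hv0 ?_) ?_ ⟨y.1, y.2, h.preceq hm⟩)
            · have : e v = 0 := Subtype.ext h0
              exact e.injective (this.trans (map_zero e.toLieModuleHom).symm)
            · exact (hv.map e.toLieModuleHom).map S.incl
      exact FreeHom.projective_of_subsingleton
  have hSproj : Module.Projective (frakB V Γ)ᵐᵒᵖ (FreeHom V Γ S t) :=
    FreeHom.projective_of_retract e.symm.toLieModuleHom e.toLieModuleHom e.apply_symm_apply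
  let q : W →ₗ⁅ℂ, L⁆ W ⧸ S := LieSubmodule.Quotient.mk' S
  have hq : Function.Surjective q := LieSubmodule.Quotient.surjective_mk' S
  obtain ⟨σ, hσ⟩ := exists_lieModuleHom_lift q (LieModuleHom.id (R := ℂ) (L := L) (M := W ⧸ S))
    (fun m => hq m)
  have hσ0 : ∀ y, σ y = 0 → y = 0 := fun y hy => by
    have := hσ y
    rw [hy, map_zero] at this
    exact this.symm
  have hQproj : Module.Projective (frakB V Γ)ᵐᵒᵖ (FreeHom V Γ (W ⧸ S) t) := by
    refine ih _ ?_ (fun κ w hw0 hw hy => hW κ (σ w) (fun h => hw0 (hσ0 w h)) (hw.map σ) hy) rfl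
    have h1 := Submodule.finrank_quotient_add_finrank S.toSubmodule
    have h2 : 0 < Module.finrank ℂ S.toSubmodule := Module.finrank_pos (M := S)
    change Module.finrank ℂ (W ⧸ S.toSubmodule) < n
    omega
  have hmem : ∀ w, w - σ (q w) ∈ S := fun w => by
    have : q (w - σ (q w)) = 0 := by
      rw [map_sub, hσ]
      exact sub_self _
    exact (LieSubmodule.Quotient.mk_eq_zero S).1 this
  let π : W →ₗ⁅ℂ, L⁆ S :=
    { LinearMap.codRestrict S.toSubmodule (LinearMap.id - (σ.comp q : W →ₗ[ℂ] W)) hmem with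
      map_lie' := fun {z w} => Subtype.ext (by
        change ⁅z, w⁆ - σ (q ⁅z, w⁆) = ⁅z, w - σ (q w)⁆
        rw [LieModuleHom.map_lie, LieModuleHom.map_lie, lie_sub]) }
  exact FreeHom.projective_of_sum π S.incl q σ fun w => sub_add_cancel w _

end Projective

/-! ### The Koszul resolution -/

variable (V Γ) in
/-- The terms of the Koszul resolution at `x`. -/
abbrev KoszulTerm (x : Γ) (j : ℕ) : Type (max u v) :=
  FreeHom V Γ (ExtTensor L V (Simple b x.1.1) j) (x.1.2 + j)

variable (V) in
/-- The differential of the Koszul resolution at `x`. -/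
def koszulDiff (x : Γ) (j : ℕ) :
    KoszulTerm V Γ x (j + 1) →ₗ[(frakB V Γ)ᵐᵒᵖ] KoszulTerm V Γ x j :=
  FreeHom.post (koszulMap L V (Simple b x.1.1) j) fun k s hs => by
    have := koszulMap_mem j hs
    have h : k - (x.1.2 + ((j + 1 : ℕ) : ℤ)) + 1 = k - (x.1.2 + (j : ℤ)) := by push_cast; ring
    rwa [h] at this

theorem koszulDiff_toHom (x : Γ) (j : ℕ) (h : KoszulTerm V Γ x (j + 1)) (p : PGamma V Γ) :
    (koszulDiff V x j h).toHom p = koszulMap L V _ j (h.toHom p) := rfl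

/-- A homomorphism is determined by its values on the generators at each `y`, and these are lifted
through the Koszul differential by Weyl's theorem. Their total degree is `y.2 - x.2`; the assumption
`hx` disposes of the case where it is zero and the Koszul complex may fail to be exact. -/
theorem exists_koszulDiff_eq (x : Γ) (j : ℕ) (h : KoszulTerm V Γ x j)
    (h0 : ∀ p, koszulFull L V (Simple b x.1.1)
      (freeMap (extIncl L V (Simple b x.1.1) j) (h.toHom p)) = 0)
    (hx : ∀ y : Γ, y.1.2 = x.1.2 → ∀ m, h.toHom (pIncl V y (1 ⊗ₜ m)) = 0) :
    ∃ h', koszulDiff V x j h' = h := by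
  have key : ∀ y : Γ, ∃ g : Simple b y.1.1 →ₗ⁅ℂ, L⁆ freeGradeLie L V
      (ExtTensor L V (Simple b x.1.1) (j + 1)) (y.1.2 - (x.1.2 + j) - 1),
      ∀ m, koszulMap L V (Simple b x.1.1) j (g m) = h.toHom (pIncl V y (1 ⊗ₜ m)) := by
    intro y
    by_cases hy : y.1.2 = x.1.2
    · refine ⟨0, fun m => ?_⟩
      rw [hx y hy m]
      exact map_zero (koszulMap L V (Simple b x.1.1) j)
    · let p : freeGradeLie L V (ExtTensor L V (Simple b x.1.1) (j + 1))
          (y.1.2 - (x.1.2 + j) - 1) →ₗ⁅ℂ, L⁆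
            SymmetricAlgebra ℂ V ⊗[ℂ] ExtTensor L V (Simple b x.1.1) j :=
        { (koszulMap L V (Simple b x.1.1) j).restrictScalars ℂ ∘ₗ
            (freeGradeLie L V _ _).toSubmodule.subtype with
          map_lie' := fun {z t} => linearMap_lie_of_ua (koszulMap L V (Simple b x.1.1) j) z t }
      refine exists_lieModuleHom_lift p (genRestrictLie y h.toHom) fun m => ?_
      obtain ⟨t', ht', e⟩ := koszulMap_exact (j := j) (n := y.1.2 - (x.1.2 + j))
        (by omega) (h.toHom_gen_mem y m) (h0 _)
      exact ⟨⟨t', ht'⟩, e⟩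
  choose g hg using key
  let f : PGamma V Γ →ₗ[Ua L V]
      SymmetricAlgebra ℂ V ⊗[ℂ] ExtTensor L V (Simple b x.1.1) (j + 1) := pLift fun y =>
    freeLift ((freeGradeLie L V _ _).toSubmodule.subtype ∘ₗ (g y : Simple b y.1.1 →ₗ[ℂ] _))
      (fun z m => by
        rw [uaGen_inl_smul]
        exact congrArg Subtype.val ((g y).map_lie z m))
  have hf : ∀ y m, f (pIncl V y (1 ⊗ₜ m)) = g y m := fun y m => by
    rw [pLift_pIncl, freeLift_one_tmul]
    rfl
  refine ⟨FreeHom.mk f fun y m => ?_, FreeHom.ext fun y m => ?_⟩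
  · rw [hf]
    have : y.1.2 - (x.1.2 + ((j + 1 : ℕ) : ℤ)) = y.1.2 - (x.1.2 + j) - 1 := by push_cast; ring
    rw [this]
    exact (g y m).2
  · rw [koszulDiff_toHom, FreeHom.mk_toHom, hf, hg]

theorem ker_koszulDiff (x : Γ) (j : ℕ) :
    LinearMap.ker (koszulDiff V x j) = LinearMap.range (koszulDiff V x (j + 1)) := by
  ext h
  rw [LinearMap.mem_ker, LinearMap.mem_range]
  constructor
  · intro hh
    refine exists_koszulDiff_eq x (j + 1) h (fun p => ?_) (fun y hy m => ?_)
    · rw [← freeMap_koszulMap]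
      have : koszulMap L V _ j (h.toHom p) = 0 := by
        rw [← koszulDiff_toHom, hh, FreeHom.zero_toHom]
      rw [this, map_zero]
    -- For `y` in the degree of `x`, the symmetric degree would be `-(j + 1)`.
    · have := h.toHom_gen_mem y m
      rwa [freeGrade_eq_bot (by push_cast; omega), Submodule.mem_bot] at this
  · rintro ⟨h', rfl⟩
    refine FreeHom.ext fun y m => ?_
    rw [koszulDiff_toHom, koszulDiff_toHom, koszulMap_koszulMap, FreeHom.zero_toHom]

/-- Boundaries have positive total degree, and conversely exactness holds there. So the cokernel at
the end of the resolution sees only values on generators in the degree of `x`. -/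
theorem mem_range_koszulDiff_zero (x : Γ) (h : KoszulTerm V Γ x 0) :
    h ∈ LinearMap.range (koszulDiff V x 0) ↔
      ∀ y : Γ, y.1.2 = x.1.2 → ∀ m, h.toHom (pIncl V y (1 ⊗ₜ m)) = 0 := by
  constructor
  · rintro ⟨h', rfl⟩ y hy m
    rw [koszulDiff_toHom]
    have := h'.toHom_gen_mem y m
    rw [freeGrade_eq_bot (by push_cast; omega), Submodule.mem_bot] at this
    rw [this, map_zero]
  · intro hh
    exact exists_koszulDiff_eq x 0 h (fun p => koszulFull_freeMap_zero _) hh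

/-- Interval-closedness enters here: a constituent `V(ν)` of `Λ^j V ⊗ V(λ)` yields `(ν, r + j)`
above `x`, and if it also lies below an element of `Γ` it belongs to `Γ`. -/
theorem projective_koszulTerm (hΓ : IntervalClosed V Γ) (x : Γ) (j : ℕ) :
    Module.Projective (frakB V Γ)ᵐᵒᵖ (KoszulTerm V Γ x j) := by
  refine projective_freeHom fun ν w hw0 hw hy => ?_
  obtain ⟨y, hy, hνy⟩ := hy
  exact hΓ x.1 x.2 y hy _ (preceq_of_isHighest (isDerAction_ext L V) hw0 hw x.1.2) hνy

/-- A nonzero element would give a highest weight vector in `Sym^n V ⊗ Λ^j V ⊗ V(λ)` with weight in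
`π₁(Γ)`, so `j ≤ N_Ψ`. This is the source of the bound on the global dimension. -/
theorem subsingleton_koszulTerm {Ψ : Finset (Module.Dual ℂ H)}
    (hwt : (Ψ : Set (Module.Dual ℂ H)) ⊆ wt H V) (hR : Rigid (wt H V) Ψ) {x₀ : Lam b}
    (hx₀ : ∀ x ∈ Γ, PreceqPsi Ψ x₀ x) (x : Γ) (j : ℕ) (hj : nPsi V Ψ < j) :
    Subsingleton (KoszulTerm V Γ x j) := by
  refine FreeHom.subsingleton_of_forall fun h y m => ?_
  by_contra hm
  obtain ⟨n, hn, z, hz0, hz⟩ := h.exists_isHighest hm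
  have := le_nPsi_of_isHighest hwt hR (hx₀ x.1 x.2) (hx₀ y.1 y.2) (n := n) (j := j) (by omega)
    hz0 hz
  omega

end Resolution

/-! ### The global dimension of `𝔅(Γ)^op` -/

section GlobalDim

variable {L : Type u} [LieRing L] [LieAlgebra ℂ L] [FiniteDimensional ℂ L]
  [LieAlgebra.IsSemisimple ℂ L]
variable {H : LieSubalgebra ℂ L} [H.IsCartanSubalgebra]
variable {b : (LieAlgebra.IsKilling.rootSystem H).Base}
variable {V : Type v} [AddCommGroup V] [Module ℂ V] [LieRingModule L V] [LieModule ℂ L V]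
variable {Γ : Finset (Lam b)}

theorem Preceq.eq_or_lt {x y : Lam b} (h : Preceq V x y) : x = y ∨ x.2 < y.2 := by
  induction h with
  | refl => exact Or.inl rfl
  | tail _ hc ih =>
    right
    have := hc.1
    rcases ih with rfl | ih <;> omega

variable (V) in
/-- The idempotent of `𝔅(Γ)` given by the projection onto a summand. -/
def vertex (x : Γ) : frakB V Γ :=
  ⟨pIncl V x ∘ₗ pCoord V x, fun _ _ hp => pIncl_mem_pGammaGrade (mem_pGammaGrade_iff.1 hp x)⟩

theorem vertex_mul_self (x : Γ) : vertex V x * vertex V x = vertex V x :=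
  Subtype.ext (LinearMap.ext fun p =>
    congrArg (pIncl V x) (pCoord_pIncl_self x (pCoord V x p)))

theorem sum_vertex : ∑ x : Γ, vertex V x = 1 := by
  refine Subtype.ext (LinearMap.ext fun p => ?_)
  have : (∑ x : Γ, vertex V x).1 = ∑ x : Γ, (vertex V x).1 := map_sum (frakB V Γ).val _ _
  rw [this, LinearMap.sum_apply]
  exact sum_pIncl_pCoord p

/-- A nonzero component from `y` to `x` forces `x ≼ y`, hence `x = y` or a strictly smaller degree
at `x`: the algebra is triangular. -/
theorem pCoord_frakB_eq_zero_of_le [FiniteDimensional ℂ V] (f : frakB V Γ) {x y : Γ}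
    (hxy : x ≠ y) (h : y.1.2 ≤ x.1.2) (t : FreeSimple V y.1.1) :
    pCoord V x (f.1 (pIncl V y t)) = 0 := by
  have : pCoord V x ∘ₗ f.1 ∘ₗ pIncl V y = 0 := free_ext fun m => by
    by_contra hm
    rcases (preceq_of_pCoord_ne_zero f hm).1.eq_or_lt with h' | h'
    · exact hxy (Subtype.ext h')
    · omega
  exact LinearMap.congr_fun this t

theorem vertex_mul_mul_vertex_apply (f : frakB V Γ) (x y : Γ) (p : PGamma V Γ) :
    (vertex V x * f * vertex V y).1 p = pIncl V x (pCoord V x (f.1 (pIncl V y (pCoord V y p)))) :=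
  rfl

theorem vertex_mul_mul_vertex_of_le [FiniteDimensional ℂ V] (f : frakB V Γ) {x y : Γ}
    (hxy : x ≠ y) (h : y.1.2 ≤ x.1.2) : vertex V x * f * vertex V y = 0 := by
  refine Subtype.ext (LinearMap.ext fun p => ?_)
  rw [vertex_mul_mul_vertex_apply, pCoord_frakB_eq_zero_of_le f hxy h, map_zero]
  rfl

/-- Schur's lemma. -/
theorem exists_eq_smul_of_irreducible {X : Type*} [AddCommGroup X] [Module ℂ X]
    [LieRingModule L X] [LieModule ℂ L X] [FiniteDimensional ℂ X]
    (hX : Subsingleton X ∨ LieModule.IsIrreducible ℂ L X) (ψ : X →ₗ⁅ℂ, L⁆ X) :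
    ∃ c : ℂ, ∀ m, ψ m = c • m := by
  rcases hX with h | h
  · exact ⟨0, fun m => Subsingleton.elim _ _⟩
  have := LieModule.nontrivial_of_isIrreducible ℂ L X
  obtain ⟨c, hc⟩ := Module.End.exists_eigenvalue (ψ : X →ₗ[ℂ] X)
  obtain ⟨w, hw⟩ := hc.exists_hasEigenvector
  refine ⟨c, ?_⟩
  let D : LieSubmodule ℂ L X :=
    { Module.End.eigenspace (ψ : X →ₗ[ℂ] X) c with
      lie_mem := fun {z m} hm => by
        have hm' : ψ m = c • m := Module.End.mem_eigenspace_iff.1 hm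
        refine Module.End.mem_eigenspace_iff.2 ?_
        change ψ ⁅z, m⁆ = c • ⁅z, m⁆
        rw [LieModuleHom.map_lie, hm', lie_smul] }
  have hD : D = ⊤ := by
    refine (eq_bot_or_eq_top D).resolve_left fun h => hw.2 ?_
    have : w ∈ D := hw.1
    rwa [h, LieSubmodule.mem_bot] at this
  intro m
  have : m ∈ D := by rw [hD]; trivial
  exact Module.End.mem_eigenspace_iff.1 this

variable (V) in
/-- The projection of `Sym V ⊗ X` onto its component of degree zero. -/
def freeCounit (X : Type*) [AddCommGroup X] [Module ℂ X] : SymmetricAlgebra ℂ V ⊗[ℂ] X →ₗ[ℂ] X :=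
  TensorProduct.lid ℂ X ∘ₗ
    LinearMap.rTensor X (SymmetricAlgebra.algebraMapInv (R := ℂ) (M := V)).toLinearMap

theorem freeCounit_one_tmul {X : Type*} [AddCommGroup X] [Module ℂ X] (m : X) :
    freeCounit V X (1 ⊗ₜ m) = m := by
  change SymmetricAlgebra.algebraMapInv (1 : SymmetricAlgebra ℂ V) • m = m
  rw [map_one, one_smul]

theorem one_tmul_freeCounit {X : Type*} [AddCommGroup X] [Module ℂ X]
    {t : SymmetricAlgebra ℂ V ⊗[ℂ] X} (ht : t ∈ freeGrade V X 0) : 1 ⊗ₜ freeCounit V X t = t := by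
  obtain ⟨m, rfl⟩ : t ∈ LinearMap.range (TensorProduct.mk ℂ (SymmetricAlgebra ℂ V) X 1) := by
    refine freeGrade_le_comap LinearMap.id (fun n hn s hs m => ?_) ht
    obtain rfl : n = 0 := by exact_mod_cast hn
    rw [symPow, pow_zero] at hs
    obtain ⟨c, rfl⟩ := Submodule.mem_one.1 hs
    refine ⟨c • m, ?_⟩
    rw [TensorProduct.mk_apply, ← TensorProduct.smul_tmul, Algebra.algebraMap_eq_smul_one]
    rfl
  rw [TensorProduct.mk_apply, freeCounit_one_tmul]

/-- A diagonal component has symmetric degree zero on generators, so it comes from an endomorphism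
of `V(λ)`, which is a scalar by Schur's lemma. -/
theorem exists_pCoord_eq_smul (f : frakB V Γ) (x : Γ) :
    ∃ c : ℂ, ∀ t, pCoord V x (f.1 (pIncl V x t)) = c • t := by
  let g := genRestrictLie x (pCoord V x ∘ₗ f.1)
  have hg : ∀ m, 1 ⊗ₜ freeCounit V (Simple b x.1.1) (g m) = g m := fun m =>
    one_tmul_freeCounit (by
      have := frakB_mem f x x m
      rwa [sub_self] at this)
  let ψ : Simple b x.1.1 →ₗ⁅ℂ, L⁆ Simple b x.1.1 :=
    { freeCounit V (Simple b x.1.1) ∘ₗ (g : Simple b x.1.1 →ₗ[ℂ] _) with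
      map_lie' := fun {z m} => by
        change freeCounit V _ (g ⁅z, m⁆) = ⁅z, freeCounit V _ (g m)⁆
        rw [LieModuleHom.map_lie]
        conv_lhs => rw [← hg m]
        rw [TensorProduct.LieModule.lie_tmul_right, lie_sym_one, TensorProduct.zero_tmul, zero_add,
          freeCounit_one_tmul] }
  obtain ⟨c, hc⟩ := exists_eq_smul_of_irreducible
    ((Simple.subsingleton_or x.1.1).imp_right And.left) ψ
  refine ⟨c, fun t => ?_⟩
  induction t using TensorProduct.induction_on with
  | zero => rw [map_zero, map_zero, map_zero, smul_zero]
  | add s t hs ht => rw [map_add, map_add, map_add, hs, ht, smul_add]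
  | tmul s m =>
    have h1 : pCoord V x (f.1 (pIncl V x (1 ⊗ₜ m))) = c • ((1 : SymmetricAlgebra ℂ V) ⊗ₜ[ℂ] m) := by
      refine (hg m).symm.trans ?_
      rw [← TensorProduct.tmul_smul]
      exact congrArg _ (hc m)
    rw [← symToUa_smul_one_tmul (L := L) s m, map_smul, map_smul, map_smul, h1, ua_smul_smul]

theorem exists_vertex_mul_eq_smul (f : frakB V Γ) (x : Γ) :
    ∃ c : ℂ, vertex V x * f * vertex V x = c • vertex V x := by
  obtain ⟨c, hc⟩ := exists_pCoord_eq_smul f x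
  refine ⟨c, Subtype.ext (LinearMap.ext fun p => ?_)⟩
  rw [vertex_mul_mul_vertex_apply, hc]
  exact map_smul ((pIncl V x).restrictScalars ℂ) c _

variable [FiniteDimensional ℂ V]

variable (L V) in
theorem exists_equiv_extTensor_zero (X : Type*) [AddCommGroup X] [Module ℂ X] [LieRingModule L X]
    [LieModule ℂ L X] : Nonempty (X ≃ₗ⁅ℂ, L⁆ ExtTensor L V X 0) := by
  have hone : (1 : ExteriorAlgebra ℂ V) ∈ (isDerAction_ext L V).comp 0 := by
    rw [IsDerAction.mem_comp, pow_zero]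
    exact Submodule.mem_one.2 ⟨1, map_one _⟩
  let one : (isDerAction_ext L V).comp 0 := ⟨1, hone⟩
  let f : X →ₗ⁅ℂ, L⁆ ExtTensor L V X 0 :=
    { TensorProduct.mk ℂ ((isDerAction_ext L V).comp 0) X one with
      map_lie' := fun {z m} => by
        have : ⁅z, one⁆ = 0 := Subtype.ext ((isDerAction_ext L V).lie_one z)
        change one ⊗ₜ ⁅z, m⁆ = ⁅z, one ⊗ₜ[ℂ] m⁆
        rw [TensorProduct.LieModule.lie_tmul_right, this, TensorProduct.zero_tmul, zero_add] }
  have hf : ∀ m, f m = ExtTensor.tmul one m := fun m => rfl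
  refine ⟨lieModuleEquivOfBijective f ⟨fun m n h => ?_, fun n => ?_⟩⟩
  · have h1 : extIncl L V X 0 (f m) = extIncl L V X 0 (f n) := congrArg _ h
    rw [hf, hf, extIncl_tmul, extIncl_tmul] at h1
    have h2 := congrArg ((TensorProduct.lid ℂ X).toLinearMap ∘ₗ LinearMap.rTensor X
      (ExteriorAlgebra.algebraMapInv (R := ℂ) (M := V)).toLinearMap) h1
    have h3 : ∀ m : X, ((TensorProduct.lid ℂ X).toLinearMap ∘ₗ LinearMap.rTensor X
        (ExteriorAlgebra.algebraMapInv (R := ℂ) (M := V)).toLinearMap)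
        ((one : ExteriorAlgebra ℂ V) ⊗ₜ[ℂ] m) = m := fun m => by
      change ExteriorAlgebra.algebraMapInv (1 : ExteriorAlgebra ℂ V) • m = m
      rw [map_one, one_smul]
    rwa [h3, h3] at h2
  · induction n using ExtTensor.induction with
    | zero => exact ⟨0, map_zero f⟩
    | add a c ha hc =>
      obtain ⟨m, rfl⟩ := ha
      obtain ⟨n, rfl⟩ := hc
      exact ⟨m + n, map_add f m n⟩
    | tmul ω m =>
      obtain ⟨ω, hω⟩ := ω
      have hω' := hω
      rw [IsDerAction.mem_comp, pow_zero] at hω'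
      obtain ⟨c, rfl⟩ := Submodule.mem_one.1 hω'
      refine ⟨c • m, ?_⟩
      have : (⟨algebraMap ℂ _ c, hω⟩ : (isDerAction_ext L V).comp 0) = c • one :=
        Subtype.ext (Algebra.algebraMap_eq_smul_one c)
      rw [this, hf]
      exact (TensorProduct.smul_tmul c one m).symm

/-- The first term of the Koszul resolution at `x` is the projective module at `x`. -/
theorem exists_koszulTerm_hom (x : Γ) :
    ∃ i : KoszulTerm V Γ x 0 →ₗ[(frakB V Γ)ᵐᵒᵖ] (frakB V Γ)ᵐᵒᵖ,
      (∀ h, vertex V x * (i h).unop = (i h).unop) ∧ (∃ h, (i h).unop = vertex V x) ∧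
      ∀ h, vertex V x * (i h).unop * vertex V x = 0 ↔
        h ∈ LinearMap.range (koszulDiff V x 0) := by
  obtain ⟨θ⟩ := exists_equiv_extTensor_zero L V (Simple b x.1.1)
  let θ₁ : SymmetricAlgebra ℂ V ⊗[ℂ] ExtTensor L V (Simple b x.1.1) 0 →ₗ[Ua L V]
    FreeSimple V x.1.1 := freeMap θ.symm.toLieModuleHom
  let θ₂ : FreeSimple V x.1.1 →ₗ[Ua L V]
    SymmetricAlgebra ℂ V ⊗[ℂ] ExtTensor L V (Simple b x.1.1) 0 := freeMap θ.toLieModuleHom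
  have h12 : ∀ t, θ₁ (θ₂ t) = t := fun t => by
    have : θ₁ ∘ₗ θ₂ = LinearMap.id := free_ext fun m => by
      change (1 : SymmetricAlgebra ℂ V) ⊗ₜ[ℂ] θ.symm (θ m) = 1 ⊗ₜ m
      rw [LieModuleEquiv.symm_apply_apply]
    exact LinearMap.congr_fun this t
  have hinj : Function.Injective θ₁ := freeMap_injective _ θ.symm.injective
  let i : KoszulTerm V Γ x 0 →ₗ[(frakB V Γ)ᵐᵒᵖ] (frakB V Γ)ᵐᵒᵖ :=
    FreeHom.toOp x ∘ₗ FreeHom.post (t' := x.1.2) θ₁ fun k s hs => by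
      refine freeMap_mem_freeGrade _ ?_
      rwa [Nat.cast_zero, add_zero] at hs
  have hi : ∀ h p, (i h).unop.1 p = pIncl V x (θ₁ (h.toHom p)) := fun h p => rfl
  refine ⟨i, fun h => ?_, ?_, fun h => ?_⟩
  · refine Subtype.ext (LinearMap.ext fun p => ?_)
    change pIncl V x (pCoord V x ((i h).unop.1 p)) = (i h).unop.1 p
    rw [hi, pCoord_pIncl_self]
  · refine ⟨FreeHom.mk (θ₂ ∘ₗ pCoord V x) fun y m => ?_, ?_⟩
    · refine freeMap_mem_freeGrade _ ?_
      rw [Nat.cast_zero, add_zero]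
      exact frakB_mem (1 : frakB V Γ) y x m
    · refine Subtype.ext (LinearMap.ext fun p => ?_)
      rw [hi, FreeHom.mk_toHom, LinearMap.comp_apply, h12]
      rfl
  · rw [mem_range_koszulDiff_zero]
    constructor
    · intro h0 y hy m
      refine hinj ((Eq.trans ?_ (?_ : pCoord V x ((i h).unop.1 (pIncl V y (1 ⊗ₜ m))) = 0)).trans
        (map_zero θ₁).symm)
      · rw [hi, pCoord_pIncl_self]
      -- The vertices other than `x` in the degree of `x` contribute nothing, by triangularity. Thus
      -- the boundary condition at all of them amounts to the one at `x`.
      · by_cases hxy : x = y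
        · subst hxy
          have := congrArg (fun f : frakB V Γ => pCoord V x (f.1 (pIncl V x (1 ⊗ₜ m)))) h0
          simp only [vertex_mul_mul_vertex_apply, pCoord_pIncl_self] at this
          exact this.trans (map_zero (pCoord V x))
        · exact pCoord_frakB_eq_zero_of_le _ hxy hy.le _
    · intro hh
      refine Subtype.ext (pGamma_hom_ext fun y m => ?_)
      rw [vertex_mul_mul_vertex_apply]
      have : h.toHom ∘ₗ pIncl V x = 0 := free_ext (hh x rfl)
      have h' : ∀ t, h.toHom (pIncl V x t) = 0 := LinearMap.congr_fun this
      rw [hi, h', map_zero, map_zero, map_zero, map_zero]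
      rfl

end GlobalDim

/-! ### Filtering a module by vertices and bounding its projective dimension -/

section GlobalDim

open CategoryTheory MulOpposite

variable {L : Type u} [LieRing L] [LieAlgebra ℂ L] [FiniteDimensional ℂ L]
  [LieAlgebra.IsSemisimple ℂ L]
variable {H : LieSubalgebra ℂ L} [H.IsCartanSubalgebra]
variable {b : (LieAlgebra.IsKilling.rootSystem H).Base}
variable {V : Type v} [AddCommGroup V] [Module ℂ V] [LieRingModule L V] [LieModule ℂ L V]
  [FiniteDimensional ℂ V]
variable {Γ : Finset (Lam b)}

section Action

variable {M : Type*} [AddCommGroup M] [Module (frakB V Γ)ᵐᵒᵖ M]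

theorem sum_op_vertex_smul (m : M) : ∑ y : Γ, op (vertex V y) • m = m := by
  rw [← Finset.sum_smul, ← Finset.op_sum, sum_vertex, op_one, one_smul]

/-- The part of the result at another vertex `y` vanishes: by triangularity if the degree of `y` is
at most that of `x`, and by `hmax` otherwise. Only the diagonal entry of `r` survives, and it is a
scalar. -/
theorem smul_op_vertex_smul {x : Γ}
    (hmax : ∀ y : Γ, x.1.2 < y.1.2 → ∀ m : M, op (vertex V y) • m = 0)
    (r : (frakB V Γ)ᵐᵒᵖ) (m : M) :
    r • op (vertex V x) • m = op (vertex V x * r.unop * vertex V x) • m := by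
  rw [← sum_op_vertex_smul (V := V) (Γ := Γ) (r • op (vertex V x) • m), Finset.sum_eq_single x]
  · rw [op_mul, op_mul, op_unop, mul_smul, mul_smul]
  · intro y _ hyx
    rcases le_or_gt y.1.2 x.1.2 with h | h
    · rw [← mul_smul, ← mul_smul]
      have : op (vertex V y) * r * op (vertex V x) =
          op (vertex V x * r.unop * vertex V y) := by
        rw [op_mul, op_mul, op_unop, mul_assoc]
      rw [this, vertex_mul_mul_vertex_of_le _ hyx.symm h, op_zero, zero_smul]
    · exact hmax y h _
  · exact fun h => (h (Finset.mem_univ x)).elim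

end Action

/-- As `x` has top degree in `M`, the whole algebra acts on `e_x M` by scalars. A complex basis of
`e_x M` exhibits it as a direct sum of copies of the one-dimensional module at `x`, each of which
has the Koszul resolution. -/
theorem exists_submodule_hasProjectiveDimensionLT (hΓ : IntervalClosed V Γ)
    {Ψ : Finset (Module.Dual ℂ H)} (hwt : (Ψ : Set (Module.Dual ℂ H)) ⊆ wt H V)
    (hR : Rigid (wt H V) Ψ) {x₀ : Lam b} (hx₀ : ∀ x ∈ Γ, PreceqPsi Ψ x₀ x)
    {M : Type (max u v)} [AddCommGroup M] [Module (frakB V Γ)ᵐᵒᵖ M] {x : Γ}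
    (hmax : ∀ y : Γ, x.1.2 < y.1.2 → ∀ m : M, op (vertex V y) • m = 0) :
    ∃ N : Submodule (frakB V Γ)ᵐᵒᵖ M, (∀ m : M, op (vertex V x) • m ∈ N) ∧
      HasProjectiveDimensionLT (ModuleCat.of (frakB V Γ)ᵐᵒᵖ N) (nPsi V Ψ + 1) := by
  let : Module ℂ M := Module.compHom M (algebraMap ℂ (frakB V Γ)ᵐᵒᵖ)
  have hsmul : ∀ (c : ℂ) (m : M), c • m = algebraMap ℂ (frakB V Γ)ᵐᵒᵖ c • m := fun _ _ => rfl
  have : IsScalarTower ℂ (frakB V Γ)ᵐᵒᵖ M := ⟨fun c r m => by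
    rw [hsmul, ← mul_smul, Algebra.smul_def]⟩
  choose c hc using fun f : frakB V Γ => exists_vertex_mul_eq_smul f x
  have hr : ∀ (r : (frakB V Γ)ᵐᵒᵖ) (m : M),
      r • op (vertex V x) • m = c r.unop • op (vertex V x) • m := fun r m => by
    rw [smul_op_vertex_smul hmax, hc, op_smul, smul_assoc]
  let E : Submodule ℂ M := LinearMap.range (Module.toModuleEnd ℂ (S := (frakB V Γ)ᵐᵒᵖ) M
    (op (vertex V x)))
  have hEr : ∀ (r : (frakB V Γ)ᵐᵒᵖ) (m : M), m ∈ E → r • m = c r.unop • m := by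
    rintro r m ⟨n, rfl⟩
    exact hr r n
  have hvE : ∀ m ∈ E, op (vertex V x) • m = m := by
    rintro m ⟨n, rfl⟩
    change op (vertex V x) • op (vertex V x) • n = op (vertex V x) • n
    rw [← mul_smul, ← op_mul, vertex_mul_self]
  let B := Module.Basis.ofVectorSpace ℂ E
  obtain ⟨i, -, ⟨h1, hh1⟩, hi⟩ := exists_koszulTerm_hom (V := V) x
  let π : (Module.Basis.ofVectorSpaceIndex ℂ E →₀ KoszulTerm V Γ x 0) →ₗ[(frakB V Γ)ᵐᵒᵖ] M :=
    Finsupp.lsum ℕ fun j => LinearMap.toSpanSingleton (frakB V Γ)ᵐᵒᵖ M (B j) ∘ₗ i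
  have hπ : ∀ h, π h = ((h.sum fun j k => c (i k).unop • B j : E) : M) := fun h => by
    rw [Finsupp.sum, Submodule.coe_sum]
    exact Finset.sum_congr rfl fun j _ => hEr _ _ (B j).2
  have hπs : ∀ j k, π (Finsupp.single j k) = i k • (B j : M) := fun j k => by
    rw [Finsupp.lsum_single]
    rfl
  -- If `e_x` were zero, the scalar `c` would not be determined. The basis vector `B j`, on which
  -- `e_x` acts as the identity, excludes this, which is why `j` is an argument.
  have key : ∀ j k, c (i k).unop = 0 ↔ k ∈ LinearMap.range (koszulDiff V x 0) := fun j k => by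
    rw [← hi, hc]
    refine ⟨fun h => by rw [h, zero_smul], fun h => ?_⟩
    have hB : c (i k).unop • B j = 0 := Subtype.ext (by
      change c (i k).unop • (B j : M) = 0
      rw [← hvE _ (B j).2, ← smul_assoc, ← op_smul, h, op_zero, zero_smul])
    exact (smul_eq_zero.1 hB).resolve_right (B.ne_zero j)
  refine ⟨LinearMap.range π, fun m => ?_, hasProjectiveDimensionLT_range_finsupp
    (d := koszulDiff V x) (ker_koszulDiff x) (projective_koszulTerm hΓ x)
    (subsingleton_koszulTerm hwt hR hx₀ x) π fun h => ?_⟩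
  · have hm : op (vertex V x) • m ∈ E := ⟨m, rfl⟩
    have hspan : ∀ n : E, (n : M) ∈ LinearMap.range π := fun n => by
      rw [← B.linearCombination_repr n, Finsupp.linearCombination_apply, Finsupp.sum,
        Submodule.coe_sum]
      refine Submodule.sum_mem _ fun j _ => ?_
      change B.repr n j • (B j : M) ∈ _
      rw [hsmul]
      refine Submodule.smul_mem _ _ ⟨Finsupp.single j h1, ?_⟩
      rw [hπs, ← op_unop (i h1), hh1]
      exact hvE _ (B j).2
    exact hspan ⟨_, hm⟩
  · constructor
    · intro h0 j
      by_cases hj : h j = 0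
      · rw [hj]
        exact Submodule.zero_mem _
      rw [← key j]
      rw [hπ, ZeroMemClass.coe_eq_zero] at h0
      exact linearIndependent_iff'.1 B.linearIndependent h.support _ h0 j
        (Finsupp.mem_support_iff.2 hj)
    · intro h0
      rw [hπ, ZeroMemClass.coe_eq_zero]
      exact Finset.sum_eq_zero fun j _ => by
        change c (i (h j)).unop • B j = 0
        rw [(key j _).2 (h0 j), zero_smul]

/-- Induction on the number of vertices acting non-trivially on the module. Dividing by the
submodule attached to one of top degree kills that vertex and creates no new one, and an extension
of modules within the bound stays within it. -/
theorem globalDimLE_frakB (hΓ : IntervalClosed V Γ)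
    {Ψ : Finset (Module.Dual ℂ H)} (hwt : (Ψ : Set (Module.Dual ℂ H)) ⊆ wt H V)
    (hR : Rigid (wt H V) Ψ) {x₀ : Lam b} (hx₀ : ∀ x ∈ Γ, PreceqPsi Ψ x₀ x) :
    GlobalDimLE (frakB V Γ)ᵐᵒᵖ (nPsi V Ψ) := by
  classical
  suffices h : ∀ (n : ℕ) (M : Type (max u v)) [AddCommGroup M] [Module (frakB V Γ)ᵐᵒᵖ M],
      (Finset.univ.filter fun x : Γ => ∃ m : M, op (vertex V x) • m ≠ 0).card ≤ n →
      HasProjectiveDimensionLT (ModuleCat.of (frakB V Γ)ᵐᵒᵖ M) (nPsi V Ψ + 1) from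
    fun M => h _ M le_rfl
  intro n
  induction n with
  | zero =>
    intro M _ _ hM
    have h0 : ∀ (x : Γ) (m : M), op (vertex V x) • m = 0 := fun x m => by
      by_contra h
      exact Finset.notMem_empty x ((Finset.card_eq_zero.1 (Nat.le_zero.1 hM)) ▸
        Finset.mem_filter.2 ⟨Finset.mem_univ x, m, h⟩)
    have : Subsingleton M := subsingleton_of_forall_eq 0 fun m => by
      rw [← sum_op_vertex_smul (V := V) (Γ := Γ) m]
      exact Finset.sum_eq_zero fun x _ => h0 x m
    exact hasProjectiveDimensionLT_of_subsingleton M _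
  | succ n ih =>
    intro M _ _ hM
    let s := Finset.univ.filter fun x : Γ => ∃ m : M, op (vertex V x) • m ≠ 0
    rcases s.eq_empty_or_nonempty with hs | hs
    · refine ih M ?_
      change s.card ≤ n
      rw [hs, Finset.card_empty]
      exact Nat.zero_le n
    obtain ⟨x, hx, hxm⟩ := s.exists_max_image (fun x => x.1.2) hs
    obtain ⟨N, hN, hNd⟩ := exists_submodule_hasProjectiveDimensionLT hΓ hwt hR hx₀ (M := M)
      (x := x) fun y hy m => by
        by_contra h
        have := hxm y (Finset.mem_filter.2 ⟨Finset.mem_univ y, m, h⟩)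
        omega
    refine hasProjectiveDimensionLT_of_quotient N hNd (ih (M ⧸ N) ?_)
    have hlt : (Finset.univ.filter fun y : Γ => ∃ m : M ⧸ N, op (vertex V y) • m ≠ 0) ⊂ s := by
      refine (Finset.ssubset_iff_of_subset fun y hy => ?_).2 ⟨x, hx, fun h => ?_⟩
      · obtain ⟨m, hm⟩ := (Finset.mem_filter.1 hy).2
        obtain ⟨m, rfl⟩ := N.mkQ_surjective m
        refine Finset.mem_filter.2 ⟨Finset.mem_univ y, m, fun h => hm ?_⟩
        rw [← map_smul, h, map_zero]
      · obtain ⟨m, hm⟩ := (Finset.mem_filter.1 h).2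
        obtain ⟨m, rfl⟩ := N.mkQ_surjective m
        exact hm ((Submodule.Quotient.mk_eq_zero N).2 (hN m))
    have := Finset.card_lt_card hlt
    have hM' : s.card ≤ n + 1 := hM
    omega

end GlobalDim

end FaceKoszul

end

theorem lemmaL76 {L : Type*} [LieRing L] [LieAlgebra ℂ L] [FiniteDimensional ℂ L]
    [LieAlgebra.IsSemisimple ℂ L] (H : LieSubalgebra ℂ L) [H.IsCartanSubalgebra]
    (b : (LieAlgebra.IsKilling.rootSystem H).Base)
    (V : Type*) [AddCommGroup V] [Module ℂ V] [LieRingModule L V] [LieModule ℂ L V]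
    [FiniteDimensional ℂ V]
    (Ψ : Finset (Module.Dual ℂ H)) (hne : Ψ.Nonempty)
    (hwt : (Ψ : Set (Module.Dual ℂ H)) ⊆ FaceKoszul.wt H V)
    (hrigid : FaceKoszul.Rigid (FaceKoszul.wt H V) Ψ)
    (x₀ : FaceKoszul.Lam b) (Γ : Finset (FaceKoszul.Lam b))
    (hΓ : FaceKoszul.IntervalClosed V Γ)
    (hx₀ : ∀ x ∈ Γ, FaceKoszul.PreceqPsi Ψ x₀ x) :
    FaceKoszul.GlobalDimLE (FaceKoszul.frakB V Γ)ᵐᵒᵖ (FaceKoszul.nPsi V Ψ) ∧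
    Nonempty (GradedAlgebra (FaceKoszul.frakBGrade V Γ)) ∧
    ∃ φ : (FaceKoszul.frakB V Γ)ᵐᵒᵖ ≃ₗ[ℂ] FaceKoszul.aPsiInv V b Ψ (FaceKoszul.proj Γ),
      (∀ f g, (φ (f * g) : FaceKoszul.BigA b V) = φ f * φ g) ∧
      ∀ (k : ℕ) (f : (FaceKoszul.frakB V Γ)ᵐᵒᵖ),
        f.unop ∈ FaceKoszul.frakBGrade V Γ k ↔
          (φ f : FaceKoszul.BigA b V) ∈ FaceKoszul.bigAGrade b V k := by
  refine ⟨FaceKoszul.globalDimLE_frakB hΓ hwt hrigid hx₀,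
    FaceKoszul.nonempty_gradedAlgebra_frakBGrade V Γ,
    FaceKoszul.exists_equiv_aPsiInv
      (fun x y h => Subtype.ext (FaceKoszul.eq_of_fst_eq (hx₀ x.1 x.2) (hx₀ y.1 y.2) h))
      -- The roles of `x` and `y` are exchanged because a homomorphism from the summand at `x` to
      -- the one at `y` has `y` below `x`.
      (fun x y h => FaceKoszul.lePsi_of_preceq hwt hrigid (hx₀ y.1 y.2) (hx₀ x.1 x.2) h)
      fun x y h => FaceKoszul.dPsi_eq_of_lePsi hwt hrigid (hx₀ y.1 y.2) (hx₀ x.1 x.2) h⟩
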